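/- Notation. A net $(w_\varepsilon)_{\varepsilon\in(0,1]}$ of smooth functions on an open set, depending smoothly on $\varepsilon$, is *moderate* if on every compact set each derivative is $O(\varepsilon^{-m})$ for some $m$, and *negligible* if it is moderate and on every compact set it is $O(\varepsilon^{m})$ for all $m$ (as $\varepsilon\to0$). $\mathcal G(\mathbb R)$ is the algebra of moderate nets of functions on $\mathbb R$ modulo negligible ones; generalized $(0,2)$-tensor fields $\mathcal G^0_2(M)$ on a manifold $M$ are defined in the same way by means of coefficients in charts. For an open interval $J$, $\mathcal G[J,M]$ is the set of nets $(\gamma_\varepsilon)$ of smooth maps $J\to M$, depending smoothly on $\varepsilon$, for which $(\psi\circ\gamma_\varepsilon)$ is moderate for all $\psi\in C^\infty(M)$, where $(\gamma_\varepsilon)$ and $(\tilde\gamma_\varepsilon)$ are identified if $(\psi\circ\gamma_\varepsilon-\psi\circ\tilde\gamma_\varepsilon)$ is negligible for all such $\psi$. A *generalized semi-Riemannian metric* is a symmetric $g=[(g_\varepsilon)]\in\mathcal G^0_2(M)$ whose determinant is invertible (in each chart and on each compact set, $|\det g_\varepsilon|>\varepsilon^m$ for some $m$ and all small $\varepsilon$)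 and which has a well-defined index (for some $\nu$, on each compact subset of a chart, the index of $g_\varepsilon$ is $\nu$ for all small $\varepsilon$). A *geodesic* of $g$ on $J$ is a $\gamma=[(\gamma_\varepsilon)]\in\mathcal G[J,M]$ with $\gamma''=0$, i.e. in local coordinates the net $\ddot\gamma^k_\varepsilon+\sum_{i,j}\Gamma^k_{\varepsilon ij}(\gamma_\varepsilon)\dot\gamma^i_\varepsilon\dot\gamma^j_\varepsilon$ is negligible, where $\Gamma_\varepsilon$ are the Christoffel symbols of $g_\varepsilon$. Its velocity is *bounded at* $t_0\in J$ if $(\psi\circ\gamma_\varepsilon)'(t_0)=O(1)$ for every $\psi\in C^\infty(M)$; this holds in particular if the initial data of $\gamma$ at $t_0$ are a classical point and a classical tangent vector. The pair $(M,g)$ is *geodesically complete* if, for every nonempty open interval $J$, every geodesic $\gamma\in\mathcal G[J,M]$ of $g$ whose velocity is bounded at some point of $J$ can be defined on $\mathbb R$, i.e. is the restriction to $J$ of a geodesic of $g$ in $\mathcal G[\mathbb R,M]$. A *generalized delta-function* is a $D\in\mathcal G(\mathbb R)$ that has a representative $(\delta_\varepsilon)$ with $\operatorname{supp}\delta_\varepsilon\subseteq(-\varepsilon,\varepsilon)$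 for all $\varepsilon\in(0,1]$, $\int_{\mathbb R}\delta_\varepsilon\to1$ as $\varepsilon\searrow0$, and $\|\delta_\varepsilon\|_{L^1}\le C$ for some $C>0$ and all $\varepsilon\in(0,1]$. **Corollary (Completeness of INPWs).** Let $(N,h)$ be a connected complete smooth Riemannian manifold of finite dimension, let $f\in C^\infty(N)$, and let $D$ be a generalized delta-function. Then, on $M=N\times\mathbb R^2$ with global coordinates $(u,v)$ on $\mathbb R^2$, $$ds^2=dh^2+2\,du\,dv+f(x)\,D(u)\,du^2$$ is a generalized semi-Riemannian metric, and $(M,ds^2)$ is geodesically complete. -/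

import Mathlib

open Set Filter Topology Bundle
open scoped Manifold ContDiff Bundle

attribute [-instance] TopCat.of.chartedSpace

noncomputable section

namespace Colombeau

/-! ### Nets of functions on open subsets of a normed space -/

section Nets

set_option linter.unusedSectionVars false

variable {F : Type*} [NormedAddCommGroup F] [NormedSpace ℝ F]
  {V : Type*} [NormedAddCommGroup V] [NormedSpace ℝ V]

/-- The net `(w ε)`, `ε ∈ (0,1]`, consists of smooth functions on the open set `U` and depends
smoothly on `ε`.  (Values of `w` for other `ε`, or off `U`, are irrelevant.) -/
def SmoothNet (U : Set F) (w : ℝ → F → V) : Prop :=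
  ContDiffOn ℝ ∞ (fun q : ℝ × F => w q.1 q.2) (Ioc (0 : ℝ) 1 ×ˢ U)

/-- Moderateness on `U`: every derivative is `O(ε ^ (-m))` for some `m`, on every compact set. -/
def ModerateOn (U : Set F) (w : ℝ → F → V) : Prop :=
  ∀ K ⊆ U, IsCompact K → ∀ k : ℕ, ∃ (m : ℕ) (C ε₀ : ℝ), 0 < ε₀ ∧
    ∀ ε ∈ Ioo 0 ε₀, ∀ y ∈ K, ‖iteratedFDeriv ℝ k (w ε) y‖ ≤ C / ε ^ m

/-- Negligibility on `U` (for moderate nets): `O(ε ^ m)` for all `m`, on every compact set. -/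
def NegligibleOn (U : Set F) (w : ℝ → F → V) : Prop :=
  ∀ K ⊆ U, IsCompact K → ∀ m : ℕ, ∃ C ε₀ : ℝ, 0 < ε₀ ∧
    ∀ ε ∈ Ioo 0 ε₀, ∀ y ∈ K, ‖w ε y‖ ≤ C * ε ^ m

theorem NegligibleOn.zero (U : Set F) : NegligibleOn U (fun (_ : ℝ) (_ : F) => (0 : V)) :=
  fun _ _ _ _ => ⟨0, 1, one_pos, by simp⟩

theorem NegligibleOn.neg {U : Set F} {w : ℝ → F → V} (h : NegligibleOn U w) :
    NegligibleOn U (fun ε y => - w ε y) := by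
  simpa only [NegligibleOn, norm_neg] using h

theorem NegligibleOn.add {U : Set F} {w w' : ℝ → F → V} (h : NegligibleOn U w)
    (h' : NegligibleOn U w') : NegligibleOn U (fun ε y => w ε y + w' ε y) := by
  intro K hK hKc m
  obtain ⟨C, e, he, H⟩ := h K hK hKc m
  obtain ⟨C', e', he', H'⟩ := h' K hK hKc m
  refine ⟨C + C', min e e', lt_min he he', fun ε hε y hy => ?_⟩
  have h1 := H ε ⟨hε.1, hε.2.trans_le (min_le_left _ _)⟩ y hy
  have h2 := H' ε ⟨hε.1, hε.2.trans_le (min_le_right _ _)⟩ y hy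
  calc _ ≤ ‖w ε y‖ + ‖w' ε y‖ := norm_add_le _ _
    _ ≤ _ := by rw [add_mul]; exact add_le_add h1 h2

theorem NegligibleOn.sub_self (U : Set F) (w : ℝ → F → V) :
    NegligibleOn U (fun ε y => w ε y - w ε y) := by
  simpa only [_root_.sub_self] using NegligibleOn.zero U

theorem NegligibleOn.sub_symm {U : Set F} {w w' : ℝ → F → V}
    (h : NegligibleOn U (fun ε y => w ε y - w' ε y)) :
    NegligibleOn U (fun ε y => w' ε y - w ε y) := by
  simpa only [neg_sub] using h.neg

theorem NegligibleOn.sub_trans {U : Set F} {w w' w'' : ℝ → F → V}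
    (h : NegligibleOn U (fun ε y => w ε y - w' ε y))
    (h' : NegligibleOn U (fun ε y => w' ε y - w'' ε y)) :
    NegligibleOn U (fun ε y => w ε y - w'' ε y) := by
  simpa only [sub_add_sub_cancel] using h.add h'

theorem NegligibleOn.congr {U : Set F} {w w' : ℝ → F → V} (h : NegligibleOn U w)
    (hw : ∀ ε, ∀ y ∈ U, w' ε y = w ε y) : NegligibleOn U w' := by
  intro K hK hKc m
  obtain ⟨C, e, he, H⟩ := h K hK hKc m
  exact ⟨C, e, he, fun ε hε y hy => by rw [hw ε y (hK hy)]; exact H ε hε y hy⟩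

theorem SmoothNet.congr {U : Set F} {w w' : ℝ → F → V} (h : SmoothNet U w)
    (hw : ∀ ε, ∀ y ∈ U, w' ε y = w ε y) : SmoothNet U w' :=
  ContDiffOn.congr h fun q hq => hw q.1 q.2 hq.2

theorem ModerateOn.congr {U : Set F} (hU : IsOpen U) {w w' : ℝ → F → V} (h : ModerateOn U w)
    (hw : ∀ ε, ∀ y ∈ U, w' ε y = w ε y) : ModerateOn U w' := by
  intro K hK hKc k
  obtain ⟨m, C, e, he, H⟩ := h K hK hKc k
  refine ⟨m, C, e, he, fun ε hε y hy => ?_⟩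
  have h1 : w' ε =ᶠ[𝓝 y] w ε := by
    filter_upwards [hU.mem_nhds (hK hy)] with z hz using hw ε z hz
  rw [(h1.iteratedFDeriv ℝ k).eq_of_nhds]
  exact H ε hε y hy

theorem NegligibleOn.mono {U U' : Set F} {w : ℝ → F → V} (h : NegligibleOn U w) (hU : U' ⊆ U) :
    NegligibleOn U' w := fun K hK => h K (hK.trans hU)

theorem ModerateOn.mono {U U' : Set F} {w : ℝ → F → V} (h : ModerateOn U w) (hU : U' ⊆ U) :
    ModerateOn U' w := fun K hK => h K (hK.trans hU)

/-- Auxiliary: a nonnegative net is `O(ε ^ (-m))` on `K` for some `m`. -/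
def PolyBdd {X : Type*} (K : Set X) (φ : ℝ → X → ℝ) : Prop :=
  ∃ (m : ℕ) (C ε₀ : ℝ), 0 < ε₀ ∧ ∀ ε ∈ Ioo 0 ε₀, ∀ y ∈ K, φ ε y ≤ C / ε ^ m

theorem PolyBdd.le {X : Type*} {K : Set X} {φ φ' : ℝ → X → ℝ} (h : PolyBdd K φ)
    (hle : ∀ ε ∈ Ioo (0 : ℝ) 1, ∀ y ∈ K, φ' ε y ≤ φ ε y) : PolyBdd K φ' := by
  obtain ⟨m, C, e, he, H⟩ := h
  refine ⟨m, C, min e 1, lt_min he one_pos, fun ε hε y hy => ?_⟩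
  exact (hle ε ⟨hε.1, hε.2.trans_le (min_le_right _ _)⟩ y hy).trans
    (H ε ⟨hε.1, hε.2.trans_le (min_le_left _ _)⟩ y hy)

theorem PolyBdd.const {X : Type*} {K : Set X} (C : ℝ) : PolyBdd K (fun _ _ => C) :=
  ⟨0, C, 1, one_pos, by simp⟩

theorem PolyBdd.add {X : Type*} {K : Set X} {φ φ' : ℝ → X → ℝ} (h : PolyBdd K φ)
    (h' : PolyBdd K φ') : PolyBdd K (fun ε y => φ ε y + φ' ε y) := by
  obtain ⟨m, C, e, he, H⟩ := h
  obtain ⟨m', C', e', he', H'⟩ := h'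
  refine ⟨m + m', |C| + |C'|, min 1 (min e e'), by positivity, fun ε hε y hy => ?_⟩
  obtain ⟨h0, hlt⟩ := hε
  simp only [lt_min_iff] at hlt
  have h1 := H ε ⟨h0, hlt.2.1⟩ y hy
  have h2 := H' ε ⟨h0, hlt.2.2⟩ y hy
  have p1 : ε ^ (m + m') ≤ ε ^ m := pow_le_pow_of_le_one h0.le hlt.1.le (by omega)
  have p2 : ε ^ (m + m') ≤ ε ^ m' := pow_le_pow_of_le_one h0.le hlt.1.le (by omega)
  have q1 : C / ε ^ m ≤ |C| / ε ^ (m + m') :=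
    div_le_div₀ (abs_nonneg _) (le_abs_self _) (by positivity) p1
  have q2 : C' / ε ^ m' ≤ |C'| / ε ^ (m + m') :=
    div_le_div₀ (abs_nonneg _) (le_abs_self _) (by positivity) p2
  rw [add_div]
  linarith

theorem PolyBdd.mul {X : Type*} {K : Set X} {φ φ' : ℝ → X → ℝ} (h : PolyBdd K φ)
    (h' : PolyBdd K φ') (h0 : ∀ ε y, 0 ≤ φ ε y) (h0' : ∀ ε y, 0 ≤ φ' ε y) :
    PolyBdd K (fun ε y => φ ε y * φ' ε y) := by
  obtain ⟨m, C, e, he, H⟩ := h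
  obtain ⟨m', C', e', he', H'⟩ := h'
  refine ⟨m + m', C * C', min e e', lt_min he he', fun ε hε y hy => ?_⟩
  have h1 := H ε ⟨hε.1, hε.2.trans_le (min_le_left _ _)⟩ y hy
  have h2 := H' ε ⟨hε.1, hε.2.trans_le (min_le_right _ _)⟩ y hy
  calc φ ε y * φ' ε y ≤ (C / ε ^ m) * (C' / ε ^ m') :=
        mul_le_mul h1 h2 (h0' _ _) ((h0 _ _).trans h1)
    _ = C * C' / ε ^ (m + m') := by rw [div_mul_div_comm, pow_add]

theorem PolyBdd.sum {X ι : Type*} {K : Set X} (s : Finset ι) {φ : ι → ℝ → X → ℝ}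
    (h : ∀ i ∈ s, PolyBdd K (φ i)) : PolyBdd K (fun ε y => ∑ i ∈ s, φ i ε y) := by
  classical
  induction s using Finset.induction_on with
  | empty => simpa using PolyBdd.const (K := K) 0
  | insert i s hi ih =>
    simp only [Finset.sum_insert hi]
    exact (h i (Finset.mem_insert_self _ _)).add
      (ih fun j hj => h j (Finset.mem_insert_of_mem hj))

theorem polyBdd_of_contDiffOn {U K : Set F} (hU : IsOpen U) (hK : K ⊆ U) (hKc : IsCompact K)
    {S : F → V} (hS : ContDiffOn ℝ ∞ S U) (k : ℕ) :
    PolyBdd K (fun _ y => ‖iteratedFDerivWithin ℝ k S U y‖) := by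
  have hc : ContinuousOn (fun y => ‖iteratedFDerivWithin ℝ k S U y‖) K :=
    ((hS.continuousOn_iteratedFDerivWithin (by exact_mod_cast le_top)
      hU.uniqueDiffOn).mono hK).norm
  obtain ⟨C, hC⟩ := hKc.bddAbove_image hc
  exact ⟨0, C, 1, one_pos, fun ε _ y hy => by simpa using hC (mem_image_of_mem _ hy)⟩

/-- Nets of the form `S + a · (δ_ε ∘ L) B` are moderate. -/
theorem moderate_aux {U : Set F} (hU : IsOpen U) {S : F → V} (hS : ContDiffOn ℝ ∞ S U)
    {a : F → ℝ} (ha : ContDiffOn ℝ ∞ a U) (L : F →L[ℝ] ℝ) (B : V) {δ : ℝ → ℝ → ℝ}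
    (hδ : SmoothNet univ δ) (hδm : ModerateOn univ δ) :
    SmoothNet U (fun ε y => S y + (a y * δ ε (L y)) • B) ∧
    ModerateOn U (fun ε y => S y + (a y * δ ε (L y)) • B) := by
  have hδε : ∀ ε ∈ Ioo (0 : ℝ) 1, ContDiff ℝ ∞ (δ ε) := by
    intro ε hε
    rw [← contDiffOn_univ]
    have : ContDiffOn ℝ ∞ (fun x : ℝ => ((ε, x) : ℝ × ℝ)) univ :=
      (contDiff_const.prodMk contDiff_id).contDiffOn
    have hδ' : ContDiffOn ℝ ∞ (fun q : ℝ × ℝ => δ q.1 q.2) (Ioc (0 : ℝ) 1 ×ˢ univ) := hδ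
    exact hδ'.comp this (fun x _ => ⟨⟨hε.1, hε.2.le⟩, mem_univ _⟩)
  constructor
  · have h2 : ContDiffOn ℝ ∞ (fun q : ℝ × F => q.2) (Ioc (0 : ℝ) 1 ×ˢ U) :=
      contDiff_snd.contDiffOn
    have hL : ContDiffOn ℝ ∞ (fun q : ℝ × F => ((q.1, L q.2) : ℝ × ℝ)) (Ioc (0 : ℝ) 1 ×ˢ U) :=
      (contDiff_fst.prodMk (L.contDiff.comp contDiff_snd)).contDiffOn
    have hS' := hS.comp h2 (fun q hq => hq.2)
    have ha' := ha.comp h2 (fun q hq => hq.2)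
    have hδ0 : ContDiffOn ℝ ∞ (fun q : ℝ × ℝ => δ q.1 q.2) (Ioc (0 : ℝ) 1 ×ˢ univ) := hδ
    have hδ' := hδ0.comp hL (fun q hq => ⟨hq.1, mem_univ _⟩)
    exact hS'.add ((ha'.mul hδ').smul contDiffOn_const)
  · intro K hK hKc k
    let Bil : ℝ →L[ℝ] ℝ →L[ℝ] V :=
      (ContinuousLinearMap.compL ℝ ℝ ℝ V (ContinuousLinearMap.toSpanSingleton ℝ B)).comp
        (ContinuousLinearMap.mul ℝ ℝ)
    have hδL : ∀ j : ℕ, PolyBdd K (fun ε y => ‖iteratedFDeriv ℝ j (δ ε) (L y)‖) := by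
      intro j
      obtain ⟨m, C, e, he, H⟩ := hδm (L '' K) (subset_univ _) (hKc.image L.continuous) j
      exact ⟨m, C, e, he, fun ε hε y hy => H ε hε (L y) (mem_image_of_mem _ hy)⟩
    have hsum : PolyBdd K (fun ε y => ‖iteratedFDerivWithin ℝ k S U y‖ + ‖Bil‖ *
        ∑ i ∈ Finset.range (k + 1), ((k.choose i : ℝ) * ‖iteratedFDerivWithin ℝ i a U y‖) *
          (‖iteratedFDeriv ℝ (k - i) (δ ε) (L y)‖ * ‖L‖ ^ (k - i))) := by
      refine (polyBdd_of_contDiffOn hU hK hKc hS k).add ((PolyBdd.const _).mul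
        (PolyBdd.sum _ fun i _ => (((PolyBdd.const _).mul
          (polyBdd_of_contDiffOn hU hK hKc ha i) ?_ ?_)).mul
          ((hδL (k - i)).mul (PolyBdd.const _) ?_ ?_) ?_ ?_) ?_ ?_) <;>
        intros <;> positivity
    refine hsum.le fun ε hε y hy => ?_
    have hyU := hK hy
    have hcomp : ContDiff ℝ ∞ (δ ε ∘ L) := (hδε ε hε).comp L.contDiff
    have hk : ((k : ℕ) : ℕ∞ω) ≤ (∞ : ℕ∞ω) := by exact_mod_cast le_top
    rw [← iteratedFDerivWithin_of_isOpen k hU hyU]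
    have e1 : (fun y => S y + (a y * δ ε (L y)) • B) = S + fun y => Bil (a y) ((δ ε ∘ L) y) := by
      funext y
      simp [Bil]
    have hB : ContDiffOn ℝ ∞ (fun y => Bil (a y) ((δ ε ∘ L) y)) U :=
      (Bil.contDiff.comp_contDiffOn ha).clm_apply hcomp.contDiffOn
    beta_reduce
    rw [e1, iteratedFDerivWithin_add_apply ((hS y hyU).of_le hk) ((hB y hyU).of_le hk)
      hU.uniqueDiffOn hyU]
    refine (norm_add_le _ _).trans (add_le_add le_rfl ?_)
    refine (Bil.norm_iteratedFDerivWithin_le_of_bilinear ha hcomp.contDiffOn hU.uniqueDiffOn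
      hyU hk).trans ?_
    gcongr with i hi
    rw [iteratedFDerivWithin_of_isOpen _ hU hyU,
      L.iteratedFDeriv_comp_right (hδε ε hε) y (i := k - i)
        (WithTop.coe_le_coe.2 le_top)]
    refine (ContinuousMultilinearMap.norm_compContinuousLinearMap_le _ _).trans ?_
    simp

/-- If `δ_ε - δ'_ε` is negligible, so is `a · ((δ_ε - δ'_ε) ∘ L) B`. -/
theorem negligible_aux {U : Set F} {S : F → V} {a : F → ℝ} (ha : ContDiffOn ℝ ∞ a U)
    (L : F →L[ℝ] ℝ) (B : V) {δ δ' : ℝ → ℝ → ℝ}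
    (h : NegligibleOn univ (fun ε t => δ ε t - δ' ε t)) :
    NegligibleOn U (fun ε y => (S y + (a y * δ ε (L y)) • B)
      - (S y + (a y * δ' ε (L y)) • B)) := by
  intro K hK hKc m
  obtain ⟨C, e, he, H⟩ := h (L '' K) (subset_univ _) (hKc.image L.continuous) m
  obtain ⟨A, hA⟩ := hKc.bddAbove_image ((ha.continuousOn.mono hK).norm)
  refine ⟨A * C * ‖B‖, e, he, fun ε hε y hy => ?_⟩
  have h1 := H ε hε (L y) (mem_image_of_mem _ hy)
  have h2 : ‖a y‖ ≤ A := hA (mem_image_of_mem _ hy)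
  have e1 : (S y + (a y * δ ε (L y)) • B) - (S y + (a y * δ' ε (L y)) • B)
      = (a y * (δ ε (L y) - δ' ε (L y))) • B := by
    rw [add_sub_add_left_eq_sub, ← sub_smul, mul_sub]
  beta_reduce
  rw [e1, norm_smul, norm_mul]
  calc ‖a y‖ * ‖δ ε (L y) - δ' ε (L y)‖ * ‖B‖ ≤ A * (C * ε ^ m) * ‖B‖ := by
        gcongr
        exact (norm_nonneg _).trans h2
    _ = A * C * ‖B‖ * ε ^ m := by ring

end Nets

/-! ### Generalized functions on an open set -/

section GenFun

variable {F : Type*} [NormedAddCommGroup F] [NormedSpace ℝ F]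
  {V : Type*} [NormedAddCommGroup V] [NormedSpace ℝ V]

variable (V) in
/-- Moderate nets on the open set `U` with values in `V`. -/
def ModNet (U : Set F) : Type _ :=
  {w : ℝ → F → V // SmoothNet U w ∧ ModerateOn U w}

instance ModNet.setoid (U : Set F) : Setoid (ModNet V U) where
  r w w' := NegligibleOn U (fun ε y => w.1 ε y - w'.1 ε y)
  iseqv :=
    { refl := fun w => NegligibleOn.sub_self U w.1
      symm := fun h => h.sub_symm
      trans := fun h h' => h.sub_trans h' }

variable (V) in
/-- The special Colombeau algebra `𝒢(U)` (with values in `V`): moderate modulo negligible nets. -/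
def GenFun (U : Set F) : Type _ := Quotient (ModNet.setoid (V := V) U)

/-- `D ∈ 𝒢(ℝ)` is a generalized delta-function: some representative is a strict delta net. -/
def IsGenDelta (D : GenFun ℝ (univ : Set ℝ)) : Prop :=
  ∃ δ : ModNet ℝ (univ : Set ℝ), Quotient.mk _ δ = D ∧
    (∀ ε ∈ Ioc (0 : ℝ) 1, tsupport (δ.1 ε) ⊆ Ioo (-ε) ε) ∧
    Tendsto (fun ε => ∫ x, δ.1 ε x) (𝓝[>] 0) (𝓝 1) ∧
    ∃ C : ℝ, 0 < C ∧ ∀ ε ∈ Ioc (0 : ℝ) 1, ∫ x, |δ.1 ε x| ≤ C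

end GenFun

section Manifold

variable {F : Type*} [NormedAddCommGroup F] [NormedSpace ℝ F]
  {H : Type*} [TopologicalSpace H] (I : ModelWithCorners ℝ F H)
  (M : Type*) [TopologicalSpace M] [ChartedSpace H M]

/-! ### Generalized maps from an open interval into a manifold -/

/-- Moderate nets of maps from the open set `J ⊆ ℝ` to `M`: they are smooth, depend smoothly on
`ε`, and all compositions with smooth `ψ : M → ℝ` are moderate. -/
def ModMap (J : Set ℝ) : Type _ :=
  {c : ℝ → ℝ → M //
    ContMDiffOn 𝓘(ℝ, ℝ × ℝ) I ∞ (fun q : ℝ × ℝ => c q.1 q.2) (Ioc (0 : ℝ) 1 ×ˢ J) ∧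
    ∀ ψ : M → ℝ, ContMDiff I 𝓘(ℝ, ℝ) ∞ ψ → ModerateOn J (fun ε t => ψ (c ε t))}

instance ModMap.setoid (J : Set ℝ) : Setoid (ModMap I M J) where
  r c c' := ∀ ψ : M → ℝ, ContMDiff I 𝓘(ℝ, ℝ) ∞ ψ →
    NegligibleOn J (fun ε t => ψ (c.1 ε t) - ψ (c'.1 ε t))
  iseqv :=
    { refl := fun _ _ _ => NegligibleOn.sub_self J _
      symm := fun h ψ hψ => (h ψ hψ).sub_symm
      trans := fun h h' ψ hψ => (h ψ hψ).sub_trans (h' ψ hψ) }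

/-- The space `𝒢[J, M]` of generalized functions on `J` taking values in `M`. -/
def GenMap (J : Set ℝ) : Type _ := Quotient (ModMap.setoid I M J)

variable {I M}

/-- Restriction `𝒢[J, M] → 𝒢[J', M]` for `J' ⊆ J`. -/
def GenMap.restrict {J J' : Set ℝ} (hJ : J' ⊆ J) : GenMap I M J → GenMap I M J' :=
  Quotient.map
    (fun c => ⟨c.1, c.2.1.mono (prod_mono le_rfl hJ), fun ψ hψ => (c.2.2 ψ hψ).mono hJ⟩)
    (fun _ _ h ψ hψ => (h ψ hψ).mono hJ)

/-! ### Generalized `(0,2)`-tensor fields -/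

variable (I M) in
/-- Rough `(0,2)`-tensor fields on `M`. -/
abbrev Tensor02 : Type _ :=
  (x : M) → TangentSpace I x →L[ℝ] TangentSpace I x →L[ℝ] ℝ

variable (I) in
/-- The coordinate expression of a `(0,2)`-tensor field in the preferred chart at `p`, that is its
pull-back under the inverse of the chart; meaningful on `(extChartAt I p).target`. -/
def chartCoeff (p : M) (g : Tensor02 I M) (y : F) : F →L[ℝ] F →L[ℝ] ℝ :=
  let A : F →L[ℝ] TangentSpace I ((extChartAt I p).symm y) :=
    mfderiv 𝓘(ℝ, F) I (extChartAt I p).symm y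
  (A.precomp ℝ).comp ((g ((extChartAt I p).symm y)).comp A)

variable (I M) in
/-- Moderate nets of smooth `(0,2)`-tensor fields, depending smoothly on `ε`. -/
def ModTensor : Type _ :=
  {g : ℝ → Tensor02 I M // ∀ p : M,
    SmoothNet (extChartAt I p).target (fun ε => chartCoeff I p (g ε)) ∧
    ModerateOn (extChartAt I p).target (fun ε => chartCoeff I p (g ε))}

instance ModTensor.setoid : Setoid (ModTensor I M) where
  r g g' := ∀ p : M, NegligibleOn (extChartAt I p).target
    (fun ε y => chartCoeff I p (g.1 ε) y - chartCoeff I p (g'.1 ε) y)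
  iseqv :=
    { refl := fun _ _ => NegligibleOn.sub_self _ _
      symm := fun h p => (h p).sub_symm
      trans := fun h h' p => (h p).sub_trans (h' p) }

variable (I M) in
/-- The space `𝒢⁰₂(M)` of generalized `(0,2)`-tensor fields. -/
def GenTensor : Type _ := Quotient (ModTensor.setoid (I := I) (M := M))

/-- `B` has index `ν`: the largest dimension of a negative definite subspace is `ν`. -/
def HasIndex (B : F →L[ℝ] F →L[ℝ] ℝ) (ν : ℕ) : Prop :=
  IsGreatest {k : ℕ | ∃ W : Submodule ℝ F, Module.finrank ℝ W = k ∧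
    ∀ w ∈ W, w ≠ 0 → B w w < 0} ν

/-- Generalized semi-Riemannian metrics: symmetric, with (generalized) determinant invertible,
i.e. `|det| > ε ^ m` for some `m` on compact subsets of charts for small `ε`, and with a
well-defined index. -/
def IsGenMetric [FiniteDimensional ℝ F] (g : GenTensor I M) : Prop :=
  ∃ G : ModTensor I M, Quotient.mk _ G = g ∧
    (∀ ε ∈ Ioc (0 : ℝ) 1, ∀ (x : M) (a b : TangentSpace I x), G.1 ε x a b = G.1 ε x b a) ∧
    (∀ p : M, ∀ K ⊆ (extChartAt I p).target, IsCompact K → ∃ (m : ℕ) (ε₀ : ℝ), 0 < ε₀ ∧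
      ∀ ε ∈ Ioo 0 ε₀, ∀ y ∈ K, ε ^ m < |(Matrix.of fun i j =>
        chartCoeff I p (G.1 ε) y (Module.finBasis ℝ F i) (Module.finBasis ℝ F j)).det|) ∧
    ∃ ν : ℕ, ∀ p : M, ∀ K ⊆ (extChartAt I p).target, IsCompact K → ∃ ε₀ : ℝ, 0 < ε₀ ∧
      ∀ ε ∈ Ioo 0 ε₀, ∀ y ∈ K, HasIndex (chartCoeff I p (G.1 ε) y) ν

/-! ### Geodesics -/

/-- The Christoffel symbols (of the second kind) `Γ(a,b) = (∑ Γᵏᵢⱼ aⁱ bʲ)ₖ` at `y` of the metric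
with coordinate expression `G`: the vector with
`G(Γ(a,b), c) = ½ (∂_a G(b,c) + ∂_b G(a,c) - ∂_c G(a,b))` for all `c`. -/
def christoffel (G : F → F →L[ℝ] F →L[ℝ] ℝ) (y a b : F) : F :=
  (G y).inverse ((1 / 2 : ℝ) • (fderiv ℝ G y a b + fderiv ℝ G y b a
    - ((fderiv ℝ G y).flip a).flip b))

variable (I) in
/-- The coordinate expression of `c''` (the induced covariant derivative of `c'` along `c`) with
respect to the metric `g`, in the preferred chart at `p`. -/
def covAccel (g : Tensor02 I M) (c : ℝ → M) (p : M) (t : ℝ) : F :=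
  let x : ℝ → F := fun s => extChartAt I p (c s)
  iteratedDeriv 2 x t + christoffel (chartCoeff I p g) (x t) (deriv x t) (deriv x t)

/-- `γ ∈ 𝒢[J, M]` is a geodesic of `g`: `γ'' = 0` as a generalized vector field along `γ`.
Negligibility of the net of vector fields `γ_ε''` along `γ_ε` is tested in charts of `M`, at those
parameters for which `γ_ε` lies in a given compact subset of the chart domain. -/
def IsGeodesic (g : GenTensor I M) {J : Set ℝ} (γ : GenMap I M J) : Prop :=
  ∃ (G : ModTensor I M) (c : ModMap I M J), Quotient.mk _ G = g ∧ Quotient.mk _ c = γ ∧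
    ∀ p : M, ∀ K ⊆ (extChartAt I p).source, IsCompact K → ∀ L ⊆ J, IsCompact L →
      ∀ m : ℕ, ∃ C ε₀ : ℝ, 0 < ε₀ ∧ ∀ ε ∈ Ioo 0 ε₀, ∀ t ∈ L, c.1 ε t ∈ K →
        ‖covAccel I (G.1 ε) (c.1 ε) p t‖ ≤ C * ε ^ m

/-- The velocity of `γ` at `t₀` is bounded, i.e. `γ'(t₀)` is a compactly supported generalized
point of the tangent bundle (e.g. a classical tangent vector). -/
def BoundedVelocityAt {J : Set ℝ} (γ : GenMap I M J) (t₀ : ℝ) : Prop :=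
  ∃ c : ModMap I M J, Quotient.mk _ c = γ ∧ ∀ ψ : M → ℝ, ContMDiff I 𝓘(ℝ, ℝ) ∞ ψ →
    ∃ C ε₀ : ℝ, 0 < ε₀ ∧ ∀ ε ∈ Ioo 0 ε₀, |deriv (fun t => ψ (c.1 ε t)) t₀| ≤ C

/-- Geodesic completeness: every geodesic `γ ∈ 𝒢[J, M]` on an open interval `J` (with bounded
velocity at some parameter) can be defined on `ℝ`, i.e. is the restriction of a geodesic in
`𝒢[ℝ, M]`. -/
def GeodesicallyComplete (g : GenTensor I M) : Prop :=
  ∀ J : Set ℝ, IsOpen J → J.OrdConnected → ∀ γ : GenMap I M J, IsGeodesic g γ →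
    (∃ t₀ ∈ J, BoundedVelocityAt γ t₀) →
    ∃ γ' : GenMap I M univ, IsGeodesic g γ' ∧ γ'.restrict (subset_univ J) = γ

end Manifold

/-! ### The INPW metric -/

section INPW

variable {E : Type*} [NormedAddCommGroup E] [NormedSpace ℝ E]
  {N : Type*} [TopologicalSpace N] [ChartedSpace E N]

variable (E) in
/-- The product model of `M = N × ℝ²`, with points `(x, (u, v))`. -/
abbrev inpwModel : ModelWithCorners ℝ (E × (ℝ × ℝ)) (ModelProd E (ℝ × ℝ)) :=
  𝓘(ℝ, E).prod 𝓘(ℝ, ℝ × ℝ)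

/-- The one-form `du` on `N × ℝ²`. -/
def dU (q : N × (ℝ × ℝ)) : TangentSpace (inpwModel E) q →L[ℝ] ℝ :=
  mfderiv (inpwModel E) 𝓘(ℝ, ℝ) (fun q : N × (ℝ × ℝ) => q.2.1) q

/-- The one-form `dv` on `N × ℝ²`. -/
def dV (q : N × (ℝ × ℝ)) : TangentSpace (inpwModel E) q →L[ℝ] ℝ :=
  mfderiv (inpwModel E) 𝓘(ℝ, ℝ) (fun q : N × (ℝ × ℝ) => q.2.2) q

variable [RiemannianBundle (fun x : N => TangentSpace 𝓘(ℝ, E) x)]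

/-- The pull-back `dh²` to `N × ℝ²` of the Riemannian metric of `N`. -/
def dH (q : N × (ℝ × ℝ)) :
    TangentSpace (inpwModel E) q →L[ℝ] TangentSpace (inpwModel E) q →L[ℝ] ℝ :=
  let P : TangentSpace (inpwModel E) q →L[ℝ] TangentSpace 𝓘(ℝ, E) q.1 :=
    mfderiv (inpwModel E) 𝓘(ℝ, E) Prod.fst q
  (P.precomp ℝ).comp ((innerSL ℝ (E := TangentSpace 𝓘(ℝ, E) q.1)).comp P)

/-- `dh² + 2 du dv + f(x) d(u) du²`. -/
def inpwTensor (f : N → ℝ) (d : ℝ → ℝ) : Tensor02 (inpwModel E) (N × (ℝ × ℝ)) := fun q =>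
  dH q + ((dU q).smulRight (dV q) + (dV q).smulRight (dU q))
    + (f q.1 * d q.2.1) • (dU q).smulRight (dU q)


variable [FiniteDimensional ℝ E] [IsManifold 𝓘(ℝ, E) ∞ N]
  [IsContMDiffRiemannianBundle 𝓘(ℝ, E) ∞ E (fun x : N => TangentSpace 𝓘(ℝ, E) x)]

/-- The Riemannian metric of `N` has smooth coordinate expressions. -/
theorem contDiffOn_metric (p : N) :
    ContDiffOn ℝ ∞ (chartCoeff 𝓘(ℝ, E) p
      (fun x => innerSL ℝ (E := TangentSpace 𝓘(ℝ, E) x))) (extChartAt 𝓘(ℝ, E) p).target := by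
  have ho : IsOpen (extChartAt 𝓘(ℝ, E) p).target := isOpen_extChartAt_target p
  have hs : ∀ a : E, ContMDiffOn 𝓘(ℝ, E) 𝓘(ℝ, E).tangent ∞
      (fun y : E => (⟨(extChartAt 𝓘(ℝ, E) p).symm y,
        mfderiv 𝓘(ℝ, E) 𝓘(ℝ, E) (extChartAt 𝓘(ℝ, E) p).symm y a⟩ : TangentBundle 𝓘(ℝ, E) N))
      (extChartAt 𝓘(ℝ, E) p).target := by
    intro a
    have h1 := (contMDiffOn_extChartAt_symm (I := 𝓘(ℝ, E)) (n := ∞)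
      p).contMDiffOn_tangentMapWithin (m := ∞) (by simp) ho.uniqueMDiffOn
    have h2 : ContMDiff 𝓘(ℝ, E) 𝓘(ℝ, E).tangent ∞
        (fun y : E => (⟨y, a⟩ : TangentBundle 𝓘(ℝ, E) E)) := by
      exact contMDiff_vectorSpace_iff_contDiff.2 contDiff_const
    refine (h1.comp h2.contMDiffOn (t := _) (s := (extChartAt 𝓘(ℝ, E) p).target)
      (fun y hy => hy)).congr ?_
    intro y hy
    simp only [Function.comp, tangentMapWithin, mfderivWithin_of_isOpen ho hy]
  rw [contDiffOn_clm_apply]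
  intro a
  rw [contDiffOn_clm_apply]
  intro b
  have h := ContMDiffOn.inner_bundle (IB := 𝓘(ℝ, E)) (n := ∞) (F := E)
    (E := fun x : N => TangentSpace 𝓘(ℝ, E) x) (IM := 𝓘(ℝ, E))
    (s := (extChartAt 𝓘(ℝ, E) p).target)
    (b := (extChartAt 𝓘(ℝ, E) p).symm)
    (v := fun y => mfderiv 𝓘(ℝ, E) 𝓘(ℝ, E) (extChartAt 𝓘(ℝ, E) p).symm y a)
    (w := fun y => mfderiv 𝓘(ℝ, E) 𝓘(ℝ, E) (extChartAt 𝓘(ℝ, E) p).symm y b)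
    (hs a) (hs b)
  exact h.contDiffOn

/-- The coordinate expression of the INPW metric. -/
theorem exists_chartCoeff_inpwTensor {f : N → ℝ} (hf : ContMDiff 𝓘(ℝ, E) 𝓘(ℝ, ℝ) ∞ f)
    (p : N × (ℝ × ℝ)) :
    ∃ (S : E × (ℝ × ℝ) → (E × (ℝ × ℝ)) →L[ℝ] (E × (ℝ × ℝ)) →L[ℝ] ℝ)
      (a : E × (ℝ × ℝ) → ℝ) (L : (E × (ℝ × ℝ)) →L[ℝ] ℝ)
      (B : (E × (ℝ × ℝ)) →L[ℝ] (E × (ℝ × ℝ)) →L[ℝ] ℝ),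
      ContDiffOn ℝ ∞ S (extChartAt (inpwModel E) p).target ∧
      ContDiffOn ℝ ∞ a (extChartAt (inpwModel E) p).target ∧
      ∀ (d : ℝ → ℝ), ∀ y ∈ (extChartAt (inpwModel E) p).target,
        chartCoeff (inpwModel E) p (inpwTensor f d) y = S y + (a y * d (L y)) • B := by
  have ht : (extChartAt (inpwModel E) p).target =
      (extChartAt 𝓘(ℝ, E) p.1).target ×ˢ univ := by
    rw [extChartAt_prod, PartialEquiv.prod_target, extChartAt_model_space_eq_id]; rfl
  let P : (E × (ℝ × ℝ)) →L[ℝ] E := ContinuousLinearMap.fst ℝ E (ℝ × ℝ)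
  let uL : (E × (ℝ × ℝ)) →L[ℝ] ℝ :=
    (ContinuousLinearMap.fst ℝ ℝ ℝ).comp (ContinuousLinearMap.snd ℝ E (ℝ × ℝ))
  let vL : (E × (ℝ × ℝ)) →L[ℝ] ℝ :=
    (ContinuousLinearMap.snd ℝ ℝ ℝ).comp (ContinuousLinearMap.snd ℝ E (ℝ × ℝ))
  let Hc := chartCoeff 𝓘(ℝ, E) p.1 (fun x : N => innerSL ℝ (E := TangentSpace 𝓘(ℝ, E) x))
  have hHc : ContDiffOn ℝ ∞ Hc (extChartAt 𝓘(ℝ, E) p.1).target := contDiffOn_metric p.1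
  have hfst : MapsTo (fun y : E × (ℝ × ℝ) => y.1) (extChartAt (inpwModel E) p).target
      (extChartAt 𝓘(ℝ, E) p.1).target := fun y hy => by rw [ht] at hy; exact hy.1
  refine ⟨fun y => (P.precomp ℝ).comp ((Hc y.1).comp P) + (uL.smulRight vL + vL.smulRight uL),
    fun y => f ((extChartAt 𝓘(ℝ, E) p.1).symm y.1), uL, uL.smulRight uL, ?_, ?_, ?_⟩
  · rw [contDiffOn_clm_apply]
    intro a
    rw [contDiffOn_clm_apply]
    intro b
    have h1 : ContDiffOn ℝ ∞ (fun y : E × (ℝ × ℝ) => Hc y.1 (P a) (P b))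
        (extChartAt (inpwModel E) p).target :=
      ((hHc.comp contDiff_fst.contDiffOn hfst).clm_apply contDiffOn_const).clm_apply
        contDiffOn_const
    exact h1.add contDiffOn_const
  · have h1 := (hf.comp_contMDiffOn (contMDiffOn_extChartAt_symm (I := 𝓘(ℝ, E)) (n := ∞)
      p.1)).contDiffOn
    exact h1.comp contDiff_fst.contDiffOn hfst
  · intro d y hy
    have hy1 := hfst hy
    let Ψ := (extChartAt (inpwModel E) p).symm
    have hΨ : ∀ z, Ψ z = ((extChartAt 𝓘(ℝ, E) p.1).symm z.1, z.2) := by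
      intro z
      simp only [Ψ, inpwModel]
      rw [extChartAt_prod, extChartAt_model_space_eq_id]
      rfl
    have hd : MDifferentiableAt 𝓘(ℝ, E × (ℝ × ℝ)) (inpwModel E) Ψ y :=
      ((contMDiffOn_extChartAt_symm (I := inpwModel E) (n := ∞) p).contMDiffAt
        ((isOpen_extChartAt_target p).mem_nhds hy)).mdifferentiableAt (by simp)
    have hd1 : MDifferentiableAt 𝓘(ℝ, E) 𝓘(ℝ, E) (extChartAt 𝓘(ℝ, E) p.1).symm y.1 :=
      ((contMDiffOn_extChartAt_symm (I := 𝓘(ℝ, E)) (n := ∞) p.1).contMDiffAt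
        ((isOpen_extChartAt_target p.1).mem_nhds hy1)).mdifferentiableAt (by simp)
    have hP : (Prod.fst : N × (ℝ × ℝ) → N) ∘ Ψ
        = (extChartAt 𝓘(ℝ, E) p.1).symm ∘ (Prod.fst : E × (ℝ × ℝ) → E) := by
      funext z; simp [hΨ]
    have hu : (fun q : N × (ℝ × ℝ) => q.2.1) ∘ Ψ = uL := by funext z; simp [hΨ, uL]
    have hv : (fun q : N × (ℝ × ℝ) => q.2.2) ∘ Ψ = vL := by funext z; simp [hΨ, vL]
    have eP : (mfderiv (inpwModel E) 𝓘(ℝ, E) Prod.fst (Ψ y)).comp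
        (mfderiv 𝓘(ℝ, E × (ℝ × ℝ)) (inpwModel E) Ψ y)
        = (mfderiv 𝓘(ℝ, E) 𝓘(ℝ, E) (extChartAt 𝓘(ℝ, E) p.1).symm y.1).comp P := by
      have h1 := mfderiv_comp y (I'' := 𝓘(ℝ, E)) (mdifferentiableAt_fst (x := Ψ y)) hd
      have h2 := mfderiv_comp y (I := 𝓘(ℝ, E × (ℝ × ℝ))) (f := (Prod.fst : E × (ℝ × ℝ) → E))
        hd1 (contMDiff_iff_contDiff.2 (contDiff_fst (n := 1))
          |>.mdifferentiableAt (by simp))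
      rw [← h1, hP, h2, mfderiv_eq_fderiv, fderiv_fst]
      rfl
    have eu : (dU (Ψ y)).comp (mfderiv 𝓘(ℝ, E × (ℝ × ℝ)) (inpwModel E) Ψ y) = uL := by
      have hm : MDifferentiableAt (inpwModel E) 𝓘(ℝ, ℝ) (fun q : N × (ℝ × ℝ) => q.2.1) (Ψ y) :=
        ((contDiff_fst.contMDiff.comp contMDiff_snd) : ContMDiff (inpwModel E) 𝓘(ℝ, ℝ) ∞
          (fun q : N × (ℝ × ℝ) => q.2.1)).mdifferentiableAt (by simp)
      have h1 := mfderiv_comp y hm hd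
      rw [hu, mfderiv_eq_fderiv, uL.fderiv] at h1
      exact h1.symm
    have ev : (dV (Ψ y)).comp (mfderiv 𝓘(ℝ, E × (ℝ × ℝ)) (inpwModel E) Ψ y) = vL := by
      have hm : MDifferentiableAt (inpwModel E) 𝓘(ℝ, ℝ) (fun q : N × (ℝ × ℝ) => q.2.2) (Ψ y) :=
        ((contDiff_snd.contMDiff.comp contMDiff_snd) : ContMDiff (inpwModel E) 𝓘(ℝ, ℝ) ∞
          (fun q : N × (ℝ × ℝ) => q.2.2)).mdifferentiableAt (by simp)
      have h1 := mfderiv_comp y hm hd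
      rw [hv, mfderiv_eq_fderiv, vL.fderiv] at h1
      exact h1.symm
    let A : (E × (ℝ × ℝ)) →L[ℝ] TangentSpace (inpwModel E) (Ψ y) :=
      mfderiv 𝓘(ℝ, E × (ℝ × ℝ)) (inpwModel E) Ψ y
    let A₁ : E →L[ℝ] TangentSpace 𝓘(ℝ, E) ((extChartAt 𝓘(ℝ, E) p.1).symm y.1) :=
      mfderiv 𝓘(ℝ, E) 𝓘(ℝ, E) (extChartAt 𝓘(ℝ, E) p.1).symm y.1
    let Q : TangentSpace (inpwModel E) (Ψ y) →L[ℝ]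
        TangentSpace 𝓘(ℝ, E) ((extChartAt 𝓘(ℝ, E) p.1).symm y.1) :=
      mfderiv (inpwModel E) 𝓘(ℝ, E) Prod.fst (Ψ y)
    have eP' : ∀ a, Q (A a) = A₁ (P a) := fun a => DFunLike.congr_fun eP a
    have eu' : ∀ a, dU (Ψ y) (A a) = uL a := fun a => DFunLike.congr_fun eu a
    have ev' : ∀ a, dV (Ψ y) (A a) = vL a := fun a => DFunLike.congr_fun ev a
    refine ContinuousLinearMap.ext fun a => ContinuousLinearMap.ext fun b => ?_
    have e1 : chartCoeff (inpwModel E) p (inpwTensor f d) y a b =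
        innerSL ℝ (E := TangentSpace 𝓘(ℝ, E) ((extChartAt 𝓘(ℝ, E) p.1).symm y.1))
          (Q (A a)) (Q (A b))
        + (dU (Ψ y) (A a) * dV (Ψ y) (A b) + dV (Ψ y) (A a) * dU (Ψ y) (A b))
        + (f ((extChartAt 𝓘(ℝ, E) p.1).symm y.1) * d (uL y))
          * (dU (Ψ y) (A a) * dU (Ψ y) (A b)) := rfl
    rw [e1, eu', eu', ev', ev', eP', eP']
    rfl

/-- The net `dh² + 2 du dv + f(x) δ_ε(u) du²` for a moderate net `(δ_ε)`. -/
def inpwNet (f : C^∞⟮𝓘(ℝ, E), N; ℝ⟯) (δ : ModNet ℝ (univ : Set ℝ)) :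
    ModTensor (inpwModel E) (N × (ℝ × ℝ)) :=
  ⟨fun ε => inpwTensor f (δ.1 ε), by
    intro p
    obtain ⟨S, a, L, B, hS, ha, h⟩ := exists_chartCoeff_inpwTensor f.contMDiff p
    have ho := isOpen_extChartAt_target (I := inpwModel E) p
    obtain ⟨h1, h2⟩ := moderate_aux ho hS ha L B δ.2.1 δ.2.2
    exact ⟨h1.congr fun ε => h (δ.1 ε), h2.congr ho fun ε => h (δ.1 ε)⟩⟩

/-- The generalized INPW metric `dh² + 2 du dv + f(x) D(u) du²` on `N × ℝ²`, `D ∈ 𝒢(ℝ)`. -/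
def inpwMetric (f : C^∞⟮𝓘(ℝ, E), N; ℝ⟯) :
    GenFun ℝ (univ : Set ℝ) → GenTensor (inpwModel E) (N × (ℝ × ℝ)) :=
  Quotient.map (inpwNet f) (by
    intro δ δ' hδ p
    obtain ⟨S, a, L, B, hS, ha, h⟩ := exists_chartCoeff_inpwTensor f.contMDiff p
    refine (negligible_aux (S := S) ha L B hδ).congr fun ε y hy => ?_
    have e1 := h (δ.1 ε) y hy
    have e2 := h (δ'.1 ε) y hy
    simp only [inpwNet]
    rw [e1, e2])

end INPW

end Colombeau

end

universe u

namespace Colombeau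

section Superposition

set_option synthInstance.maxHeartbeats 200000
set_option linter.unusedSectionVars false

variable {K : Type*} [TopologicalSpace K] [CompactSpace K]
  {E F G : Type*} [NormedAddCommGroup E] [NormedSpace ℝ E] [NormedAddCommGroup F] [NormedSpace ℝ F]
  [NormedAddCommGroup G] [NormedSpace ℝ G]

/-- The superposition operator `α ↦ f ∘ α` on continuous functions. -/
def superpose (K : Type*) [TopologicalSpace K] {f : E → F} (hf : Continuous f) (α : C(K, E)) :
    C(K, F) := ⟨fun s => f (α s), hf.comp α.continuous⟩

/-- Pointwise application `A ↦ (β ↦ (s ↦ A s (β s)))`. -/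
noncomputable def pointwiseApply (K : Type*) [TopologicalSpace K] [CompactSpace K]
    (E F : Type*) [NormedAddCommGroup E] [NormedSpace ℝ E] [NormedAddCommGroup F]
    [NormedSpace ℝ F] : C(K, E →L[ℝ] F) →L[ℝ] C(K, E) →L[ℝ] C(K, F) :=
  LinearMap.mkContinuous₂
    (LinearMap.mk₂ ℝ (fun (A : C(K, E →L[ℝ] F)) (β : C(K, E)) =>
      (⟨fun s => A s (β s), A.continuous.clm_apply β.continuous⟩ : C(K, F)))
      (by intros; ext; simp) (by intros; ext; simp) (by intros; ext; simp) (by intros; ext; simp))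
    1 (by
      intro A β
      rw [ContinuousMap.norm_le _ (by positivity)]
      intro s
      rw [one_mul]
      exact ((A s).le_opNorm _).trans
        (by gcongr <;> apply ContinuousMap.norm_coe_le_norm))

@[simp] theorem pointwiseApply_apply (A : C(K, E →L[ℝ] F)) (β : C(K, E)) (s : K) :
    pointwiseApply K E F A β s = A s (β s) := rfl

theorem continuous_superpose {f : E → F} (hf : Continuous f) : Continuous (superpose K hf) :=
  ContinuousMap.continuous_postcomp ⟨f, hf⟩

theorem hasFDerivAt_superpose {f : E → F} (hf : ContDiff ℝ 1 f) (α : C(K, E)) :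
    HasFDerivAt (superpose K hf.continuous)
      (pointwiseApply K E F (superpose K (hf.continuous_fderiv one_ne_zero) α)) α := by
  rw [hasFDerivAt_iff_isLittleO_nhds_zero, Asymptotics.isLittleO_iff]
  intro c hc
  have hcomp : IsCompact (range α) := isCompact_range α.continuous
  have hu := hcomp.uniformContinuousAt_of_continuousAt (fderiv ℝ f)
    (fun a _ => (hf.continuous_fderiv one_ne_zero).continuousAt) (Metric.dist_mem_uniformity hc)
  obtain ⟨δ, hδ, H⟩ := Metric.mem_uniformity_dist.1 hu
  filter_upwards [Metric.ball_mem_nhds (0 : C(K, E)) hδ] with β hβ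
  rw [ContinuousMap.norm_le _ (by positivity)]
  intro s
  have hβ' : ‖β‖ < δ := by simpa using hβ
  have hs : ‖β s‖ ≤ ‖β‖ := β.norm_coe_le_norm s
  have key : ‖f (α s + β s) - f (α s) - fderiv ℝ f (α s) (α s + β s - α s)‖
      ≤ c * ‖α s + β s - α s‖ := by
    refine (convex_ball (α s) δ).norm_image_sub_le_of_norm_hasFDerivWithin_le'
      (f' := fderiv ℝ f) (fun z _ => ((hf.differentiable one_ne_zero) z).hasFDerivAt.hasFDerivWithinAt)
      (fun z hz => ?_) (Metric.mem_ball_self hδ) (by simpa using hs.trans_lt hβ')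
    have := H (a := α s) (b := z) (by rw [dist_comm]; exact hz) (mem_range_self s)
    rw [← dist_eq_norm, dist_comm]
    exact this.le
  calc _ = ‖f (α s + β s) - f (α s) - fderiv ℝ f (α s) (α s + β s - α s)‖ := by
        simp [superpose]
    _ ≤ c * ‖α s + β s - α s‖ := key
    _ ≤ c * ‖β‖ := by rw [add_sub_cancel_left]; gcongr

theorem contDiff_superpose_nat {E : Type u} [NormedAddCommGroup E] [NormedSpace ℝ E] (n : ℕ) :
    ∀ {F : Type u} [NormedAddCommGroup F] [NormedSpace ℝ F] {f : E → F} (hf : ContDiff ℝ ∞ f), ContDiff ℝ n (superpose K hf.continuous) := by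
  induction n with
  | zero =>
    intro F _ _ f hf
    exact contDiff_zero.2 (continuous_superpose hf.continuous)
  | succ n ih =>
    intro F _ _ f hf
    have hf1 : ContDiff ℝ 1 f := hf.of_le (by exact_mod_cast le_top)
    have hf' : ContDiff ℝ ∞ (fderiv ℝ f) := (contDiff_infty_iff_fderiv.1 hf).2
    rw [Nat.cast_add, Nat.cast_one, contDiff_succ_iff_fderiv]
    refine ⟨fun α => (hasFDerivAt_superpose hf1 α).differentiableAt, by simp, ?_⟩
    have e : fderiv ℝ (superpose K hf.continuous) =
        fun α => pointwiseApply K E F (superpose K hf'.continuous α) := by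
      funext α
      exact (hasFDerivAt_superpose hf1 α).fderiv
    rw [e]
    exact (pointwiseApply K E F).contDiff.comp (ih hf')

theorem contDiff_superpose {E F : Type u} [NormedAddCommGroup E] [NormedSpace ℝ E]
    [NormedAddCommGroup F] [NormedSpace ℝ F] {f : E → F} (hf : ContDiff ℝ ∞ f) :
    ContDiff ℝ ∞ (superpose K hf.continuous) :=
  contDiff_infty.2 fun n => contDiff_superpose_nat n hf

end Superposition

set_option linter.unusedSectionVars false

section LocalFlow

variable {Z : Type u} [NormedAddCommGroup Z] [NormedSpace ℝ Z] [CompleteSpace Z]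

/-- The primitive operator `α ↦ (s ↦ ∫₀ˢ α)` on `C([-1,1], Z)`. -/
noncomputable def primitiveCLM (Z : Type u) [NormedAddCommGroup Z] [NormedSpace ℝ Z] :
    C(Icc (-1 : ℝ) 1, Z) →L[ℝ] C(Icc (-1 : ℝ) 1, Z) :=
  LinearMap.mkContinuous
    { toFun := fun α => ⟨fun s => ∫ r in (0 : ℝ)..s, IccExtend (by norm_num : (-1 : ℝ) ≤ 1) α r,
        (intervalIntegral.continuous_primitive (f := IccExtend (by norm_num : (-1 : ℝ) ≤ 1) α)
          (fun a b => (α.continuous.Icc_extend').intervalIntegrable a b) 0).comp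
          continuous_subtype_val⟩
      map_add' := by
        intro α β
        ext s
        exact intervalIntegral.integral_add ((α.continuous.Icc_extend').intervalIntegrable _ _)
          ((β.continuous.Icc_extend').intervalIntegrable _ _)
      map_smul' := by
        intro c α
        ext s
        exact intervalIntegral.integral_smul c (IccExtend (by norm_num : (-1 : ℝ) ≤ 1) α) }
    1 (by
      intro α
      rw [ContinuousMap.norm_le _ (by positivity)]
      intro s
      have := intervalIntegral.norm_integral_le_of_norm_le_const (a := 0) (b := (s : ℝ))
        (f := IccExtend (by norm_num : (-1 : ℝ) ≤ 1) α) (C := ‖α‖)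
        (fun r _ => α.norm_coe_le_norm _)
      refine this.trans ?_
      rw [one_mul, sub_zero]
      exact mul_le_of_le_one_right (norm_nonneg _) (abs_le.2 s.2))

theorem primitiveCLM_apply (α : C(Icc (-1 : ℝ) 1, Z)) (s : Icc (-1 : ℝ) 1) :
    primitiveCLM Z α s = ∫ r in (0 : ℝ)..s, IccExtend (by norm_num : (-1 : ℝ) ≤ 1) α r := rfl

/-- If `α = x + τ ∫₀ f(α)` on `[-1,1]`, then `α` solves `α' = τ f(α)`, `α(0) = x`. -/
theorem hasDerivAt_of_eq_primitive {f : Z → Z} (hf : Continuous f) {τ : ℝ} {x : Z}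
    {α : C(Icc (-1 : ℝ) 1, Z)}
    (h : α - ContinuousMap.const _ x - τ • primitiveCLM Z (superpose _ hf α) = 0) :
    IccExtend (by norm_num : (-1 : ℝ) ≤ 1) α 0 = x ∧
    ∀ s ∈ Ioo (-1 : ℝ) 1, HasDerivAt (IccExtend (by norm_num : (-1 : ℝ) ≤ 1) α)
      (τ • f (IccExtend (by norm_num : (-1 : ℝ) ≤ 1) α s)) s := by
  have hval : ∀ s : Icc (-1 : ℝ) 1, α s = x +
      τ • ∫ r in (0 : ℝ)..s, f (IccExtend (by norm_num : (-1 : ℝ) ≤ 1) α r) := by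
    intro s
    have := DFunLike.congr_fun h s
    simp only [ContinuousMap.sub_apply, ContinuousMap.const_apply, ContinuousMap.smul_apply,
      ContinuousMap.zero_apply, primitiveCLM_apply] at this
    rw [sub_sub, sub_eq_zero] at this
    exact this
  have hc : Continuous fun r => f (IccExtend (by norm_num : (-1 : ℝ) ≤ 1) α r) :=
    hf.comp α.continuous.Icc_extend'
  constructor
  · rw [IccExtend_of_mem _ _ (by norm_num : (0 : ℝ) ∈ Icc (-1 : ℝ) 1), hval]
    simp
  · intro s hs
    have h1 : HasDerivAt (fun s => x + τ • ∫ r in (0 : ℝ)..s,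
        f (IccExtend (by norm_num : (-1 : ℝ) ≤ 1) α r))
        (τ • f (IccExtend (by norm_num : (-1 : ℝ) ≤ 1) α s)) s := by
      refine HasDerivAt.const_add x (HasDerivAt.const_smul τ ?_)
      exact intervalIntegral.integral_hasDerivAt_right (hc.intervalIntegrable _ _)
        (hc.stronglyMeasurableAtFilter _ _) hc.continuousAt
    refine h1.congr_of_eventuallyEq ?_
    filter_upwards [Ioo_mem_nhds hs.1 hs.2] with r hr
    rw [IccExtend_of_mem _ _ ⟨hr.1.le, hr.2.le⟩, hval]

open ContinuousMap in
/-- The map whose local inverse yields the flow. -/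
noncomputable def flowMap {f : Z → Z} (hf : Continuous f)
    (q : (ℝ × Z) × C(Icc (-1 : ℝ) 1, Z)) : (ℝ × Z) × C(Icc (-1 : ℝ) 1, Z) :=
  (q.1, q.2 - ContinuousMap.const _ q.1.2 - q.1.1 • primitiveCLM Z (superpose _ hf q.2))

/-- The inclusion of constants. -/
noncomputable def constCLM (Z : Type u) [NormedAddCommGroup Z] [NormedSpace ℝ Z] :
    Z →L[ℝ] C(Icc (-1 : ℝ) 1, Z) :=
  LinearMap.mkContinuous
    { toFun := fun x => ContinuousMap.const _ x
      map_add' := fun _ _ => rfl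
      map_smul' := fun _ _ => rfl } 1 (by
      intro x
      rw [ContinuousMap.norm_le _ (by positivity)]
      intro s
      exact (one_mul ‖x‖).ge)

theorem constCLM_apply (x : Z) : constCLM Z x = ContinuousMap.const _ x := rfl

theorem contDiff_flowMap {f : Z → Z} (hf : ContDiff ℝ ∞ f) :
    ContDiff ℝ ∞ (flowMap hf.continuous) := by
  refine contDiff_fst.prodMk ?_
  refine (contDiff_snd.sub ((constCLM Z).contDiff.comp
    (contDiff_snd.comp contDiff_fst))).sub ?_
  exact (contDiff_fst.comp contDiff_fst).smul
    ((primitiveCLM Z).contDiff.comp ((contDiff_superpose hf).comp contDiff_snd))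

theorem hasFDerivAt_flowMap {f : Z → Z} (hf : ContDiff ℝ ∞ f) (z : Z) :
    ∃ e : ((ℝ × Z) × C(Icc (-1 : ℝ) 1, Z)) ≃L[ℝ] ((ℝ × Z) × C(Icc (-1 : ℝ) 1, Z)),
      HasFDerivAt (flowMap hf.continuous) (e : _ →L[ℝ] _) ((0, z), constCLM Z z) := by
  let P := primitiveCLM Z (superpose _ hf.continuous (constCLM Z z))
  let A : (ℝ × Z) →L[ℝ] C(Icc (-1 : ℝ) 1, Z) :=
    -((constCLM Z).comp (ContinuousLinearMap.snd ℝ ℝ Z))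
      - (ContinuousLinearMap.fst ℝ ℝ Z).smulRight P
  refine ⟨(ContinuousLinearEquiv.refl ℝ _).skewProd (ContinuousLinearEquiv.refl ℝ _) A, ?_⟩
  have hd : DifferentiableAt ℝ (fun q : (ℝ × Z) × C(Icc (-1 : ℝ) 1, Z) =>
      primitiveCLM Z (superpose _ hf.continuous q.2)) ((0, z), constCLM Z z) :=
    (((primitiveCLM Z).contDiff.comp ((contDiff_superpose hf).comp
      contDiff_snd)).differentiable (by simp)) _
  have h1 := (hasFDerivAt_fst (𝕜 := ℝ) (p := (((0, z), constCLM Z z) :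
    (ℝ × Z) × C(Icc (-1 : ℝ) 1, Z)))).fst.smul hd.hasFDerivAt
  have h2 := (((hasFDerivAt_snd (𝕜 := ℝ) (p := (((0, z), constCLM Z z) :
    (ℝ × Z) × C(Icc (-1 : ℝ) 1, Z))))).sub ((constCLM Z).hasFDerivAt.comp _
      (hasFDerivAt_fst (𝕜 := ℝ) (p := (((0, z), constCLM Z z) :
    (ℝ × Z) × C(Icc (-1 : ℝ) 1, Z)))).snd)).sub h1
  have h3 := (hasFDerivAt_fst (𝕜 := ℝ) (p := (((0, z), constCLM Z z) :
    (ℝ × Z) × C(Icc (-1 : ℝ) 1, Z)))).prodMk h2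
  refine h3.congr_fderiv ?_
  refine ContinuousLinearMap.ext fun q => Prod.ext ?_ ?_
  · simp
  · simp [A, P]
    abel

theorem exists_flow_of_lipschitz {f : Z → Z} (hf : ContDiff ℝ ∞ f) {L : NNReal}
    (hL : LipschitzWith L f) (z : Z) :
    ∃ δ > 0, ∃ Fl : ℝ → Z → Z,
      ContDiffOn ℝ ∞ (fun q : ℝ × Z => Fl q.1 q.2) (Ioo (-δ) δ ×ˢ Metric.ball z δ) ∧
      ∀ x ∈ Metric.ball z δ, Fl 0 x = x ∧
        ∀ t ∈ Ioo (-δ) δ, HasDerivAt (fun t => Fl t x) (f (Fl t x)) t := by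
  obtain ⟨e, he⟩ := hasFDerivAt_flowMap hf z
  have hG := contDiff_flowMap hf
  have hstrict : HasStrictFDerivAt (flowMap hf.continuous) (e : _ →L[ℝ] _)
      ((0, z), constCLM Z z) := hG.contDiffAt.hasStrictFDerivAt' he (by simp)
  let Φ := hstrict.toOpenPartialHomeomorph (flowMap hf.continuous)
  have hΦ : ∀ q, Φ q = flowMap hf.continuous q := fun q => rfl
  have hsrc : ((0, z), constCLM Z z) ∈ Φ.source := hstrict.mem_toOpenPartialHomeomorph_source
  have hG0 : flowMap hf.continuous ((0, z), constCLM Z z) = ((0, z), 0) := by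
    simp [flowMap, constCLM_apply]
  have htgt : (((0, z), 0) : (ℝ × Z) × C(Icc (-1 : ℝ) 1, Z)) ∈ Φ.target := by
    have := Φ.map_source hsrc
    rwa [hΦ, hG0] at this
  have hsymm0 : Φ.symm ((0, z), 0) = ((0, z), constCLM Z z) := by
    rw [← hG0, ← hΦ, Φ.left_inv hsrc]
  -- invertibility of the derivative near the base point
  have hinv : ∀ᶠ q in 𝓝 (((0, z), constCLM Z z) : (ℝ × Z) × C(Icc (-1 : ℝ) 1, Z)),
      fderiv ℝ (flowMap hf.continuous) q ∈ range (fun e : ((ℝ × Z) × C(Icc (-1 : ℝ) 1, Z)) ≃L[ℝ]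
        ((ℝ × Z) × C(Icc (-1 : ℝ) 1, Z)) => (e : _ →L[ℝ] _)) := by
    have hc : ContinuousAt (fderiv ℝ (flowMap hf.continuous)) ((0, z), constCLM Z z) :=
      (hG.continuous_fderiv (by simp)).continuousAt
    refine hc.eventually_mem ?_
    rw [he.fderiv]
    exact e.nhds
  let ι : ℝ × Z → (ℝ × Z) × C(Icc (-1 : ℝ) 1, Z) := fun p => (p, 0)
  have hι : Continuous ι := by fun_prop
  have hgood : ∀ᶠ p in 𝓝 ((0, z) : ℝ × Z), ι p ∈ Φ.target ∧
      fderiv ℝ (flowMap hf.continuous) (Φ.symm (ι p)) ∈ range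
        (fun e : ((ℝ × Z) × C(Icc (-1 : ℝ) 1, Z)) ≃L[ℝ]
        ((ℝ × Z) × C(Icc (-1 : ℝ) 1, Z)) => (e : _ →L[ℝ] _)) := by
    refine (hι.continuousAt.eventually_mem (Φ.open_target.mem_nhds htgt)).and ?_
    have hc : ContinuousAt (fun p => Φ.symm (ι p)) (0, z) :=
      ContinuousAt.comp (Φ.continuousAt_symm htgt) hι.continuousAt
    refine hc.eventually (p := fun q => fderiv ℝ (flowMap hf.continuous) q ∈ range
        (fun e : ((ℝ × Z) × C(Icc (-1 : ℝ) 1, Z)) ≃L[ℝ]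
        ((ℝ × Z) × C(Icc (-1 : ℝ) 1, Z)) => (e : _ →L[ℝ] _))) ?_
    beta_reduce
    rw [show Φ.symm (ι (0, z)) = ((0, z), constCLM Z z) from hsymm0]
    exact hinv
  obtain ⟨δ, hδ, hball⟩ := Metric.mem_nhds_iff.1 hgood
  have hbox : ∀ t ∈ Ioo (-δ) δ, ∀ x ∈ Metric.ball z δ, ((t, x) : ℝ × Z) ∈ Metric.ball (0, z) δ := by
    intro t ht x hx
    rw [← ball_prod_same]
    exact ⟨by simpa [abs_lt] using ht, hx⟩
  let α : ℝ × Z → C(Icc (-1 : ℝ) 1, Z) := fun p => (Φ.symm (ι p)).2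
  have h1 : (1 : ℝ) ∈ Icc (-1 : ℝ) 1 := by norm_num
  have hα : ∀ p ∈ Metric.ball ((0, z) : ℝ × Z) δ, α p - ContinuousMap.const _ p.2 -
      p.1 • primitiveCLM Z (superpose _ hf.continuous (α p)) = 0 := by
    intro p hp
    have h := Φ.right_inv (hball hp).1
    rw [hΦ] at h
    have h1 : (Φ.symm (ι p)).1 = p := congrArg Prod.fst h
    have h2 := congrArg Prod.snd h
    simp only [flowMap, h1] at h2
    exact h2
  have hαs : ContDiffOn ℝ ∞ α (Metric.ball (0, z) δ) := by
    intro p hp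
    obtain ⟨hp1, e', he'⟩ := hball hp
    have hd : HasFDerivAt (flowMap hf.continuous) (e' : _ →L[ℝ] _) (Φ.symm (ι p)) := by
      rw [show (e' : _ →L[ℝ] _) = fderiv ℝ (flowMap hf.continuous) (Φ.symm (ι p)) from he']
      exact (hG.differentiable (by simp) _).hasFDerivAt
    have := Φ.contDiffAt_symm (n := ∞) hp1 hd hG.contDiffAt
    have hι' : ContDiff ℝ ∞ ι := contDiff_id.prodMk contDiff_const
    exact (contDiffAt_snd.comp p (this.comp p hι'.contDiffAt)).contDiffWithinAt
  have hαd := fun p hp => hasDerivAt_of_eq_primitive hf.continuous (hα p hp)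
  -- rescaling: `α (c τ) s = α τ (c s)`
  have hscale : ∀ τ x c, |c| < 1 → τ ∈ Ioo 0 δ → x ∈ Metric.ball z δ →
      α (c * τ, x) ⟨1, h1⟩ = IccExtend (by norm_num : (-1 : ℝ) ≤ 1) (α (τ, x)) c := by
    intro τ x c hc hτ hx
    have hcτ : |c * τ| < δ := by
      rw [abs_mul, abs_of_pos hτ.1]
      nlinarith [hτ.1, hτ.2, abs_nonneg c]
    obtain ⟨a0, a1⟩ := hαd (τ, x) (hbox τ ⟨by linarith [hτ.1], hτ.2⟩ x hx)
    obtain ⟨b0, b1⟩ := hαd (c * τ, x) (hbox (c * τ) (abs_lt.1 hcτ) x hx)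
    have key : EqOn (IccExtend (by norm_num : (-1 : ℝ) ≤ 1) (α (c * τ, x)))
        (fun s => IccExtend (by norm_num : (-1 : ℝ) ≤ 1) (α (τ, x)) (c * s)) (Icc (-1) 1) := by
      refine ODE_solution_unique_of_mem_Icc (v := fun _ y => (c * τ) • f y) (s := fun _ => univ)
        (K := ‖c * τ‖₊ * L) (t₀ := 0) ?_ (by norm_num) ?_ ?_ (by simp) ?_ ?_
        (by simp) ?_
      · intro t _
        refine LipschitzOnWith.of_dist_le_mul fun y _ y' _ => ?_
        rw [dist_smul₀, NNReal.coe_mul, mul_assoc, coe_nnnorm]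
        exact mul_le_mul_of_nonneg_left (hL.dist_le_mul y y') (norm_nonneg _)
      · exact (α (c * τ, x)).continuous.Icc_extend'.continuousOn
      · exact b1
      · exact ((α (τ, x)).continuous.Icc_extend'.comp (continuous_const_mul c)).continuousOn
      · intro t ht
        have hct : c * t ∈ Ioo (-1 : ℝ) 1 := by
          have : |c * t| < 1 := by
            rw [abs_mul]
            have := abs_lt.2 ht
            nlinarith [abs_nonneg c, abs_nonneg t]
          exact abs_lt.1 this
        have := (a1 (c * t) hct).scomp t ((hasDerivAt_id t).const_mul c)
        simpa [Function.comp_def, mul_smul] using this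
      · simp [a0, b0]
    have := key h1
    rw [IccExtend_of_mem _ _ h1] at this
    simpa using this
  refine ⟨δ, hδ, fun t x => α (t, x) ⟨1, h1⟩, ?_, ?_⟩
  · have hc : ContDiff ℝ ∞ (fun a : C(Icc (-1 : ℝ) 1, Z) => a ⟨1, h1⟩) :=
      ((ContinuousMap.evalCLM ℝ (⟨1, h1⟩ : Icc (-1 : ℝ) 1)) :
        C(Icc (-1 : ℝ) 1, Z) →L[ℝ] Z).contDiff
    have := hc.comp_contDiffOn hαs
    exact this.mono fun q hq => hbox q.1 hq.1 q.2 hq.2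
  · intro x hx
    have hd2 : ∀ t ∈ Ioo (-δ) δ, ∃ τ ∈ Ioo 0 δ, |t| < τ := by
      intro t ht
      exact ⟨(|t| + δ) / 2, ⟨by positivity, by linarith [abs_lt.2 ht]⟩, by linarith [abs_lt.2 ht]⟩
    constructor
    · have hτ : δ / 2 ∈ Ioo 0 δ := ⟨by positivity, by linarith⟩
      have := hscale (δ / 2) x 0 (by simp) hτ hx
      rw [zero_mul] at this
      refine this.trans ?_
      exact (hαd (δ / 2, x) (hbox (δ / 2) ⟨by linarith, hτ.2⟩ x hx)).1
    · intro t ht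
      obtain ⟨τ, hτ, htτ⟩ := hd2 t ht
      have hτ0 : τ ≠ 0 := hτ.1.ne'
      have hs : t / τ ∈ Ioo (-1 : ℝ) 1 := by
        rw [mem_Ioo, ← abs_lt, abs_div, abs_of_pos hτ.1, div_lt_one hτ.1]
        exact htτ
      have a1 := (hαd (τ, x) (hbox τ ⟨by linarith [hτ.1], hτ.2⟩ x hx)).2 (t / τ) hs
      have h2 := a1.scomp t ((hasDerivAt_id t).div_const τ)
      have e : (fun t => α (t, x) ⟨1, h1⟩) =ᶠ[𝓝 t]
          (IccExtend (by norm_num : (-1 : ℝ) ≤ 1) (α (τ, x))) ∘ fun t => id t / τ := by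
        have : ∀ᶠ r in 𝓝 t, |r| < τ := continuous_abs.continuousAt.eventually_lt_const htτ
        filter_upwards [this] with r hr
        have := hscale τ x (r / τ) (by
          rw [abs_div, abs_of_pos hτ.1, div_lt_one hτ.1]; exact hr) hτ hx
        rw [div_mul_cancel₀ _ hτ0] at this
        simpa using this
      have h3 := h2.congr_of_eventuallyEq e
      have ev := e.eq_of_nhds
      simp only [Function.comp, id] at ev
      simp only [ev]
      refine h3.congr_deriv ?_
      rw [smul_smul]
      simp [hτ0]

/-- **Local flow** of a smooth vector field, depending smoothly on time and initial point. -/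
theorem exists_local_flow {Z : Type u} [NormedAddCommGroup Z] [NormedSpace ℝ Z]
    [FiniteDimensional ℝ Z] {Ω : Set Z} (hΩ : IsOpen Ω) {f : Z → Z}
    (hf : ContDiffOn ℝ ∞ f Ω) {z : Z} (hz : z ∈ Ω) :
    ∃ δ > 0, ∃ Fl : ℝ → Z → Z,
      ContDiffOn ℝ ∞ (fun q : ℝ × Z => Fl q.1 q.2) (Ioo (-δ) δ ×ˢ Metric.ball z δ) ∧
      ∀ x ∈ Metric.ball z δ, Fl 0 x = x ∧
        ∀ t ∈ Ioo (-δ) δ, Fl t x ∈ Ω ∧ HasDerivAt (fun t => Fl t x) (f (Fl t x)) t := by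
  have : CompleteSpace Z := FiniteDimensional.complete ℝ Z
  obtain ⟨r, hr, hrΩ⟩ := Metric.nhds_basis_closedBall.mem_iff.1 (hΩ.mem_nhds hz)
  let χ : ContDiffBump z := ⟨r / 2, r, by positivity, by linarith⟩
  let g : Z → Z := fun x => χ x • f x
  have hg : ContDiff ℝ ∞ g := by
    rw [contDiff_iff_contDiffAt]
    intro x
    by_cases hx : x ∈ Ω
    · exact χ.contDiff.contDiffAt.smul (hf.contDiffAt (hΩ.mem_nhds hx))
    · have hx' : x ∉ tsupport χ := fun h => hx (hrΩ (by rwa [χ.tsupport_eq] at h))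
      have : g =ᶠ[𝓝 x] fun _ => 0 := by
        filter_upwards [(isClosed_tsupport χ).isOpen_compl.mem_nhds hx'] with y hy
        simp [g, image_eq_zero_of_notMem_tsupport hy]
      exact contDiffAt_const.congr_of_eventuallyEq this
  have hgc : HasCompactSupport g := χ.hasCompactSupport.smul_right
  obtain ⟨L, hL⟩ := hg.lipschitzWith_of_hasCompactSupport hgc (by simp)
  obtain ⟨δ, hδ, Fl, h1, h2⟩ := exists_flow_of_lipschitz hg hL z
  have hc : ContinuousAt (fun q : ℝ × Z => Fl q.1 q.2) (0, z) :=
    h1.continuousOn.continuousAt (prod_mem_nhds (Ioo_mem_nhds (by linarith) hδ)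
      (Metric.ball_mem_nhds z hδ))
  have hev : ∀ᶠ q in 𝓝 ((0, z) : ℝ × Z), Fl q.1 q.2 ∈ Metric.ball z (r / 2) := by
    refine hc.eventually_mem (Metric.isOpen_ball.mem_nhds ?_)
    rw [(h2 z (Metric.mem_ball_self hδ)).1]
    exact Metric.mem_ball_self (by positivity)
  obtain ⟨η, hη, hηb⟩ := Metric.mem_nhds_iff.1 hev
  have hsub : Metric.ball z (min δ η) ⊆ Metric.ball z δ := Metric.ball_subset_ball (min_le_left _ _)
  refine ⟨min δ η, lt_min hδ hη, Fl, h1.mono (prod_mono ?_ hsub), fun x hx =>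
    ⟨(h2 x (hsub hx)).1, fun t ht => ?_⟩⟩
  · exact Ioo_subset_Ioo (neg_le_neg (min_le_left _ _)) (min_le_left _ _)
  · have hin : Fl t x ∈ Metric.ball z (r / 2) := by
      refine hηb (a := (t, x)) ?_
      rw [← ball_prod_same]
      refine ⟨?_, Metric.ball_subset_ball (min_le_right _ _) hx⟩
      have := (abs_lt.2 ht).trans_le (min_le_right _ _)
      simpa using this
    have ht' : t ∈ Ioo (-δ) δ := abs_lt.1 ((abs_lt.2 ht).trans_le (min_le_left _ _))
    refine ⟨hrΩ (Metric.ball_subset_closedBall (Metric.ball_subset_ball (by linarith) hin)), ?_⟩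
    have := (h2 x (hsub hx)).2 t ht'
    have e : χ (Fl t x) = 1 := χ.one_of_mem_closedBall (Metric.ball_subset_closedBall hin)
    simpa [g, e] using this

end LocalFlow

theorem contDiff_primitive {g : ℝ × ℝ → ℝ} (hg : ContDiff ℝ ∞ g) (t₀ : ℝ) :
    ContDiff ℝ ∞ (fun q : ℝ × ℝ => ∫ s in t₀..q.2, g (q.1, s)) := by
  have h1 : (1 : ℝ) ∈ Icc (-1 : ℝ) 1 := by norm_num
  let e : C(Icc (-1 : ℝ) 1, ℝ × ℝ) := ⟨fun r => (0, r), by fun_prop⟩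
  let α : ℝ × ℝ → C(Icc (-1 : ℝ) 1, ℝ × ℝ) := fun q => constCLM (ℝ × ℝ) (q.1, t₀) + (q.2 - t₀) • e
  have hα : ContDiff ℝ ∞ α := by
    refine ContDiff.add ((constCLM (ℝ × ℝ)).contDiff.comp (contDiff_fst.prodMk contDiff_const)) ?_
    exact (contDiff_snd.sub contDiff_const).smul contDiff_const
  have hev : ContDiff ℝ ∞ (fun a : C(Icc (-1 : ℝ) 1, ℝ) => a ⟨1, h1⟩) :=
    ((ContinuousMap.evalCLM ℝ (⟨1, h1⟩ : Icc (-1 : ℝ) 1)) :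
      C(Icc (-1 : ℝ) 1, ℝ) →L[ℝ] ℝ).contDiff
  have h2 : ContDiff ℝ ∞ (fun q : ℝ × ℝ => (q.2 - t₀) *
      (primitiveCLM ℝ (superpose _ hg.continuous (α q))) ⟨1, h1⟩) :=
    (contDiff_snd.sub contDiff_const).mul (hev.comp ((primitiveCLM ℝ).contDiff.comp
      ((contDiff_superpose hg).comp hα)))
  convert h2 using 1
  funext q
  have h3 : (primitiveCLM ℝ (superpose _ hg.continuous (α q))) ⟨1, h1⟩ =
      ∫ r in (0 : ℝ)..1, g (q.1, t₀ + (q.2 - t₀) * r) := by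
    rw [primitiveCLM_apply]
    refine intervalIntegral.integral_congr fun r hr => ?_
    rw [uIcc_of_le zero_le_one] at hr
    have hr' : r ∈ Icc (-1 : ℝ) 1 := ⟨by linarith [hr.1], hr.2⟩
    rw [IccExtend_of_mem _ _ hr']
    simp [superpose, α, e, constCLM_apply]
  rw [h3]
  have h4 := intervalIntegral.mul_integral_comp_add_mul (a := 0) (b := 1)
    (f := fun s => g (q.1, s)) (c := q.2 - t₀) (d := t₀)
  rw [h4]
  simp

theorem contDiffOn_primitive {Λ : Set ℝ} (hΛ : IsOpen Λ) {g : ℝ × ℝ → ℝ}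
    (hg : ContDiffOn ℝ ∞ g (Λ ×ˢ univ)) (t₀ : ℝ) :
    ContDiffOn ℝ ∞ (fun q : ℝ × ℝ => ∫ s in t₀..q.2, g (q.1, s)) (Λ ×ˢ univ) := by
  rintro ⟨ε, t⟩ ⟨hε, -⟩
  obtain ⟨r, hr, hrΛ⟩ := Metric.nhds_basis_closedBall.mem_iff.1 (hΛ.mem_nhds hε)
  let χ : ContDiffBump ε := ⟨r / 2, r, by positivity, by linarith⟩
  have hg' : ContDiff ℝ ∞ (fun q : ℝ × ℝ => χ q.1 * g q) := by
    rw [contDiff_iff_contDiffAt]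
    intro x
    by_cases hx : x.1 ∈ Λ
    · exact (χ.contDiff.contDiffAt.comp x contDiffAt_fst).mul
        (hg.contDiffAt ((hΛ.prod isOpen_univ).mem_nhds ⟨hx, mem_univ _⟩))
    · have hx' : x.1 ∉ tsupport χ := fun h => hx (hrΛ (by rwa [χ.tsupport_eq] at h))
      have : (fun q : ℝ × ℝ => χ q.1 * g q) =ᶠ[𝓝 x] fun _ => 0 := by
        filter_upwards [continuousAt_fst.eventually_mem
          ((isClosed_tsupport χ).isOpen_compl.mem_nhds hx')] with y hy
        simp [image_eq_zero_of_notMem_tsupport hy]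
      exact contDiffAt_const.congr_of_eventuallyEq this
  refine ((contDiff_primitive hg' t₀).contDiffAt.congr_of_eventuallyEq ?_).contDiffWithinAt
  have : ∀ᶠ q in 𝓝 ((ε, t) : ℝ × ℝ), χ q.1 = 1 := by
    refine continuousAt_fst.eventually (p := fun y => χ y = 1) ?_
    filter_upwards [Metric.closedBall_mem_nhds ε (by positivity : 0 < r / 2)] with y hy
    exact χ.one_of_mem_closedBall hy
  filter_upwards [this] with q hq
  simp [hq]

section NetCalculus

variable {F : Type*} [NormedAddCommGroup F] [NormedSpace ℝ F]
  {V : Type*} [NormedAddCommGroup V] [NormedSpace ℝ V]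

theorem SmoothNet.contDiffOn {U : Set F} {w : ℝ → F → V} (h : SmoothNet U w) {ε : ℝ}
    (hε : ε ∈ Ioc (0 : ℝ) 1) : ContDiffOn ℝ ∞ (w ε) U := by
  have h' : ContDiffOn ℝ ∞ (fun q : ℝ × F => w q.1 q.2) (Ioc (0 : ℝ) 1 ×ˢ U) := h
  have : ContDiffOn ℝ ∞ (fun x : F => ((ε, x) : ℝ × F)) U :=
    (contDiff_const.prodMk contDiff_id).contDiffOn
  exact h'.comp this (fun x hx => ⟨hε, hx⟩)

theorem norm_fderiv_apply_mul_le {w : F → V} {U : Set F} (hU : IsOpen U) (hw : ContDiffOn ℝ ∞ w U)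
    {y : F} {s B : ℝ} (hs : 0 < s) (hball : Metric.closedBall y s ⊆ U)
    (hB : ∀ z ∈ Metric.closedBall y s, ‖iteratedFDeriv ℝ 2 w z‖ ≤ B) {a : F} (ha : ‖a‖ = 1) :
    s * ‖fderiv ℝ w y a‖ ≤ ‖w (y + s • a)‖ + ‖w y‖ + B * s * s := by
  have hy : y ∈ Metric.closedBall y s := Metric.mem_closedBall_self hs.le
  have h2 : ContDiffOn ℝ ∞ (fderiv ℝ w) U := hw.fderiv_of_isOpen hU (by simp)
  have hd2 : ∀ z ∈ Metric.closedBall y s, DifferentiableAt ℝ (fderiv ℝ w) z := fun z hz =>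
    (h2.contDiffAt (hU.mem_nhds (hball hz))).differentiableAt (by simp)
  have hB2 : ∀ z ∈ Metric.closedBall y s, ‖fderiv ℝ (fderiv ℝ w) z‖ ≤ B := fun z hz => by
    rw [← norm_iteratedFDeriv_one, norm_iteratedFDeriv_fderiv]
    exact hB z hz
  have hB0 : 0 ≤ B := (norm_nonneg _).trans (hB y hy)
  have hlip : ∀ z ∈ Metric.closedBall y s, ‖fderiv ℝ w z - fderiv ℝ w y‖ ≤ B * s := by
    intro z hz
    refine ((convex_closedBall y s).norm_image_sub_le_of_norm_fderiv_le hd2 hB2 hy hz).trans ?_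
    exact mul_le_mul_of_nonneg_left (by rwa [← dist_eq_norm]) hB0
  have hz : y + s • a ∈ Metric.closedBall y s := by
    simp [norm_smul, ha, abs_of_pos hs]
  have key := (convex_closedBall y s).norm_image_sub_le_of_norm_hasFDerivWithin_le'
    (fun z hz => ((hw.contDiffAt (hU.mem_nhds (hball hz))).differentiableAt
      (by simp)).hasFDerivAt.hasFDerivWithinAt) hlip hy hz
  rw [add_sub_cancel_left, map_smul, norm_smul, ha, mul_one, Real.norm_eq_abs, abs_of_pos hs] at key
  calc s * ‖fderiv ℝ w y a‖ = ‖s • fderiv ℝ w y a‖ := by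
        rw [norm_smul, Real.norm_eq_abs, abs_of_pos hs]
    _ = ‖w (y + s • a) - w y - (w (y + s • a) - w y - s • fderiv ℝ w y a)‖ := by congr 1; abel
    _ ≤ ‖w (y + s • a) - w y‖ + ‖w (y + s • a) - w y - s • fderiv ℝ w y a‖ := norm_sub_le _ _
    _ ≤ _ := add_le_add (norm_sub_le _ _) key

/-- The derivative of a negligible net is negligible. -/
theorem NegligibleOn.fderiv [FiniteDimensional ℝ F] {U : Set F} (hU : IsOpen U) {w : ℝ → F → V}
    (hs : ∀ ε ∈ Ioo (0 : ℝ) 1, ContDiffOn ℝ ∞ (w ε) U) (hm : ModerateOn U w)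
    (hn : NegligibleOn U w) : NegligibleOn U (fun ε => fderiv ℝ (w ε)) := by
  have : ProperSpace F := FiniteDimensional.proper_real F
  intro K hK hKc m
  obtain ⟨δ, hδ, hδU⟩ := hKc.exists_cthickening_subset_open hU hK
  have hK' : IsCompact (Metric.cthickening δ K) := hKc.cthickening
  obtain ⟨m₂, C₂, e₂, he₂, H₂⟩ := hm _ hδU hK' 2
  obtain ⟨C₁, e₁, he₁, H₁⟩ := hn _ hδU hK' (m + (m + m₂ + 1))
  refine ⟨2 * |C₁| + |C₂|, min (min 1 δ) (min e₁ e₂), by positivity, fun ε hε y hy => ?_⟩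
  obtain ⟨hε0, hε'⟩ := hε
  simp only [lt_min_iff] at hε'
  obtain ⟨⟨hε1, hεδ⟩, hεe₁, hεe₂⟩ := hε'
  have hsδ : ε ^ (m + m₂ + 1) ≤ δ := by
    refine (pow_le_of_le_one hε0.le hε1.le (by omega)).trans hεδ.le
  have hsp : 0 < ε ^ (m + m₂ + 1) := by positivity
  have hsub : Metric.closedBall y (ε ^ (m + m₂ + 1)) ⊆ Metric.cthickening δ K :=
    (Metric.closedBall_subset_closedBall hsδ).trans (Metric.closedBall_subset_cthickening hy δ)
  refine ContinuousLinearMap.opNorm_le_of_unit_norm (by positivity) fun a ha => ?_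
  have h1 := norm_fderiv_apply_mul_le hU (hs ε ⟨hε0, hε1⟩) hsp (hsub.trans hδU)
    (fun z hz => H₂ ε ⟨hε0, hεe₂⟩ z (hsub hz)) ha
  have h2 := H₁ ε ⟨hε0, hεe₁⟩ (y + ε ^ (m + m₂ + 1) • a) (hsub (by
    simp [norm_smul, ha, abs_of_pos hε0]))
  have h3 := H₁ ε ⟨hε0, hεe₁⟩ y (hsub (Metric.mem_closedBall_self hsp.le))
  have h4 : C₁ * ε ^ (m + (m + m₂ + 1)) ≤ |C₁| * ε ^ m * ε ^ (m + m₂ + 1) := by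
    rw [pow_add, ← mul_assoc]
    gcongr
    exact le_abs_self _
  have h5 : C₂ / ε ^ m₂ * ε ^ (m + m₂ + 1) ≤ |C₂| * ε ^ m := by
    have e : C₂ / ε ^ m₂ * ε ^ (m + m₂ + 1) = C₂ * (ε ^ m * ε) := by
      field_simp
      ring
    rw [e]
    calc C₂ * (ε ^ m * ε) ≤ |C₂| * (ε ^ m * 1) := by
          gcongr
          exact le_abs_self _
      _ = _ := by ring
  have h6 := mul_le_mul_of_nonneg_right h5 hsp.le
  refine le_of_mul_le_mul_left (h1.trans ?_) hsp
  nlinarith [h2, h3, h4, h6]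

/-- A smooth reparametrization of `(0,1]` into `(0,1)`, equal to the identity near `0`. -/
theorem exists_reparam : ∃ φ : ℝ → ℝ, ContDiff ℝ ∞ φ ∧ (∀ ε ∈ Ioc (0 : ℝ) 1, φ ε ∈ Ioo (0 : ℝ) 1) ∧
    ∀ ε ≤ (1 / 4 : ℝ), φ ε = ε := by
  let s : ℝ → ℝ := fun ε => Real.smoothTransition (4 * ε - 1)
  have hs : ContDiff ℝ ∞ s := Real.smoothTransition.contDiff.comp
    ((contDiff_const.mul contDiff_id).sub contDiff_const)
  refine ⟨fun ε => ε * (1 - s ε) + 1 / 2 * s ε, ?_, fun ε hε => ?_, fun ε hε => ?_⟩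
  · exact (contDiff_id.mul (contDiff_const.sub hs)).add (contDiff_const.mul hs)
  · have h0 : 0 ≤ s ε := Real.smoothTransition.nonneg _
    have h1 : s ε ≤ 1 := Real.smoothTransition.le_one _
    by_cases h : ε < 1 / 2
    · constructor <;> nlinarith [hε.1, hε.2]
    · have : s ε = 1 := Real.smoothTransition.one_of_one_le (by linarith)
      simp only [this]
      norm_num
  · have : s ε = 0 := Real.smoothTransition.zero_of_nonpos (by linarith)
    simp [this]

/-- A **Gronwall** inequality with integrable kernel. -/
theorem norm_le_of_norm_deriv_le_kernel_right {a b : ℝ} {Z Z' : ℝ → V} {k : ℝ → ℝ}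
    (hk : Continuous k) (hk0 : ∀ t, 0 ≤ k t) (hZ : ∀ t ∈ Icc a b, HasDerivAt Z (Z' t) t)
    {η η' : ℝ} (hη : 0 ≤ η) (hη' : η < η') (hb : ∀ t ∈ Icc a b, ‖Z' t‖ ≤ k t * ‖Z t‖ + η)
    (h0 : Z a = 0) :
    ∀ t ∈ Icc a b, ‖Z t‖ ≤ η' * (t - a) * Real.exp (∫ s in a..t, k s) := by
  have hη0 : 0 < η' := hη.trans_lt hη'
  have hK : ∀ t, HasDerivAt (fun t => ∫ s in a..t, k s) (k t) t := fun t =>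
    intervalIntegral.integral_hasDerivAt_right (hk.intervalIntegrable _ _)
      (hk.stronglyMeasurableAtFilter _ _) hk.continuousAt
  refine image_norm_le_of_norm_deriv_right_lt_deriv_boundary'
    (f' := Z') (B' := fun t => η' * Real.exp (∫ s in a..t, k s)
      + η' * (t - a) * (Real.exp (∫ s in a..t, k s) * k t))
    (fun t ht => (hZ t ht).continuousAt.continuousWithinAt)
    (fun t ht => (hZ t ⟨ht.1, ht.2.le⟩).hasDerivWithinAt) (by simp [h0]) ?_ ?_ ?_
  · refine ContinuousOn.mul (by fun_prop) (Real.continuous_exp.comp_continuousOn fun t _ =>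
      (hK t).continuousAt.continuousWithinAt)
  · intro t _
    have h1 : HasDerivAt (fun t => η' * (t - a)) η' t := by
      simpa using ((hasDerivAt_id t).sub_const a).const_mul η'
    exact (h1.mul (hK t).exp).hasDerivWithinAt
  · intro t ht he
    have h1 := hb t ⟨ht.1, ht.2.le⟩
    have h2 : 1 ≤ Real.exp (∫ s in a..t, k s) := by
      rw [Real.one_le_exp_iff]
      exact intervalIntegral.integral_nonneg ht.1 fun s _ => hk0 s
    rw [he] at h1
    nlinarith [hk0 t]

theorem norm_le_of_norm_deriv_le_kernel {a b t₀ : ℝ} (ht₀ : t₀ ∈ Icc a b) {Z Z' : ℝ → V}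
    {k : ℝ → ℝ} (hk : Continuous k) (hk0 : ∀ t, 0 ≤ k t)
    (hZ : ∀ t ∈ Icc a b, HasDerivAt Z (Z' t) t)
    {η : ℝ} (hη : 0 < η) (hb : ∀ t ∈ Icc a b, ‖Z' t‖ ≤ k t * ‖Z t‖ + η)
    (h0 : Z t₀ = 0) {B : ℝ} (hB : ∫ s in a..b, k s ≤ B) :
    ∀ t ∈ Icc a b, ‖Z t‖ ≤ 2 * η * (b - a) * Real.exp B := by
  have hsub : ∀ c d, a ≤ c → c ≤ d → d ≤ b → ∫ s in c..d, k s ≤ B := by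
    intro c d hc hcd hd
    refine le_trans ?_ hB
    exact intervalIntegral.integral_mono_interval hc hcd hd (Eventually.of_forall hk0)
      (hk.intervalIntegrable _ _)
  intro t ht
  rcases le_total t₀ t with h | h
  · have := norm_le_of_norm_deriv_le_kernel_right hk hk0
      (fun s hs => hZ s ⟨ht₀.1.trans hs.1, hs.2⟩) hη.le (by linarith : η < 2 * η)
      (fun s hs => hb s ⟨ht₀.1.trans hs.1, hs.2⟩) h0 t ⟨h, ht.2⟩
    refine this.trans ?_
    have h1 := hsub t₀ t ht₀.1 h ht.2
    exact mul_le_mul (mul_le_mul_of_nonneg_left (by linarith [ht.2, ht₀.1]) (by positivity))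
      (Real.exp_le_exp.2 h1) (Real.exp_pos _).le
      (mul_nonneg (by positivity) (by linarith [ht.1, ht.2]))
  · have := norm_le_of_norm_deriv_le_kernel_right (a := t₀) (b := 2 * t₀ - a)
      (Z := fun s => Z (2 * t₀ - s)) (Z' := fun s => -Z' (2 * t₀ - s))
      (k := fun s => k (2 * t₀ - s)) (by fun_prop) (fun s => hk0 _)
      (fun s hs => by
        have h1 := (hZ (2 * t₀ - s) ⟨by linarith [hs.2], by linarith [hs.1, ht₀.2]⟩).scomp s
          ((hasDerivAt_id s).const_sub (2 * t₀))
        simpa [Function.comp_def] using h1) hη.le (by linarith : η < 2 * η)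
      (fun s hs => by
        simpa using hb (2 * t₀ - s) ⟨by linarith [hs.2], by linarith [hs.1, ht₀.2]⟩)
      (by simpa [two_mul] using h0) (2 * t₀ - t) ⟨by linarith, by linarith [ht.1]⟩
    simp only [sub_sub_cancel] at this
    refine this.trans ?_
    have h1 : ∫ s in t₀..(2 * t₀ - t), k (2 * t₀ - s) ≤ B := by
      rw [intervalIntegral.integral_comp_sub_left]
      refine hsub _ _ ?_ ?_ ?_ <;> linarith [ht.1, ht₀.2]
    exact mul_le_mul (mul_le_mul_of_nonneg_left (by linarith [ht.1, ht₀.2]) (by positivity))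
      (Real.exp_le_exp.2 h1) (Real.exp_pos _).le
      (mul_nonneg (by positivity) (by linarith [ht.1, ht.2]))

/-- If `|e'| ≤ 2 k √e`, then `√e` varies by at most `∫ k`. -/
theorem sqrt_le_sqrt_add_integral {a b : ℝ} {e e' k : ℝ → ℝ} (hk : Continuous k)
    (hk0 : ∀ t, 0 ≤ k t) (he : ∀ t ∈ Icc a b, HasDerivAt e (e' t) t) (he0 : ∀ t ∈ Icc a b, 0 ≤ e t)
    (hb : ∀ t ∈ Icc a b, |e' t| ≤ 2 * k t * √(e t)) {s t : ℝ} (hs : s ∈ Icc a b)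
    (ht : t ∈ Icc a b) : √(e t) ≤ √(e s) + ∫ r in a..b, k r := by
  refine le_of_forall_pos_le_add fun θ hθ => ?_
  have hK : ∀ t, HasDerivAt (fun t => ∫ s in a..t, k s) (k t) t := fun t =>
    intervalIntegral.integral_hasDerivAt_right (hk.intervalIntegrable _ _)
      (hk.stronglyMeasurableAtFilter _ _) hk.continuousAt
  have hpos : ∀ t ∈ Icc a b, 0 < e t + θ ^ 2 := fun t ht => by have := he0 t ht; positivity
  have hd : ∀ t ∈ Icc a b, HasDerivAt (fun t => √(e t + θ ^ 2)) (e' t / (2 * √(e t + θ ^ 2))) t :=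
    fun t ht => ((he t ht).add_const _).sqrt (hpos t ht).ne'
  have hbd : ∀ t ∈ Icc a b, |e' t / (2 * √(e t + θ ^ 2))| ≤ k t := by
    intro t ht
    have hp : 0 < √(e t + θ ^ 2) := Real.sqrt_pos.2 (hpos t ht)
    rw [abs_div, abs_of_pos (by positivity : 0 < 2 * √(e t + θ ^ 2)), div_le_iff₀ (by positivity)]
    refine (hb t ht).trans ?_
    have : √(e t) ≤ √(e t + θ ^ 2) := Real.sqrt_le_sqrt (by nlinarith)
    nlinarith [hk0 t]
  have h1 : MonotoneOn (fun t => (∫ r in a..t, k r) - √(e t + θ ^ 2)) (Icc a b) := by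
    refine monotoneOn_of_deriv_nonneg (convex_Icc a b)
      (fun t ht => ((hK t).sub (hd t ht)).continuousAt.continuousWithinAt)
      (fun t ht => ((hK t).sub (hd t (interior_subset ht))).differentiableAt.differentiableWithinAt)
      fun t ht => ?_
    have ht' := interior_subset ht
    rw [((hK t).fun_sub (hd t ht')).deriv]
    linarith [(abs_le.1 (hbd t ht')).2]
  have h2 : MonotoneOn (fun t => (∫ r in a..t, k r) + √(e t + θ ^ 2)) (Icc a b) := by
    refine monotoneOn_of_deriv_nonneg (convex_Icc a b)
      (fun t ht => ((hK t).add (hd t ht)).continuousAt.continuousWithinAt)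
      (fun t ht => ((hK t).add (hd t (interior_subset ht))).differentiableAt.differentiableWithinAt)
      fun t ht => ?_
    have ht' := interior_subset ht
    rw [((hK t).fun_add (hd t ht')).deriv]
    linarith [(abs_le.1 (hbd t ht')).1]
  have hmono : MonotoneOn (fun t => ∫ r in a..t, k r) (Icc a b) := by
    intro x hx y hy hxy
    exact intervalIntegral.integral_mono_interval le_rfl hx.1 hxy (Eventually.of_forall hk0)
      (hk.intervalIntegrable _ _)
  have hab : a ≤ b := hs.1.trans hs.2
  have hI0 : ∀ x ∈ Icc a b, 0 ≤ ∫ r in a..x, k r := fun x hx =>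
    intervalIntegral.integral_nonneg hx.1 fun r _ => hk0 r
  have hI1 : ∀ x ∈ Icc a b, ∫ r in a..x, k r ≤ ∫ r in a..b, k r := fun x hx =>
    hmono hx (right_mem_Icc.2 hab) hx.2
  have h3 : √(e t + θ ^ 2) ≤ √(e s + θ ^ 2) + ∫ r in a..b, k r := by
    rcases le_total s t with h | h
    · have := h1 hs ht h
      simp only at this
      linarith [hI0 s hs, hI1 t ht]
    · have := h2 ht hs h
      simp only at this
      linarith [hI0 t ht, hI1 s hs]
  have h4 : √(e s + θ ^ 2) ≤ √(e s) + θ := by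
    refine Real.sqrt_le_iff.2 ⟨by positivity, ?_⟩
    nlinarith [Real.sq_sqrt (he0 s hs), Real.sqrt_nonneg (e s)]
  have h5 : √(e t) ≤ √(e t + θ ^ 2) := Real.sqrt_le_sqrt (by nlinarith)
  linarith

end NetCalculus

section Bounded

variable {F : Type*} [NormedAddCommGroup F] [NormedSpace ℝ F] [FiniteDimensional ℝ F]
  {H : Type*} [TopologicalSpace H] {I : ModelWithCorners ℝ F H}
  {M : Type*} [TopologicalSpace M] [ChartedSpace H M] [IsManifold I ∞ M] [SigmaCompactSpace M]
  [T2Space M]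

theorem exists_contMDiff_ge (I : ModelWithCorners ℝ F H) [IsManifold I ∞ M] {ρ : M → ℝ}
    (hρ : Continuous ρ) {g : ℝ → ℝ} (hg : Monotone g) :
    ∃ ψ : M → ℝ, ContMDiff I 𝓘(ℝ, ℝ) ∞ ψ ∧ ∀ x, g (ρ x) ≤ ψ x := by
  obtain ⟨ψ, hψ⟩ := exists_contMDiffMap_forall_mem_convex_of_local_const (n := ⊤) I
    (t := fun x => Ici (g (ρ x))) (fun x => convex_Ici _) (fun x => by
      refine ⟨g (ρ x + 1), ?_⟩
      filter_upwards [hρ.continuousAt.eventually_lt_const (lt_add_one (ρ x))] with y hy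
      exact hg hy.le)
  exact ⟨ψ, ψ.contMDiff, hψ⟩

/-- Generalized maps are bounded on compact sets, uniformly in `ε`. -/
theorem ModMap.exists_bound {J : Set ℝ} (c : ModMap I M J) {ρ : M → ℝ} (hρ : Continuous ρ)
    {L : Set ℝ} (hL : L ⊆ J) (hLc : IsCompact L) :
    ∃ R ε₀ : ℝ, 0 < ε₀ ∧ ∀ ε ∈ Ioo 0 ε₀, ∀ t ∈ L, ρ (c.1 ε t) ≤ R := by
  by_contra! hcon
  have h1 : ∀ n : ℕ, ∃ ε ∈ Ioo (0 : ℝ) (1 / (n + 1)), ∃ t ∈ L, (n : ℝ) < ρ (c.1 ε t) :=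
    fun n => hcon n (1 / (n + 1)) (by positivity)
  choose e he t ht hr using h1
  let g : ℝ → ℝ := fun r => ∑ n ∈ Finset.range ⌈r⌉₊, (1 / e n) ^ n
  have hpos : ∀ n, 0 ≤ (1 / e n) ^ n := fun n => by
    have := (he n).1
    positivity
  have hg : Monotone g := by
    intro r s hrs
    refine Finset.sum_le_sum_of_subset_of_nonneg ?_ fun n _ _ => hpos n
    exact Finset.range_mono (Nat.ceil_mono hrs)
  obtain ⟨ψ, hψ, hψg⟩ := exists_contMDiff_ge I hρ hg
  obtain ⟨m, C, e₀, he₀, H⟩ := c.2.2 ψ hψ L hL hLc 0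
  obtain ⟨n, hn⟩ := exists_nat_gt (max (max (m + 1 : ℝ) |C|) (1 / e₀))
  simp only [max_lt_iff] at hn
  obtain ⟨⟨hnm, hnC⟩, hne⟩ := hn
  have hnm' : m + 1 < n := by exact_mod_cast hnm
  obtain ⟨hen0, hen⟩ := he n
  have hn1 : (1 : ℝ) / (n + 1) < e₀ := by
    rw [div_lt_iff₀ (by positivity)]
    rw [div_lt_iff₀ he₀] at hne
    nlinarith
  have h2 := H (e n) ⟨hen0, hen.trans hn1⟩ (t n) (ht n)
  rw [norm_iteratedFDeriv_zero, Real.norm_eq_abs] at h2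
  have h3 : (1 / e n) ^ n ≤ g (ρ (c.1 (e n) (t n))) := by
    refine Finset.single_le_sum (f := fun n => (1 / e n) ^ n) (fun k _ => hpos k) ?_
    rw [Finset.mem_range, Nat.lt_ceil]
    exact hr n
  have h4 : (1 / e n) ^ n ≤ C / e n ^ m := h3.trans ((hψg _).trans ((le_abs_self _).trans h2))
  have h5 : (n : ℝ) + 1 < 1 / e n := by
    rw [lt_div_iff₀ hen0]
    rw [lt_div_iff₀ (by positivity)] at hen
    linarith
  have h6 : (1 / e n) ^ (n - m) ≤ C := by
    have e1 : (1 / e n) ^ n = (1 / e n) ^ (n - m) / e n ^ m := by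
      have e0 : ∀ (x : ℝ) (k : ℕ), (1 / x) ^ (k + m) = (1 / x) ^ k / x ^ m := fun x k => by
        rw [pow_add, one_div_pow x m, mul_one_div]
      rw [← e0, Nat.sub_add_cancel (by omega)]
    rw [e1, div_le_div_iff_of_pos_right (by positivity)] at h4
    exact h4
  have h7 : 1 / e n ≤ (1 / e n) ^ (n - m) :=
    le_self_pow₀ (by linarith [(Nat.cast_nonneg n : (0 : ℝ) ≤ n)]) (by omega)
  linarith [le_abs_self C]

end Bounded

section Christoffel

set_option synthInstance.maxHeartbeats 100000

variable {F : Type*} [NormedAddCommGroup F] [NormedSpace ℝ F]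

theorem exists_equiv_of_nondegenerate [FiniteDimensional ℝ F] {B : F →L[ℝ] F →L[ℝ] ℝ}
    (hB : ∀ a, (∀ b, B a b = 0) → a = 0) : ∃ e : F ≃L[ℝ] (F →L[ℝ] ℝ), (e : F →L[ℝ] _) = B := by
  have hinj : Function.Injective (B : F →ₗ[ℝ] (F →L[ℝ] ℝ)) := by
    rw [← LinearMap.ker_eq_bot, LinearMap.ker_eq_bot']
    intro a ha
    exact hB a fun b => DFunLike.congr_fun (show B a = 0 from ha) b
  have hdim : Module.finrank ℝ F = Module.finrank ℝ (F →L[ℝ] ℝ) := by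
    rw [← (LinearMap.toContinuousLinearMap : (F →ₗ[ℝ] ℝ) ≃ₗ[ℝ] (F →L[ℝ] ℝ)).finrank_eq,
      Module.finrank_linearMap_self]
  have hfin : FiniteDimensional ℝ (F →L[ℝ] ℝ) :=
    (LinearMap.toContinuousLinearMap : (F →ₗ[ℝ] ℝ) ≃ₗ[ℝ] (F →L[ℝ] ℝ)).finiteDimensional
  refine ⟨(LinearEquiv.ofInjectiveOfFinrankEq (B : F →ₗ[ℝ] (F →L[ℝ] ℝ)) hinj
    hdim).toContinuousLinearEquiv, ?_⟩
  ext a b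
  rfl

theorem apply_inverse_of_equiv {B : F →L[ℝ] F →L[ℝ] ℝ} {e : F ≃L[ℝ] (F →L[ℝ] ℝ)}
    (he : (e : F →L[ℝ] _) = B) (l : F →L[ℝ] ℝ) : B (B.inverse l) = l := by
  subst he
  simp

theorem eq_inverse_of_apply {B : F →L[ℝ] F →L[ℝ] ℝ} {e : F ≃L[ℝ] (F →L[ℝ] ℝ)}
    (he : (e : F →L[ℝ] _) = B) {z : F} {l : F →L[ℝ] ℝ} (h : B z = l) : z = B.inverse l := by
  subst he
  simp [← h]

variable {G : F → F →L[ℝ] F →L[ℝ] ℝ} {y : F}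

theorem apply_christoffel {e : F ≃L[ℝ] (F →L[ℝ] ℝ)} (he : (e : F →L[ℝ] _) = G y) (a b c : F) :
    G y (christoffel G y a b) c =
      1 / 2 * (fderiv ℝ G y a b c + fderiv ℝ G y b a c - fderiv ℝ G y c a b) := by
  rw [christoffel, apply_inverse_of_equiv he]
  simp

theorem eq_christoffel {e : F ≃L[ℝ] (F →L[ℝ] ℝ)} (he : (e : F →L[ℝ] _) = G y) {a b z : F}
    (h : ∀ c, G y z c =
      1 / 2 * (fderiv ℝ G y a b c + fderiv ℝ G y b a c - fderiv ℝ G y c a b)) :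
    z = christoffel G y a b := by
  refine eq_inverse_of_apply he (ContinuousLinearMap.ext fun c => ?_)
  rw [h]
  simp

/-- The transformation law of the Christoffel symbols. -/
theorem christoffel_comp {G₁ G₂ : F → F →L[ℝ] F →L[ℝ] ℝ} {τ : F → F}
    (hτ : ContDiffAt ℝ ∞ τ y) (hsurj : Function.Surjective (fderiv ℝ τ y))
    (hG₂ : DifferentiableAt ℝ G₂ (τ y))
    (hG : ∀ᶠ z in 𝓝 y, ∀ a b, G₁ z a b = G₂ (τ z) (fderiv ℝ τ z a) (fderiv ℝ τ z b))
    (hsymm : ∀ a b, G₂ (τ y) a b = G₂ (τ y) b a) (hG₁ : DifferentiableAt ℝ G₁ y)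
    {e₁ : F ≃L[ℝ] (F →L[ℝ] ℝ)} (he₁ : (e₁ : F →L[ℝ] _) = G₁ y)
    {e₂ : F ≃L[ℝ] (F →L[ℝ] ℝ)} (he₂ : (e₂ : F →L[ℝ] _) = G₂ (τ y)) (a b : F) :
    christoffel G₂ (τ y) (fderiv ℝ τ y a) (fderiv ℝ τ y b) =
      fderiv ℝ τ y (christoffel G₁ y a b) - fderiv ℝ (fderiv ℝ τ) y a b := by
  have hτd : DifferentiableAt ℝ τ y := hτ.differentiableAt (by simp)
  have hτ' : DifferentiableAt ℝ (fderiv ℝ τ) y :=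
    (hτ.fderiv_right (m := 1) (by norm_cast)).differentiableAt (by simp)
  have h2 : ∀ u v, fderiv ℝ (fderiv ℝ τ) y u v = fderiv ℝ (fderiv ℝ τ) y v u := fun u v =>
    by
    have := hτ.isSymmSndFDerivAt (n := ∞) (by
      simpa using (WithTop.coe_le_coe.2 le_top : ((2 : ℕ∞) : ℕ∞ω) ≤ ∞))
    exact this.eq u v
  have hD : ∀ v a b, fderiv ℝ G₁ y v a b =
      fderiv ℝ G₂ (τ y) (fderiv ℝ τ y v) (fderiv ℝ τ y a) (fderiv ℝ τ y b)
      + G₂ (τ y) (fderiv ℝ (fderiv ℝ τ) y v a) (fderiv ℝ τ y b)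
      + G₂ (τ y) (fderiv ℝ τ y a) (fderiv ℝ (fderiv ℝ τ) y v b) := by
    intro v a b
    have h1 : HasFDerivAt (fun z => G₁ z a b) _ y :=
      ((hG₁.hasFDerivAt.clm_apply (hasFDerivAt_const a y)).clm_apply (hasFDerivAt_const b y))
    have hc : HasFDerivAt (fun z => G₂ (τ z)) ((fderiv ℝ G₂ (τ y)).comp (fderiv ℝ τ y)) y :=
      HasFDerivAt.comp (𝕜 := ℝ) (G := F →L[ℝ] F →L[ℝ] ℝ) (g := G₂) y hG₂.hasFDerivAt hτd.hasFDerivAt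
    have hv : ∀ u, HasFDerivAt (fun z => fderiv ℝ τ z u) ((fderiv ℝ (fderiv ℝ τ) y).flip u) y :=
      fun u => by simpa using hτ'.hasFDerivAt.clm_apply (hasFDerivAt_const u y)
    have h3 := (hc.clm_apply (hv a)).clm_apply (hv b)
    have h4 : (fun z => G₁ z a b) =ᶠ[𝓝 y] fun z => G₂ (τ z) (fderiv ℝ τ z a) (fderiv ℝ τ z b) :=
      hG.mono fun z hz => hz a b
    have h5 := (h3.congr_of_eventuallyEq h4).unique h1
    have h6 := DFunLike.congr_fun h5 v
    simp at h6
    linarith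
  symm
  refine eq_christoffel he₂ fun c => ?_
  obtain ⟨v, rfl⟩ := hsurj c
  have h7 := hG.self_of_nhds (christoffel G₁ y a b) v
  rw [apply_christoffel he₁, hD, hD, hD] at h7
  rw [map_sub, sub_apply, ← h7]
  rw [hsymm (fderiv ℝ τ y b) (fderiv ℝ (fderiv ℝ τ) y a v), h2 b a, h2 v a, h2 v b,
    hsymm (fderiv ℝ τ y a) (fderiv ℝ (fderiv ℝ τ) y b v)]
  ring

theorem contDiffOn_inverse {X : Type*} [NormedAddCommGroup X] [NormedSpace ℝ X] {s : Set X}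
    [FiniteDimensional ℝ F] {G : X → F →L[ℝ] F →L[ℝ] ℝ} (hG : ContDiffOn ℝ ∞ G s)
    (hnd : ∀ x ∈ s, ∀ a, (∀ b, G x a b = 0) → a = 0) :
    ContDiffOn ℝ ∞ (fun x => (G x).inverse) s := by
  have : CompleteSpace F := FiniteDimensional.complete ℝ F
  intro x hx
  obtain ⟨e, he⟩ := exists_equiv_of_nondegenerate (hnd x hx)
  have h1 : ContDiffAt ℝ ∞ (ContinuousLinearMap.inverse : (F →L[ℝ] F →L[ℝ] ℝ) → _) (G x) := by
    rw [← he]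
    exact contDiffAt_map_inverse e
  exact h1.comp_contDiffWithinAt x (hG x hx)

end Christoffel

section Charts

set_option linter.unusedSectionVars false

variable {E : Type*} [NormedAddCommGroup E] [NormedSpace ℝ E]
  {N : Type*} [TopologicalSpace N] [ChartedSpace E N] [IsManifold 𝓘(ℝ, E) ∞ N]
  {D : Type*} [NormedAddCommGroup D] [NormedSpace ℝ D]

/-- The change of coordinates from the preferred chart at `p` to the one at `q`. -/
noncomputable def chartChange (p q : N) (y : E) : E :=
  extChartAt 𝓘(ℝ, E) q ((extChartAt 𝓘(ℝ, E) p).symm y)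

theorem contDiffAt_chart {g : D → N} {d : D} (hg : ContMDiffAt 𝓘(ℝ, D) 𝓘(ℝ, E) ∞ g d) {p : N}
    (hd : g d ∈ (extChartAt 𝓘(ℝ, E) p).source) :
    ContDiffAt ℝ ∞ (fun s => extChartAt 𝓘(ℝ, E) p (g s)) d := by
  rw [← contMDiffAt_iff_contDiffAt]
  exact (contMDiffAt_extChartAt' (by simpa using hd)).comp d hg

theorem contMDiffAt_chart_symm {p : N} {y : E} (hy : y ∈ (extChartAt 𝓘(ℝ, E) p).target) :
    ContMDiffAt 𝓘(ℝ, E) 𝓘(ℝ, E) ∞ (extChartAt 𝓘(ℝ, E) p).symm y :=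
  (contMDiffOn_extChartAt_symm (I := 𝓘(ℝ, E)) (n := ∞) p).contMDiffAt
    ((isOpen_extChartAt_target p).mem_nhds hy)

theorem contDiffAt_chartChange {p q : N} {y : E} (hy : y ∈ (extChartAt 𝓘(ℝ, E) p).target)
    (hq : (extChartAt 𝓘(ℝ, E) p).symm y ∈ (extChartAt 𝓘(ℝ, E) q).source) :
    ContDiffAt ℝ ∞ (chartChange p q) y :=
  contDiffAt_chart (contMDiffAt_chart_symm hy) hq

theorem chartChange_chart {p q x : N} (hx : x ∈ (extChartAt 𝓘(ℝ, E) p).source) :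
    chartChange (E := E) p q (extChartAt 𝓘(ℝ, E) p x) = extChartAt 𝓘(ℝ, E) q x := by
  rw [chartChange, (extChartAt 𝓘(ℝ, E) p).left_inv hx]

theorem fderiv_chartChange_symm {p q : N} {y : E} (hy : y ∈ (extChartAt 𝓘(ℝ, E) p).target)
    (hq : (extChartAt 𝓘(ℝ, E) p).symm y ∈ (extChartAt 𝓘(ℝ, E) q).source) (w : E) :
    fderiv ℝ (chartChange q p) (chartChange p q y) (fderiv ℝ (chartChange p q) y w) = w := by
  have hy' : chartChange p q y ∈ (extChartAt 𝓘(ℝ, E) q).target :=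
    (extChartAt 𝓘(ℝ, E) q).map_source hq
  have hs : (extChartAt 𝓘(ℝ, E) q).symm (chartChange p q y) = (extChartAt 𝓘(ℝ, E) p).symm y :=
    (extChartAt 𝓘(ℝ, E) q).left_inv hq
  have h1 := (contDiffAt_chartChange hy hq).differentiableAt (by simp)
  have h2 : DifferentiableAt ℝ (chartChange q p) (chartChange p q y) :=
    (contDiffAt_chartChange hy' (by
      rw [hs]; exact (extChartAt 𝓘(ℝ, E) p).map_target hy)).differentiableAt (by simp)
  have h3 := h2.hasFDerivAt.comp y h1.hasFDerivAt
  have h4 : chartChange q p ∘ chartChange (E := E) p q =ᶠ[𝓝 y] id := by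
    have hc : ContinuousAt (extChartAt 𝓘(ℝ, E) p).symm y := (contMDiffAt_chart_symm hy).continuousAt
    filter_upwards [(isOpen_extChartAt_target p).mem_nhds hy,
      hc.eventually_mem ((isOpen_extChartAt_source q).mem_nhds hq)] with z hz hzq
    simp only [Function.comp, chartChange, id]
    rw [(extChartAt 𝓘(ℝ, E) q).left_inv hzq, (extChartAt 𝓘(ℝ, E) p).right_inv hz]
  have h5 := (h3.congr_of_eventuallyEq h4.symm).unique (hasFDerivAt_id y)
  exact DFunLike.congr_fun h5 w

theorem surjective_fderiv_chartChange {p q : N} {y : E}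
    (hy : y ∈ (extChartAt 𝓘(ℝ, E) p).target)
    (hq : (extChartAt 𝓘(ℝ, E) p).symm y ∈ (extChartAt 𝓘(ℝ, E) q).source) :
    Function.Surjective (fderiv ℝ (chartChange p q) y) := by
  intro v
  have hy' : chartChange p q y ∈ (extChartAt 𝓘(ℝ, E) q).target :=
    (extChartAt 𝓘(ℝ, E) q).map_source hq
  have hs : (extChartAt 𝓘(ℝ, E) q).symm (chartChange p q y) = (extChartAt 𝓘(ℝ, E) p).symm y :=
    (extChartAt 𝓘(ℝ, E) q).left_inv hq
  have h := fderiv_chartChange_symm (p := q) (q := p) hy' (by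
      rw [hs]; exact (extChartAt 𝓘(ℝ, E) p).map_target hy) v
  have e : chartChange q p (chartChange p q y) = y := by
    simp only [chartChange]
    rw [(extChartAt 𝓘(ℝ, E) q).left_inv hq, (extChartAt 𝓘(ℝ, E) p).right_inv hy]
  rw [e] at h
  exact ⟨_, h⟩

section Curves

variable {x : ℝ → N} {t : ℝ}

theorem chart_eventuallyEq_chartChange (hx : ContinuousAt x t) {p : N} (q : N)
    (hp : x t ∈ (extChartAt 𝓘(ℝ, E) p).source) :
    (fun s => extChartAt 𝓘(ℝ, E) q (x s)) =ᶠ[𝓝 t]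
      fun s => chartChange p q (extChartAt 𝓘(ℝ, E) p (x s)) := by
  filter_upwards [hx.eventually_mem ((isOpen_extChartAt_source p).mem_nhds hp)] with s hs
  rw [chartChange_chart hs]

theorem deriv_chart_change (hx : ContMDiffAt 𝓘(ℝ, ℝ) 𝓘(ℝ, E) ∞ x t) {p q : N}
    (hp : x t ∈ (extChartAt 𝓘(ℝ, E) p).source) (hq : x t ∈ (extChartAt 𝓘(ℝ, E) q).source) :
    deriv (fun s => extChartAt 𝓘(ℝ, E) q (x s)) t =
      fderiv ℝ (chartChange p q) (extChartAt 𝓘(ℝ, E) p (x t))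
        (deriv (fun s => extChartAt 𝓘(ℝ, E) p (x s)) t) := by
  have h1 := (contDiffAt_chart hx hp).differentiableAt (by simp)
  have h2 := (contDiffAt_chartChange (q := q) ((extChartAt 𝓘(ℝ, E) p).map_source hp) (by
    rwa [(extChartAt 𝓘(ℝ, E) p).left_inv hp])).differentiableAt (by simp)
  have h3 := h2.hasFDerivAt.comp_hasDerivAt t h1.hasDerivAt
  exact (h3.congr_of_eventuallyEq (chart_eventuallyEq_chartChange hx.continuousAt q hp)).deriv

theorem contDiffAt_deriv {V : Type*} [NormedAddCommGroup V] [NormedSpace ℝ V] {y : ℝ → V}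
    (hy : ContDiffAt ℝ ∞ y t) : ContDiffAt ℝ ∞ (deriv y) t :=
  (hy.fderiv_right (m := ∞) (by simp)).clm_apply contDiffAt_const

theorem deriv_deriv_chart_change (hx : ∀ᶠ s in 𝓝 t, ContMDiffAt 𝓘(ℝ, ℝ) 𝓘(ℝ, E) ∞ x s) {p q : N}
    (hp : x t ∈ (extChartAt 𝓘(ℝ, E) p).source) (hq : x t ∈ (extChartAt 𝓘(ℝ, E) q).source) :
    deriv (deriv (fun s => extChartAt 𝓘(ℝ, E) q (x s))) t =
      fderiv ℝ (chartChange p q) (extChartAt 𝓘(ℝ, E) p (x t))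
        (deriv (deriv (fun s => extChartAt 𝓘(ℝ, E) p (x s))) t)
      + fderiv ℝ (fderiv ℝ (chartChange p q)) (extChartAt 𝓘(ℝ, E) p (x t))
        (deriv (fun s => extChartAt 𝓘(ℝ, E) p (x s)) t)
        (deriv (fun s => extChartAt 𝓘(ℝ, E) p (x s)) t) := by
  have hxt := hx.self_of_nhds
  have e : deriv (fun s => extChartAt 𝓘(ℝ, E) q (x s)) =ᶠ[𝓝 t] fun s =>
      fderiv ℝ (chartChange p q) (extChartAt 𝓘(ℝ, E) p (x s))
        (deriv (fun s => extChartAt 𝓘(ℝ, E) p (x s)) s) := by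
    filter_upwards [hx, hxt.continuousAt.eventually_mem ((isOpen_extChartAt_source p).mem_nhds hp),
      hxt.continuousAt.eventually_mem ((isOpen_extChartAt_source q).mem_nhds hq)] with s h1 h2 h3
    exact deriv_chart_change h1 h2 h3
  have hc := contDiffAt_chart hxt hp
  have h1 := hc.differentiableAt (by simp)
  have h1' : DifferentiableAt ℝ (deriv (fun s => extChartAt 𝓘(ℝ, E) p (x s))) t :=
    (contDiffAt_deriv hc).differentiableAt (by simp)
  have h2 := (contDiffAt_chartChange (q := q) ((extChartAt 𝓘(ℝ, E) p).map_source hp) (by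
    rwa [(extChartAt 𝓘(ℝ, E) p).left_inv hp]))
  have h2' : DifferentiableAt ℝ (fderiv ℝ (chartChange p q)) (extChartAt 𝓘(ℝ, E) p (x t)) :=
    (h2.fderiv_right (m := 1) (by norm_cast)).differentiableAt (by simp)
  have h3 : HasDerivAt (fun s => fderiv ℝ (chartChange p q) (extChartAt 𝓘(ℝ, E) p (x s)))
      (fderiv ℝ (fderiv ℝ (chartChange p q)) (extChartAt 𝓘(ℝ, E) p (x t))
        (deriv (fun s => extChartAt 𝓘(ℝ, E) p (x s)) t)) t :=
    h2'.hasFDerivAt.comp_hasDerivAt t h1.hasDerivAt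
  have h4 := h3.clm_apply h1'.hasDerivAt
  rw [e.deriv_eq, h4.deriv, add_comm]

end Curves

end Charts

section SecondOrder

set_option linter.unusedSectionVars false

variable {E : Type u} [NormedAddCommGroup E] [NormedSpace ℝ E] [FiniteDimensional ℝ E]
  {N : Type*} [TopologicalSpace N] [ChartedSpace E N] [IsManifold 𝓘(ℝ, E) ∞ N]

/-- A smooth second order equation `x'' = acc(ε, t, x, x')` on `N`, given in the preferred charts,
depending on the parameter `ε ∈ Λ` and on time. -/
structure SecondOrderField (E : Type u) [NormedAddCommGroup E] [NormedSpace ℝ E]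
    (N : Type*) [TopologicalSpace N] [ChartedSpace E N] (Λ : Set ℝ) where
  /-- the acceleration in the preferred chart at a point -/
  acc : N → ℝ × ℝ → E → E → E
  smooth : ∀ p, ContDiffOn ℝ ∞ (fun z : (ℝ × ℝ) × E × E => acc p z.1 z.2.1 z.2.2)
    ((Λ ×ˢ univ) ×ˢ ((extChartAt 𝓘(ℝ, E) p).target ×ˢ univ))
  compat : ∀ p q, ∀ y ∈ (extChartAt 𝓘(ℝ, E) p).target,
    (extChartAt 𝓘(ℝ, E) p).symm y ∈ (extChartAt 𝓘(ℝ, E) q).source → ∀ ε ∈ Λ, ∀ t w,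
    acc q (ε, t) (chartChange p q y) (fderiv ℝ (chartChange p q) y w) =
      fderiv ℝ (chartChange p q) y (acc p (ε, t) y w)
        + fderiv ℝ (fderiv ℝ (chartChange p q)) y w w

theorem hasDerivAt_fst {V W : Type*} [NormedAddCommGroup V] [NormedSpace ℝ V]
    [NormedAddCommGroup W] [NormedSpace ℝ W] {g : ℝ → V × W} {g' : V × W} {t : ℝ}
    (h : HasDerivAt g g' t) : HasDerivAt (fun s => (g s).1) g'.1 t :=
  (ContinuousLinearMap.fst ℝ V W).hasFDerivAt.comp_hasDerivAt t h

theorem hasDerivAt_snd {V W : Type*} [NormedAddCommGroup V] [NormedSpace ℝ V]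
    [NormedAddCommGroup W] [NormedSpace ℝ W] {g : ℝ → V × W} {g' : V × W} {t : ℝ}
    (h : HasDerivAt g g' t) : HasDerivAt (fun s => (g s).2) g'.2 t :=
  (ContinuousLinearMap.snd ℝ V W).hasFDerivAt.comp_hasDerivAt t h

variable {Λ : Set ℝ} (S : SecondOrderField E N Λ)

/-- `x` solves the equation at time `t`. -/
def SecondOrderField.IsSolution (ε : ℝ) (x : ℝ → N) (t : ℝ) : Prop :=
  ContMDiffAt 𝓘(ℝ, ℝ) 𝓘(ℝ, E) ∞ x t ∧ ∀ p, x t ∈ (extChartAt 𝓘(ℝ, E) p).source →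
    deriv (deriv (fun s => extChartAt 𝓘(ℝ, E) p (x s))) t =
      S.acc p (ε, t) (extChartAt 𝓘(ℝ, E) p (x t)) (deriv (fun s => extChartAt 𝓘(ℝ, E) p (x s)) t)

/-- The curves `x` and `x'` have the same position and velocity at `t`. -/
def SameJet (E : Type u) [NormedAddCommGroup E] [NormedSpace ℝ E]
    {N : Type*} [TopologicalSpace N] [ChartedSpace E N] (x x' : ℝ → N) (t : ℝ) : Prop :=
  x t = x' t ∧ ∀ p, x t ∈ (extChartAt 𝓘(ℝ, E) p).source →
    deriv (fun s => extChartAt 𝓘(ℝ, E) p (x s)) t = deriv (fun s => extChartAt 𝓘(ℝ, E) p (x' s)) t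

theorem SameJet.symm {x x' : ℝ → N} {t : ℝ} (h : SameJet E x x' t) : SameJet E x' x t :=
  ⟨h.1.symm, fun p hp => (h.2 p (by rwa [h.1])).symm⟩

theorem SameJet.trans {x x' x'' : ℝ → N} {t : ℝ} (h : SameJet E x x' t) (h' : SameJet E x' x'' t) :
    SameJet E x x'' t :=
  ⟨h.1.trans h'.1, fun p hp => (h.2 p hp).trans (h'.2 p (by rwa [← h.1]))⟩

theorem SameJet.of_eventuallyEq {x x' : ℝ → N} {t : ℝ} (h : x =ᶠ[𝓝 t] x') : SameJet E x x' t :=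
  ⟨h.eq_of_nhds, fun p _ => (h.fun_comp (extChartAt 𝓘(ℝ, E) p)).deriv_eq⟩

theorem SameJet.of_chart {x x' : ℝ → N} {t : ℝ} (hx : ContMDiffAt 𝓘(ℝ, ℝ) 𝓘(ℝ, E) ∞ x t)
    (hx' : ContMDiffAt 𝓘(ℝ, ℝ) 𝓘(ℝ, E) ∞ x' t) (h : x t = x' t) {p : N}
    (hp : x t ∈ (extChartAt 𝓘(ℝ, E) p).source)
    (hd : deriv (fun s => extChartAt 𝓘(ℝ, E) p (x s)) t =
      deriv (fun s => extChartAt 𝓘(ℝ, E) p (x' s)) t) : SameJet E x x' t := by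
  refine ⟨h, fun q hq => ?_⟩
  rw [deriv_chart_change hx hp hq,
    deriv_chart_change (p := p) (q := q) hx' (by rwa [← h]) (by rwa [← h]), hd, h]

variable {S}

theorem SecondOrderField.IsSolution.of_chart {ε : ℝ} (hε : ε ∈ Λ) {x : ℝ → N} {t : ℝ}
    (hx : ∀ᶠ s in 𝓝 t, ContMDiffAt 𝓘(ℝ, ℝ) 𝓘(ℝ, E) ∞ x s) {p : N}
    (hp : x t ∈ (extChartAt 𝓘(ℝ, E) p).source)
    (h : deriv (deriv (fun s => extChartAt 𝓘(ℝ, E) p (x s))) t =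
      S.acc p (ε, t) (extChartAt 𝓘(ℝ, E) p (x t))
        (deriv (fun s => extChartAt 𝓘(ℝ, E) p (x s)) t)) : S.IsSolution ε x t := by
  refine ⟨hx.self_of_nhds, fun q hq => ?_⟩
  rw [deriv_deriv_chart_change hx hp hq, deriv_chart_change hx.self_of_nhds hp hq, h,
    ← chartChange_chart (p := p) (q := q) hp]
  exact (S.compat p q _ ((extChartAt 𝓘(ℝ, E) p).map_source hp)
    (by rwa [(extChartAt 𝓘(ℝ, E) p).left_inv hp]) ε hε t _).symm

theorem SecondOrderField.IsSolution.congr {ε : ℝ} {x x' : ℝ → N} {t : ℝ}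
    (h : S.IsSolution ε x t) (he : x' =ᶠ[𝓝 t] x) : S.IsSolution ε x' t := by
  refine ⟨h.1.congr_of_eventuallyEq he, fun p hp => ?_⟩
  have e1 : (fun s => extChartAt 𝓘(ℝ, E) p (x' s)) =ᶠ[𝓝 t] fun s => extChartAt 𝓘(ℝ, E) p (x s) :=
    he.fun_comp (extChartAt 𝓘(ℝ, E) p)
  rw [e1.deriv.deriv_eq, e1.deriv_eq, he.eq_of_nhds]
  exact h.2 p (by rwa [← he.eq_of_nhds])

variable (S)

/-- The first order vector field in the chart at `p`. -/
def SecondOrderField.phase (p : N) (z : (ℝ × ℝ) × E × E) : (ℝ × ℝ) × E × E :=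
  ((0, 1), (z.2.2, S.acc p z.1 z.2.1 z.2.2))

/-- The domain of `SecondOrderField.phase`. -/
def phaseDomain (E : Type u) [NormedAddCommGroup E] [NormedSpace ℝ E]
    {N : Type*} [TopologicalSpace N] [ChartedSpace E N] (Λ : Set ℝ) (p : N) :
    Set ((ℝ × ℝ) × E × E) :=
  (Λ ×ˢ univ) ×ˢ ((extChartAt 𝓘(ℝ, E) p).target ×ˢ univ)

theorem isOpen_phaseDomain (hΛ : IsOpen Λ) (p : N) : IsOpen (phaseDomain E Λ p) :=
  (hΛ.prod isOpen_univ).prod ((isOpen_extChartAt_target p).prod isOpen_univ)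

theorem SecondOrderField.contDiffOn_phase (p : N) :
    ContDiffOn ℝ ∞ (S.phase p) (phaseDomain E Λ p) :=
  contDiffOn_const.prodMk ((contDiff_snd.comp contDiff_snd).contDiffOn.prodMk (S.smooth p))

variable {S}

theorem SecondOrderField.IsSolution.hasDerivAt_phase {ε : ℝ} {x : ℝ → N} {t : ℝ}
    (h : S.IsSolution ε x t) {p : N} (hp : x t ∈ (extChartAt 𝓘(ℝ, E) p).source) :
    HasDerivAt (fun s => (((ε, s), (extChartAt 𝓘(ℝ, E) p (x s),
      deriv (fun s => extChartAt 𝓘(ℝ, E) p (x s)) s)) : (ℝ × ℝ) × E × E))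
      (S.phase p ((ε, t), (extChartAt 𝓘(ℝ, E) p (x t),
        deriv (fun s => extChartAt 𝓘(ℝ, E) p (x s)) t))) t := by
  have hc := contDiffAt_chart h.1 hp
  refine ((hasDerivAt_const t ε).prodMk (hasDerivAt_id t)).prodMk
    ((hc.differentiableAt (by simp)).hasDerivAt.prodMk ?_)
  rw [← h.2 p hp]
  exact ((contDiffAt_deriv hc).differentiableAt (by simp)).hasDerivAt

/-- Local uniqueness of solutions. -/
theorem SecondOrderField.eventuallyEq_of_sameJet (hΛ : IsOpen Λ) {ε : ℝ} (hε : ε ∈ Λ)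
    {x x' : ℝ → N} {t : ℝ} (hx : ∀ᶠ s in 𝓝 t, S.IsSolution ε x s)
    (hx' : ∀ᶠ s in 𝓝 t, S.IsSolution ε x' s) (hj : SameJet E x x' t) : x =ᶠ[𝓝 t] x' := by
  let p := x t
  have hp : x t ∈ (extChartAt 𝓘(ℝ, E) p).source := mem_extChartAt_source p
  have hp' : x' t ∈ (extChartAt 𝓘(ℝ, E) p).source := hj.1 ▸ hp
  let Zc : (ℝ → N) → ℝ → (ℝ × ℝ) × E × E := fun x s => ((ε, s), (extChartAt 𝓘(ℝ, E) p (x s),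
      deriv (fun s => extChartAt 𝓘(ℝ, E) p (x s)) s))
  have hz : Zc x t ∈ phaseDomain E Λ p :=
    ⟨⟨hε, mem_univ _⟩, ⟨(extChartAt 𝓘(ℝ, E) p).map_source hp, mem_univ _⟩⟩
  have hcd : ContDiffAt ℝ 1 (S.phase p) (Zc x t) :=
    ((S.contDiffOn_phase p).contDiffAt ((isOpen_phaseDomain hΛ p).mem_nhds hz)).of_le
      (by exact_mod_cast le_top)
  obtain ⟨K, U, hU, hL⟩ := hcd.exists_lipschitzOnWith
  have key : ∀ x : ℝ → N, x t ∈ (extChartAt 𝓘(ℝ, E) p).source →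
      (∀ᶠ s in 𝓝 t, S.IsSolution ε x s) → U ∈ 𝓝 (Zc x t) →
      ∀ᶠ s in 𝓝 t, HasDerivAt (Zc x) (S.phase p (Zc x s)) s ∧ Zc x s ∈ U := by
    intro x hp hx hU
    have hc : ContinuousAt (Zc x) t := (hx.self_of_nhds.hasDerivAt_phase hp).continuousAt
    filter_upwards [hx, hx.self_of_nhds.1.continuousAt.eventually_mem
      ((isOpen_extChartAt_source p).mem_nhds hp), hc.eventually_mem hU] with s h1 h2 h3
    exact ⟨h1.hasDerivAt_phase h2, h3⟩
  have he : Zc x t = Zc x' t := by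
    simp only [Zc, hj.2 p hp, hj.1]
  have h := ODE_solution_unique_of_eventually (v := fun _ => S.phase p) (s := fun _ => U)
    (Eventually.of_forall fun _ => hL) (key x hp hx hU) (key x' hp' hx' (he ▸ hU)) he
  filter_upwards [h, hx.self_of_nhds.1.continuousAt.eventually_mem
      ((isOpen_extChartAt_source p).mem_nhds hp), hx'.self_of_nhds.1.continuousAt.eventually_mem
      ((isOpen_extChartAt_source p).mem_nhds hp')] with s h1 h2 h3
  exact (extChartAt 𝓘(ℝ, E) p).injOn h2 h3 (congrArg (fun z : (ℝ × ℝ) × E × E => z.2.1) h1)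

/-- Uniqueness of solutions on open intervals. -/
theorem SecondOrderField.eqOn_of_sameJet [T2Space N] (hΛ : IsOpen Λ) {ε : ℝ} (hε : ε ∈ Λ)
    {x x' : ℝ → N} {J : Set ℝ} (hJ : IsOpen J) (hJc : J.OrdConnected)
    (hx : ∀ s ∈ J, S.IsSolution ε x s) (hx' : ∀ s ∈ J, S.IsSolution ε x' s) {t : ℝ} (ht : t ∈ J)
    (hj : SameJet E x x' t) : EqOn x x' J := by
  have hev : ∀ {z : ℝ → N}, (∀ s ∈ J, S.IsSolution ε z s) → ∀ s ∈ J,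
      ∀ᶠ r in 𝓝 s, S.IsSolution ε z r := fun hz s hs => by
    filter_upwards [hJ.mem_nhds hs] with r hr using hz r hr
  let A : Set ℝ := {s | x =ᶠ[𝓝 s] x'}
  have hAo : IsOpen A := by
    rw [isOpen_iff_mem_nhds]
    intro s hs
    exact eventually_eventually_nhds.2 hs
  have htA : t ∈ A := SecondOrderField.eventuallyEq_of_sameJet hΛ hε (hev hx t ht) (hev hx' t ht) hj
  have hsub : J ⊆ A := by
    refine hJc.isPreconnected.subset_of_closure_inter_subset hAo ⟨t, ht, htA⟩ ?_
    rintro s ⟨hsc, hsJ⟩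
    refine SecondOrderField.eventuallyEq_of_sameJet hΛ hε (hev hx s hsJ) (hev hx' s hsJ) ?_
    have hfr : ∃ᶠ r in 𝓝 s, x =ᶠ[𝓝 r] x' := mem_closure_iff_frequently.1 hsc
    have hcx := (hx s hsJ).1.continuousAt
    have hcx' := (hx' s hsJ).1.continuousAt
    have e1 : x s = x' s := by
      by_contra hne
      have h1 : ∀ᶠ r in 𝓝 s, x r ≠ x' r := by
        obtain ⟨U, V, hU, hV, hxU, hxV, hd⟩ := t2_separation hne
        filter_upwards [hcx.eventually_mem (hU.mem_nhds hxU),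
          hcx'.eventually_mem (hV.mem_nhds hxV)] with r h1 h2 h3
        exact (Set.disjoint_left.1 hd) h1 (h3 ▸ h2)
      obtain ⟨r, hr1, hr2⟩ := (hfr.and_eventually h1).exists
      exact hr2 hr1.eq_of_nhds
    refine SameJet.of_chart (hx s hsJ).1 (hx' s hsJ).1 e1 (mem_extChartAt_source (x s)) ?_
    have hd1 := (contDiffAt_deriv (contDiffAt_chart (hx s hsJ).1
      (mem_extChartAt_source (x s)))).continuousAt
    have hd2 := (contDiffAt_deriv (contDiffAt_chart (p := x s) (hx' s hsJ).1
      (e1 ▸ mem_extChartAt_source (x s)))).continuousAt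
    by_contra hne
    have h1 := (hd1.sub hd2).eventually_ne (sub_ne_zero.2 hne)
    obtain ⟨r, hr1, hr2⟩ := (hfr.and_eventually h1).exists
    refine hr2 (sub_eq_zero.2 ?_)
    exact (hr1.fun_comp (extChartAt 𝓘(ℝ, E) (x s))).deriv_eq
  exact fun s hs => (hsub hs : x =ᶠ[𝓝 s] x').eq_of_nhds

variable (S) in
/-- The local flow of a second order equation. -/
theorem SecondOrderField.exists_local_family (hΛ : IsOpen Λ) {ε₀ : ℝ} (hε₀ : ε₀ ∈ Λ) (t₁ : ℝ)
    (p : N) {y₀ : E} (hy₀ : y₀ ∈ (extChartAt 𝓘(ℝ, E) p).target) (w₀ : E) :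
    ∃ δ > 0, ∃ Y : (ℝ × ℝ) × E × E → ℝ → N,
      ContMDiffOn 𝓘(ℝ, ((ℝ × ℝ) × E × E) × ℝ) 𝓘(ℝ, E) ∞
        (fun q : ((ℝ × ℝ) × E × E) × ℝ => Y q.1 q.2)
        (Metric.ball ((ε₀, t₁), (y₀, w₀)) δ ×ˢ Ioo (t₁ - δ) (t₁ + δ)) ∧
      ∀ z ∈ Metric.ball (((ε₀, t₁), (y₀, w₀)) : (ℝ × ℝ) × E × E) δ, z.1.1 ∈ Λ ∧
        z.1.2 ∈ Ioo (t₁ - δ) (t₁ + δ) ∧ z.2.1 ∈ (extChartAt 𝓘(ℝ, E) p).target ∧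
        Y z z.1.2 = (extChartAt 𝓘(ℝ, E) p).symm z.2.1 ∧
        deriv (fun s => extChartAt 𝓘(ℝ, E) p (Y z s)) z.1.2 = z.2.2 ∧
        ∀ t ∈ Ioo (t₁ - δ) (t₁ + δ), S.IsSolution z.1.1 (Y z) t := by
  have hz₀ : (((ε₀, t₁), (y₀, w₀)) : (ℝ × ℝ) × E × E) ∈ phaseDomain E Λ p :=
    ⟨⟨hε₀, mem_univ _⟩, ⟨hy₀, mem_univ _⟩⟩
  obtain ⟨δ, hδ, Fl, hFs, hF⟩ :=
    exists_local_flow (isOpen_phaseDomain hΛ p) (S.contDiffOn_phase p) hz₀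
  have hsub : Metric.ball (((ε₀, t₁), (y₀, w₀)) : (ℝ × ℝ) × E × E) (δ / 2) ⊆
    Metric.ball ((ε₀, t₁), (y₀, w₀)) δ := Metric.ball_subset_ball (by linarith)
  have hs : ∀ z ∈ Metric.ball (((ε₀, t₁), (y₀, w₀)) : (ℝ × ℝ) × E × E) (δ / 2),
      |z.1.2 - t₁| < δ / 2 := by
    intro z hz
    rw [Metric.mem_ball, Prod.dist_eq, max_lt_iff, Prod.dist_eq, max_lt_iff] at hz
    exact hz.1.2
  have hτ : ∀ z ∈ Metric.ball (((ε₀, t₁), (y₀, w₀)) : (ℝ × ℝ) × E × E) (δ / 2),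
      ∀ t ∈ Ioo (t₁ - δ / 2) (t₁ + δ / 2), t - z.1.2 ∈ Ioo (-δ) δ := by
    intro z hz t ht
    have := abs_lt.1 (hs z hz)
    constructor <;> linarith [ht.1, ht.2, this.1, this.2]
  -- the first components of the flow
  have hfst : ∀ z ∈ Metric.ball (((ε₀, t₁), (y₀, w₀)) : (ℝ × ℝ) × E × E) δ, ∀ τ ∈ Ioo (-δ) δ,
      (Fl τ z).1 = (z.1.1, z.1.2 + τ) := by
    intro z hz τ hτ
    have hd : ∀ r ∈ Ioo (-δ) δ, HasDerivAt (fun r => (Fl r z).1 - (z.1.1, z.1.2 + r)) 0 r := by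
      intro r hr
      have h1 := hasDerivAt_fst ((hF z hz).2 r hr).2
      have h2 : HasDerivAt (fun r : ℝ => ((z.1.1, z.1.2 + r) : ℝ × ℝ)) (0, 1) r :=
        (hasDerivAt_const r _).prodMk ((hasDerivAt_id r).const_add _)
      refine (h1.fun_sub h2).congr_deriv ?_
      simp [SecondOrderField.phase]
    have h3 := isOpen_Ioo.is_const_of_deriv_eq_zero (isPreconnected_Ioo)
      (fun r hr => (hd r hr).differentiableAt.differentiableWithinAt)
      (fun r hr => (hd r hr).deriv) hτ (show (0 : ℝ) ∈ Ioo (-δ) δ from ⟨by linarith, hδ⟩)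
    simp only [(hF z hz).1, add_zero] at h3
    have h4 : z.1 - (z.1.1, z.1.2) = 0 := sub_self _
    rw [h4] at h3
    exact sub_eq_zero.1 h3
  let Y : (ℝ × ℝ) × E × E → ℝ → N := fun z t =>
    (extChartAt 𝓘(ℝ, E) p).symm (Fl (t - z.1.2) z).2.1
  have hsm : ContMDiffOn 𝓘(ℝ, ((ℝ × ℝ) × E × E) × ℝ) 𝓘(ℝ, E) ∞
        (fun q : ((ℝ × ℝ) × E × E) × ℝ => Y q.1 q.2)
        (Metric.ball ((ε₀, t₁), (y₀, w₀)) (δ / 2) ×ˢ Ioo (t₁ - δ / 2) (t₁ + δ / 2)) := by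
    have h1 : ContDiffOn ℝ ∞ (fun q : ((ℝ × ℝ) × E × E) × ℝ => (Fl (q.2 - q.1.1.2) q.1).2.1)
        (Metric.ball ((ε₀, t₁), (y₀, w₀)) (δ / 2) ×ˢ Ioo (t₁ - δ / 2) (t₁ + δ / 2)) := by
      have h2 : ContDiff ℝ ∞ (fun q : ((ℝ × ℝ) × E × E) × ℝ => ((q.2 - q.1.1.2, q.1) :
          ℝ × ((ℝ × ℝ) × E × E))) := by fun_prop
      have h3 := hFs.comp h2.contDiffOn (s := Metric.ball ((ε₀, t₁), (y₀, w₀)) (δ / 2) ×ˢ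
        Ioo (t₁ - δ / 2) (t₁ + δ / 2)) (fun q hq => ⟨hτ q.1 hq.1 q.2 hq.2, hsub hq.1⟩)
      exact (contDiff_fst.comp contDiff_snd).comp_contDiffOn h3
    refine (contMDiffOn_extChartAt_symm (I := 𝓘(ℝ, E)) (n := ∞) p).comp h1.contMDiffOn ?_
    intro q hq
    exact (((hF q.1 (hsub hq.1)).2 _ (hτ q.1 hq.1 q.2 hq.2)).1).2.1
  refine ⟨δ / 2, by positivity, Y, hsm, fun z hz => ?_⟩
  have hzz := hF z (hsub hz)
  have h0 : (0 : ℝ) ∈ Ioo (-δ) δ := ⟨by linarith, hδ⟩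
  have hzΩ : z ∈ phaseDomain E Λ p := by
    have := (hzz.2 0 h0).1
    rwa [hzz.1] at this
  have hz12 : z.1.2 ∈ Ioo (t₁ - δ / 2) (t₁ + δ / 2) := by
    have := abs_lt.1 (hs z hz)
    constructor <;> linarith [this.1, this.2]
  have hYs : ∀ t ∈ Ioo (t₁ - δ / 2) (t₁ + δ / 2), ContMDiffAt 𝓘(ℝ, ℝ) 𝓘(ℝ, E) ∞ (Y z) t := by
    intro t ht
    have h1 := hsm.contMDiffAt ((Metric.isOpen_ball.prod isOpen_Ioo).mem_nhds
      (show (z, t) ∈ Metric.ball ((ε₀, t₁), (y₀, w₀)) (δ / 2) ×ˢ Ioo (t₁ - δ / 2) (t₁ + δ / 2)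
        from ⟨hz, ht⟩))
    have h2 : ContMDiff 𝓘(ℝ, ℝ) 𝓘(ℝ, ((ℝ × ℝ) × E × E) × ℝ) ∞
        (fun t : ℝ => ((z, t) : ((ℝ × ℝ) × E × E) × ℝ)) :=
      (contDiff_const.prodMk contDiff_id).contMDiff
    exact h1.comp t h2.contMDiffAt
  have hchart : ∀ t ∈ Ioo (t₁ - δ / 2) (t₁ + δ / 2),
      extChartAt 𝓘(ℝ, E) p (Y z t) = (Fl (t - z.1.2) z).2.1 := fun t ht =>
    (extChartAt 𝓘(ℝ, E) p).right_inv ((hzz.2 _ (hτ z hz t ht)).1).2.1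
  have hFd : ∀ t ∈ Ioo (t₁ - δ / 2) (t₁ + δ / 2), HasDerivAt (fun t => Fl (t - z.1.2) z)
      (S.phase p (Fl (t - z.1.2) z)) t := fun t ht => by
    have := (hzz.2 _ (hτ z hz t ht)).2.scomp t ((hasDerivAt_id t).sub_const z.1.2)
    simpa [Function.comp_def] using this
  have hd1 : ∀ t ∈ Ioo (t₁ - δ / 2) (t₁ + δ / 2),
      deriv (fun s => extChartAt 𝓘(ℝ, E) p (Y z s)) t = (Fl (t - z.1.2) z).2.2 := by
    intro t ht
    have e : (fun s => extChartAt 𝓘(ℝ, E) p (Y z s)) =ᶠ[𝓝 t] fun t => (Fl (t - z.1.2) z).2.1 := by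
      filter_upwards [isOpen_Ioo.mem_nhds ht] with s hs using hchart s hs
    rw [e.deriv_eq]
    exact (hasDerivAt_fst (hasDerivAt_snd (hFd t ht))).deriv
  refine ⟨hzΩ.1.1, hz12, hzΩ.2.1, by simp [Y, hzz.1], ?_, fun t ht => ?_⟩
  · rw [hd1 _ hz12, sub_self, hzz.1]
  · refine SecondOrderField.IsSolution.of_chart hzΩ.1.1 (p := p) ?_ ?_ ?_
    · filter_upwards [isOpen_Ioo.mem_nhds ht] with s hs using hYs s hs
    · exact (extChartAt 𝓘(ℝ, E) p).map_target ((hzz.2 _ (hτ z hz t ht)).1).2.1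
    · have e : deriv (fun s => extChartAt 𝓘(ℝ, E) p (Y z s)) =ᶠ[𝓝 t]
          fun t => (Fl (t - z.1.2) z).2.2 := by
        filter_upwards [isOpen_Ioo.mem_nhds ht] with s hs using hd1 s hs
      rw [e.deriv_eq, (hasDerivAt_snd (hasDerivAt_snd (hFd t ht))).deriv, hd1 t ht, hchart t ht]
      simp only [SecondOrderField.phase]
      rw [hfst z (hsub hz) _ (hτ z hz t ht)]
      simp

end SecondOrder

section GlobalFamily

set_option linter.unusedSectionVars false

variable {E : Type u} [NormedAddCommGroup E] [NormedSpace ℝ E] [FiniteDimensional ℝ E]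
  {N : Type*} [TopologicalSpace N] [ChartedSpace E N] [IsManifold 𝓘(ℝ, E) ∞ N]
  {Λ : Set ℝ} {S : SecondOrderField E N Λ}

/-- Joint smoothness of a family of curves. -/
def SmoothFamily (E : Type u) [NormedAddCommGroup E] [NormedSpace ℝ E]
    {N : Type*} [TopologicalSpace N] [ChartedSpace E N] (U J : Set ℝ) (X : ℝ → ℝ → N) : Prop :=
  ContMDiffOn 𝓘(ℝ, ℝ × ℝ) 𝓘(ℝ, E) ∞ (fun q : ℝ × ℝ => X q.1 q.2) (U ×ˢ J)

/-- A smooth family of solutions. -/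
def SecondOrderField.IsFamily (S : SecondOrderField E N Λ) (U J : Set ℝ) (X : ℝ → ℝ → N) : Prop :=
  SmoothFamily E U J X ∧ ∀ ε ∈ U, ∀ t ∈ J, S.IsSolution ε (X ε) t

theorem SmoothFamily.mono {U J U' J' : Set ℝ} {X : ℝ → ℝ → N} (h : SmoothFamily E U J X)
    (hU : U' ⊆ U) (hJ : J' ⊆ J) : SmoothFamily E U' J' X := ContMDiffOn.mono h (prod_mono hU hJ)

theorem SecondOrderField.IsFamily.mono {U J U' J' : Set ℝ} {X : ℝ → ℝ → N} (h : S.IsFamily U J X)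
    (hU : U' ⊆ U) (hJ : J' ⊆ J) : S.IsFamily U' J' X :=
  ⟨h.1.mono hU hJ, fun ε hε t ht => h.2 ε (hU hε) t (hJ ht)⟩

theorem SmoothFamily.contMDiffAt {U J : Set ℝ} (hU : IsOpen U) (hJ : IsOpen J) {X : ℝ → ℝ → N}
    (h : SmoothFamily E U J X) {ε t : ℝ} (hε : ε ∈ U) (ht : t ∈ J) :
    ContMDiffAt 𝓘(ℝ, ℝ × ℝ) 𝓘(ℝ, E) ∞ (fun q : ℝ × ℝ => X q.1 q.2) (ε, t) :=
  ContMDiffOn.contMDiffAt h ((hU.prod hJ).mem_nhds ⟨hε, ht⟩)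

theorem SmoothFamily.curve {U J : Set ℝ} (hU : IsOpen U) (hJ : IsOpen J) {X : ℝ → ℝ → N}
    (h : SmoothFamily E U J X) {ε t : ℝ} (hε : ε ∈ U) (ht : t ∈ J) :
    ContMDiffAt 𝓘(ℝ, ℝ) 𝓘(ℝ, E) ∞ (X ε) t := by
  have h2 : ContMDiff 𝓘(ℝ, ℝ) 𝓘(ℝ, ℝ × ℝ) ∞ (fun t : ℝ => ((ε, t) : ℝ × ℝ)) :=
    (contDiff_const.prodMk contDiff_id).contMDiff
  exact (h.contMDiffAt hU hJ hε ht).comp t h2.contMDiffAt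

/-- The initial data of a smooth family depend smoothly on the parameter. -/
theorem SmoothFamily.exists_contDiffOn_jet {U J : Set ℝ} (hU : IsOpen U) (hJ : IsOpen J)
    {X : ℝ → ℝ → N} (h : SmoothFamily E U J X) {ε₀ t : ℝ} (hε₀ : ε₀ ∈ U) (ht : t ∈ J) {p : N}
    (hp : X ε₀ t ∈ (extChartAt 𝓘(ℝ, E) p).source) :
    ∃ U' : Set ℝ, IsOpen U' ∧ ε₀ ∈ U' ∧ U' ⊆ U ∧
      (∀ ε ∈ U', X ε t ∈ (extChartAt 𝓘(ℝ, E) p).source) ∧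
      ContDiffOn ℝ ∞ (fun ε => ((extChartAt 𝓘(ℝ, E) p (X ε t),
        deriv (fun s => extChartAt 𝓘(ℝ, E) p (X ε s)) t) : E × E)) U' := by
  have hι : ContDiff ℝ ∞ (fun ε : ℝ => ((ε, t) : ℝ × ℝ)) := contDiff_id.prodMk contDiff_const
  have hcont : ContinuousOn (fun ε => X ε t) U := fun ε hε =>
    (ContinuousAt.comp (f := fun ε : ℝ => ((ε, t) : ℝ × ℝ)) (x := ε)
      (h.contMDiffAt hU hJ hε ht).continuousAt
      hι.continuous.continuousAt).continuousWithinAt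
  refine ⟨U ∩ (fun ε => X ε t) ⁻¹' (extChartAt 𝓘(ℝ, E) p).source,
    hcont.isOpen_inter_preimage hU (isOpen_extChartAt_source p), ⟨hε₀, hp⟩, inter_subset_left,
    fun ε hε => hε.2, ?_⟩
  rintro ε ⟨hε, hεp⟩
  have h1 : ContDiffAt ℝ ∞ (fun q : ℝ × ℝ => extChartAt 𝓘(ℝ, E) p (X q.1 q.2)) (ε, t) :=
    contDiffAt_chart (h.contMDiffAt hU hJ hε ht) hεp
  have h2 : ContDiffAt ℝ ∞ (fun ε : ℝ => extChartAt 𝓘(ℝ, E) p (X ε t)) ε :=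
    ContDiffAt.comp (g := fun q : ℝ × ℝ => extChartAt 𝓘(ℝ, E) p (X q.1 q.2)) ε h1 hι.contDiffAt
  have h3 : ContDiffAt ℝ ∞ (fun ε : ℝ =>
      fderiv ℝ (fun q : ℝ × ℝ => extChartAt 𝓘(ℝ, E) p (X q.1 q.2)) (ε, t) (0, 1)) ε :=
    (ContDiffAt.comp (g := fderiv ℝ (fun q : ℝ × ℝ => extChartAt 𝓘(ℝ, E) p (X q.1 q.2))) ε
      (h1.fderiv_right (m := ∞) (by simp)) hι.contDiffAt).clm_apply contDiffAt_const
  refine (h2.prodMk (h3.congr_of_eventuallyEq ?_)).contDiffWithinAt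
  have hev : ∀ᶠ ε' in 𝓝 ε, ε' ∈ U ∩ (fun ε => X ε t) ⁻¹' (extChartAt 𝓘(ℝ, E) p).source :=
    (hcont.isOpen_inter_preimage hU (isOpen_extChartAt_source p)).mem_nhds ⟨hε, hεp⟩
  filter_upwards [hev] with ε' hε'
  have h4 : DifferentiableAt ℝ (fun q : ℝ × ℝ => extChartAt 𝓘(ℝ, E) p (X q.1 q.2)) (ε', t) :=
    (contDiffAt_chart (h.contMDiffAt hU hJ hε'.1 ht) hε'.2).differentiableAt (by simp)
  exact (h4.hasFDerivAt.comp_hasDerivAt t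
    ((hasDerivAt_const t ε').prodMk (hasDerivAt_id t))).deriv

/-- Starting a family of solutions from the jets of a smooth family close to a given state. -/
theorem SecondOrderField.exists_launch (S : SecondOrderField E N Λ) (hΛ : IsOpen Λ) {ε₀ : ℝ}
    (hε₀ : ε₀ ∈ Λ) (b : ℝ)
    (p : N) {y₀ : E} (hy₀ : y₀ ∈ (extChartAt 𝓘(ℝ, E) p).target) (w₀ : E) :
    ∃ δ > 0, ∀ {U J : Set ℝ} {X : ℝ → ℝ → N} {t : ℝ}, IsOpen U → IsOpen J → SmoothFamily E U J X →
      ε₀ ∈ U → t ∈ J → X ε₀ t ∈ (extChartAt 𝓘(ℝ, E) p).source →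
      (((ε₀, t), (extChartAt 𝓘(ℝ, E) p (X ε₀ t),
        deriv (fun s => extChartAt 𝓘(ℝ, E) p (X ε₀ s)) t)) : (ℝ × ℝ) × E × E) ∈
        Metric.ball ((ε₀, b), (y₀, w₀)) δ →
      t ∈ Ioo (b - δ) (b + δ) ∧ ∃ U' ⊆ U, IsOpen U' ∧ ε₀ ∈ U' ∧ U' ⊆ Λ ∧ ∃ Y : ℝ → ℝ → N,
        S.IsFamily U' (Ioo (b - δ) (b + δ)) Y ∧ ∀ ε ∈ U', SameJet E (Y ε) (X ε) t := by
  obtain ⟨δ, hδ, Y, hYs, hY⟩ := S.exists_local_family hΛ hε₀ b p hy₀ w₀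
  refine ⟨δ, hδ, fun {U J X t} hU hJ hX hεU ht hp hb => ⟨(hY _ hb).2.1, ?_⟩⟩
  obtain ⟨U₁, hU₁, hεU₁, hU₁U, hU₁p, hsm⟩ := hX.exists_contDiffOn_jet hU hJ hεU ht hp
  let z : ℝ → (ℝ × ℝ) × E × E := fun ε => ((ε, t), (extChartAt 𝓘(ℝ, E) p (X ε t),
    deriv (fun s => extChartAt 𝓘(ℝ, E) p (X ε s)) t))
  have hz : ContDiffOn ℝ ∞ z U₁ := (contDiff_id.prodMk contDiff_const).contDiffOn.prodMk hsm
  refine ⟨U₁ ∩ z ⁻¹' Metric.ball ((ε₀, b), (y₀, w₀)) δ, inter_subset_left.trans hU₁U,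
    hz.continuousOn.isOpen_inter_preimage hU₁ Metric.isOpen_ball, ⟨hεU₁, hb⟩,
    fun ε hε => (hY _ hε.2).1, fun ε => Y (z ε), ⟨?_, fun ε hε s hs => ?_⟩, fun ε hε => ?_⟩
  · have h1 : ContDiffOn ℝ ∞ (fun q : ℝ × ℝ => ((z q.1, q.2) : ((ℝ × ℝ) × E × E) × ℝ))
      ((U₁ ∩ z ⁻¹' Metric.ball ((ε₀, b), (y₀, w₀)) δ) ×ˢ Ioo (b - δ) (b + δ)) :=
      (hz.comp contDiff_fst.contDiffOn fun q hq => hq.1.1).prodMk contDiff_snd.contDiffOn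
    exact hYs.comp h1.contMDiffOn fun q hq => ⟨hq.1.2, hq.2⟩
  · exact (hY _ hε.2).2.2.2.2.2 s hs
  · obtain ⟨-, h1, h2, h3, h4, h5⟩ := hY _ hε.2
    have h6 : Y (z ε) t = X ε t := by
      refine h3.trans ?_
      exact (extChartAt 𝓘(ℝ, E) p).left_inv (hU₁p ε hε.1)
    refine SameJet.of_chart (h5 t h1).1 (hX.curve hU hJ (hU₁U hε.1) ht) h6 (p := p) ?_ h4
    have h7 := hU₁p ε hε.1
    rw [← h6] at h7
    exact h7

variable [T2Space N]

theorem SecondOrderField.IsFamily.glue (hΛ : IsOpen Λ) {U J J' : Set ℝ} (hU : IsOpen U)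
    (hUΛ : U ⊆ Λ) (hJ : IsOpen J) (hJc : J.OrdConnected) (hJ' : IsOpen J') (hJc' : J'.OrdConnected)
    {X Y : ℝ → ℝ → N} (hX : S.IsFamily U J X) (hY : S.IsFamily U J' Y) {t : ℝ} (ht : t ∈ J)
    (ht' : t ∈ J') (hj : ∀ ε ∈ U, SameJet E (Y ε) (X ε) t) :
    ∃ Z : ℝ → ℝ → N, S.IsFamily U (J ∪ J') Z ∧ ∀ ε ∈ U, ∀ s ∈ J, Z ε s = X ε s := by
  classical
  let Z : ℝ → ℝ → N := fun ε s => if s ∈ J then X ε s else Y ε s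
  have hZX : ∀ ε ∈ U, ∀ s ∈ J, Z ε s = X ε s := fun ε _ s hs => if_pos hs
  have hZY : ∀ ε ∈ U, ∀ s ∈ J', Z ε s = Y ε s := by
    intro ε hε s hs
    by_cases hsJ : s ∈ J
    · rw [hZX ε hε s hsJ]
      exact SecondOrderField.eqOn_of_sameJet hΛ (hUΛ hε) (hJ.inter hJ') (hJc.inter hJc')
        (fun r hr => hX.2 ε hε r hr.1) (fun r hr => hY.2 ε hε r hr.2) ⟨ht, ht'⟩ (hj ε hε).symm
        ⟨hsJ, hs⟩
    · exact if_neg hsJ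
  refine ⟨Z, ⟨?_, ?_⟩, hZX⟩
  · rintro ⟨ε, s⟩ ⟨hε, hs | hs⟩
    · refine ((hX.1.contMDiffAt hU hJ hε hs).congr_of_eventuallyEq ?_).contMDiffWithinAt
      filter_upwards [(hU.prod hJ).mem_nhds ⟨hε, hs⟩] with q hq using hZX _ hq.1 _ hq.2
    · refine ((hY.1.contMDiffAt hU hJ' hε hs).congr_of_eventuallyEq ?_).contMDiffWithinAt
      filter_upwards [(hU.prod hJ').mem_nhds ⟨hε, hs⟩] with q hq using hZY _ hq.1 _ hq.2
  · rintro ε hε s (hs | hs)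
    · refine (hX.2 ε hε s hs).congr ?_
      filter_upwards [hJ.mem_nhds hs] with r hr using hZX ε hε r hr
    · refine (hY.2 ε hε s hs).congr ?_
      filter_upwards [hJ'.mem_nhds hs] with r hr using hZY ε hε r hr

/-- The curve and its velocity in a chart have limits at the end point `b` of `J`. -/
def HasEndLimit (E : Type u) [NormedAddCommGroup E] [NormedSpace ℝ E]
    {N : Type*} [TopologicalSpace N] [ChartedSpace E N] (x : ℝ → N) (J : Set ℝ) (b : ℝ) : Prop :=
  ∃ (xb : N) (w : E), Tendsto x (𝓝[J] b) (𝓝 xb) ∧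
    Tendsto (deriv (fun s => extChartAt 𝓘(ℝ, E) xb (x s))) (𝓝[J] b) (𝓝 w)

theorem SecondOrderField.exists_extension (S : SecondOrderField E N Λ) (hΛ : IsOpen Λ) {ε₀ : ℝ}
    (hε₀ : ε₀ ∈ Λ) {x : ℝ → N} {J : Set ℝ} {b : ℝ} (hb : HasEndLimit E x J b) :
    ∃ δ > 0, ∀ᶠ t in 𝓝[J] b, ∀ {U I : Set ℝ} {X : ℝ → ℝ → N}, IsOpen U → U ⊆ Λ → IsOpen I →
      I.OrdConnected → S.IsFamily U I X → ε₀ ∈ U → t ∈ I → X ε₀ =ᶠ[𝓝 t] x →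
      ∃ U' ⊆ U, IsOpen U' ∧ ε₀ ∈ U' ∧ ∃ Z : ℝ → ℝ → N, S.IsFamily U' (I ∪ Ioo (b - δ) (b + δ)) Z ∧
        ∀ ε ∈ U', ∀ s ∈ I, Z ε s = X ε s := by
  obtain ⟨xb, w, h1, h2⟩ := hb
  have hs := mem_extChartAt_source (I := 𝓘(ℝ, E)) xb
  obtain ⟨δ, hδ, H⟩ := S.exists_launch hΛ hε₀ b xb ((extChartAt 𝓘(ℝ, E) xb).map_source hs) w
  refine ⟨δ, hδ, ?_⟩
  have hid : Tendsto (fun t : ℝ => t) (𝓝[J] b) (𝓝 b) := tendsto_id.mono_left nhdsWithin_le_nhds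
  have h3 : Tendsto (fun t => (((ε₀, t), (extChartAt 𝓘(ℝ, E) xb (x t),
      deriv (fun s => extChartAt 𝓘(ℝ, E) xb (x s)) t)) : (ℝ × ℝ) × E × E)) (𝓝[J] b)
      (𝓝 ((ε₀, b), (extChartAt 𝓘(ℝ, E) xb xb, w))) :=
    (tendsto_const_nhds.prodMk_nhds hid).prodMk_nhds
      ((((continuousAt_extChartAt xb).tendsto).comp h1).prodMk_nhds h2)
  filter_upwards [h1.eventually_mem ((isOpen_extChartAt_source xb).mem_nhds hs),
    h3.eventually_mem (Metric.ball_mem_nhds _ hδ)] with t ht1 ht2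
  intro U I X hU hUΛ hI hIc hX hεU htI he
  obtain ⟨htb, U', hU'U, hU', hεU', hU'Λ, Y, hY, hj⟩ := H hU hI hX.1 hεU htI
    (by rwa [he.eq_of_nhds]) (by
      have e1 : (fun s => extChartAt 𝓘(ℝ, E) xb (X ε₀ s)) =ᶠ[𝓝 t]
          fun s => extChartAt 𝓘(ℝ, E) xb (x s) := he.fun_comp _
      rw [he.eq_of_nhds, e1.deriv_eq]; exact ht2)
  obtain ⟨Z, hZ, hZX⟩ := (hX.mono hU'U subset_rfl).glue hΛ hU' hU'Λ hI hIc isOpen_Ioo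
    ordConnected_Ioo hY htI htb hj
  exact ⟨U', hU'U, hU', hεU', Z, hZ, hZX⟩

/-- If solutions with the given initial jets never run out of bounds in finite time, then there is
a global smooth family of solutions. -/
theorem SecondOrderField.exists_global_family (S : SecondOrderField E N Λ) (hΛ : IsOpen Λ)
    {J : Set ℝ} (hJ : IsOpen J) {c : ℝ → ℝ → N} (hc : SmoothFamily E Λ J c) {t₀ : ℝ} (ht₀ : t₀ ∈ J)
    (hend : ∀ ε ∈ Λ, ∀ r > 0, ∀ x : ℝ → N, (∀ t ∈ Ioo (t₀ - r) (t₀ + r), S.IsSolution ε x t) →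
      SameJet E x (c ε) t₀ → HasEndLimit E x (Ioo (t₀ - r) (t₀ + r)) (t₀ - r) ∧
        HasEndLimit E x (Ioo (t₀ - r) (t₀ + r)) (t₀ + r)) :
    ∃ X : ℝ → ℝ → N, S.IsFamily Λ univ X ∧ ∀ ε ∈ Λ, SameJet E (X ε) (c ε) t₀ := by
  have : Nonempty N := ⟨c 0 t₀⟩
  let P : ℝ → ℝ → Prop := fun ε₀ r => ∃ U : Set ℝ, IsOpen U ∧ U ⊆ Λ ∧ ε₀ ∈ U ∧ ∃ X : ℝ → ℝ → N,
    S.IsFamily U (Ioo (t₀ - r) (t₀ + r)) X ∧ ∀ ε ∈ U, SameJet E (X ε) (c ε) t₀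
  have hmono : ∀ {ε r r'}, r' ≤ r → P ε r → P ε r' := by
    rintro ε r r' hr ⟨U, h1, h2, h3, X, h4, h5⟩
    exact ⟨U, h1, h2, h3, X, h4.mono subset_rfl (Ioo_subset_Ioo (by linarith) (by linarith)), h5⟩
  have huniq : ∀ {ε r r' : ℝ} {x x' : ℝ → N}, ε ∈ Λ →
      (∀ s ∈ Ioo (t₀ - r) (t₀ + r), S.IsSolution ε x s) → SameJet E x (c ε) t₀ →
      (∀ s ∈ Ioo (t₀ - r') (t₀ + r'), S.IsSolution ε x' s) → SameJet E x' (c ε) t₀ →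
      ∀ t, |t - t₀| < r → |t - t₀| < r' → x t = x' t := by
    intro ε r r' x x' hε hx hj hx' hj' t h1 h2
    have hpos : 0 < min r r' := (abs_nonneg (t - t₀)).trans_lt (lt_min h1 h2)
    have hmem : ∀ ρ s : ℝ, s ∈ Ioo (t₀ - ρ) (t₀ + ρ) ↔ |s - t₀| < ρ := fun ρ s => by
      rw [abs_lt, mem_Ioo]
      constructor <;> rintro ⟨h1, h2⟩ <;> constructor <;> linarith
    refine SecondOrderField.eqOn_of_sameJet hΛ hε (isOpen_Ioo (a := t₀ - min r r')
      (b := t₀ + min r r')) ordConnected_Ioo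
      (fun s hs => hx s ((hmem _ _).2 (((hmem _ _).1 hs).trans_le (min_le_left _ _))))
      (fun s hs => hx' s ((hmem _ _).2 (((hmem _ _).1 hs).trans_le (min_le_right _ _))))
      (t := t₀) ((hmem _ _).2 (by simpa using hpos)) (hj.trans hj'.symm)
      ((hmem _ _).2 (lt_min h1 h2))
  have hP : ∀ ε₀ ∈ Λ, ∀ r, P ε₀ r := by
    intro ε₀ hε₀
    have hbase : ∃ r > 0, P ε₀ r := by
      have hs := mem_extChartAt_source (I := 𝓘(ℝ, E)) (c ε₀ t₀)
      obtain ⟨δ, hδ, H⟩ := S.exists_launch hΛ hε₀ t₀ (c ε₀ t₀)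
        ((extChartAt 𝓘(ℝ, E) (c ε₀ t₀)).map_source hs)
        (deriv (fun s => extChartAt 𝓘(ℝ, E) (c ε₀ t₀) (c ε₀ s)) t₀)
      obtain ⟨-, U', -, hU', hεU', hU'Λ, Y, hY, hj⟩ := H hΛ hJ hc hε₀ ht₀ hs
        (Metric.mem_ball_self hδ)
      exact ⟨δ, hδ, U', hU', hU'Λ, hεU', Y, hY, hj⟩
    obtain ⟨r₀, hr₀, hPr₀⟩ := hbase
    by_contra! hcon
    obtain ⟨r₁, hr₁⟩ := hcon
    have hbdd : BddAbove {r | P ε₀ r} := ⟨r₁, fun r hr => by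
      by_contra! h
      exact hr₁ (hmono h.le hr)⟩
    set R := sSup {r | P ε₀ r} with hR
    have hR0 : 0 < R := hr₀.trans_le (le_csSup hbdd hPr₀)
    have hlt : ∀ r < R, P ε₀ r := by
      intro r hr
      obtain ⟨r', hr', hrr'⟩ := exists_lt_of_lt_csSup ⟨r₀, hPr₀⟩ hr
      exact hmono hrr'.le hr'
    choose! U hU hUΛ hεU X hX hj using hlt
    let x : ℝ → N := fun t => X ((|t - t₀| + R) / 2) ε₀ t
    have hxX : ∀ r < R, ∀ t, |t - t₀| < r → x t = X r ε₀ t := by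
      intro r hr t ht
      have h1 : (|t - t₀| + R) / 2 < R := by linarith
      exact huniq hε₀ (hX _ h1 |>.2 ε₀ (hεU _ h1)) (hj _ h1 ε₀ (hεU _ h1))
        (hX _ hr |>.2 ε₀ (hεU _ hr)) (hj _ hr ε₀ (hεU _ hr)) t (by linarith) ht
    have hxev : ∀ r < R, ∀ t, |t - t₀| < r → X r ε₀ =ᶠ[𝓝 t] x := by
      intro r hr t ht
      have : ∀ᶠ s in 𝓝 t, |s - t₀| < r :=
        (by fun_prop : ContinuousAt (fun s : ℝ => |s - t₀|) t).eventually_lt_const ht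
      filter_upwards [this] with s hs using (hxX r hr s hs).symm
    have habs : ∀ r t : ℝ, t ∈ Ioo (t₀ - r) (t₀ + r) ↔ |t - t₀| < r := by
      intro r t
      rw [abs_lt, mem_Ioo]
      constructor <;> rintro ⟨h1, h2⟩ <;> constructor <;> linarith
    have hxsol : ∀ t ∈ Ioo (t₀ - R) (t₀ + R), S.IsSolution ε₀ x t := by
      intro t ht
      replace ht := (habs _ _).1 ht
      have h1 : (|t - t₀| + R) / 2 < R := by linarith
      have h2 : |t - t₀| < (|t - t₀| + R) / 2 := by linarith
      exact (hX _ h1 |>.2 ε₀ (hεU _ h1) t ((habs _ _).2 h2)).congr (hxev _ h1 t h2).symm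
    have hxj : SameJet E x (c ε₀) t₀ := by
      have h1 : R / 2 < R := by linarith
      exact (SameJet.of_eventuallyEq (hxev _ h1 t₀ (by simpa using hR0)).symm).trans
        (hj _ h1 ε₀ (hεU _ h1))
    obtain ⟨hl, hr⟩ := hend ε₀ hε₀ R hR0 x hxsol hxj
    obtain ⟨δ₁, hδ₁, H₁⟩ := S.exists_extension hΛ hε₀ hl
    obtain ⟨δ₂, hδ₂, H₂⟩ := S.exists_extension hΛ hε₀ hr
    have hne1 : (𝓝[Ioo (t₀ - R) (t₀ + R)] (t₀ - R)).NeBot := left_nhdsWithin_Ioo_neBot (by linarith)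
    have hne2 : (𝓝[Ioo (t₀ - R) (t₀ + R)] (t₀ + R)).NeBot :=
      right_nhdsWithin_Ioo_neBot (by linarith)
    obtain ⟨a, ha, haI⟩ := (H₁.and self_mem_nhdsWithin).exists
    obtain ⟨b, hb, hbI⟩ := (H₂.and self_mem_nhdsWithin).exists
    replace haI := (habs _ _).1 haI
    replace hbI := (habs _ _).1 hbI
    obtain ⟨r, hr1, hr2⟩ : ∃ r, max (max (|a - t₀|) (|b - t₀|)) (max (R - δ₁) (R - δ₂)) < r ∧ r < R :=
      exists_between (max_lt (max_lt haI hbI) (max_lt (by linarith) (by linarith)))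
    simp only [max_lt_iff] at hr1
    obtain ⟨⟨hra, hrb⟩, hrδ₁, hrδ₂⟩ := hr1
    have hr0 : 0 < r := (abs_nonneg _).trans_lt hra
    obtain ⟨U₁, hU₁U, hU₁, hεU₁, Z₁, hZ₁, hZX₁⟩ := ha (hU r hr2) (hUΛ r hr2) isOpen_Ioo
      ordConnected_Ioo (hX r hr2) (hεU r hr2) ((habs _ _).2 hra) (hxev r hr2 a hra)
    have hsub1 : Ioo (t₀ - R - δ₁) (t₀ + r) ⊆
        Ioo (t₀ - r) (t₀ + r) ∪ Ioo (t₀ - R - δ₁) (t₀ - R + δ₁) := by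
      intro s hs
      by_cases h : t₀ - r < s
      · exact Or.inl ⟨h, hs.2⟩
      · exact Or.inr ⟨hs.1, by linarith⟩
    have hZ₁' := hZ₁.mono subset_rfl hsub1
    obtain ⟨U₂, hU₂U, hU₂, hεU₂, Z₂, hZ₂, hZX₂⟩ := hb hU₁ (hU₁U.trans (hUΛ r hr2)) isOpen_Ioo
      ordConnected_Ioo hZ₁' hεU₁ (by
        have := (habs _ _).2 hrb
        exact ⟨by linarith [this.1], this.2⟩) (by
        refine EventuallyEq.trans ?_ (hxev r hr2 b hrb)
        filter_upwards [isOpen_Ioo.mem_nhds ((habs _ _).2 hrb)] with s hs using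
          hZX₁ ε₀ hεU₁ s hs)
    have hsub2 : Ioo (t₀ - (R + min δ₁ δ₂)) (t₀ + (R + min δ₁ δ₂)) ⊆
        Ioo (t₀ - R - δ₁) (t₀ + r) ∪ Ioo (t₀ + R - δ₂) (t₀ + R + δ₂) := by
      intro s hs
      have h1 := min_le_left δ₁ δ₂
      have h2 := min_le_right δ₁ δ₂
      by_cases h : s < t₀ + r
      · exact Or.inl ⟨by linarith [hs.1], h⟩
      · exact Or.inr ⟨by linarith, by linarith [hs.2]⟩
    have hfin : P ε₀ (R + min δ₁ δ₂) := by
      refine ⟨U₂, hU₂, hU₂U.trans (hU₁U.trans (hUΛ r hr2)), hεU₂, Z₂, hZ₂.mono subset_rfl hsub2,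
        fun ε hε => ?_⟩
      refine (SameJet.of_eventuallyEq ?_).trans (hj r hr2 ε (hU₁U (hU₂U hε)))
      have h0 : t₀ ∈ Ioo (t₀ - r) (t₀ + r) := ⟨by linarith, by linarith⟩
      filter_upwards [isOpen_Ioo.mem_nhds h0] with s hs
      rw [hZX₂ ε hε s ⟨by linarith [hs.1], hs.2⟩, hZX₁ ε (hU₂U hε) s hs]
    have := le_csSup hbdd hfin
    have := lt_min hδ₁ hδ₂
    linarith
  choose! U hU hUΛ hεU X hX hj using hP
  have habs : ∀ r t : ℝ, t ∈ Ioo (t₀ - r) (t₀ + r) ↔ |t - t₀| < r := by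
    intro r t
    rw [abs_lt, mem_Ioo]
    constructor <;> rintro ⟨h1, h2⟩ <;> constructor <;> linarith
  let Y : ℝ → ℝ → N := fun ε t => X ε (|t - t₀| + 1) ε t
  have hY : ∀ ε₀ ∈ Λ, ∀ r, ∀ ε ∈ U ε₀ r, ∀ t, |t - t₀| < r → Y ε t = X ε₀ r ε t := by
    intro ε₀ hε₀ r ε hε t ht
    have hεΛ := hUΛ ε₀ hε₀ r hε
    exact huniq hεΛ ((hX ε hεΛ _).2 ε (hεU ε hεΛ _)) (hj ε hεΛ _ ε (hεU ε hεΛ _))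
      ((hX ε₀ hε₀ r).2 ε hε) (hj ε₀ hε₀ r ε hε) t (lt_add_one _) ht
  have hYev : ∀ ε ∈ Λ, ∀ t, Y ε =ᶠ[𝓝 t] X ε (|t - t₀| + 1) ε := by
    intro ε hε t
    have : ∀ᶠ s in 𝓝 t, |s - t₀| < |t - t₀| + 1 :=
      (by fun_prop : ContinuousAt (fun s : ℝ => |s - t₀|) t).eventually_lt_const (lt_add_one _)
    filter_upwards [this] with s hs using hY ε hε _ ε (hεU ε hε _) s hs
  refine ⟨Y, ⟨?_, fun ε hε t _ => ?_⟩, fun ε hε => ?_⟩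
  · rintro ⟨ε, t⟩ ⟨hε, -⟩
    have hmem : t ∈ Ioo (t₀ - (|t - t₀| + 1)) (t₀ + (|t - t₀| + 1)) :=
      (habs _ _).2 (lt_add_one _)
    refine (((hX ε hε (|t - t₀| + 1)).1.contMDiffAt (hU ε hε _) isOpen_Ioo (hεU ε hε _)
      hmem).congr_of_eventuallyEq ?_).contMDiffWithinAt
    filter_upwards [((hU ε hε (|t - t₀| + 1)).prod isOpen_Ioo).mem_nhds ⟨hεU ε hε _, hmem⟩]
      with q hq using hY ε hε _ _ hq.1 _ ((habs _ _).1 hq.2)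
  · exact ((hX ε hε (|t - t₀| + 1)).2 ε (hεU ε hε _) t ((habs _ _).2 (lt_add_one _))).congr
      (hYev ε hε t)
  · exact (SameJet.of_eventuallyEq (hYev ε hε t₀)).trans (hj ε hε _ ε (hεU ε hε _))

end GlobalFamily

set_option synthInstance.maxHeartbeats 200000 in
theorem contDiffOn_christoffel {F : Type*} [NormedAddCommGroup F] [NormedSpace ℝ F]
    [FiniteDimensional ℝ F] {U : Set F} (hU : IsOpen U) {G : F → F →L[ℝ] F →L[ℝ] ℝ}
    (hG : ContDiffOn ℝ ∞ G U) (hnd : ∀ x ∈ U, ∀ a, (∀ b, G x a b = 0) → a = 0) :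
    ContDiffOn ℝ ∞ (fun z : F × F => christoffel G z.1 z.2 z.2) (U ×ˢ univ) := by
  have h1 : ContDiffOn ℝ ∞ (fun z : F × F => (G z.1).inverse) (U ×ˢ univ) :=
    (contDiffOn_inverse hG hnd).comp contDiff_fst.contDiffOn fun z hz => hz.1
  have h2 := (hG.fderiv_of_isOpen hU (m := ∞) (by simp)).comp
    (contDiff_fst (E := F) (F := F)).contDiffOn (s := U ×ˢ univ) fun z hz => hz.1
  have hw : ContDiffOn ℝ ∞ (fun z : F × F => z.2) (U ×ˢ univ) := contDiff_snd.contDiffOn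
  have h3 : ContDiffOn ℝ ∞ (fun z : F × F => fderiv ℝ G z.1 z.2 z.2) (U ×ˢ univ) :=
    (h2.clm_apply hw).clm_apply hw
  have h4 : ContDiffOn ℝ ∞ (fun z : F × F => ((fderiv ℝ G z.1).flip z.2).flip z.2)
      (U ×ˢ univ) := by
    rw [contDiffOn_clm_apply]
    intro c
    exact ((h2.clm_apply contDiffOn_const).clm_apply hw).clm_apply hw
  have h5 : ContDiffOn ℝ ∞ (fun z : F × F => (1 / 2 : ℝ) • (fderiv ℝ G z.1 z.2 z.2 +
      fderiv ℝ G z.1 z.2 z.2 - ((fderiv ℝ G z.1).flip z.2).flip z.2)) (U ×ˢ univ) :=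
    ContDiffOn.const_smul (1 / 2 : ℝ) ((h3.add h3).sub h4)
  exact h1.clm_apply h5

section MetricCoeff

set_option linter.unusedSectionVars false
set_option synthInstance.maxHeartbeats 100000

variable {E : Type u} [NormedAddCommGroup E] [NormedSpace ℝ E]
  {N : Type*} [TopologicalSpace N] [ChartedSpace E N]
  [RiemannianBundle (fun x : N => TangentSpace 𝓘(ℝ, E) x)]

/-- The metric of `N` as a tensor field. -/
noncomputable def metricTensor (E : Type u) [NormedAddCommGroup E] [NormedSpace ℝ E]
    (N : Type*) [TopologicalSpace N] [ChartedSpace E N]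
    [RiemannianBundle (fun x : N => TangentSpace 𝓘(ℝ, E) x)] : Tensor02 𝓘(ℝ, E) N :=
  fun x => innerSL ℝ (E := TangentSpace 𝓘(ℝ, E) x)

/-- The coefficients of the metric of `N` in the preferred chart at `p`. -/
noncomputable def metricCoeff (p : N) : E → E →L[ℝ] E →L[ℝ] ℝ :=
  chartCoeff 𝓘(ℝ, E) p (metricTensor E N)

theorem metricCoeff_apply (p : N) (y a b : E) : metricCoeff p y a b =
    inner ℝ (mfderiv 𝓘(ℝ, E) 𝓘(ℝ, E) (extChartAt 𝓘(ℝ, E) p).symm y a :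
      TangentSpace 𝓘(ℝ, E) ((extChartAt 𝓘(ℝ, E) p).symm y))
      (mfderiv 𝓘(ℝ, E) 𝓘(ℝ, E) (extChartAt 𝓘(ℝ, E) p).symm y b :
      TangentSpace 𝓘(ℝ, E) ((extChartAt 𝓘(ℝ, E) p).symm y)) := rfl

theorem metricCoeff_symm (p : N) (y a b : E) : metricCoeff p y a b = metricCoeff p y b a := by
  rw [metricCoeff_apply, metricCoeff_apply]
  exact real_inner_comm _ _

theorem metricCoeff_nonneg (p : N) (y a : E) : 0 ≤ metricCoeff p y a a := by
  rw [metricCoeff_apply]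
  exact real_inner_self_nonneg

theorem metricCoeff_cauchySchwarz (p : N) (y a b : E) :
    |metricCoeff p y a b| ≤ √(metricCoeff p y a a) * √(metricCoeff p y b b) := by
  simp only [metricCoeff_apply, real_inner_self_eq_norm_sq, Real.sqrt_sq (norm_nonneg _)]
  exact abs_real_inner_le_norm _ _

variable [IsManifold 𝓘(ℝ, E) ∞ N]

theorem mfderiv_chart_symm_injective {p : N} {y : E} (hy : y ∈ (extChartAt 𝓘(ℝ, E) p).target) :
    Function.Injective (mfderiv 𝓘(ℝ, E) 𝓘(ℝ, E) (extChartAt 𝓘(ℝ, E) p).symm y) := by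
  have h1 : MDifferentiableAt 𝓘(ℝ, E) 𝓘(ℝ, E) (extChartAt 𝓘(ℝ, E) p).symm y :=
    (contMDiffAt_chart_symm hy).mdifferentiableAt (by simp)
  have h2 : MDifferentiableAt 𝓘(ℝ, E) 𝓘(ℝ, E) (extChartAt 𝓘(ℝ, E) p)
      ((extChartAt 𝓘(ℝ, E) p).symm y) :=
    (contMDiffAt_extChartAt' (n := 1) (by
      rw [← extChartAt_source 𝓘(ℝ, E)]
      exact (extChartAt 𝓘(ℝ, E) p).map_target hy)).mdifferentiableAt (by simp)
  have h3 := mfderiv_comp y h2 h1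
  have h4 : (extChartAt 𝓘(ℝ, E) p : N → E) ∘ (extChartAt 𝓘(ℝ, E) p).symm =ᶠ[𝓝 y] id := by
    filter_upwards [(isOpen_extChartAt_target p).mem_nhds hy] with z hz using
      (extChartAt 𝓘(ℝ, E) p).right_inv hz
  rw [h4.mfderiv_eq, mfderiv_id] at h3
  intro a b hab
  have h5 := DFunLike.congr_fun h3 a
  have h6 := DFunLike.congr_fun h3 b
  have h7 : (mfderiv 𝓘(ℝ, E) 𝓘(ℝ, E) (extChartAt 𝓘(ℝ, E) p) ((extChartAt 𝓘(ℝ, E) p).symm y))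
      (mfderiv 𝓘(ℝ, E) 𝓘(ℝ, E) (extChartAt 𝓘(ℝ, E) p).symm y a) =
      (mfderiv 𝓘(ℝ, E) 𝓘(ℝ, E) (extChartAt 𝓘(ℝ, E) p) ((extChartAt 𝓘(ℝ, E) p).symm y))
      (mfderiv 𝓘(ℝ, E) 𝓘(ℝ, E) (extChartAt 𝓘(ℝ, E) p).symm y b) := congrArg _ hab
  exact h5.trans (h7.trans h6.symm)

theorem metricCoeff_pos {p : N} {y : E} (hy : y ∈ (extChartAt 𝓘(ℝ, E) p).target) {a : E}
    (ha : a ≠ 0) : 0 < metricCoeff p y a a := by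
  rw [metricCoeff_apply]
  refine real_inner_self_pos.2 fun h => ha ?_
  exact mfderiv_chart_symm_injective hy (h.trans (map_zero _).symm)

theorem metricCoeff_nondegenerate {p : N} {y : E} (hy : y ∈ (extChartAt 𝓘(ℝ, E) p).target) (a : E)
    (h : ∀ b, metricCoeff p y a b = 0) : a = 0 := by
  by_contra ha
  exact (metricCoeff_pos hy ha).ne' (h a)

theorem mfderiv_chart_symm_chartChange {p q : N} {y : E} (hy : y ∈ (extChartAt 𝓘(ℝ, E) p).target)
    (hq : (extChartAt 𝓘(ℝ, E) p).symm y ∈ (extChartAt 𝓘(ℝ, E) q).source) (a : E) :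
    (mfderiv 𝓘(ℝ, E) 𝓘(ℝ, E) (extChartAt 𝓘(ℝ, E) p).symm y a : E) =
      mfderiv 𝓘(ℝ, E) 𝓘(ℝ, E) (extChartAt 𝓘(ℝ, E) q).symm (chartChange p q y)
        (fderiv ℝ (chartChange p q) y a) := by
  have hτ := contDiffAt_chartChange hy hq
  have ht : chartChange p q y ∈ (extChartAt 𝓘(ℝ, E) q).target :=
    (extChartAt 𝓘(ℝ, E) q).map_source hq
  have h1 : (extChartAt 𝓘(ℝ, E) p).symm =ᶠ[𝓝 y]
      (extChartAt 𝓘(ℝ, E) q).symm ∘ chartChange p q := by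
    have hc := (contMDiffAt_chart_symm hy).continuousAt
    filter_upwards [hc.eventually_mem ((isOpen_extChartAt_source q).mem_nhds hq)] with z hz
    exact ((extChartAt 𝓘(ℝ, E) q).left_inv hz).symm
  have h2 := mfderiv_comp y ((contMDiffAt_chart_symm ht).mdifferentiableAt (by simp))
    ((hτ.differentiableAt (by simp)).mdifferentiableAt)
  rw [← h1.mfderiv_eq, mfderiv_eq_fderiv] at h2
  exact DFunLike.congr_fun h2 a

theorem metricCoeff_chartChange {p q : N} {y : E} (hy : y ∈ (extChartAt 𝓘(ℝ, E) p).target)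
    (hq : (extChartAt 𝓘(ℝ, E) p).symm y ∈ (extChartAt 𝓘(ℝ, E) q).source) (a b : E) :
    metricCoeff p y a b = metricCoeff q (chartChange p q y) (fderiv ℝ (chartChange p q) y a)
      (fderiv ℝ (chartChange p q) y b) := by
  have ht : (extChartAt 𝓘(ℝ, E) q).symm (chartChange p q y) = (extChartAt 𝓘(ℝ, E) p).symm y :=
    (extChartAt 𝓘(ℝ, E) q).left_inv hq
  have key : ∀ (x x' : N), x = x' → ∀ (a b : E),
      @inner ℝ (TangentSpace 𝓘(ℝ, E) x) _ a b = @inner ℝ (TangentSpace 𝓘(ℝ, E) x') _ a b := by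
    rintro x _ rfl a b; rfl
  rw [metricCoeff_apply, metricCoeff_apply]
  have h1 := mfderiv_chart_symm_chartChange hy hq a
  have h2 := mfderiv_chart_symm_chartChange hy hq b
  refine (key _ _ ht.symm _ _).trans ?_
  exact congrArg₂ (fun a b : E => @inner ℝ
    (TangentSpace 𝓘(ℝ, E) ((extChartAt 𝓘(ℝ, E) q).symm (chartChange p q y))) _ a b) h1 h2

variable [FiniteDimensional ℝ E]
  [IsContMDiffRiemannianBundle 𝓘(ℝ, E) ∞ E (fun x : N => TangentSpace 𝓘(ℝ, E) x)]

theorem contDiffOn_metricCoeff (p : N) :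
    ContDiffOn ℝ ∞ (metricCoeff p) (extChartAt 𝓘(ℝ, E) p).target := contDiffOn_metric p

theorem contDiffAt_metricCoeff {p : N} {y : E} (hy : y ∈ (extChartAt 𝓘(ℝ, E) p).target) :
    ContDiffAt ℝ ∞ (metricCoeff p) y :=
  (contDiffOn_metricCoeff p).contDiffAt ((isOpen_extChartAt_target p).mem_nhds hy)

theorem exists_metricEquiv {p : N} {y : E} (hy : y ∈ (extChartAt 𝓘(ℝ, E) p).target) :
    ∃ e : E ≃L[ℝ] (E →L[ℝ] ℝ), (e : E →L[ℝ] _) = metricCoeff p y :=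
  exists_equiv_of_nondegenerate (metricCoeff_nondegenerate hy)

/-- The gradient of `F` in the preferred chart at `p`. -/
noncomputable def chartGrad (F : N → ℝ) (p : N) (y : E) : E :=
  (metricCoeff p y).inverse (fderiv ℝ (fun z => F ((extChartAt 𝓘(ℝ, E) p).symm z)) y)

theorem metricCoeff_chartGrad (F : N → ℝ) {p : N} {y : E}
    (hy : y ∈ (extChartAt 𝓘(ℝ, E) p).target) (a : E) : metricCoeff p y (chartGrad F p y) a =
      fderiv ℝ (fun z => F ((extChartAt 𝓘(ℝ, E) p).symm z)) y a := by
  obtain ⟨e, he⟩ := exists_metricEquiv hy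
  rw [chartGrad, apply_inverse_of_equiv he]

theorem contDiffAt_chart_function {W : Type*} [NormedAddCommGroup W] [NormedSpace ℝ W] {F : N → W}
    (hF : ContMDiff 𝓘(ℝ, E) 𝓘(ℝ, W) ∞ F)
    {p : N} {y : E} (hy : y ∈ (extChartAt 𝓘(ℝ, E) p).target) :
    ContDiffAt ℝ ∞ (fun z => F ((extChartAt 𝓘(ℝ, E) p).symm z)) y :=
  ((hF _).comp y (contMDiffAt_chart_symm hy)).contDiffAt

theorem fderiv_chart_function {F : N → ℝ} (hF : ContMDiff 𝓘(ℝ, E) 𝓘(ℝ, ℝ) ∞ F) {p q : N} {y : E}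
    (hy : y ∈ (extChartAt 𝓘(ℝ, E) p).target)
    (hq : (extChartAt 𝓘(ℝ, E) p).symm y ∈ (extChartAt 𝓘(ℝ, E) q).source) (a : E) :
    fderiv ℝ (fun z => F ((extChartAt 𝓘(ℝ, E) p).symm z)) y a =
      fderiv ℝ (fun z => F ((extChartAt 𝓘(ℝ, E) q).symm z)) (chartChange p q y)
        (fderiv ℝ (chartChange p q) y a) := by
  have hτ := contDiffAt_chartChange hy hq
  have ht : chartChange p q y ∈ (extChartAt 𝓘(ℝ, E) q).target :=
    (extChartAt 𝓘(ℝ, E) q).map_source hq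
  have h1 : (fun z => F ((extChartAt 𝓘(ℝ, E) p).symm z)) =ᶠ[𝓝 y]
      (fun z => F ((extChartAt 𝓘(ℝ, E) q).symm z)) ∘ chartChange p q := by
    have hc := (contMDiffAt_chart_symm hy).continuousAt
    filter_upwards [hc.eventually_mem ((isOpen_extChartAt_source q).mem_nhds hq)] with z hz
    exact congrArg F ((extChartAt 𝓘(ℝ, E) q).left_inv hz).symm
  rw [h1.fderiv_eq, fderiv_comp y ((contDiffAt_chart_function hF ht).differentiableAt (by simp))
    (hτ.differentiableAt (by simp))]
  rfl

theorem chartGrad_chartChange {F : N → ℝ} (hF : ContMDiff 𝓘(ℝ, E) 𝓘(ℝ, ℝ) ∞ F) {p q : N} {y : E}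
    (hy : y ∈ (extChartAt 𝓘(ℝ, E) p).target)
    (hq : (extChartAt 𝓘(ℝ, E) p).symm y ∈ (extChartAt 𝓘(ℝ, E) q).source) :
    chartGrad F q (chartChange p q y) = fderiv ℝ (chartChange p q) y (chartGrad F p y) := by
  have ht : chartChange p q y ∈ (extChartAt 𝓘(ℝ, E) q).target :=
    (extChartAt 𝓘(ℝ, E) q).map_source hq
  obtain ⟨e, he⟩ := exists_metricEquiv ht
  symm
  refine eq_inverse_of_apply he (ContinuousLinearMap.ext fun b => ?_)
  obtain ⟨b, rfl⟩ := surjective_fderiv_chartChange hy hq b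
  rw [← metricCoeff_chartChange hy hq, metricCoeff_chartGrad F hy, fderiv_chart_function hF hy hq]

theorem contDiffOn_chartGrad {F : N → ℝ} (hF : ContMDiff 𝓘(ℝ, E) 𝓘(ℝ, ℝ) ∞ F) (p : N) :
    ContDiffOn ℝ ∞ (chartGrad F p) (extChartAt 𝓘(ℝ, E) p).target := by
  refine (contDiffOn_inverse (contDiffOn_metricCoeff p)
    fun y hy => metricCoeff_nondegenerate hy).clm_apply fun y hy => ?_
  exact ((contDiffAt_chart_function hF hy).fderiv_right (m := ∞) (by simp)).contDiffWithinAt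

theorem contDiffOn_christoffel_metricCoeff (p : N) :
    ContDiffOn ℝ ∞ (fun z : E × E => christoffel (metricCoeff p) z.1 z.2 z.2)
      ((extChartAt 𝓘(ℝ, E) p).target ×ˢ univ) :=
  contDiffOn_christoffel (isOpen_extChartAt_target p) (contDiffOn_metricCoeff p)
    fun _ hy => metricCoeff_nondegenerate hy

theorem christoffel_metricCoeff_chartChange {p q : N} {y : E}
    (hy : y ∈ (extChartAt 𝓘(ℝ, E) p).target)
    (hq : (extChartAt 𝓘(ℝ, E) p).symm y ∈ (extChartAt 𝓘(ℝ, E) q).source) (a b : E) :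
    christoffel (metricCoeff q) (chartChange p q y) (fderiv ℝ (chartChange p q) y a)
      (fderiv ℝ (chartChange p q) y b) =
      fderiv ℝ (chartChange p q) y (christoffel (metricCoeff p) y a b) -
        fderiv ℝ (fderiv ℝ (chartChange p q)) y a b := by
  have ht : chartChange p q y ∈ (extChartAt 𝓘(ℝ, E) q).target :=
    (extChartAt 𝓘(ℝ, E) q).map_source hq
  obtain ⟨e₁, he₁⟩ := exists_metricEquiv hy
  obtain ⟨e₂, he₂⟩ := exists_metricEquiv ht
  refine christoffel_comp (contDiffAt_chartChange hy hq) (surjective_fderiv_chartChange hy hq)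
    ((contDiffAt_metricCoeff ht).differentiableAt (by simp)) ?_ (metricCoeff_symm q _)
    ((contDiffAt_metricCoeff hy).differentiableAt (by simp)) he₁ he₂ a b
  have hc := (contMDiffAt_chart_symm hy).continuousAt
  filter_upwards [hc.eventually_mem ((isOpen_extChartAt_source q).mem_nhds hq),
    (isOpen_extChartAt_target p).mem_nhds hy] with z hz hz' a b
  exact metricCoeff_chartChange hz' hz a b

/-- The equation `x'' = κ(ε, t) grad F_ε` on `N`. -/
noncomputable def forcedGeodesicField {Λ : Set ℝ} (hΛ : IsOpen Λ) {κ : ℝ × ℝ → ℝ}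
    (hκ : ContDiffOn ℝ ∞ κ (Λ ×ˢ univ)) {F : ℝ → N → ℝ}
    (hF : ContMDiffOn (𝓘(ℝ, ℝ).prod 𝓘(ℝ, E)) 𝓘(ℝ, ℝ) ∞ (fun z : ℝ × N => F z.1 z.2)
      (Λ ×ˢ univ)) : SecondOrderField E N Λ where
  acc p z y w := - christoffel (metricCoeff p) y w w + κ z • chartGrad (F z.1) p y
  smooth p := by
    have hdom : IsOpen ((Λ ×ˢ (univ : Set ℝ)) ×ˢ
      ((extChartAt 𝓘(ℝ, E) p).target ×ˢ (univ : Set E))) :=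
      (hΛ.prod isOpen_univ).prod ((isOpen_extChartAt_target p).prod isOpen_univ)
    have h1 : ContDiffOn ℝ ∞ (fun z : (ℝ × ℝ) × E × E =>
        christoffel (metricCoeff p) z.2.1 z.2.2 z.2.2)
        ((Λ ×ˢ univ) ×ˢ ((extChartAt 𝓘(ℝ, E) p).target ×ˢ univ)) :=
      (contDiffOn_christoffel_metricCoeff p).comp contDiff_snd.contDiffOn fun z hz => hz.2
    have h2 : ContDiffOn ℝ ∞ (fun z : (ℝ × ℝ) × E × E => κ z.1)
        ((Λ ×ˢ univ) ×ˢ ((extChartAt 𝓘(ℝ, E) p).target ×ˢ univ)) :=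
      hκ.comp contDiff_fst.contDiffOn fun z hz => hz.1
    have h3 : ContDiffOn ℝ ∞ (fun z : (ℝ × ℝ) × E × E => (metricCoeff p z.2.1).inverse)
        ((Λ ×ˢ univ) ×ˢ ((extChartAt 𝓘(ℝ, E) p).target ×ˢ univ)) :=
      (contDiffOn_inverse (contDiffOn_metricCoeff p)
        fun y hy => metricCoeff_nondegenerate hy).comp
        (contDiff_fst.comp contDiff_snd).contDiffOn fun z hz => hz.2.1
    have h4 : ContDiffOn ℝ ∞ (fun z : ℝ × E => F z.1 ((extChartAt 𝓘(ℝ, E) p).symm z.2))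
        (Λ ×ˢ (extChartAt 𝓘(ℝ, E) p).target) := by
      have h5 : ContMDiffOn 𝓘(ℝ, ℝ × E) (𝓘(ℝ, ℝ).prod 𝓘(ℝ, E)) ∞
          (fun z : ℝ × E => (z.1, (extChartAt 𝓘(ℝ, E) p).symm z.2))
          (Λ ×ˢ (extChartAt 𝓘(ℝ, E) p).target) :=
        contDiff_fst.contMDiff.contMDiffOn.prodMk
          ((contMDiffOn_extChartAt_symm p).comp contDiff_snd.contMDiff.contMDiffOn
            fun z hz => hz.2)
      exact (hF.comp h5 fun z hz => ⟨hz.1, mem_univ _⟩).contDiffOn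
    have hopen : IsOpen (Λ ×ˢ (extChartAt 𝓘(ℝ, E) p).target) :=
      hΛ.prod (isOpen_extChartAt_target p)
    have h6 : ContDiffOn ℝ ∞ (fun z : ℝ × E =>
        fderiv ℝ (fun y => F z.1 ((extChartAt 𝓘(ℝ, E) p).symm y)) z.2)
        (Λ ×ˢ (extChartAt 𝓘(ℝ, E) p).target) := by
      have h7 : ContDiffOn ℝ ∞ (fun z : ℝ × E => (fderiv ℝ (fun z : ℝ × E =>
          F z.1 ((extChartAt 𝓘(ℝ, E) p).symm z.2)) z).comp (ContinuousLinearMap.inr ℝ ℝ E))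
          (Λ ×ˢ (extChartAt 𝓘(ℝ, E) p).target) :=
        (h4.fderiv_of_isOpen hopen (m := ∞) (by simp)).clm_comp contDiffOn_const
      refine h7.congr fun z hz => ?_
      have h8 : DifferentiableAt ℝ (fun z : ℝ × E =>
          F z.1 ((extChartAt 𝓘(ℝ, E) p).symm z.2)) z :=
        (h4.contDiffAt (hopen.mem_nhds hz)).differentiableAt (by simp)
      exact (HasFDerivAt.comp (f := fun y : E => (z.1, y)) z.2 h8.hasFDerivAt
        (hasFDerivAt_prodMk_right z.1 z.2)).fderiv
    have h9 : ContDiffOn ℝ ∞ (fun z : (ℝ × ℝ) × E × E =>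
        fderiv ℝ (fun y => F z.1.1 ((extChartAt 𝓘(ℝ, E) p).symm y)) z.2.1)
        ((Λ ×ˢ univ) ×ˢ ((extChartAt 𝓘(ℝ, E) p).target ×ˢ univ)) :=
      h6.comp ((contDiff_fst.comp contDiff_fst).prodMk
        (contDiff_fst.comp contDiff_snd)).contDiffOn fun z hz => ⟨hz.1.1, hz.2.1⟩
    exact h1.neg.add (h2.smul (h3.clm_apply h9))
  compat p q y hy hq ε hε t w := by
    have hFε : ContMDiff 𝓘(ℝ, E) 𝓘(ℝ, ℝ) ∞ (F ε) := by
      rw [← contMDiffOn_univ]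
      exact hF.comp ((contMDiff_const.prodMk contMDiff_id).contMDiffOn) fun x _ => ⟨hε, mem_univ _⟩
    rw [christoffel_metricCoeff_chartChange hy hq, chartGrad_chartChange hFε hy hq]
    simp only [map_add, map_neg, map_smul]
    abel

end MetricCoeff

set_option synthInstance.maxHeartbeats 100000 in
theorem hasDerivAt_energy {F : Type*} [NormedAddCommGroup F] [NormedSpace ℝ F]
    {G : F → F →L[ℝ] F →L[ℝ] ℝ} {y : ℝ → F} {t : ℝ} (hy : ContDiffAt ℝ ∞ y t)
    (hG : DifferentiableAt ℝ G (y t)) (hsymm : ∀ a b, G (y t) a b = G (y t) b a)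
    {e : F ≃L[ℝ] (F →L[ℝ] ℝ)} (he : (e : F →L[ℝ] _) = G (y t)) :
    HasDerivAt (fun s => G (y s) (deriv y s) (deriv y s))
      (2 * G (y t) (deriv (deriv y) t + christoffel G (y t) (deriv y t) (deriv y t))
        (deriv y t)) t := by
  have h1 : HasDerivAt y (deriv y t) t := (hy.differentiableAt (by simp)).hasDerivAt
  have h2 : HasDerivAt (deriv y) (deriv (deriv y) t) t :=
    ((contDiffAt_deriv hy).differentiableAt (by simp)).hasDerivAt
  have h3 : HasDerivAt (fun s => G (y s)) (fderiv ℝ G (y t) (deriv y t)) t :=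
    HasFDerivAt.comp_hasDerivAt (F := F) (E := F →L[ℝ] F →L[ℝ] ℝ) (l := G) t hG.hasFDerivAt h1
  refine ((h3.clm_apply h2).clm_apply h2).congr_deriv ?_
  have h4 := apply_christoffel he (deriv y t) (deriv y t) (deriv y t)
  simp only [map_add, _root_.add_apply, hsymm (deriv y t) (deriv (deriv y) t), h4]
  ring

section Speed

set_option linter.unusedSectionVars false

variable {E : Type u} [NormedAddCommGroup E] [NormedSpace ℝ E]
  {N : Type*} [TopologicalSpace N] [ChartedSpace E N]
  [RiemannianBundle (fun x : N => TangentSpace 𝓘(ℝ, E) x)]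

/-- The squared speed of a curve. -/
noncomputable def speedSq (E : Type u) [NormedAddCommGroup E] [NormedSpace ℝ E]
    {N : Type*} [TopologicalSpace N] [ChartedSpace E N]
    [RiemannianBundle (fun x : N => TangentSpace 𝓘(ℝ, E) x)] (x : ℝ → N) (t : ℝ) : ℝ :=
  metricCoeff (x t) (extChartAt 𝓘(ℝ, E) (x t) (x t))
    (deriv (fun s => extChartAt 𝓘(ℝ, E) (x t) (x s)) t)
    (deriv (fun s => extChartAt 𝓘(ℝ, E) (x t) (x s)) t)

/-- The covariant acceleration of a curve in the preferred chart at `p`. -/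
noncomputable def chartAccel (x : ℝ → N) (p : N) (t : ℝ) : E :=
  deriv (deriv (fun s => extChartAt 𝓘(ℝ, E) p (x s))) t +
    christoffel (metricCoeff p) (extChartAt 𝓘(ℝ, E) p (x t))
      (deriv (fun s => extChartAt 𝓘(ℝ, E) p (x s)) t)
      (deriv (fun s => extChartAt 𝓘(ℝ, E) p (x s)) t)

theorem speedSq_nonneg (x : ℝ → N) (t : ℝ) : 0 ≤ speedSq E x t := metricCoeff_nonneg _ _ _

variable [IsManifold 𝓘(ℝ, E) ∞ N]

theorem speedSq_eq {x : ℝ → N} {t : ℝ} (hx : ContMDiffAt 𝓘(ℝ, ℝ) 𝓘(ℝ, E) ∞ x t) {p : N}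
    (hp : x t ∈ (extChartAt 𝓘(ℝ, E) p).source) :
    speedSq E x t = metricCoeff p (extChartAt 𝓘(ℝ, E) p (x t))
      (deriv (fun s => extChartAt 𝓘(ℝ, E) p (x s)) t)
      (deriv (fun s => extChartAt 𝓘(ℝ, E) p (x s)) t) := by
  have hq := mem_extChartAt_source (I := 𝓘(ℝ, E)) (x t)
  rw [metricCoeff_chartChange ((extChartAt 𝓘(ℝ, E) p).map_source hp) (q := x t)
    (by rwa [(extChartAt 𝓘(ℝ, E) p).left_inv hp]), chartChange_chart hp,
    ← deriv_chart_change hx hp hq]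
  rfl

theorem SameJet.speedSq_eq {x x' : ℝ → N} {t : ℝ} (h : SameJet E x x' t) :
    speedSq E x t = speedSq E x' t := by
  have h1 := h.2 (x t) (mem_extChartAt_source (x t))
  simp only [speedSq]
  rw [h1, ← h.1]

theorem enorm_mfderiv_eq {x : ℝ → N} {t : ℝ} (hx : ContMDiffAt 𝓘(ℝ, ℝ) 𝓘(ℝ, E) ∞ x t) :
    ‖(mfderiv 𝓘(ℝ, ℝ) 𝓘(ℝ, E) x t (1 : ℝ) : TangentSpace 𝓘(ℝ, E) (x t))‖ₑ =
      ENNReal.ofReal (√(speedSq E x t)) := by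
  have hp := mem_extChartAt_source (I := 𝓘(ℝ, E)) (x t)
  have ht := (extChartAt 𝓘(ℝ, E) (x t)).map_source hp
  let y : ℝ → E := fun s => extChartAt 𝓘(ℝ, E) (x t) (x s)
  have hy : ContDiffAt ℝ ∞ y t := contDiffAt_chart hx hp
  have h1 : x =ᶠ[𝓝 t] (extChartAt 𝓘(ℝ, E) (x t)).symm ∘ y := by
    filter_upwards [hx.continuousAt.eventually_mem ((isOpen_extChartAt_source (x t)).mem_nhds hp)]
      with s hs using ((extChartAt 𝓘(ℝ, E) (x t)).left_inv hs).symm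
  have h2 := mfderiv_comp t ((contMDiffAt_chart_symm ht).mdifferentiableAt (by simp))
    ((hy.differentiableAt (by simp)).mdifferentiableAt)
  rw [← h1.mfderiv_eq, mfderiv_eq_fderiv] at h2
  have h3 : (mfderiv 𝓘(ℝ, ℝ) 𝓘(ℝ, E) x t (1 : ℝ) : E) =
      mfderiv 𝓘(ℝ, E) 𝓘(ℝ, E) (extChartAt 𝓘(ℝ, E) (x t)).symm (y t) (deriv y t) :=
    DFunLike.congr_fun h2 (1 : ℝ)
  have key : ∀ (z z' : N), z = z' → ∀ a b : E, a = b →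
      @norm (TangentSpace 𝓘(ℝ, E) z) _ a = @norm (TangentSpace 𝓘(ℝ, E) z') _ b := by
    rintro x _ rfl a _ rfl; rfl
  rw [← ofReal_norm]
  congr 1
  symm
  rw [Real.sqrt_eq_iff_mul_self_eq (speedSq_nonneg _ _) (norm_nonneg _), speedSq, metricCoeff_apply,
    real_inner_self_eq_norm_mul_norm]
  have h4 := key _ _ ((extChartAt 𝓘(ℝ, E) (x t)).left_inv hp) _ _ h3.symm
  exact congrArg₂ (· * ·) h4 h4

variable [FiniteDimensional ℝ E]
  [IsContMDiffRiemannianBundle 𝓘(ℝ, E) ∞ E (fun x : N => TangentSpace 𝓘(ℝ, E) x)]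

theorem hasDerivAt_speedSq {x : ℝ → N} {t : ℝ}
    (hx : ∀ᶠ s in 𝓝 t, ContMDiffAt 𝓘(ℝ, ℝ) 𝓘(ℝ, E) ∞ x s) {p : N}
    (hp : x t ∈ (extChartAt 𝓘(ℝ, E) p).source) :
    HasDerivAt (speedSq E x) (2 * metricCoeff p (extChartAt 𝓘(ℝ, E) p (x t)) (chartAccel x p t)
      (deriv (fun s => extChartAt 𝓘(ℝ, E) p (x s)) t)) t := by
  have ht := (extChartAt 𝓘(ℝ, E) p).map_source hp
  obtain ⟨e, he⟩ := exists_metricEquiv ht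
  have h1 := hasDerivAt_energy (contDiffAt_chart hx.self_of_nhds hp)
    ((contDiffAt_metricCoeff ht).differentiableAt (by simp)) (metricCoeff_symm p _) he
  refine h1.congr_of_eventuallyEq ?_
  filter_upwards [hx, hx.self_of_nhds.continuousAt.eventually_mem
    ((isOpen_extChartAt_source p).mem_nhds hp)] with s hs hs' using speedSq_eq hs hs'

end Speed

section Distance

set_option linter.unusedSectionVars false

variable {E : Type u} [NormedAddCommGroup E] [NormedSpace ℝ E]
  {N : Type*} [MetricSpace N] [ChartedSpace E N]
  [RiemannianBundle (fun x : N => TangentSpace 𝓘(ℝ, E) x)]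
  [IsManifold 𝓘(ℝ, E) ∞ N] [IsRiemannianManifold 𝓘(ℝ, E) N]

theorem dist_le_mul_of_speed_le {x : ℝ → N} {a b S : ℝ} (hab : a ≤ b)
    (hx : ∀ t ∈ Icc a b, ContMDiffAt 𝓘(ℝ, ℝ) 𝓘(ℝ, E) ∞ x t)
    (hS : ∀ t ∈ Icc a b, √(speedSq E x t) ≤ S) : dist (x a) (x b) ≤ S * (b - a) := by
  have hS0 : 0 ≤ S := (Real.sqrt_nonneg _).trans (hS a (left_mem_Icc.2 hab))
  have h1 : edist (x a) (x b) ≤ ENNReal.ofReal (S * (b - a)) := by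
    rw [IsRiemannianManifold.out (I := 𝓘(ℝ, E)) (x a) (x b)]
    refine (Manifold.riemannianEDist_le_pathELength (fun t ht =>
      ((hx t ht).of_le (by exact_mod_cast le_top)).contMDiffWithinAt) rfl rfl hab).trans ?_
    rw [Manifold.pathELength_eq_lintegral_mfderiv_Icc]
    calc _ ≤ ∫⁻ _ in Icc a b, ENNReal.ofReal S := by
          refine MeasureTheory.setLIntegral_mono measurable_const fun t ht => ?_
          exact (enorm_mfderiv_eq (hx t ht)).trans_le (ENNReal.ofReal_le_ofReal (hS t ht))
      _ = _ := by
          rw [MeasureTheory.setLIntegral_const, Real.volume_Icc, ENNReal.ofReal_mul hS0]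
  rw [edist_dist] at h1
  exact (ENNReal.ofReal_le_ofReal_iff (mul_nonneg hS0 (sub_nonneg.2 hab))).1 h1

/-- A Riemannian manifold is a length space. -/
theorem exists_between_of_dist_lt (E : Type u) [NormedAddCommGroup E] [NormedSpace ℝ E]
    {N : Type*} [MetricSpace N] [ChartedSpace E N]
    [RiemannianBundle (fun x : N => TangentSpace 𝓘(ℝ, E) x)]
    [IsRiemannianManifold 𝓘(ℝ, E) N] {x y : N} {r s : ℝ} (hr : 0 ≤ r)
    (hs : 0 < s) (h : dist x y < r + s) : ∃ z, dist x z ≤ r ∧ dist z y < s := by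
  by_cases hxy : dist x y ≤ r
  · exact ⟨y, hxy, by simpa using hs⟩
  have h1 : Manifold.riemannianEDist 𝓘(ℝ, E) x y < ENNReal.ofReal (r + s) := by
    rw [← IsRiemannianManifold.out (I := 𝓘(ℝ, E)) x y, edist_dist]
    exact (ENNReal.ofReal_lt_ofReal_iff (by positivity)).2 h
  obtain ⟨γ, h0, h1, hγ, hl⟩ := Manifold.exists_lt_of_riemannianEDist_lt h1
  have hc : ContinuousOn (fun t => dist x (γ t)) (Icc 0 1) :=
    (continuous_const.dist continuous_id).comp_continuousOn hγ.continuousOn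
  obtain ⟨t, ht, htr⟩ := intermediate_value_Icc zero_le_one hc
    (show r ∈ Icc (dist x (γ 0)) (dist x (γ 1)) by
      rw [h0, h1, dist_self]; exact ⟨hr, (not_le.1 hxy).le⟩)
  refine ⟨γ t, le_of_eq htr, ?_⟩
  have e1 : edist x (γ t) ≤ Manifold.pathELength 𝓘(ℝ, E) γ 0 t := by
    rw [IsRiemannianManifold.out (I := 𝓘(ℝ, E))]
    exact Manifold.riemannianEDist_le_pathELength
      (hγ.mono (Icc_subset_Icc_right ht.2)) h0 rfl ht.1
  have e2 : edist (γ t) y ≤ Manifold.pathELength 𝓘(ℝ, E) γ t 1 := by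
    rw [IsRiemannianManifold.out (I := 𝓘(ℝ, E))]
    exact Manifold.riemannianEDist_le_pathELength
      (hγ.mono (Icc_subset_Icc_left ht.1)) rfl h1 ht.2
  have e3 : edist x (γ t) + edist (γ t) y < ENNReal.ofReal (r + s) := by
    refine lt_of_le_of_lt (add_le_add e1 e2) ?_
    rwa [Manifold.pathELength_add ht.1 ht.2]
  rw [edist_dist, edist_dist, ← ENNReal.ofReal_add dist_nonneg dist_nonneg,
    ENNReal.ofReal_lt_ofReal_iff (by positivity)] at e3
  have htr' : dist x (γ t) = r := htr
  linarith

/-- The Hopf–Rinow theorem: bounded closed sets in a complete Riemannian manifold are compact. -/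
theorem properSpace_of_completeSpace (E : Type u) [NormedAddCommGroup E] [NormedSpace ℝ E]
    {N : Type*} [MetricSpace N] [ChartedSpace E N]
    [RiemannianBundle (fun x : N => TangentSpace 𝓘(ℝ, E) x)]
    [IsRiemannianManifold 𝓘(ℝ, E) N] [FiniteDimensional ℝ E] [CompleteSpace N] :
    ProperSpace N := by
  have hlc : LocallyCompactSpace N := Manifold.locallyCompact_of_finiteDimensional 𝓘(ℝ, E)
  refine ⟨fun x r₀ => ?_⟩
  by_contra hcon
  let A : Set ℝ := {r | IsCompact (Metric.closedBall x r)}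
  have hmono : ∀ {r r'}, r' ≤ r → r ∈ A → r' ∈ A := fun hr h =>
    IsCompact.of_isClosed_subset h Metric.isClosed_closedBall (Metric.closedBall_subset_closedBall hr)
  have hbdd : BddAbove A := ⟨r₀, fun r hr => by
    by_contra! h
    exact hcon (hmono h.le hr)⟩
  have h0 : (0 : ℝ) ∈ A := by
    change IsCompact (Metric.closedBall x 0)
    rw [Metric.closedBall_zero]
    exact isCompact_singleton
  set R := sSup A
  have hR0 : 0 ≤ R := le_csSup hbdd h0
  have hlt : ∀ r < R, r ∈ A := fun r hr => by
    obtain ⟨r', hr', hrr'⟩ := exists_lt_of_lt_csSup ⟨0, h0⟩ hr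
    exact hmono hrr'.le hr'
  have hR : R ∈ A := by
    refine isCompact_iff_totallyBounded_isComplete.2
      ⟨Metric.totallyBounded_iff.2 ?_, Metric.isClosed_closedBall.isComplete⟩
    intro η hη
    by_cases hRη : R < η / 2
    · refine ⟨{x}, finite_singleton _, fun y hy => ?_⟩
      simp only [mem_singleton_iff, iUnion_iUnion_eq_left, Metric.mem_ball]
      exact (Metric.mem_closedBall.1 hy).trans_lt (by linarith)
    · have h1 : IsCompact (Metric.closedBall x (R - η / 4)) := hlt _ (by linarith)
      obtain ⟨T, hT, hTc⟩ := Metric.totallyBounded_iff.1 h1.totallyBounded (η / 2) (by positivity)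
      refine ⟨T, hT, fun y hy => ?_⟩
      obtain ⟨z, hz1, hz2⟩ := exists_between_of_dist_lt E (x := x) (y := y) (r := R - η / 4)
        (s := η / 2) (by linarith) (by positivity)
        (by rw [dist_comm]; linarith [Metric.mem_closedBall.1 hy])
      have hz3 := hTc (show z ∈ Metric.closedBall x (R - η / 4) by
        rwa [Metric.mem_closedBall, dist_comm])
      simp only [mem_iUnion, Metric.mem_ball, exists_prop] at hz3 ⊢
      obtain ⟨w, hw, hzw⟩ := hz3
      refine ⟨w, hw, ?_⟩
      have := dist_triangle y z w
      rw [dist_comm y z] at this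
      linarith
  obtain ⟨K, hK, hsub⟩ := exists_compact_superset (show IsCompact (Metric.closedBall x R) from hR)
  obtain ⟨δ, hδ, hδK⟩ := IsCompact.exists_thickening_subset_open hR isOpen_interior hsub
  have h2 : R + δ / 2 ∈ A := by
    refine hK.of_isClosed_subset Metric.isClosed_closedBall fun y hy => interior_subset (hδK ?_)
    obtain ⟨z, hz1, hz2⟩ := exists_between_of_dist_lt E (x := x) (y := y) (r := R) (s := δ)
      hR0 hδ (by rw [dist_comm]; linarith [Metric.mem_closedBall.1 hy])
    rw [Metric.mem_thickening_iff]
    exact ⟨z, by rwa [Metric.mem_closedBall, dist_comm], by rwa [dist_comm]⟩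
  have := le_csSup hbdd h2
  change R + δ / 2 ≤ R at this
  linarith

end Distance

theorem exists_tendsto_of_dist_le {W : Type*} [PseudoMetricSpace W] [CompleteSpace W] {g : ℝ → W}
    {J A : Set ℝ} {e C : ℝ} [h : (𝓝[J] e).NeBot] (hA : A ∈ 𝓝[J] e)
    (hg : ∀ s ∈ A, ∀ t ∈ A, dist (g s) (g t) ≤ C * dist s t) :
    ∃ w, Tendsto g (𝓝[J] e) (𝓝 w) := by
  have h1 : LipschitzOnWith C.toNNReal g A := LipschitzOnWith.of_dist_le_mul fun s hs t ht =>
    (hg s hs t ht).trans (mul_le_mul_of_nonneg_right (Real.le_coe_toNNReal C) dist_nonneg)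
  have h2 : Cauchy (𝓝[J] e) := cauchy_nhds.mono nhdsWithin_le_nhds
  exact cauchy_map_iff_exists_tendsto.1
    (h2.map_of_le h1.uniformContinuousOn (le_principal_iff.2 hA))

theorem exists_bilin_bounds {F : Type*} [NormedAddCommGroup F] [NormedSpace ℝ F]
    [FiniteDimensional ℝ F] {K : Set F} (hK : IsCompact K) {G : F → F →L[ℝ] F →L[ℝ] ℝ}
    (hG : ContinuousOn G K) (hpos : ∀ y ∈ K, ∀ a, a ≠ 0 → 0 < G y a a) : ∃ c > 0, ∃ C > 0,
      ∀ y ∈ K, ∀ a, c * ‖a‖ ^ 2 ≤ G y a a ∧ G y a a ≤ C * ‖a‖ ^ 2 := by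
  have h1 : ContinuousOn (fun z : F × F => G z.1 z.2 z.2) (K ×ˢ Metric.sphere (0 : F) 1) := by
    have h2 : ContinuousOn (fun z : F × F => G z.1) (K ×ˢ Metric.sphere (0 : F) 1) :=
      hG.comp continuousOn_fst fun z hz => hz.1
    exact (h2.clm_apply continuousOn_snd).clm_apply continuousOn_snd
  have hcomp := hK.prod (isCompact_sphere (0 : F) 1)
  obtain ⟨c, hc, h⟩ := hcomp.exists_forall_le' h1 (a := 0)
    fun z hz => hpos _ hz.1 _ fun h0 => by
      have := mem_sphere_zero_iff_norm.1 hz.2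
      rw [h0, norm_zero] at this
      exact zero_ne_one this
  obtain ⟨C, hC⟩ := hcomp.bddAbove_image h1
  refine ⟨c, hc, max C 1, by positivity, fun y hy a => ?_⟩
  by_cases ha : a = 0
  · simp [ha]
  have hn : ‖a‖ ≠ 0 := norm_ne_zero_iff.2 ha
  have hm : (y, ‖a‖⁻¹ • a) ∈ K ×ˢ Metric.sphere (0 : F) 1 := ⟨hy, by
    rw [mem_sphere_zero_iff_norm, norm_smul, norm_inv, norm_norm, inv_mul_cancel₀ hn]⟩
  have he : G y a a = G y (‖a‖⁻¹ • a) (‖a‖⁻¹ • a) * ‖a‖ ^ 2 := by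
    simp only [map_smul, _root_.smul_apply, smul_eq_mul]
    field_simp
  rw [he]
  exact ⟨mul_le_mul_of_nonneg_right (h _ hm) (by positivity), mul_le_mul_of_nonneg_right
    ((hC (mem_image_of_mem _ hm)).trans (le_max_left _ _)) (by positivity)⟩

section Bounds

set_option linter.unusedSectionVars false

variable {E : Type u} [NormedAddCommGroup E] [NormedSpace ℝ E] [FiniteDimensional ℝ E]
  {N : Type*} [TopologicalSpace N] [ChartedSpace E N] [IsManifold 𝓘(ℝ, E) ∞ N]
  [RiemannianBundle (fun x : N => TangentSpace 𝓘(ℝ, E) x)]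
  [IsContMDiffRiemannianBundle 𝓘(ℝ, E) ∞ E (fun x : N => TangentSpace 𝓘(ℝ, E) x)]

theorem exists_metricCoeff_bounds {p : N} {K : Set E} (hK : IsCompact K)
    (hKt : K ⊆ (extChartAt 𝓘(ℝ, E) p).target) : ∃ c > 0, ∃ C > 0, ∀ y ∈ K, ∀ a,
      c * ‖a‖ ^ 2 ≤ metricCoeff p y a a ∧ metricCoeff p y a a ≤ C * ‖a‖ ^ 2 :=
  exists_bilin_bounds hK ((contDiffOn_metricCoeff p).continuousOn.mono hKt) fun _ hy _ ha =>
    metricCoeff_pos (hKt hy) ha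

/-- The gradient of `F` is bounded by `B` on the set `A`. -/
def GradBound (E : Type u) [NormedAddCommGroup E] [NormedSpace ℝ E]
    {N : Type*} [TopologicalSpace N] [ChartedSpace E N]
    [RiemannianBundle (fun x : N => TangentSpace 𝓘(ℝ, E) x)] (F : N → ℝ) (A : Set N) (B : ℝ) :
    Prop :=
  ∀ p : N, ∀ y ∈ (extChartAt 𝓘(ℝ, E) p).target, (extChartAt 𝓘(ℝ, E) p).symm y ∈ A → ∀ a,
    |fderiv ℝ (fun z => F ((extChartAt 𝓘(ℝ, E) p).symm z)) y a| ≤ B * √(metricCoeff p y a a)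

theorem GradBound.mono {F : N → ℝ} {A A' : Set N} {B B' : ℝ} (h : GradBound E F A B) (hA : A' ⊆ A)
    (hB : B ≤ B') : GradBound E F A' B' := fun p y hy hyA a =>
  (h p y hy (hA hyA) a).trans (mul_le_mul_of_nonneg_right hB (Real.sqrt_nonneg _))

theorem GradBound.congr {F F' : N → ℝ} {A : Set N} {B : ℝ} (h : GradBound E F A B)
    (hF : ∀ x ∈ A, F' =ᶠ[𝓝 x] F) : GradBound E F' A B := by
  intro p y hy hyA a
  have hc := (contMDiffAt_chart_symm hy).continuousAt
  have h1 : (fun z => F' ((extChartAt 𝓘(ℝ, E) p).symm z)) =ᶠ[𝓝 y]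
      fun z => F ((extChartAt 𝓘(ℝ, E) p).symm z) := hc.eventually (hF _ hyA)
  rw [h1.fderiv_eq]
  exact h p y hy hyA a

theorem exists_gradBound {F : N → ℝ} (hF : ContMDiff 𝓘(ℝ, E) 𝓘(ℝ, ℝ) ∞ F) {K : Set N}
    (hK : IsCompact K) : ∃ B ≥ 0, GradBound E F K B := by
  refine hK.induction_on (p := fun A => ∃ B ≥ 0, GradBound E F A B) ?_ ?_ ?_ ?_
  · exact ⟨0, le_rfl, fun _ _ _ h => h.elim⟩
  · rintro A A' hA ⟨B, hB0, hB⟩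
    exact ⟨B, hB0, hB.mono hA le_rfl⟩
  · rintro A A' ⟨B, hB0, hB⟩ ⟨B', hB0', hB'⟩
    refine ⟨max B B', hB0.trans (le_max_left _ _), fun p y hy hyA => hyA.elim ?_ ?_⟩
    · exact fun h => (hB.mono subset_rfl (le_max_left B B')) p y hy h
    · exact fun h => (hB'.mono subset_rfl (le_max_right B B')) p y hy h
  · intro x _
    have hx := mem_extChartAt_source (I := 𝓘(ℝ, E)) x
    have ht := (extChartAt 𝓘(ℝ, E) x).map_source hx
    obtain ⟨r, hr, hrt⟩ := Metric.nhds_basis_closedBall.mem_iff.1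
      ((isOpen_extChartAt_target x).mem_nhds ht)
    have hcomp := isCompact_closedBall (extChartAt 𝓘(ℝ, E) x x) r
    obtain ⟨c, hc, _, _, hcl⟩ := exists_metricCoeff_bounds hcomp hrt
    have hcont : ContinuousOn (fderiv ℝ (fun z => F ((extChartAt 𝓘(ℝ, E) x).symm z)))
        (Metric.closedBall (extChartAt 𝓘(ℝ, E) x x) r) := fun y hy =>
      ((contDiffAt_chart_function hF (hrt hy)).fderiv_right (m := ∞)
        (by simp)).continuousAt.continuousWithinAt
    obtain ⟨C, hC⟩ := hcomp.bddAbove_image hcont.norm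
    have hC0 : 0 ≤ C := (norm_nonneg _).trans
      (hC (mem_image_of_mem _ (Metric.mem_closedBall_self hr.le)))
    refine ⟨(extChartAt 𝓘(ℝ, E) x).source ∩ extChartAt 𝓘(ℝ, E) x ⁻¹'
      Metric.closedBall (extChartAt 𝓘(ℝ, E) x x) r, mem_nhdsWithin_of_mem_nhds
        (inter_mem ((isOpen_extChartAt_source x).mem_nhds hx)
        ((continuousAt_extChartAt x).preimage_mem_nhds (Metric.closedBall_mem_nhds _ hr))),
      C / √c, by positivity, fun p y hy hyA a => ?_⟩
    have h1 : chartChange p x y ∈ Metric.closedBall (extChartAt 𝓘(ℝ, E) x x) r := hyA.2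
    rw [fderiv_chart_function hF hy hyA.1, metricCoeff_chartChange hy hyA.1]
    set b := fderiv ℝ (chartChange p x) y a
    calc _ ≤ ‖fderiv ℝ (fun z => F ((extChartAt 𝓘(ℝ, E) x).symm z)) (chartChange p x y)‖ * ‖b‖ :=
          ContinuousLinearMap.le_opNorm _ b
      _ ≤ C * ‖b‖ := by gcongr; exact hC (mem_image_of_mem _ h1)
      _ = C / √c * √(c * ‖b‖ ^ 2) := by
        rw [Real.sqrt_mul hc.le, Real.sqrt_sq (norm_nonneg _)]
        field_simp
      _ ≤ _ := by gcongr; exact (hcl _ h1 b).1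

theorem exists_gradBound_of_hasCompactSupport {F : N → ℝ} (hF : ContMDiff 𝓘(ℝ, E) 𝓘(ℝ, ℝ) ∞ F)
    (hFc : HasCompactSupport F) : ∃ B ≥ 0, GradBound E F univ B := by
  obtain ⟨B, hB0, hB⟩ := exists_gradBound hF hFc
  refine ⟨B, hB0, fun p y hy _ a => ?_⟩
  by_cases h : (extChartAt 𝓘(ℝ, E) p).symm y ∈ tsupport F
  · exact hB p y hy h a
  · have hc := (contMDiffAt_chart_symm hy).continuousAt
    have h1 : (fun z => F ((extChartAt 𝓘(ℝ, E) p).symm z)) =ᶠ[𝓝 y] fun _ => 0 :=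
      hc.eventually (notMem_tsupport_iff_eventuallyEq.1 h)
    rw [h1.fderiv_eq]
    simpa using mul_nonneg hB0 (Real.sqrt_nonneg _)

end Bounds

section Global

set_option linter.unusedSectionVars false

variable {E : Type u} [NormedAddCommGroup E] [NormedSpace ℝ E] [FiniteDimensional ℝ E]
  {N : Type*} [MetricSpace N] [ChartedSpace E N] [IsManifold 𝓘(ℝ, E) ∞ N]
  [RiemannianBundle (fun x : N => TangentSpace 𝓘(ℝ, E) x)]
  [IsContMDiffRiemannianBundle 𝓘(ℝ, E) ∞ E (fun x : N => TangentSpace 𝓘(ℝ, E) x)]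
  [IsRiemannianManifold 𝓘(ℝ, E) N]

theorem dist_le_mul_dist_of_speed_le {x : ℝ → N} {J : Set ℝ} {B : ℝ} (hJ : J.OrdConnected)
    (hx : ∀ t ∈ J, ContMDiffAt 𝓘(ℝ, ℝ) 𝓘(ℝ, E) ∞ x t) (hB : ∀ t ∈ J, √(speedSq E x t) ≤ B) :
    ∀ s ∈ J, ∀ t ∈ J, dist (x s) (x t) ≤ B * dist s t := by
  have key : ∀ s ∈ J, ∀ t ∈ J, s ≤ t → dist (x s) (x t) ≤ B * dist s t := by
    intro s hs t ht hst
    rw [dist_comm s t, Real.dist_eq, abs_of_nonneg (sub_nonneg.2 hst)]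
    exact dist_le_mul_of_speed_le hst (fun r hr => hx r (hJ.out hs ht hr))
      fun r hr => hB r (hJ.out hs ht hr)
  intro s hs t ht
  rcases le_total s t with h | h
  · exact key s hs t ht h
  · rw [dist_comm, dist_comm s]
    exact key t ht s hs h

variable [CompleteSpace N]

theorem SecondOrderField.hasEndLimit_of_speed_le {Λ : Set ℝ} (S : SecondOrderField E N Λ) {ε : ℝ}
    (hε : ε ∈ Λ) {x : ℝ → N} {J : Set ℝ} (hJc : J.OrdConnected)
    (hx : ∀ t ∈ J, S.IsSolution ε x t) {B : ℝ} (hB : ∀ t ∈ J, √(speedSq E x t) ≤ B) {e : ℝ}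
    [hne : (𝓝[J] e).NeBot] : HasEndLimit E x J e := by
  obtain ⟨xb, hxb⟩ := exists_tendsto_of_dist_le (g := x) (e := e) self_mem_nhdsWithin
    (dist_le_mul_dist_of_speed_le hJc (fun t ht => (hx t ht).1) hB)
  have hs := mem_extChartAt_source (I := 𝓘(ℝ, E)) xb
  have ht := (extChartAt 𝓘(ℝ, E) xb).map_source hs
  obtain ⟨r, hr, hrt⟩ := Metric.nhds_basis_closedBall.mem_iff.1
    ((isOpen_extChartAt_target xb).mem_nhds ht)
  have hcomp := isCompact_closedBall (extChartAt 𝓘(ℝ, E) xb xb) r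
  obtain ⟨c, hc, _, _, hcl⟩ := exists_metricCoeff_bounds hcomp hrt
  have h1 : ∀ᶠ t in 𝓝[J] e, x t ∈ (extChartAt 𝓘(ℝ, E) xb).source ∧
      extChartAt 𝓘(ℝ, E) xb (x t) ∈ Metric.closedBall (extChartAt 𝓘(ℝ, E) xb xb) r :=
    (hxb.eventually_mem ((isOpen_extChartAt_source xb).mem_nhds hs)).and
      ((((continuousAt_extChartAt xb).tendsto).comp hxb).eventually_mem
        (Metric.closedBall_mem_nhds _ hr))
  obtain ⟨η, hη, hηJ⟩ := Metric.mem_nhdsWithin_iff.1 h1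
  let y : ℝ → E := fun s => extChartAt 𝓘(ℝ, E) xb (x s)
  have hvel : ∀ t ∈ Metric.ball e η ∩ J, ‖deriv y t‖ ≤ B / √c := by
    intro t ht
    have h2 := (hcl _ (hηJ ht).2 (deriv y t)).1
    rw [← speedSq_eq (hx t ht.2).1 (hηJ ht).1] at h2
    have h3 := (Real.sqrt_le_sqrt h2).trans (hB t ht.2)
    rw [Real.sqrt_mul hc.le, Real.sqrt_sq (norm_nonneg _)] at h3
    rw [le_div_iff₀ (Real.sqrt_pos.2 hc)]
    linarith
  have hcont : ContinuousOn (fun z : ℝ × E × E => S.acc xb (ε, z.1) z.2.1 z.2.2)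
      (Metric.closedBall e η ×ˢ (Metric.closedBall (extChartAt 𝓘(ℝ, E) xb xb) r ×ˢ
        Metric.closedBall 0 (B / √c))) :=
    (S.smooth xb).continuousOn.comp (f := fun z : ℝ × E × E => (((ε, z.1), z.2) : (ℝ × ℝ) × E × E))
      (by fun_prop) fun z hz => ⟨⟨hε, mem_univ _⟩, ⟨hrt hz.2.1, mem_univ _⟩⟩
  obtain ⟨A, hA⟩ := ((isCompact_closedBall e η).prod (hcomp.prod
    (isCompact_closedBall (0 : E) (B / √c)))).bddAbove_image hcont.norm
  have hconv : Convex ℝ (Metric.ball e η ∩ J) := by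
    refine (convex_ball e η).inter ?_
    exact hJc.convex
  have hlip : ∀ s ∈ Metric.ball e η ∩ J, ∀ t ∈ Metric.ball e η ∩ J,
      dist (deriv y s) (deriv y t) ≤ A * dist s t := by
    intro s hs t ht
    rw [dist_eq_norm, dist_eq_norm]
    refine hconv.norm_image_sub_le_of_norm_deriv_le (fun u hu => ?_) (fun u hu => ?_) ht hs
    · exact (contDiffAt_deriv (contDiffAt_chart (hx u hu.2).1 (hηJ hu).1)).differentiableAt
        (by simp)
    · rw [(hx u hu.2).2 xb (hηJ hu).1]
      exact hA ⟨(u, y u, deriv y u), ⟨Metric.ball_subset_closedBall hu.1, (hηJ hu).2,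
        mem_closedBall_zero_iff.2 (hvel u hu)⟩, rfl⟩
  obtain ⟨w, hw⟩ := exists_tendsto_of_dist_le (g := deriv y) (J := J) (e := e)
    (Metric.mem_nhdsWithin_iff.2 ⟨η, hη, subset_rfl⟩) hlip
  exact ⟨xb, w, hxb, hw⟩

end Global

section Forced

set_option linter.unusedSectionVars false

variable {E : Type u} [NormedAddCommGroup E] [NormedSpace ℝ E] [FiniteDimensional ℝ E]
  {N : Type*} [TopologicalSpace N] [ChartedSpace E N] [IsManifold 𝓘(ℝ, E) ∞ N]
  [RiemannianBundle (fun x : N => TangentSpace 𝓘(ℝ, E) x)]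
  [IsContMDiffRiemannianBundle 𝓘(ℝ, E) ∞ E (fun x : N => TangentSpace 𝓘(ℝ, E) x)]

/-- If the covariant acceleration is `κ grad F + e`, then the squared speed changes at most at
rate `2 (|κ| B + ‖e‖) ‖x'‖`. -/
theorem abs_deriv_speedSq_le {x : ℝ → N} {t κ B η : ℝ} {F : N → ℝ}
    (hx : ∀ᶠ s in 𝓝 t, ContMDiffAt 𝓘(ℝ, ℝ) 𝓘(ℝ, E) ∞ x s) {p : N}
    (hp : x t ∈ (extChartAt 𝓘(ℝ, E) p).source) {A : Set N} (hA : x t ∈ A) (hB : GradBound E F A B)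
    {e : E} (hacc : chartAccel x p t = κ • chartGrad F p (extChartAt 𝓘(ℝ, E) p (x t)) + e)
    (he : √(metricCoeff p (extChartAt 𝓘(ℝ, E) p (x t)) e e) ≤ η) :
    HasDerivAt (speedSq E x) (deriv (speedSq E x) t) t ∧
      |deriv (speedSq E x) t| ≤ 2 * (B * |κ| + η) * √(speedSq E x t) := by
  have ht := (extChartAt 𝓘(ℝ, E) p).map_source hp
  have h1 := hasDerivAt_speedSq hx hp
  refine ⟨h1.differentiableAt.hasDerivAt, ?_⟩
  rw [h1.deriv, hacc, speedSq_eq hx.self_of_nhds hp]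
  set y := extChartAt 𝓘(ℝ, E) p (x t)
  set w := deriv (fun s => extChartAt 𝓘(ℝ, E) p (x s)) t
  rw [map_add, map_smul, _root_.add_apply, _root_.smul_apply, metricCoeff_chartGrad F ht, smul_eq_mul]
  have h2 := hB p y ht (by rwa [(extChartAt 𝓘(ℝ, E) p).left_inv hp]) w
  have h3 := (metricCoeff_cauchySchwarz p y e w).trans
    (mul_le_mul_of_nonneg_right he (Real.sqrt_nonneg _))
  rw [abs_mul, abs_two, mul_assoc 2 (B * |κ| + η)]
  refine mul_le_mul_of_nonneg_left ((abs_add_le _ _).trans ?_) zero_le_two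
  rw [abs_mul, add_mul]
  refine add_le_add ?_ h3
  calc _ ≤ |κ| * (B * √(metricCoeff p y w w)) := by gcongr
    _ = _ := by ring

theorem isSolution_forcedGeodesicField_iff {Λ : Set ℝ} (hΛ : IsOpen Λ) {κ : ℝ × ℝ → ℝ}
    (hκ : ContDiffOn ℝ ∞ κ (Λ ×ˢ univ)) {F : ℝ → N → ℝ}
    (hF : ContMDiffOn (𝓘(ℝ, ℝ).prod 𝓘(ℝ, E)) 𝓘(ℝ, ℝ) ∞ (fun z : ℝ × N => F z.1 z.2)
      (Λ ×ˢ univ)) {ε : ℝ} {x : ℝ → N} {t : ℝ} :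
    (forcedGeodesicField hΛ hκ hF).IsSolution ε x t ↔ ContMDiffAt 𝓘(ℝ, ℝ) 𝓘(ℝ, E) ∞ x t ∧
      ∀ p, x t ∈ (extChartAt 𝓘(ℝ, E) p).source →
        chartAccel x p t = κ (ε, t) • chartGrad (F ε) p (extChartAt 𝓘(ℝ, E) p (x t)) := by
  refine and_congr_right fun _ => forall_congr' fun p => imp_congr_right fun _ => ?_
  change _ = - _ + _ ↔ _ + _ = _
  rw [eq_neg_add_iff_add_eq, add_comm]

end Forced

section ForcedGlobal

set_option linter.unusedSectionVars false

variable {E : Type u} [NormedAddCommGroup E] [NormedSpace ℝ E] [FiniteDimensional ℝ E]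
  {N : Type*} [MetricSpace N] [ChartedSpace E N] [IsManifold 𝓘(ℝ, E) ∞ N]
  [RiemannianBundle (fun x : N => TangentSpace 𝓘(ℝ, E) x)]
  [IsContMDiffRiemannianBundle 𝓘(ℝ, E) ∞ E (fun x : N => TangentSpace 𝓘(ℝ, E) x)]
  [IsRiemannianManifold 𝓘(ℝ, E) N] [CompleteSpace N]

/-- Global solvability of `x'' = κ(ε, t) grad F_ε` when the `F_ε` have compact support. -/
theorem exists_global_forcedGeodesic {Λ : Set ℝ} (hΛ : IsOpen Λ) {κ : ℝ × ℝ → ℝ}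
    (hκ : ContDiffOn ℝ ∞ κ (Λ ×ˢ univ)) {F : ℝ → N → ℝ}
    (hF : ContMDiffOn (𝓘(ℝ, ℝ).prod 𝓘(ℝ, E)) 𝓘(ℝ, ℝ) ∞ (fun z : ℝ × N => F z.1 z.2)
      (Λ ×ˢ univ)) (hFc : ∀ ε ∈ Λ, HasCompactSupport (F ε))
    {J : Set ℝ} (hJ : IsOpen J) {c : ℝ → ℝ → N} (hc : SmoothFamily E Λ J c) {t₀ : ℝ}
    (ht₀ : t₀ ∈ J) :
    ∃ X : ℝ → ℝ → N, (forcedGeodesicField hΛ hκ hF).IsFamily Λ univ X ∧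
      ∀ ε ∈ Λ, SameJet E (X ε) (c ε) t₀ := by
  refine (forcedGeodesicField hΛ hκ hF).exists_global_family hΛ hJ hc ht₀ ?_
  intro ε hε r hr x hx _
  have hFε : ContMDiff 𝓘(ℝ, E) 𝓘(ℝ, ℝ) ∞ (F ε) := by
    rw [← contMDiffOn_univ]
    exact hF.comp ((contMDiff_const.prodMk contMDiff_id).contMDiffOn) fun x _ => ⟨hε, mem_univ _⟩
  obtain ⟨B, hB0, hB⟩ := exists_gradBound_of_hasCompactSupport hFε (hFc ε hε)
  have hκε : Continuous fun t => B * |κ (ε, t)| := by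
    have : Continuous fun t => κ (ε, t) := by
      rw [← continuousOn_univ]
      exact hκ.continuousOn.comp (f := fun t : ℝ => (ε, t)) (by fun_prop)
        fun t _ => ⟨hε, mem_univ _⟩
    exact continuous_const.mul this.abs
  set J' := Ioo (t₀ - r) (t₀ + r)
  have hev : ∀ t ∈ J', ∀ᶠ s in 𝓝 t, ContMDiffAt 𝓘(ℝ, ℝ) 𝓘(ℝ, E) ∞ x s := fun t ht => by
    filter_upwards [isOpen_Ioo.mem_nhds ht] with s hs using (hx s hs).1
  have hE : ∀ t ∈ J', HasDerivAt (speedSq E x) (deriv (speedSq E x) t) t ∧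
      |deriv (speedSq E x) t| ≤ 2 * (B * |κ (ε, t)|) * √(speedSq E x t) := by
    intro t ht
    have h1 := ((isSolution_forcedGeodesicField_iff hΛ hκ hF).1 (hx t ht)).2 (x t)
      (mem_extChartAt_source _)
    have h2 := abs_deriv_speedSq_le (hev t ht) (mem_extChartAt_source (x t)) (mem_univ _) hB
      (e := 0) (η := 0) (by rw [h1, add_zero]) (by simp)
    rwa [add_zero] at h2
  have ht₀' : t₀ ∈ J' := ⟨by linarith, by linarith⟩
  have hspeed : ∀ t ∈ J', √(speedSq E x t) ≤ √(speedSq E x t₀) +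
      ∫ s in (t₀ - r)..(t₀ + r), B * |κ (ε, s)| := by
    intro t ht
    have hsub : Icc (min t t₀) (max t t₀) ⊆ J' := by
      intro s hs
      exact ⟨(lt_min ht.1 ht₀'.1).trans_le hs.1, hs.2.trans_lt (max_lt ht.2 ht₀'.2)⟩
    refine (sqrt_le_sqrt_add_integral hκε (fun _ => by positivity)
      (fun s hs => (hE s (hsub hs)).1) (fun s _ => speedSq_nonneg x s)
      (fun s hs => (hE s (hsub hs)).2) (s := t₀) (t := t)
      ⟨min_le_right _ _, le_max_right _ _⟩ ⟨min_le_left _ _, le_max_left _ _⟩).trans ?_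
    gcongr
    refine intervalIntegral.integral_mono_interval (lt_min ht.1 ht₀'.1).le min_le_max
      (max_lt ht.2 ht₀'.2).le (Eventually.of_forall fun s => by positivity)
      (hκε.intervalIntegrable _ _)
  have hne1 : (𝓝[J'] (t₀ - r)).NeBot := left_nhdsWithin_Ioo_neBot (by linarith)
  have hne2 : (𝓝[J'] (t₀ + r)).NeBot := right_nhdsWithin_Ioo_neBot (by linarith)
  exact ⟨SecondOrderField.hasEndLimit_of_speed_le _ hε ordConnected_Ioo hx hspeed,
    SecondOrderField.hasEndLimit_of_speed_le _ hε ordConnected_Ioo hx hspeed⟩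

end ForcedGlobal

theorem exists_smooth_inv : ∃ g : ℝ → ℝ, ContDiff ℝ ∞ g ∧ (∀ s, 1 ≤ s → g s * s = 1) := by
  refine ⟨fun s => Real.smoothTransition (2 * s - 1) * s⁻¹, ?_, fun s hs => ?_⟩
  · rw [contDiff_iff_contDiffAt]
    intro s
    by_cases hs : s = 0
    · have h1 : (fun s : ℝ => Real.smoothTransition (2 * s - 1) * s⁻¹) =ᶠ[𝓝 s] fun _ => 0 := by
        have : ∀ᶠ r in 𝓝 s, r < 1 / 2 := by
          rw [hs]; exact eventually_lt_nhds (by norm_num)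
        filter_upwards [this] with r hr
        rw [Real.smoothTransition.zero_of_nonpos (by linarith), zero_mul]
      exact contDiffAt_const.congr_of_eventuallyEq h1
    · exact (Real.smoothTransition.contDiffAt.comp s (by fun_prop)).mul (contDiffAt_inv ℝ hs)
  · beta_reduce
    rw [Real.smoothTransition.one_of_one_le (by linarith), one_mul,
      inv_mul_cancel₀ (by linarith)]

/-- Finitely many charts of `N`, cut off and combined into a smooth map `toFun` to a vector space,
such that smooth functions on `N` are, on the compact set `K`, smooth functions of `toFun`. -/
structure Coordinates (E : Type u) [NormedAddCommGroup E] [NormedSpace ℝ E]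
    {N : Type*} [TopologicalSpace N] [ChartedSpace E N] (K : Set N) where
  /-- the base points of the charts -/
  index : Finset N
  /-- the coordinate map -/
  toFun : N → index → ℝ × E
  contMDiff : ContMDiff 𝓘(ℝ, E) 𝓘(ℝ, index → ℝ × E) ∞ toFun
  /-- a partition of unity, in terms of the coordinates -/
  weight : index → (index → ℝ × E) → ℝ
  contDiff_weight : ∀ i, ContDiff ℝ ∞ (weight i)
  sum_weight : ∀ x ∈ K, ∑ i, weight i (toFun x) = 1
  tsupport_weight : ∀ i, ∀ z ∈ tsupport (weight i), (z i).2 ∈ (extChartAt 𝓘(ℝ, E) (i : N)).target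
  /-- the supports of the partition of unity -/
  core : index → Set N
  isCompact_core : ∀ i, IsCompact (core i)
  core_subset : ∀ i, core i ⊆ (extChartAt 𝓘(ℝ, E) (i : N)).source
  mem_core : ∀ i x, weight i (toFun x) ≠ 0 → x ∈ core i
  eventually_eq : ∀ i x, weight i (toFun x) ≠ 0 →
    ∀ᶠ x' in 𝓝 x, (toFun x' i).2 = extChartAt 𝓘(ℝ, E) (i : N) x'

section Coordinates

set_option linter.unusedSectionVars false

variable {E : Type u} [NormedAddCommGroup E] [NormedSpace ℝ E] [FiniteDimensional ℝ E]
  {N : Type*} [TopologicalSpace N] [ChartedSpace E N] [IsManifold 𝓘(ℝ, E) ∞ N]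

theorem exists_coordinates [T2Space N] {K : Set N} (hK : IsCompact K) :
    Nonempty (Coordinates E K) := by
  classical
  let f : ∀ p : N, SmoothBumpFunction 𝓘(ℝ, E) p := fun p => Classical.choice inferInstance
  let φ : ∀ p : N, N → E := fun p => extChartAt 𝓘(ℝ, E) p
  let O : N → Set N := fun p => (extChartAt 𝓘(ℝ, E) p).source ∩
    φ p ⁻¹' Metric.ball (φ p p) ((f p).rIn / 4)
  have hO : ∀ p, O p ∈ 𝓝 p := fun p => inter_mem
    ((isOpen_extChartAt_source p).mem_nhds (mem_extChartAt_source p))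
    ((continuousAt_extChartAt p).preimage_mem_nhds
      (Metric.ball_mem_nhds _ (by have := (f p).rIn_pos; positivity)))
  obtain ⟨t, -, hKt⟩ := hK.elim_nhds_subcover O fun p _ => hO p
  let Ψ : N → t → ℝ × E := fun x i => (f i x, f i x • (φ i x - φ i i) + φ i i)
  have hΨ : ContMDiff 𝓘(ℝ, E) 𝓘(ℝ, t → ℝ × E) ∞ Ψ := by
    rw [contMDiff_pi_space]
    intro i
    refine (f i).contMDiff.prodMk_space (ContMDiff.add ((f i).contMDiff_smul ?_) contMDiff_const)
    exact contMDiffOn_extChartAt.sub contMDiffOn_const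
  let β : ∀ p : N, ContDiffBump (φ p p) := fun p =>
    ⟨(f p).rIn / 4, (f p).rIn / 2, by have := (f p).rIn_pos; positivity,
      by have := (f p).rIn_pos; linarith⟩
  let μ : t → (t → ℝ × E) → ℝ := fun i z =>
    Real.smoothTransition (2 * (z i).1 - 1) * β i (z i).2
  have hμ : ∀ i, ContDiff ℝ ∞ (μ i) := fun i =>
    (Real.smoothTransition.contDiff.comp (by fun_prop)).mul
      ((β i).contDiff.comp (contDiff_snd.comp (contDiff_apply ℝ (ℝ × E) i)))
  have hμ0 : ∀ i z, 0 ≤ μ i z := fun i z =>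
    mul_nonneg (Real.smoothTransition.nonneg _) (β i).nonneg
  have hμ1 : ∀ (i : t), ∀ x ∈ O i, μ i (Ψ x) = 1 := by
    intro i x hx
    have h0 := (f (i : N)).rIn_pos
    have h1 : dist (φ i x) (φ i i) < (f (i : N)).rIn / 4 := hx.2
    have h2 : f (i : N) x = 1 := (f i).one_of_dist_le (by
      rw [← extChartAt_source 𝓘(ℝ, E)]; exact hx.1) (h1.le.trans (by linarith))
    simp only [μ, Ψ, h2, one_smul, sub_add_cancel]
    rw [Real.smoothTransition.one_of_one_le (by norm_num), one_mul]
    exact (β i).one_of_mem_closedBall h1.le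
  have hμΨ : ∀ (i : t) x, μ i (Ψ x) ≠ 0 → x ∈ (extChartAt 𝓘(ℝ, E) (i : N)).source ∧
      dist (φ i x) (φ i i) < (f (i : N)).rIn := by
    intro i x hx
    have h0 := (f (i : N)).rIn_pos
    have h1 : 1 / 2 < f (i : N) x := by
      by_contra! h
      exact hx (by
        simp only [μ, Ψ]
        rw [Real.smoothTransition.zero_of_nonpos (by linarith), zero_mul])
    have h2 : (f i x • (φ i x - φ i i) + φ i i) ∈ Metric.ball (φ i i) ((f (i : N)).rIn / 2) := by
      have : β i (f i x • (φ i x - φ i i) + φ i i) ≠ 0 := fun h => hx (by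
        simp only [μ, Ψ, h, mul_zero])
      rw [← Function.mem_support, (β i).support_eq] at this
      exact this
    rw [mem_ball_iff_norm, add_sub_cancel_right, norm_smul, Real.norm_eq_abs,
      abs_of_pos (by linarith)] at h2
    refine ⟨?_, ?_⟩
    · rw [extChartAt_source]
      exact (f i).support_subset_source (by
        rw [Function.mem_support]; linarith)
    · rw [dist_eq_norm]
      nlinarith [norm_nonneg (φ i x - φ i i)]
  obtain ⟨g, hg, hg1⟩ := exists_smooth_inv
  have hball : ∀ p, Metric.closedBall (φ p p) ((f p).rIn) ⊆ (extChartAt 𝓘(ℝ, E) p).target := by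
    intro p y hy
    refine (f p).closedBall_subset ⟨Metric.closedBall_subset_closedBall (f p).rIn_lt_rOut.le hy, ?_⟩
    simp
  have hsupp : ∀ i, ∀ z ∈ tsupport (μ i), (z i).2 ∈ (extChartAt 𝓘(ℝ, E) (i : N)).target := by
    intro i z hz
    have h0 := (f (i : N)).rIn_pos
    have h1 : IsClosed {z : t → ℝ × E | (z i).2 ∈ Metric.closedBall (φ i i) ((f (i : N)).rIn)} :=
      Metric.isClosed_closedBall.preimage (by fun_prop)
    refine hball i (closure_minimal (fun w hw => ?_) h1 hz)
    have : β i (w i).2 ≠ 0 := fun h => hw (by simp only [μ, h, mul_zero])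
    rw [← Function.mem_support, (β i).support_eq] at this
    exact Metric.ball_subset_closedBall (Metric.ball_subset_ball (by change _ / 2 ≤ _; linarith) this)
  have hne : ∀ i x, μ i (Ψ x) * g (∑ j, μ j (Ψ x)) ≠ 0 → μ i (Ψ x) ≠ 0 := fun i x h =>
    left_ne_zero_of_mul h
  exact ⟨{
    index := t
    toFun := Ψ
    contMDiff := hΨ
    weight := fun i z => μ i z * g (∑ j, μ j z)
    contDiff_weight := fun i => (hμ i).mul (hg.comp (ContDiff.sum fun j _ => hμ j))
    sum_weight := fun x hx => by
      rw [← Finset.sum_mul, mul_comm]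
      refine hg1 _ ?_
      obtain ⟨i, hi, hxi⟩ := mem_iUnion₂.1 (hKt hx)
      have h1 := hμ1 ⟨i, hi⟩ x hxi
      rw [← h1]
      exact Finset.single_le_sum (f := fun j => μ j (Ψ x)) (fun j _ => hμ0 j _)
        (Finset.mem_univ (⟨i, hi⟩ : t))
    tsupport_weight := fun i z hz => hsupp i z (closure_mono (Function.support_mul_subset_left _ _) hz)
    core := fun i => (extChartAt 𝓘(ℝ, E) (i : N)).symm ''
      Metric.closedBall (φ i i) ((f (i : N)).rIn)
    isCompact_core := fun i => (isCompact_closedBall _ _).image_of_continuousOn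
      ((continuousOn_extChartAt_symm _).mono (hball i))
    core_subset := by
      rintro i _ ⟨y, hy, rfl⟩
      exact (extChartAt 𝓘(ℝ, E) (i : N)).map_target (hball i hy)
    mem_core := fun i x hx => by
      obtain ⟨h1, h2⟩ := hμΨ i x (hne i x hx)
      exact ⟨φ i x, h2.le, (extChartAt 𝓘(ℝ, E) (i : N)).left_inv h1⟩
    eventually_eq := fun i x hx => by
      obtain ⟨h1, h2⟩ := hμΨ i x (hne i x hx)
      have h3 : ∀ᶠ x' in 𝓝 x, φ i x' ∈ Metric.ball (φ i i) ((f (i : N)).rIn) :=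
        (continuousAt_extChartAt' h1).eventually_mem (Metric.isOpen_ball.mem_nhds h2)
      filter_upwards [(isOpen_extChartAt_source (I := 𝓘(ℝ, E)) (i : N)).mem_nhds h1, h3] with x' h4 h5
      have h6 : f (i : N) x' = 1 := (f i).one_of_dist_le (by
        rw [← extChartAt_source 𝓘(ℝ, E)]; exact h4) (le_of_lt h5)
      simp only [Ψ, h6, one_smul, sub_add_cancel]
      rfl }⟩

variable {K : Set N} (C : Coordinates E K)

namespace Coordinates

/-- Combines functions in the charts to a function of the coordinates. -/
noncomputable def extend {X W : Type*} [NormedAddCommGroup W] [NormedSpace ℝ W]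
    (a : C.index → E × X → W) (z : (C.index → ℝ × E) × X) : W :=
  ∑ i, C.weight i z.1 • a i ((z.1 i).2, z.2)

theorem contDiff_extend {X W : Type*} [NormedAddCommGroup X] [NormedSpace ℝ X]
    [NormedAddCommGroup W] [NormedSpace ℝ W] {a : C.index → E × X → W}
    (ha : ∀ i, ContDiffOn ℝ ∞ (a i) ((extChartAt 𝓘(ℝ, E) (i : N)).target ×ˢ univ)) :
    ContDiff ℝ ∞ (C.extend a) := by
  refine ContDiff.sum fun i _ => ?_
  rw [contDiff_iff_contDiffAt]
  intro z
  by_cases hz : z.1 ∈ tsupport (C.weight i)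
  · have h1 : ContDiffAt ℝ ∞ (a i) ((z.1 i).2, z.2) :=
      (ha i).contDiffAt (((isOpen_extChartAt_target _).prod isOpen_univ).mem_nhds
        ⟨C.tsupport_weight i _ hz, mem_univ _⟩)
    have h2 : ContDiff ℝ ∞ fun z : (C.index → ℝ × E) × X => ((z.1 i).2, z.2) := by fun_prop
    exact ((C.contDiff_weight i).comp contDiff_fst).contDiffAt.smul
      (h1.comp (f := fun z : (C.index → ℝ × E) × X => ((z.1 i).2, z.2)) z h2.contDiffAt)
  · have h1 : ∀ᶠ z' in 𝓝 z, C.weight i z'.1 = 0 :=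
      continuous_fst.continuousAt.eventually (notMem_tsupport_iff_eventuallyEq.1 hz)
    refine contDiffAt_const (c := (0 : W)) |>.congr_of_eventuallyEq ?_
    filter_upwards [h1] with z' hz'
    rw [hz', zero_smul]

theorem extend_apply {X W : Type*} [NormedAddCommGroup W] [NormedSpace ℝ W]
    {a : C.index → E × X → W} {x : N} (hx : x ∈ K) {w : X} {b : W}
    (h : ∀ i, C.weight i (C.toFun x) ≠ 0 → a i (extChartAt 𝓘(ℝ, E) (i : N) x, w) = b) :
    C.extend a (C.toFun x, w) = b := by
  have h1 : ∀ i ∈ Finset.univ, C.weight i (C.toFun x) • a i ((C.toFun x i).2, w) =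
      C.weight i (C.toFun x) • b := by
    intro i _
    by_cases hi : C.weight i (C.toFun x) = 0
    · rw [hi, zero_smul, zero_smul]
    · rw [(C.eventually_eq i x hi).self_of_nhds, h i hi]
  rw [extend, Finset.sum_congr rfl h1, ← Finset.sum_smul, C.sum_weight x hx, one_smul]

theorem mem_source {i : C.index} {x : N} (hi : C.weight i (C.toFun x) ≠ 0) :
    x ∈ (extChartAt 𝓘(ℝ, E) (i : N)).source := C.core_subset i (C.mem_core i x hi)

/-- Smooth functions on `N × X` are smooth functions of the coordinates. -/
theorem exists_contDiff_factor {X W : Type*} [NormedAddCommGroup X] [NormedSpace ℝ X]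
    [NormedAddCommGroup W] [NormedSpace ℝ W] {ψ : N × X → W}
    (hψ : ContMDiff (𝓘(ℝ, E).prod 𝓘(ℝ, X)) 𝓘(ℝ, W) ∞ ψ) :
    ∃ ψ' : (C.index → ℝ × E) × X → W, ContDiff ℝ ∞ ψ' ∧
      ∀ x ∈ K, ∀ w, ψ (x, w) = ψ' (C.toFun x, w) := by
  refine ⟨C.extend fun i z => ψ ((extChartAt 𝓘(ℝ, E) (i : N)).symm z.1, z.2),
    C.contDiff_extend fun i => ?_, fun x hx w => (C.extend_apply hx fun i hi => ?_).symm⟩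
  · have h1 : ContMDiffOn 𝓘(ℝ, E × X) (𝓘(ℝ, E).prod 𝓘(ℝ, X)) ∞
        (fun z : E × X => ((extChartAt 𝓘(ℝ, E) (i : N)).symm z.1, z.2))
        ((extChartAt 𝓘(ℝ, E) (i : N)).target ×ˢ univ) :=
      ((contMDiffOn_extChartAt_symm (i : N)).comp contDiff_fst.contMDiff.contMDiffOn
        fun z hz => hz.1).prodMk contDiff_snd.contMDiff.contMDiffOn
    exact (hψ.comp_contMDiffOn h1).contDiffOn
  · simp only
    rw [(extChartAt 𝓘(ℝ, E) (i : N)).left_inv (C.mem_source hi)]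

end Coordinates

end Coordinates

section CoordinateEquation

set_option linter.unusedSectionVars false

variable {E : Type u} [NormedAddCommGroup E] [NormedSpace ℝ E] [FiniteDimensional ℝ E]
  {N : Type*} [TopologicalSpace N] [ChartedSpace E N] [IsManifold 𝓘(ℝ, E) ∞ N]
  [RiemannianBundle (fun x : N => TangentSpace 𝓘(ℝ, E) x)]
  [IsContMDiffRiemannianBundle 𝓘(ℝ, E) ∞ E (fun x : N => TangentSpace 𝓘(ℝ, E) x)]
  {K : Set N} (C : Coordinates E K)

theorem hasDerivAt_comp_chart {W : Type*} [NormedAddCommGroup W] [NormedSpace ℝ W] {ψ : N → W}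
    (hψ : ContMDiff 𝓘(ℝ, E) 𝓘(ℝ, W) ∞ ψ) {x : ℝ → N} {t : ℝ}
    (hx : ContMDiffAt 𝓘(ℝ, ℝ) 𝓘(ℝ, E) ∞ x t) {p : N}
    (hp : x t ∈ (extChartAt 𝓘(ℝ, E) p).source) : HasDerivAt (fun s => ψ (x s))
      (fderiv ℝ (fun y => ψ ((extChartAt 𝓘(ℝ, E) p).symm y)) (extChartAt 𝓘(ℝ, E) p (x t))
        (deriv (fun s => extChartAt 𝓘(ℝ, E) p (x s)) t)) t := by
  have ht := (extChartAt 𝓘(ℝ, E) p).map_source hp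
  have h1 : (fun s => ψ (x s)) =ᶠ[𝓝 t] (fun y => ψ ((extChartAt 𝓘(ℝ, E) p).symm y)) ∘
      fun s => extChartAt 𝓘(ℝ, E) p (x s) := by
    filter_upwards [hx.continuousAt.eventually_mem ((isOpen_extChartAt_source p).mem_nhds hp)]
      with s hs
    exact congrArg ψ ((extChartAt 𝓘(ℝ, E) p).left_inv hs).symm
  refine HasDerivAt.congr_of_eventuallyEq ?_ h1
  exact ((contDiffAt_chart_function hψ ht).differentiableAt (by simp)).hasFDerivAt.comp_hasDerivAt t
    ((contDiffAt_chart hx hp).differentiableAt (by simp)).hasDerivAt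

theorem deriv_deriv_comp_chart {W : Type*} [NormedAddCommGroup W] [NormedSpace ℝ W] {ψ : N → W}
    (hψ : ContMDiff 𝓘(ℝ, E) 𝓘(ℝ, W) ∞ ψ) {x : ℝ → N} {t : ℝ}
    (hx : ∀ᶠ s in 𝓝 t, ContMDiffAt 𝓘(ℝ, ℝ) 𝓘(ℝ, E) ∞ x s) {p : N}
    (hp : x t ∈ (extChartAt 𝓘(ℝ, E) p).source) : deriv (deriv (fun s => ψ (x s))) t =
      fderiv ℝ (fderiv ℝ (fun y => ψ ((extChartAt 𝓘(ℝ, E) p).symm y)))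
        (extChartAt 𝓘(ℝ, E) p (x t)) (deriv (fun s => extChartAt 𝓘(ℝ, E) p (x s)) t)
        (deriv (fun s => extChartAt 𝓘(ℝ, E) p (x s)) t) +
      fderiv ℝ (fun y => ψ ((extChartAt 𝓘(ℝ, E) p).symm y)) (extChartAt 𝓘(ℝ, E) p (x t))
        (deriv (deriv (fun s => extChartAt 𝓘(ℝ, E) p (x s))) t) := by
  have ht := (extChartAt 𝓘(ℝ, E) p).map_source hp
  have hy := contDiffAt_chart hx.self_of_nhds hp
  have h1 : deriv (fun s => ψ (x s)) =ᶠ[𝓝 t] fun s =>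
      fderiv ℝ (fun y => ψ ((extChartAt 𝓘(ℝ, E) p).symm y)) (extChartAt 𝓘(ℝ, E) p (x s))
        (deriv (fun s => extChartAt 𝓘(ℝ, E) p (x s)) s) := by
    filter_upwards [hx, hx.self_of_nhds.continuousAt.eventually_mem
      ((isOpen_extChartAt_source p).mem_nhds hp)] with s hs hs'
    exact (hasDerivAt_comp_chart hψ hs hs').deriv
  rw [h1.deriv_eq]
  have h2 : DifferentiableAt ℝ (fderiv ℝ (fun y => ψ ((extChartAt 𝓘(ℝ, E) p).symm y)))
      (extChartAt 𝓘(ℝ, E) p (x t)) :=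
    ((contDiffAt_chart_function hψ ht).fderiv_right (m := ∞) (by simp)).differentiableAt (by simp)
  have h3 := h2.hasFDerivAt.comp_hasDerivAt t (hy.differentiableAt (by simp)).hasDerivAt
  have h4 := ((contDiffAt_deriv hy).differentiableAt (by simp)).hasDerivAt
  exact (h3.clm_apply h4).deriv

/-- In coordinates, curves with acceleration `κ grad f` up to an error of size `η` satisfy an
ordinary differential equation up to an error proportional to `η`. -/
theorem Coordinates.exists_equation {f : N → ℝ} (hf : ContMDiff 𝓘(ℝ, E) 𝓘(ℝ, ℝ) ∞ f) :
    ∃ (Φ : (C.index → ℝ × E) × (C.index → ℝ × E) → (C.index → ℝ × E))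
      (B : (C.index → ℝ × E) → (C.index → ℝ × E)) (c : ℝ), ContDiff ℝ ∞ Φ ∧ ContDiff ℝ ∞ B ∧
      0 ≤ c ∧ ∀ (x : ℝ → N) (t κ η : ℝ), (∀ᶠ s in 𝓝 t, ContMDiffAt 𝓘(ℝ, ℝ) 𝓘(ℝ, E) ∞ x s) →
        x t ∈ K → 0 ≤ η → (∀ i, C.weight i (C.toFun (x t)) ≠ 0 → ‖chartAccel x (i : N) t -
          κ • chartGrad f (i : N) (extChartAt 𝓘(ℝ, E) (i : N) (x t))‖ ≤ η) →
        ‖deriv (deriv fun s => C.toFun (x s)) t -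
          (Φ (C.toFun (x t), deriv (fun s => C.toFun (x s)) t) + κ • B (C.toFun (x t)))‖ ≤ c * η := by
  let Θ : C.index → E → (C.index → ℝ × E) := fun i y =>
    C.toFun ((extChartAt 𝓘(ℝ, E) (i : N)).symm y)
  have hΘ : ∀ i, ContDiffOn ℝ ∞ (Θ i) (extChartAt 𝓘(ℝ, E) (i : N)).target := fun i y hy =>
    (contDiffAt_chart_function C.contMDiff hy).contDiffWithinAt
  have hDΘ : ∀ i, ContDiffOn ℝ ∞ (fderiv ℝ (Θ i)) (extChartAt 𝓘(ℝ, E) (i : N)).target := fun i =>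
    (hΘ i).fderiv_of_isOpen (isOpen_extChartAt_target _) (by simp)
  have hDDΘ : ∀ i, ContDiffOn ℝ ∞ (fderiv ℝ (fderiv ℝ (Θ i)))
      (extChartAt 𝓘(ℝ, E) (i : N)).target := fun i =>
    (hDΘ i).fderiv_of_isOpen (isOpen_extChartAt_target _) (by simp)
  let a : C.index → E × (C.index → ℝ × E) → (C.index → ℝ × E) := fun i z =>
    fderiv ℝ (fderiv ℝ (Θ i)) z.1 (z.2 i).2 (z.2 i).2 -
      fderiv ℝ (Θ i) z.1 (christoffel (metricCoeff (i : N)) z.1 (z.2 i).2 (z.2 i).2)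
  have ha : ∀ i, ContDiffOn ℝ ∞ (a i) ((extChartAt 𝓘(ℝ, E) (i : N)).target ×ˢ univ) := by
    intro i
    have hw : ContDiffOn ℝ ∞ (fun z : E × (C.index → ℝ × E) => (z.2 i).2)
        ((extChartAt 𝓘(ℝ, E) (i : N)).target ×ˢ univ) := by
      exact ContDiff.contDiffOn (by fun_prop)
    have h1 := (hDDΘ i).comp contDiff_fst.contDiffOn
      (fun (z : E × (C.index → ℝ × E)) (hz : z ∈ (extChartAt 𝓘(ℝ, E) (i : N)).target ×ˢ univ) =>
        hz.1)
    have h2 := (hDΘ i).comp contDiff_fst.contDiffOn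
      (fun (z : E × (C.index → ℝ × E)) (hz : z ∈ (extChartAt 𝓘(ℝ, E) (i : N)).target ×ˢ univ) =>
        hz.1)
    have h3 := (contDiffOn_christoffel_metricCoeff (i : N)).comp
      (contDiff_fst.contDiffOn.prodMk hw) (fun z hz => ⟨hz.1, mem_univ _⟩)
    exact ((h1.clm_apply hw).clm_apply hw).sub (h2.clm_apply h3)
  let b : C.index → E × ℝ → (C.index → ℝ × E) := fun i z =>
    fderiv ℝ (Θ i) z.1 (chartGrad f (i : N) z.1)
  have hb : ∀ i, ContDiffOn ℝ ∞ (b i) ((extChartAt 𝓘(ℝ, E) (i : N)).target ×ˢ univ) := fun i =>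
    ((hDΘ i).clm_apply (contDiffOn_chartGrad hf (i : N))).comp contDiff_fst.contDiffOn
      fun z hz => hz.1
  have hcore : ∀ i, ∃ c, ∀ x ∈ C.core i,
      ‖C.weight i (C.toFun x) • fderiv ℝ (Θ i) (extChartAt 𝓘(ℝ, E) (i : N) x)‖ ≤ c := by
    intro i
    have h1 : ContinuousOn (fun x => C.weight i (C.toFun x) •
        fderiv ℝ (Θ i) (extChartAt 𝓘(ℝ, E) (i : N) x)) (C.core i) :=
      ((C.contDiff_weight i).continuous.comp C.contMDiff.continuous).continuousOn.smul
        ((hDΘ i).continuousOn.comp ((continuousOn_extChartAt (i : N)).mono (C.core_subset i))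
          fun x hx => (extChartAt 𝓘(ℝ, E) (i : N)).map_source (C.core_subset i hx))
    obtain ⟨c, hc⟩ := (C.isCompact_core i).bddAbove_image h1.norm
    exact ⟨c, fun x hx => hc (mem_image_of_mem _ hx)⟩
  choose c hc using hcore
  refine ⟨C.extend a, fun z => C.extend b (z, 0), ∑ i, |c i|, C.contDiff_extend ha,
    (C.contDiff_extend hb).comp (contDiff_id.prodMk contDiff_const),
    Finset.sum_nonneg fun i _ => abs_nonneg _, fun x t κ η hx hxK hη0 hη => ?_⟩
  set z := C.toFun (x t) with hz
  set z' := deriv (fun s => C.toFun (x s)) t with hz'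
  set z'' := deriv (deriv fun s => C.toFun (x s)) t with hz''
  have hsum : z'' - (C.extend a (z, z') + κ • C.extend b (z, 0)) =
      ∑ i, C.weight i z • (z'' - (a i ((z i).2, z') + κ • b i ((z i).2, 0))) := by
    simp only [smul_sub, smul_add, Finset.sum_sub_distrib, Finset.sum_add_distrib, extend]
    rw [← Finset.sum_smul, C.sum_weight _ hxK, one_smul, Finset.smul_sum]
    simp only [smul_comm κ]
  rw [hsum, Finset.sum_mul]
  refine (norm_sum_le _ _).trans (Finset.sum_le_sum fun i _ => ?_)
  by_cases hi : C.weight i z = 0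
  · rw [hi, zero_smul, norm_zero]
    exact mul_nonneg (abs_nonneg _) hη0
  · have hxi := C.mem_core i _ hi
    have hp := C.mem_source hi
    have hev := hx.self_of_nhds.continuousAt.eventually (C.eventually_eq i _ hi)
    have e1 : (z i).2 = extChartAt 𝓘(ℝ, E) (i : N) (x t) := hev.self_of_nhds
    have hzd : HasDerivAt (fun s => C.toFun (x s)) z' t :=
      (hasDerivAt_comp_chart C.contMDiff hx.self_of_nhds hp).differentiableAt.hasDerivAt
    have e2 : (z' i).2 = deriv (fun s => extChartAt 𝓘(ℝ, E) (i : N) (x s)) t := by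
      have h1 : HasDerivAt (fun s => (C.toFun (x s) i).2) (z' i).2 t :=
        hasDerivAt_snd (hasDerivAt_pi.1 hzd i)
      exact (h1.congr_of_eventuallyEq (hev.mono fun s hs => hs.symm)).deriv.symm
    have e3 := deriv_deriv_comp_chart C.contMDiff hx hp
    have e4 : z'' - (a i ((z i).2, z') + κ • b i ((z i).2, 0)) =
        fderiv ℝ (Θ i) (extChartAt 𝓘(ℝ, E) (i : N) (x t)) (chartAccel x (i : N) t -
          κ • chartGrad f (i : N) (extChartAt 𝓘(ℝ, E) (i : N) (x t))) := by
      rw [hz'', e3]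
      simp only [a, b, e1, e2, chartAccel, map_sub, map_add, map_smul, Θ]
      abel
    rw [e4, ← _root_.smul_apply]
    refine (ContinuousLinearMap.le_opNorm _ _).trans ?_
    exact mul_le_mul ((hc i _ hxi).trans (le_abs_self _)) (hη i hi) (norm_nonneg _) (abs_nonneg _)

end CoordinateEquation

section NetCalculus

set_option linter.unusedSectionVars false

variable {V : Type*} [NormedAddCommGroup V] [NormedSpace ℝ V]
  {W : Type*} [NormedAddCommGroup W] [NormedSpace ℝ W]

/-- The net is bounded on compact sets, uniformly for small `ε`. -/
def LocBounded (J : Set ℝ) (g : ℝ → ℝ → V) : Prop :=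
  ∀ L ⊆ J, IsCompact L → ∃ C ε₀ : ℝ, 0 < ε₀ ∧ ∀ ε ∈ Ioo 0 ε₀, ∀ t ∈ L, ‖g ε t‖ ≤ C

/-- Moderateness of the derivatives up to order `k`. -/
def ModerateOrder (J : Set ℝ) (k : ℕ) (g : ℝ → ℝ → V) : Prop :=
  ∀ L ⊆ J, IsCompact L → ∀ j ≤ k, PolyBdd L fun ε t => ‖iteratedFDeriv ℝ j (g ε) t‖

theorem moderateOn_iff_moderateOrder {J : Set ℝ} {g : ℝ → ℝ → V} :
    ModerateOn J g ↔ ∀ k, ModerateOrder J k g :=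
  ⟨fun h _ L hL hLc j _ => h L hL hLc j, fun h L hL hLc k => h k L hL hLc k le_rfl⟩

theorem PolyBdd.pow {X : Type*} {K : Set X} {φ : ℝ → X → ℝ} (h : PolyBdd K φ)
    (h0 : ∀ ε y, 0 ≤ φ ε y) (n : ℕ) : PolyBdd K (fun ε y => φ ε y ^ n) := by
  induction n with
  | zero => simpa using PolyBdd.const (K := K) 1
  | succ n ih =>
    simp only [pow_succ]
    exact ih.mul h (fun ε y => pow_nonneg (h0 ε y) n) h0

theorem PolyBdd.of_small {X : Type*} {K : Set X} {φ φ' : ℝ → X → ℝ} (h : PolyBdd K φ) {ε₁ : ℝ}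
    (hε₁ : 0 < ε₁) (hle : ∀ ε ∈ Ioo (0 : ℝ) ε₁, ∀ y ∈ K, φ' ε y ≤ φ ε y) : PolyBdd K φ' := by
  obtain ⟨m, C, e, he, H⟩ := h
  exact ⟨m, C, min e ε₁, lt_min he hε₁, fun ε hε y hy =>
    (hle ε ⟨hε.1, hε.2.trans_le (min_le_right _ _)⟩ y hy).trans
      (H ε ⟨hε.1, hε.2.trans_le (min_le_left _ _)⟩ y hy)⟩

theorem LocBounded.polyBdd {J L : Set ℝ} {g : ℝ → ℝ → V} (h : LocBounded J g) (hL : L ⊆ J)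
    (hLc : IsCompact L) : PolyBdd L fun ε t => ‖g ε t‖ := by
  obtain ⟨C, e, he, H⟩ := h L hL hLc
  exact ⟨0, C, e, he, fun ε hε y hy => by simpa using H ε hε y hy⟩

theorem LocBounded.mono {J J' : Set ℝ} {g : ℝ → ℝ → V} (h : LocBounded J g) (hJ : J' ⊆ J) :
    LocBounded J' g := fun L hL => h L (hL.trans hJ)

theorem LocBounded.prodMk {J : Set ℝ} {g : ℝ → ℝ → V} {h : ℝ → ℝ → W} (hg : LocBounded J g)
    (hh : LocBounded J h) : LocBounded J fun ε t => (g ε t, h ε t) := by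
  intro L hL hLc
  obtain ⟨C, e, he, H⟩ := hg L hL hLc
  obtain ⟨C', e', he', H'⟩ := hh L hL hLc
  refine ⟨max C C', min e e', lt_min he he', fun ε hε t ht => max_le_max ?_ ?_⟩
  · exact H ε ⟨hε.1, hε.2.trans_le (min_le_left _ _)⟩ t ht
  · exact H' ε ⟨hε.1, hε.2.trans_le (min_le_right _ _)⟩ t ht

theorem ModerateOrder.congr_small {J : Set ℝ} (hJ : IsOpen J) {k : ℕ} {g g' : ℝ → ℝ → V}
    (h : ModerateOrder J k g) {ε₁ : ℝ} (hε₁ : 0 < ε₁)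
    (he : ∀ ε ∈ Ioo 0 ε₁, ∀ t ∈ J, g' ε t = g ε t) : ModerateOrder J k g' := by
  intro L hL hLc j hj
  refine (h L hL hLc j hj).of_small hε₁ fun ε hε t ht => ?_
  have h1 : g' ε =ᶠ[𝓝 t] g ε := by
    filter_upwards [hJ.mem_nhds (hL ht)] with s hs using he ε hε s hs
  rw [(h1.iteratedFDeriv ℝ j).eq_of_nhds]

theorem moderateOrder_zero {J : Set ℝ} {g : ℝ → ℝ → V} (h : LocBounded J g) :
    ModerateOrder J 0 g := by
  intro L hL hLc j hj
  obtain rfl := Nat.le_zero.1 hj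
  simpa using h.polyBdd hL hLc

theorem ModerateOrder.succ {J : Set ℝ} {k : ℕ} {g : ℝ → ℝ → V} (h0 : LocBounded J g)
    (h : ModerateOrder J k fun ε => deriv (g ε)) : ModerateOrder J (k + 1) g := by
  intro L hL hLc j hj
  rcases j with - | j
  · simpa using h0.polyBdd hL hLc
  · refine (h L hL hLc j (by omega)).le fun ε _ t _ => ?_
    rw [norm_iteratedFDeriv_eq_norm_iteratedDeriv, norm_iteratedFDeriv_eq_norm_iteratedDeriv,
      iteratedDeriv_succ']

theorem ModerateOrder.add {J : Set ℝ} (hJ : IsOpen J) {k : ℕ} {g h : ℝ → ℝ → V}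
    (hgs : ∀ ε ∈ Ioo (0 : ℝ) 1, ContDiffOn ℝ ∞ (g ε) J)
    (hhs : ∀ ε ∈ Ioo (0 : ℝ) 1, ContDiffOn ℝ ∞ (h ε) J) (hg : ModerateOrder J k g)
    (hh : ModerateOrder J k h) : ModerateOrder J k fun ε t => g ε t + h ε t := by
  intro L hL hLc j hj
  refine ((hg L hL hLc j hj).add (hh L hL hLc j hj)).le fun ε hε t ht => ?_
  have hk : ((j : ℕ) : ℕ∞ω) ≤ (∞ : ℕ∞ω) := by exact_mod_cast le_top
  change ‖iteratedFDeriv ℝ j (g ε + h ε) t‖ ≤ _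
  rw [iteratedFDeriv_add_apply
    (((hgs ε hε).contDiffAt (hJ.mem_nhds (hL ht))).of_le hk)
    (((hhs ε hε).contDiffAt (hJ.mem_nhds (hL ht))).of_le hk)]
  exact norm_add_le _ _

theorem ModerateOrder.prodMk {J : Set ℝ} (hJ : IsOpen J) {k : ℕ} {g : ℝ → ℝ → V} {h : ℝ → ℝ → W}
    (hgs : ∀ ε ∈ Ioo (0 : ℝ) 1, ContDiffOn ℝ ∞ (g ε) J)
    (hhs : ∀ ε ∈ Ioo (0 : ℝ) 1, ContDiffOn ℝ ∞ (h ε) J) (hg : ModerateOrder J k g)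
    (hh : ModerateOrder J k h) : ModerateOrder J k fun ε t => (g ε t, h ε t) := by
  intro L hL hLc j hj
  refine ((hg L hL hLc j hj).add (hh L hL hLc j hj)).le fun ε hε t ht => ?_
  have hk : ((j : ℕ) : ℕ∞ω) ≤ (∞ : ℕ∞ω) := by exact_mod_cast le_top
  rw [iteratedFDeriv_prodMk (i := j)
    ((hgs ε hε).contDiffAt (hJ.mem_nhds (hL ht)))
    ((hhs ε hε).contDiffAt (hJ.mem_nhds (hL ht))) hk, ContinuousMultilinearMap.opNorm_prod]
  exact max_le_add_of_nonneg (norm_nonneg _) (norm_nonneg _)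

theorem ModerateOrder.smul {J : Set ℝ} (hJ : IsOpen J) {k : ℕ} {g : ℝ → ℝ → ℝ} {h : ℝ → ℝ → V}
    (hgs : ∀ ε ∈ Ioo (0 : ℝ) 1, ContDiffOn ℝ ∞ (g ε) J)
    (hhs : ∀ ε ∈ Ioo (0 : ℝ) 1, ContDiffOn ℝ ∞ (h ε) J) (hg : ModerateOrder J k g)
    (hh : ModerateOrder J k h) : ModerateOrder J k fun ε t => g ε t • h ε t := by
  intro L hL hLc j hj
  have h1 : PolyBdd L fun ε t => ∑ i ∈ Finset.range (j + 1), ((j.choose i : ℝ) *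
      ‖iteratedFDeriv ℝ i (g ε) t‖) * ‖iteratedFDeriv ℝ (j - i) (h ε) t‖ := by
    refine PolyBdd.sum _ fun i hi => ((PolyBdd.const _).mul (hg L hL hLc i ?_) ?_ ?_).mul
      (hh L hL hLc (j - i) (by omega)) ?_ ?_
    · have := Finset.mem_range.1 hi
      omega
    all_goals intros; positivity
  refine h1.le fun ε hε t ht => ?_
  have hk : ((j : ℕ) : ℕ∞ω) ≤ (∞ : ℕ∞ω) := by exact_mod_cast le_top
  have := norm_iteratedFDerivWithin_smul_le (hgs ε hε) (hhs ε hε) hJ.uniqueDiffOn (hL ht) hk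
  simpa only [iteratedFDerivWithin_of_isOpen _ hJ (hL ht)] using this

theorem ModerateOn.comp_moderateOrder [FiniteDimensional ℝ V] {Φ : ℝ → V → W}
    (hΦs : ∀ ε ∈ Ioo (0 : ℝ) 1, ContDiff ℝ ∞ (Φ ε)) (hΦ : ModerateOn univ Φ) {J : Set ℝ}
    (hJ : IsOpen J) {k : ℕ} {g : ℝ → ℝ → V} (hgs : ∀ ε ∈ Ioo (0 : ℝ) 1, ContDiffOn ℝ ∞ (g ε) J)
    (hb : LocBounded J g) (hg : ModerateOrder J k g) :
    ModerateOrder J k fun ε t => Φ ε (g ε t) := by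
  intro L hL hLc j hj
  obtain ⟨R, e, he, hR⟩ := hb L hL hLc
  have h1 : PolyBdd L fun ε t => ∑ i ∈ Finset.range (j + 1), ‖iteratedFDeriv ℝ i (Φ ε) (g ε t)‖ := by
    refine PolyBdd.sum _ fun i _ => ?_
    obtain ⟨m, C, e', he', H⟩ := hΦ (Metric.closedBall 0 R) (subset_univ _)
      (isCompact_closedBall _ _) i
    exact ⟨m, C, min e e', lt_min he he', fun ε hε t ht =>
      H ε ⟨hε.1, hε.2.trans_le (min_le_right _ _)⟩ _ (mem_closedBall_zero_iff.2
        (hR ε ⟨hε.1, hε.2.trans_le (min_le_left _ _)⟩ t ht))⟩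
  have h2 : PolyBdd L fun ε t => 1 + ∑ i ∈ Finset.range (j + 1), ‖iteratedFDeriv ℝ i (g ε) t‖ :=
    (PolyBdd.const 1).add (PolyBdd.sum _ fun i hi => hg L hL hLc i (by
      have := Finset.mem_range.1 hi
      omega))
  have h3 := ((PolyBdd.const (K := L) (j.factorial : ℝ)).mul h1 (fun _ _ => by positivity)
    (fun _ _ => by positivity)).mul (h2.pow (fun _ _ => by positivity) j)
    (fun _ _ => by positivity) (fun _ _ => by positivity)
  refine h3.le fun ε hε t ht => ?_
  have hk : ((j : ℕ) : ℕ∞ω) ≤ (∞ : ℕ∞ω) := by exact_mod_cast le_top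
  have hle : ∀ {a : ℕ → ℝ} {i : ℕ}, (∀ i, 0 ≤ a i) → i ≤ j → a i ≤ ∑ i ∈ Finset.range (j + 1), a i :=
    fun h0 hi => Finset.single_le_sum (fun i _ => h0 i) (Finset.mem_range.2 (by omega))
  have := norm_iteratedFDerivWithin_comp_le (hΦs ε hε).contDiffOn (hgs ε hε) hk uniqueDiffOn_univ
    hJ.uniqueDiffOn (mapsTo_univ _ _) (hL ht)
    (C := ∑ i ∈ Finset.range (j + 1), ‖iteratedFDeriv ℝ i (Φ ε) (g ε t)‖)
    (D := 1 + ∑ i ∈ Finset.range (j + 1), ‖iteratedFDeriv ℝ i (g ε) t‖)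
    (fun i hi => by
      rw [iteratedFDerivWithin_univ]
      exact hle (a := fun i => ‖iteratedFDeriv ℝ i (Φ ε) (g ε t)‖) (fun _ => norm_nonneg _) hi)
    (fun i hi hij => by
      rw [iteratedFDerivWithin_of_isOpen _ hJ (hL ht)]
      have h4 := hle (a := fun i => ‖iteratedFDeriv ℝ i (g ε) t‖) (fun _ => norm_nonneg _) hij
      have h5 : 0 ≤ ∑ i ∈ Finset.range (j + 1), ‖iteratedFDeriv ℝ i (g ε) t‖ := by positivity
      refine le_trans ?_ (le_self_pow₀ (by linarith) (by omega))
      linarith)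
  rwa [iteratedFDerivWithin_of_isOpen _ hJ (hL ht)] at this

theorem moderateOn_const [FiniteDimensional ℝ V] {Φ : V → W} (hΦ : ContDiff ℝ ∞ Φ) :
    ModerateOn univ fun _ : ℝ => Φ := by
  intro K _ hKc k
  obtain ⟨C, hC⟩ := hKc.bddAbove_image
    ((hΦ.continuous_iteratedFDeriv (m := k) (by exact_mod_cast le_top)).norm.continuousOn)
  exact ⟨0, C, 1, one_pos, fun ε _ y hy => by simpa using hC (mem_image_of_mem _ hy)⟩

theorem ModerateOrder.comp [FiniteDimensional ℝ V] {Φ : V → W} (hΦ : ContDiff ℝ ∞ Φ) {J : Set ℝ}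
    (hJ : IsOpen J) {k : ℕ} {g : ℝ → ℝ → V} (hgs : ∀ ε ∈ Ioo (0 : ℝ) 1, ContDiffOn ℝ ∞ (g ε) J)
    (hb : LocBounded J g) (hg : ModerateOrder J k g) :
    ModerateOrder J k fun ε t => Φ (g ε t) :=
  (moderateOn_const hΦ).comp_moderateOrder (fun _ _ => hΦ) hJ hgs hb hg

/-- Bounded nets of solutions of a second order equation are moderate. -/
theorem moderateOn_of_equation [FiniteDimensional ℝ V] {J : Set ℝ} (hJ : IsOpen J)
    {z : ℝ → ℝ → V} (hz : ∀ ε ∈ Ioo (0 : ℝ) 1, ContDiffOn ℝ ∞ (z ε) J) (hb : LocBounded J z)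
    (hb' : LocBounded J fun ε => deriv (z ε)) {κ : ℝ → ℝ → ℝ}
    (hκs : ∀ ε ∈ Ioo (0 : ℝ) 1, ContDiffOn ℝ ∞ (κ ε) J) (hκ : ModerateOn J κ)
    {Φ : V × V → V} {B : V → V} (hΦ : ContDiff ℝ ∞ Φ) (hB : ContDiff ℝ ∞ B) {ε₁ : ℝ} (hε₁ : 0 < ε₁)
    (heq : ∀ ε ∈ Ioo 0 ε₁, ∀ t ∈ J,
      deriv (deriv (z ε)) t = Φ (z ε t, deriv (z ε) t) + κ ε t • B (z ε t)) : ModerateOn J z := by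
  have hz' : ∀ ε ∈ Ioo (0 : ℝ) 1, ContDiffOn ℝ ∞ (deriv (z ε)) J := fun ε hε =>
    (hz ε hε).deriv_of_isOpen hJ (by simp)
  have hzz : ∀ ε ∈ Ioo (0 : ℝ) 1, ContDiffOn ℝ ∞ (fun t => (z ε t, deriv (z ε) t)) J :=
    fun ε hε => (hz ε hε).prodMk (hz' ε hε)
  have key : ∀ k, ModerateOrder J k z ∧ ModerateOrder J k fun ε => deriv (z ε) := by
    intro k
    induction k with
    | zero => exact ⟨moderateOrder_zero hb, moderateOrder_zero hb'⟩
    | succ k ih =>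
      refine ⟨ModerateOrder.succ hb ih.2, ModerateOrder.succ hb' ?_⟩
      have h1 := (ih.1.prodMk hJ hz hz' ih.2).comp hΦ hJ hzz (hb.prodMk hb')
      have h2 := (moderateOn_iff_moderateOrder.1 hκ k).smul hJ hκs
        (fun ε hε => hB.comp_contDiffOn (hz ε hε)) (ih.1.comp hB hJ hz hb)
      exact (h1.add hJ (fun ε hε => hΦ.comp_contDiffOn (hzz ε hε))
        (fun ε hε => (hκs ε hε).smul (hB.comp_contDiffOn (hz ε hε))) h2).congr_small hJ hε₁ heq
  exact moderateOn_iff_moderateOrder.2 fun k => (key k).1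

theorem exists_lipschitz_closedBall [FiniteDimensional ℝ V] {Φ : V → W} (hΦ : ContDiff ℝ ∞ Φ)
    (R : ℝ) : ∃ K ≥ 0, ∀ a b, ‖a‖ ≤ R → ‖b‖ ≤ R → ‖Φ a - Φ b‖ ≤ K * ‖a - b‖ := by
  obtain ⟨K, hK⟩ := (isCompact_closedBall (0 : V) R).bddAbove_image
    (hΦ.continuous_fderiv (by simp)).norm.continuousOn
  refine ⟨max K 0, le_max_right _ _, fun a b ha hb => ?_⟩
  refine (convex_closedBall (0 : V) R).norm_image_sub_le_of_norm_fderiv_le (𝕜 := ℝ)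
    (fun x _ => hΦ.differentiable (by simp) x)
    (fun x hx => (hK (mem_image_of_mem _ hx)).trans (le_max_left _ _)) ?_ ?_
  · exact mem_closedBall_zero_iff.2 hb
  · exact mem_closedBall_zero_iff.2 ha

theorem NegligibleOn.comp_sub [FiniteDimensional ℝ V] {Φ : V → W} (hΦ : ContDiff ℝ ∞ Φ) {J : Set ℝ}
    {g h : ℝ → ℝ → V} (hg : LocBounded J g) (hh : LocBounded J h)
    (hn : NegligibleOn J fun ε t => g ε t - h ε t) :
    NegligibleOn J fun ε t => Φ (g ε t) - Φ (h ε t) := by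
  intro L hL hLc m
  obtain ⟨C, e, he, H⟩ := hg L hL hLc
  obtain ⟨C', e', he', H'⟩ := hh L hL hLc
  obtain ⟨D, e'', he'', H''⟩ := hn L hL hLc m
  obtain ⟨K, hK0, hK⟩ := exists_lipschitz_closedBall hΦ (max C C')
  refine ⟨K * D, min e (min e' e''), by positivity, fun ε hε t ht => ?_⟩
  obtain ⟨h0, h1⟩ := hε
  simp only [lt_min_iff] at h1
  calc _ ≤ K * ‖g ε t - h ε t‖ := hK _ _ ((H ε ⟨h0, h1.1⟩ t ht).trans (le_max_left _ _))
        ((H' ε ⟨h0, h1.2.1⟩ t ht).trans (le_max_right _ _))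
    _ ≤ K * (D * ε ^ m) := by gcongr; exact H'' ε ⟨h0, h1.2.2⟩ t ht
    _ = _ := by ring

/-- Comparison of approximate solutions of a second order equation with an integrable kernel. -/
theorem exists_comparison [FiniteDimensional ℝ V] {Φ : V × V → V} {B : V → V}
    (hΦ : ContDiff ℝ ∞ Φ) (hB : ContDiff ℝ ∞ B) (R k a b : ℝ) :
    ∃ C, ∀ (z w : ℝ → V) (κ : ℝ → ℝ) (η t₀ : ℝ), 0 < η → t₀ ∈ Icc a b → Continuous κ →
      ∫ s in a..b, |κ s| ≤ k → (∀ t ∈ Icc a b, ContDiffAt ℝ ∞ z t ∧ ContDiffAt ℝ ∞ w t ∧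
        ‖z t‖ ≤ R ∧ ‖deriv z t‖ ≤ R ∧ ‖w t‖ ≤ R ∧ ‖deriv w t‖ ≤ R ∧
        ‖deriv (deriv z) t - (Φ (z t, deriv z t) + κ t • B (z t))‖ ≤ η ∧
        ‖deriv (deriv w) t - (Φ (w t, deriv w t) + κ t • B (w t))‖ ≤ η) →
      z t₀ = w t₀ → deriv z t₀ = deriv w t₀ →
      ∀ t ∈ Icc a b, ‖z t - w t‖ ≤ C * η ∧ ‖deriv z t - deriv w t‖ ≤ C * η := by
  obtain ⟨K₁, hK₁0, hK₁⟩ := exists_lipschitz_closedBall hΦ R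
  obtain ⟨K₂, hK₂0, hK₂⟩ := exists_lipschitz_closedBall hB R
  refine ⟨2 * 2 * (b - a) * Real.exp ((1 + K₁) * (b - a) + K₂ * k),
    fun z w κ η t₀ hη ht₀ hκ hk h h0 h0' => ?_⟩
  have hab : a ≤ b := ht₀.1.trans ht₀.2
  let Z : ℝ → V × V := fun t => (z t - w t, deriv z t - deriv w t)
  have hZ : ∀ t ∈ Icc a b, HasDerivAt Z
      (deriv z t - deriv w t, deriv (deriv z) t - deriv (deriv w) t) t := by
    intro t ht
    obtain ⟨h1, h2, -⟩ := h t ht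
    exact ((h1.differentiableAt (by simp)).hasDerivAt.fun_sub
      (h2.differentiableAt (by simp)).hasDerivAt).prodMk
      (((contDiffAt_deriv h1).differentiableAt (by simp)).hasDerivAt.fun_sub
        ((contDiffAt_deriv h2).differentiableAt (by simp)).hasDerivAt)
  have hc : Continuous fun t => (1 + K₁) + K₂ * |κ t| := by fun_prop
  have hint : ∫ s in a..b, ((1 + K₁) + K₂ * |κ s|) ≤ (1 + K₁) * (b - a) + K₂ * k := by
    rw [intervalIntegral.integral_add (by simp) ((by fun_prop : Continuous fun t =>
      K₂ * |κ t|).intervalIntegrable _ _), intervalIntegral.integral_const,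
      intervalIntegral.integral_const_mul, smul_eq_mul, mul_comm (b - a)]
    gcongr
  have key := norm_le_of_norm_deriv_le_kernel ht₀ hc (fun t => by positivity) hZ
    (η := 2 * η) (by positivity) (fun t ht => ?_) (by simp [Z, h0, h0']) hint
  · intro t ht
    have h1 := key t ht
    have h2 : 2 * (2 * η) * (b - a) * Real.exp ((1 + K₁) * (b - a) + K₂ * k) =
      2 * 2 * (b - a) * Real.exp ((1 + K₁) * (b - a) + K₂ * k) * η := by ring
    rw [h2] at h1
    exact ⟨(norm_fst_le (Z t)).trans h1, (norm_snd_le (Z t)).trans h1⟩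
  · obtain ⟨-, -, h1, h2, h3, h4, h5, h6⟩ := h t ht
    have hZ1 : ‖z t - w t‖ ≤ ‖Z t‖ := norm_fst_le (Z t)
    have hZ2 : ‖deriv z t - deriv w t‖ ≤ ‖Z t‖ := norm_snd_le (Z t)
    have e1 : deriv (deriv z) t - deriv (deriv w) t =
        (deriv (deriv z) t - (Φ (z t, deriv z t) + κ t • B (z t))) -
        (deriv (deriv w) t - (Φ (w t, deriv w t) + κ t • B (w t))) +
        (Φ (z t, deriv z t) - Φ (w t, deriv w t)) + κ t • (B (z t) - B (w t)) := by
      rw [smul_sub]; abel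
    have h7 : ‖Φ (z t, deriv z t) - Φ (w t, deriv w t)‖ ≤ K₁ * ‖Z t‖ :=
      hK₁ _ _ (max_le h1 h2) (max_le h3 h4)
    have h8 : ‖κ t • (B (z t) - B (w t))‖ ≤ K₂ * |κ t| * ‖Z t‖ := by
      rw [norm_smul, Real.norm_eq_abs]
      calc _ ≤ |κ t| * (K₂ * ‖z t - w t‖) := by gcongr; exact hK₂ _ _ h1 h3
        _ ≤ |κ t| * (K₂ * ‖Z t‖) := by gcongr
        _ = _ := by ring
    have h9 : ‖deriv (deriv z) t - deriv (deriv w) t‖ ≤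
        2 * η + K₁ * ‖Z t‖ + K₂ * |κ t| * ‖Z t‖ := by
      rw [e1]
      refine (norm_add₃_le).trans ?_
      have := norm_sub_le (deriv (deriv z) t - (Φ (z t, deriv z t) + κ t • B (z t)))
        (deriv (deriv w) t - (Φ (w t, deriv w t) + κ t • B (w t)))
      linarith
    have h10 : 0 ≤ K₁ * ‖Z t‖ := by positivity
    have h11 : 0 ≤ K₂ * |κ t| * ‖Z t‖ := by positivity
    refine max_le ?_ ?_
    · simp only; nlinarith
    · simp only; nlinarith [norm_nonneg (Z t)]

end NetCalculus

section WaveForm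

variable {X : Type*} [NormedAddCommGroup X] [NormedSpace ℝ X]

/-- The bilinear form `H + 2 du dv + s du²` on `X × ℝ²`. -/
noncomputable def waveForm (H : X →L[ℝ] X →L[ℝ] ℝ) (s : ℝ) :
    (X × (ℝ × ℝ)) →L[ℝ] (X × (ℝ × ℝ)) →L[ℝ] ℝ :=
  let P : (X × (ℝ × ℝ)) →L[ℝ] X := ContinuousLinearMap.fst ℝ X (ℝ × ℝ)
  let uL : (X × (ℝ × ℝ)) →L[ℝ] ℝ :=
    (ContinuousLinearMap.fst ℝ ℝ ℝ).comp (ContinuousLinearMap.snd ℝ X (ℝ × ℝ))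
  let vL : (X × (ℝ × ℝ)) →L[ℝ] ℝ :=
    (ContinuousLinearMap.snd ℝ ℝ ℝ).comp (ContinuousLinearMap.snd ℝ X (ℝ × ℝ))
  (P.precomp ℝ).comp (H.comp P) + (uL.smulRight vL + vL.smulRight uL) + s • uL.smulRight uL

theorem waveForm_apply (H : X →L[ℝ] X →L[ℝ] ℝ) (s : ℝ) (a b : X × (ℝ × ℝ)) :
    waveForm H s a b = H a.1 b.1 + (a.2.1 * b.2.2 + a.2.2 * b.2.1) + s * (a.2.1 * b.2.1) := rfl

theorem norm_le_waveForm {H : X →L[ℝ] X →L[ℝ] ℝ} {c : ℝ} (hc : 0 < c)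
    (hH : ∀ a, c * ‖a‖ ^ 2 ≤ H a a) (s : ℝ) (w : X × (ℝ × ℝ)) :
    ‖w‖ ≤ (c⁻¹ + 1 + |s|) * ‖waveForm H s w‖ := by
  set B := ‖waveForm H s w‖ with hB
  have hB0 : 0 ≤ B := norm_nonneg _
  have key : ∀ b, |waveForm H s w b| ≤ B * ‖b‖ := fun b => (waveForm H s w).le_opNorm b
  have h1 : ‖w.1‖ ≤ c⁻¹ * B := by
    have h := key (w.1, (0, 0))
    rw [waveForm_apply] at h
    have hn : ‖((w.1, (0, 0)) : X × (ℝ × ℝ))‖ = ‖w.1‖ := by simp [Prod.norm_def]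
    simp only [mul_zero, add_zero, hn] at h
    have h2 := (hH w.1).trans ((le_abs_self _).trans h)
    rcases (norm_nonneg w.1).eq_or_lt with h0 | h0
    · rw [← h0]; positivity
    · rw [inv_mul_eq_div, le_div_iff₀ hc]
      nlinarith
  have h2 : |w.2.1| ≤ B := by
    have h := key (0, (0, 1))
    rw [waveForm_apply] at h
    simpa [Prod.norm_def] using h
  have h3 : |w.2.2 + s * w.2.1| ≤ B := by
    have h := key (0, (1, 0))
    rw [waveForm_apply] at h
    simpa [Prod.norm_def] using h
  have h4 : |w.2.2| ≤ (1 + |s|) * B := by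
    have e : w.2.2 = (w.2.2 + s * w.2.1) - s * w.2.1 := by ring
    rw [e]
    calc _ ≤ |w.2.2 + s * w.2.1| + |s * w.2.1| := abs_sub _ _
      _ ≤ B + |s| * B := by rw [abs_mul]; gcongr
      _ = _ := by ring
  have hc' : 0 < c⁻¹ := by positivity
  have hs := abs_nonneg s
  rw [Prod.norm_def, Prod.norm_def, Real.norm_eq_abs, Real.norm_eq_abs]
  refine max_le (h1.trans ?_) (max_le (h2.trans ?_) (h4.trans ?_)) <;> nlinarith [mul_nonneg hs hB0]

theorem waveForm_nondegenerate {H : X →L[ℝ] X →L[ℝ] ℝ} (hH : ∀ a, a ≠ 0 → 0 < H a a) (s : ℝ)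
    (w : X × (ℝ × ℝ)) (h : ∀ b, waveForm H s w b = 0) : w = 0 := by
  have h1 := h (w.1, (0, 0))
  have h2 := h (0, (0, 1))
  have h3 := h (0, (1, 0))
  simp only [waveForm_apply, mul_zero, add_zero, map_zero, mul_one, zero_add] at h1 h2 h3
  have e1 : w.1 = 0 := by
    by_contra h0
    exact (hH _ h0).ne' h1
  rw [h2, mul_zero, add_zero] at h3
  exact Prod.ext e1 (Prod.ext h2 h3)

theorem hasIndex_waveForm {H : X →L[ℝ] X →L[ℝ] ℝ} (hH : ∀ a, a ≠ 0 → 0 < H a a) (s : ℝ) :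
    HasIndex (waveForm H s) 1 := by
  have hH0 : ∀ a, 0 ≤ H a a := fun a => by
    by_cases ha : a = 0
    · simp [ha]
    · exact (hH a ha).le
  constructor
  · let w : X × (ℝ × ℝ) := (0, (1, -(s + 1) / 2))
    have hw : w ≠ 0 := fun h => one_ne_zero (congrArg (fun z : X × (ℝ × ℝ) => z.2.1) h)
    refine ⟨Submodule.span ℝ {w}, finrank_span_singleton hw, fun z hz hz0 => ?_⟩
    obtain ⟨r, rfl⟩ := Submodule.mem_span_singleton.1 hz
    have hr : r ≠ 0 := fun h => hz0 (by rw [h, zero_smul])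
    have e : waveForm H s (r • w) (r • w) = -(r ^ 2) := by
      simp only [map_smul, _root_.smul_apply, waveForm_apply, smul_eq_mul, w, map_zero]
      ring
    rw [e]
    have : 0 < r ^ 2 := by positivity
    linarith
  · rintro k ⟨W, rfl, hW⟩
    let ℓ : X × (ℝ × ℝ) →ₗ[ℝ] ℝ :=
      { toFun := fun w => w.2.1 - (w.2.2 + s / 2 * w.2.1)
        map_add' := fun a b => by simp; ring
        map_smul' := fun r a => by simp; ring }
    have hinj : Function.Injective (ℓ.domRestrict W) := by
      rw [← LinearMap.ker_eq_bot, LinearMap.ker_eq_bot']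
      rintro ⟨w, hw⟩ h0
      have h1 : w.2.1 - (w.2.2 + s / 2 * w.2.1) = 0 := h0
      by_contra hne
      have h2 := hW w hw fun h => hne (Subtype.ext h)
      have h3 : w.2.2 = w.2.1 - s / 2 * w.2.1 := by linarith
      rw [waveForm_apply, h3] at h2
      nlinarith [hH0 w.1, mul_self_nonneg w.2.1]
    simpa using LinearMap.finrank_le_finrank_of_injective hinj

theorem waveForm_eq_transvection (H : X →L[ℝ] X →L[ℝ] ℝ) (s : ℝ) : ∃ T : X × (ℝ × ℝ) →ₗ[ℝ] X × (ℝ × ℝ),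
    (T.det = 1 ∨ ¬ FiniteDimensional ℝ X) ∧ ∀ a b, waveForm H s a b = waveForm H 0 (T a) (T b) := by
  let ℓ : Module.Dual ℝ (X × (ℝ × ℝ)) := (s / 2) • (LinearMap.fst ℝ ℝ ℝ).comp (LinearMap.snd ℝ X (ℝ × ℝ))
  refine ⟨LinearMap.transvection ℓ (0, (0, 1)), ?_, fun a b => ?_⟩
  · by_cases hX : FiniteDimensional ℝ X
    · left
      rw [LinearMap.transvection.det]
      simp [ℓ]
    · exact Or.inr hX
  · simp [waveForm_apply, LinearMap.transvection.apply, ℓ]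
    ring

theorem det_gram_comp {F : Type*} [NormedAddCommGroup F] [NormedSpace ℝ F] {n : Type*} [Fintype n]
    [DecidableEq n] (b : Module.Basis n ℝ F) (B B' : F →L[ℝ] F →L[ℝ] ℝ) (T : F →ₗ[ℝ] F)
    (h : ∀ x y, B' x y = B (T x) (T y)) : (Matrix.of fun i j => B' (b i) (b j)).det =
      T.det ^ 2 * (Matrix.of fun i j => B (b i) (b j)).det := by
  let β : F →ₗ[ℝ] F →ₗ[ℝ] ℝ := LinearMap.mk₂ ℝ (fun x y => B x y) (by simp) (by simp) (by simp)
    (by simp)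
  have h1 : (Matrix.of fun i j => B (b i) (b j)) = LinearMap.toMatrix₂ b b β := by
    ext i j
    simp [LinearMap.toMatrix₂_apply, β]
  have h2 : (Matrix.of fun i j => B' (b i) (b j)) = LinearMap.toMatrix₂ b b (β.compl₁₂ T T) := by
    ext i j
    simp [LinearMap.toMatrix₂_apply, β, h]
  rw [h1, h2, LinearMap.toMatrix₂_compl₁₂ b b, Matrix.det_mul, Matrix.det_mul, Matrix.det_transpose,
    LinearMap.det_toMatrix]
  ring

theorem det_gram_ne_zero {F : Type*} [NormedAddCommGroup F] [NormedSpace ℝ F] {n : Type*} [Fintype n]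
    [DecidableEq n] (b : Module.Basis n ℝ F) (B : F →L[ℝ] F →L[ℝ] ℝ)
    (h : ∀ x, (∀ y, B x y = 0) → x = 0) : (Matrix.of fun i j => B (b i) (b j)).det ≠ 0 := by
  let β : F →ₗ[ℝ] F →ₗ[ℝ] ℝ := LinearMap.mk₂ ℝ (fun x y => B x y) (by simp) (by simp) (by simp)
    (by simp)
  have h1 : (Matrix.of fun i j => B (b i) (b j)) = LinearMap.toMatrix₂ b b β := by
    ext i j
    simp [LinearMap.toMatrix₂_apply, β]
  rw [h1]
  exact (LinearMap.separatingLeft_iff_det_ne_zero b).1 fun x hx => h x hx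

end WaveForm

section Coeff

set_option linter.unusedSectionVars false

variable {E : Type u} [NormedAddCommGroup E] [NormedSpace ℝ E] [FiniteDimensional ℝ E]
  {N : Type*} [TopologicalSpace N] [ChartedSpace E N] [IsManifold 𝓘(ℝ, E) ∞ N]
  [RiemannianBundle (fun x : N => TangentSpace 𝓘(ℝ, E) x)]
  [IsContMDiffRiemannianBundle 𝓘(ℝ, E) ∞ E (fun x : N => TangentSpace 𝓘(ℝ, E) x)]

theorem inpw_target (p : N × (ℝ × ℝ)) : (extChartAt (inpwModel E) p).target =
    (extChartAt 𝓘(ℝ, E) p.1).target ×ˢ univ := by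
  rw [extChartAt_prod, PartialEquiv.prod_target, extChartAt_model_space_eq_id]; rfl

theorem inpw_source (p : N × (ℝ × ℝ)) : (extChartAt (inpwModel E) p).source =
    (extChartAt 𝓘(ℝ, E) p.1).source ×ˢ univ := by
  rw [extChartAt_prod, PartialEquiv.prod_source, extChartAt_model_space_eq_id]; rfl

theorem inpw_chart (p q : N × (ℝ × ℝ)) :
    extChartAt (inpwModel E) p q = (extChartAt 𝓘(ℝ, E) p.1 q.1, q.2) := by
  rw [extChartAt_prod, extChartAt_model_space_eq_id]; rfl

theorem chartCoeff_inpwTensor_apply (f : N → ℝ) (d : ℝ → ℝ) (p : N × (ℝ × ℝ))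
    {y : E × (ℝ × ℝ)} (hy : y ∈ (extChartAt (inpwModel E) p).target) (a b : E × (ℝ × ℝ)) :
    chartCoeff (inpwModel E) p (inpwTensor f d) y a b = waveForm (metricCoeff p.1 y.1)
      (f ((extChartAt 𝓘(ℝ, E) p.1).symm y.1) * d y.2.1) a b := by
  have hy1 : y.1 ∈ (extChartAt 𝓘(ℝ, E) p.1).target := by
    rw [inpw_target] at hy; exact hy.1
  let P : (E × (ℝ × ℝ)) →L[ℝ] E := ContinuousLinearMap.fst ℝ E (ℝ × ℝ)
  let uL : (E × (ℝ × ℝ)) →L[ℝ] ℝ :=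
    (ContinuousLinearMap.fst ℝ ℝ ℝ).comp (ContinuousLinearMap.snd ℝ E (ℝ × ℝ))
  let vL : (E × (ℝ × ℝ)) →L[ℝ] ℝ :=
    (ContinuousLinearMap.snd ℝ ℝ ℝ).comp (ContinuousLinearMap.snd ℝ E (ℝ × ℝ))
  let Ψ := (extChartAt (inpwModel E) p).symm
  have hΨ : ∀ z, Ψ z = ((extChartAt 𝓘(ℝ, E) p.1).symm z.1, z.2) := by
    intro z
    simp only [Ψ, inpwModel]
    rw [extChartAt_prod, extChartAt_model_space_eq_id]
    rfl
  have hd : MDifferentiableAt 𝓘(ℝ, E × (ℝ × ℝ)) (inpwModel E) Ψ y :=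
    ((contMDiffOn_extChartAt_symm (I := inpwModel E) (n := ∞) p).contMDiffAt
      ((isOpen_extChartAt_target p).mem_nhds hy)).mdifferentiableAt (by simp)
  have hd1 : MDifferentiableAt 𝓘(ℝ, E) 𝓘(ℝ, E) (extChartAt 𝓘(ℝ, E) p.1).symm y.1 :=
    ((contMDiffOn_extChartAt_symm (I := 𝓘(ℝ, E)) (n := ∞) p.1).contMDiffAt
      ((isOpen_extChartAt_target p.1).mem_nhds hy1)).mdifferentiableAt (by simp)
  have hP : (Prod.fst : N × (ℝ × ℝ) → N) ∘ Ψ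
      = (extChartAt 𝓘(ℝ, E) p.1).symm ∘ (Prod.fst : E × (ℝ × ℝ) → E) := by
    funext z; simp [hΨ]
  have hu : (fun q : N × (ℝ × ℝ) => q.2.1) ∘ Ψ = uL := by funext z; simp [hΨ, uL]
  have hv : (fun q : N × (ℝ × ℝ) => q.2.2) ∘ Ψ = vL := by funext z; simp [hΨ, vL]
  have eP : (mfderiv (inpwModel E) 𝓘(ℝ, E) Prod.fst (Ψ y)).comp
      (mfderiv 𝓘(ℝ, E × (ℝ × ℝ)) (inpwModel E) Ψ y)
      = (mfderiv 𝓘(ℝ, E) 𝓘(ℝ, E) (extChartAt 𝓘(ℝ, E) p.1).symm y.1).comp P := by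
    have h1 := mfderiv_comp y (I'' := 𝓘(ℝ, E)) (mdifferentiableAt_fst (x := Ψ y)) hd
    have h2 := mfderiv_comp y (I := 𝓘(ℝ, E × (ℝ × ℝ))) (f := (Prod.fst : E × (ℝ × ℝ) → E))
      hd1 (contMDiff_iff_contDiff.2 (contDiff_fst (n := 1))
        |>.mdifferentiableAt (by simp))
    rw [← h1, hP, h2, mfderiv_eq_fderiv, fderiv_fst]
    rfl
  have eu : (dU (Ψ y)).comp (mfderiv 𝓘(ℝ, E × (ℝ × ℝ)) (inpwModel E) Ψ y) = uL := by
    have hm : MDifferentiableAt (inpwModel E) 𝓘(ℝ, ℝ) (fun q : N × (ℝ × ℝ) => q.2.1) (Ψ y) :=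
      ((contDiff_fst.contMDiff.comp contMDiff_snd) : ContMDiff (inpwModel E) 𝓘(ℝ, ℝ) ∞
        (fun q : N × (ℝ × ℝ) => q.2.1)).mdifferentiableAt (by simp)
    have h1 := mfderiv_comp y hm hd
    rw [hu, mfderiv_eq_fderiv, uL.fderiv] at h1
    exact h1.symm
  have ev : (dV (Ψ y)).comp (mfderiv 𝓘(ℝ, E × (ℝ × ℝ)) (inpwModel E) Ψ y) = vL := by
    have hm : MDifferentiableAt (inpwModel E) 𝓘(ℝ, ℝ) (fun q : N × (ℝ × ℝ) => q.2.2) (Ψ y) :=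
      ((contDiff_snd.contMDiff.comp contMDiff_snd) : ContMDiff (inpwModel E) 𝓘(ℝ, ℝ) ∞
        (fun q : N × (ℝ × ℝ) => q.2.2)).mdifferentiableAt (by simp)
    have h1 := mfderiv_comp y hm hd
    rw [hv, mfderiv_eq_fderiv, vL.fderiv] at h1
    exact h1.symm
  let A : (E × (ℝ × ℝ)) →L[ℝ] TangentSpace (inpwModel E) (Ψ y) :=
    mfderiv 𝓘(ℝ, E × (ℝ × ℝ)) (inpwModel E) Ψ y
  let A₁ : E →L[ℝ] TangentSpace 𝓘(ℝ, E) ((extChartAt 𝓘(ℝ, E) p.1).symm y.1) :=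
    mfderiv 𝓘(ℝ, E) 𝓘(ℝ, E) (extChartAt 𝓘(ℝ, E) p.1).symm y.1
  let Q : TangentSpace (inpwModel E) (Ψ y) →L[ℝ]
      TangentSpace 𝓘(ℝ, E) ((extChartAt 𝓘(ℝ, E) p.1).symm y.1) :=
    mfderiv (inpwModel E) 𝓘(ℝ, E) Prod.fst (Ψ y)
  have eP' : ∀ a, Q (A a) = A₁ (P a) := fun a => DFunLike.congr_fun eP a
  have eu' : ∀ a, dU (Ψ y) (A a) = uL a := fun a => DFunLike.congr_fun eu a
  have ev' : ∀ a, dV (Ψ y) (A a) = vL a := fun a => DFunLike.congr_fun ev a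
  have e1 : chartCoeff (inpwModel E) p (inpwTensor f d) y a b =
      innerSL ℝ (E := TangentSpace 𝓘(ℝ, E) ((extChartAt 𝓘(ℝ, E) p.1).symm y.1))
        (Q (A a)) (Q (A b))
      + (dU (Ψ y) (A a) * dV (Ψ y) (A b) + dV (Ψ y) (A a) * dU (Ψ y) (A b))
      + (f ((extChartAt 𝓘(ℝ, E) p.1).symm y.1) * d (uL y))
        * (dU (Ψ y) (A a) * dU (Ψ y) (A b)) := rfl
  rw [e1, eu', eu', ev', ev', eP', eP']
  rfl

theorem chartCoeff_inpwTensor (f : N → ℝ) (d : ℝ → ℝ) (p : N × (ℝ × ℝ))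
    {y : E × (ℝ × ℝ)} (hy : y ∈ (extChartAt (inpwModel E) p).target) :
    chartCoeff (inpwModel E) p (inpwTensor f d) y = waveForm (metricCoeff p.1 y.1)
      (f ((extChartAt 𝓘(ℝ, E) p.1).symm y.1) * d y.2.1) :=
  ContinuousLinearMap.ext fun a => ContinuousLinearMap.ext fun b =>
    chartCoeff_inpwTensor_apply f d p hy a b

theorem inpwTensor_symm (f : N → ℝ) (d : ℝ → ℝ) (q : N × (ℝ × ℝ))
    (a b : TangentSpace (inpwModel E) q) : inpwTensor f d q a b = inpwTensor f d q b a := by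
  have key : ∀ a b : TangentSpace (inpwModel E) q, inpwTensor f d q a b =
      inner ℝ (mfderiv (inpwModel E) 𝓘(ℝ, E) Prod.fst q a : TangentSpace 𝓘(ℝ, E) q.1)
        (mfderiv (inpwModel E) 𝓘(ℝ, E) Prod.fst q b : TangentSpace 𝓘(ℝ, E) q.1)
      + (dU q a * dV q b + dV q a * dU q b) + (f q.1 * d q.2.1) * (dU q a * dU q b) :=
    fun _ _ => rfl
  rw [key, key, real_inner_comm]
  ring

theorem isGenMetric_inpwMetric (f : C^∞⟮𝓘(ℝ, E), N; ℝ⟯) (D : GenFun ℝ (univ : Set ℝ)) :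
    IsGenMetric (inpwMetric f D) := by
  induction D using Quotient.inductionOn with | _ δ
  refine ⟨inpwNet f δ, rfl, fun ε _ x a b => inpwTensor_symm f _ x a b, fun p K hK hKc => ?_,
    1, fun p K hK hKc => ⟨1, one_pos, fun ε _ y hy => ?_⟩⟩
  · let bF := Module.finBasis ℝ (E × (ℝ × ℝ))
    have hcont : ContinuousOn (fun y : E × (ℝ × ℝ) => (Matrix.of fun i j =>
        waveForm (metricCoeff p.1 y.1) 0 (bF i) (bF j)).det) K := by
      refine continuous_id.matrix_det.comp_continuousOn ?_
      refine continuousOn_pi.2 fun i => continuousOn_pi.2 fun j => ?_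
      simp only [Matrix.of_apply, waveForm_apply]
      have h1 : ContinuousOn (fun y : E × (ℝ × ℝ) => metricCoeff p.1 y.1) K :=
        (contDiffOn_metricCoeff p.1).continuousOn.comp continuousOn_fst fun y hy => by
          have := hK hy
          rw [inpw_target] at this
          exact this.1
      exact (((h1.clm_apply continuousOn_const).clm_apply continuousOn_const).add
        continuousOn_const).add continuousOn_const
    obtain ⟨c, hc, hle⟩ := hKc.exists_forall_le' hcont.abs (a := 0) fun y hy => by
      have := hK hy
      rw [inpw_target] at this
      exact abs_pos.2 (det_gram_ne_zero bF _ (waveForm_nondegenerate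
        (fun a ha => metricCoeff_pos this.1 ha) 0))
    refine ⟨1, c, hc, fun ε hε y hy => ?_⟩
    rw [pow_one]
    have e1 : chartCoeff (inpwModel E) p ((inpwNet f δ).1 ε) y = _ :=
      chartCoeff_inpwTensor f (δ.1 ε) p (hK hy)
    obtain ⟨T, hT, hTe⟩ := waveForm_eq_transvection (metricCoeff p.1 y.1)
      (f ((extChartAt 𝓘(ℝ, E) p.1).symm y.1) * δ.1 ε y.2.1)
    have hT1 : T.det = 1 := hT.resolve_right (not_not.2 inferInstance)
    rw [e1, det_gram_comp bF _ _ T hTe, hT1, one_pow, one_mul]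
    exact hε.2.trans_le (hle y hy)
  · have e1 : chartCoeff (inpwModel E) p ((inpwNet f δ).1 ε) y = _ :=
      chartCoeff_inpwTensor f (δ.1 ε) p (hK hy)
    rw [e1]
    have := hK hy
    rw [inpw_target] at this
    exact hasIndex_waveForm (fun a ha => metricCoeff_pos this.1 ha) _

end Coeff

section WaveChristoffel

variable {X : Type*} [NormedAddCommGroup X] [NormedSpace ℝ X] {H : X → X →L[ℝ] X →L[ℝ] ℝ}
  {φ : X → ℝ} {d : ℝ → ℝ} {y : X × (ℝ × ℝ)}

theorem differentiableAt_add_const_add_smul {F W : Type*} [NormedAddCommGroup F] [NormedSpace ℝ F]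
    [NormedAddCommGroup W] [NormedSpace ℝ W] {h : F → W} {s : F → ℝ} {y : F} (A B : W)
    (hh : DifferentiableAt ℝ h y) (hs : DifferentiableAt ℝ s y) :
    DifferentiableAt ℝ (fun z => h z + A + s z • B) y :=
  (hh.add_const A).fun_add (hs.smul_const B)

set_option synthInstance.maxHeartbeats 400000 in
theorem differentiableAt_pullback_add {F : Type*} [NormedAddCommGroup F] [NormedSpace ℝ F]
    (P : F →L[ℝ] X) (A B : F →L[ℝ] F →L[ℝ] ℝ) {h : F → X →L[ℝ] X →L[ℝ] ℝ} {s : F → ℝ} {y : F}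
    (hh : DifferentiableAt ℝ h y) (hs : DifferentiableAt ℝ s y) :
    DifferentiableAt ℝ (fun z => (P.precomp ℝ).comp ((h z).comp P) + A + s z • B) y := by
  have h1 : DifferentiableAt ℝ (fun z => (P.precomp ℝ).comp ((h z).comp P)) y :=
    (differentiableAt_const _).clm_comp (hh.clm_comp (differentiableAt_const _))
  exact differentiableAt_add_const_add_smul A B h1 hs

set_option synthInstance.maxHeartbeats 400000 in
theorem differentiableAt_waveForm (hH : DifferentiableAt ℝ H y.1) (hφ : DifferentiableAt ℝ φ y.1)
    (hd : DifferentiableAt ℝ d y.2.1) : DifferentiableAt ℝ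
      (fun z : X × (ℝ × ℝ) => waveForm (H z.1) (φ z.1 * d z.2.1)) y := by
  have h2 : DifferentiableAt ℝ (fun z : X × (ℝ × ℝ) => φ z.1) y :=
    hφ.comp y (f := fun z : X × (ℝ × ℝ) => z.1) differentiableAt_fst
  have h3 : DifferentiableAt ℝ (fun z : X × (ℝ × ℝ) => d z.2.1) y :=
    hd.comp y (f := fun z : X × (ℝ × ℝ) => z.2.1) (by fun_prop)
  exact differentiableAt_pullback_add _ _ _
    (DifferentiableAt.fun_comp' (𝕜 := ℝ) (E := X × (ℝ × ℝ)) (g := H) (F := X)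
      (G := X →L[ℝ] X →L[ℝ] ℝ) (f := fun z : X × (ℝ × ℝ) => z.1) y hH differentiableAt_fst)
    (h2.fun_mul h3)

set_option synthInstance.maxHeartbeats 400000 in
theorem fderiv_waveForm (hH : DifferentiableAt ℝ H y.1) (hφ : DifferentiableAt ℝ φ y.1)
    (hd : DifferentiableAt ℝ d y.2.1) (c a b : X × (ℝ × ℝ)) :
    fderiv ℝ (fun z : X × (ℝ × ℝ) => waveForm (H z.1) (φ z.1 * d z.2.1)) y c a b =
      fderiv ℝ H y.1 c.1 a.1 b.1 + (fderiv ℝ φ y.1 c.1 * d y.2.1 +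
        φ y.1 * (deriv d y.2.1 * c.2.1)) * (a.2.1 * b.2.1) := by
  have h0 := (differentiableAt_waveForm hH hφ hd).hasFDerivAt
  have h1 := ((h0.clm_apply (hasFDerivAt_const a y)).clm_apply (hasFDerivAt_const b y))
  have hf : HasFDerivAt (fun z : X × (ℝ × ℝ) => z.1) (ContinuousLinearMap.fst ℝ X (ℝ × ℝ)) y :=
    hasFDerivAt_fst
  have hu : HasFDerivAt (fun z : X × (ℝ × ℝ) => z.2.1) ((ContinuousLinearMap.fst ℝ ℝ ℝ).comp
      (ContinuousLinearMap.snd ℝ X (ℝ × ℝ))) y :=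
    ((ContinuousLinearMap.fst ℝ ℝ ℝ).comp (ContinuousLinearMap.snd ℝ X (ℝ × ℝ))).hasFDerivAt
  have hHf : HasFDerivAt (fun z : X × (ℝ × ℝ) => H z.1)
      ((fderiv ℝ H y.1).comp (ContinuousLinearMap.fst ℝ X (ℝ × ℝ))) y :=
    HasFDerivAt.comp (𝕜 := ℝ) (E := X × (ℝ × ℝ)) (g := H) (F := X) (G := X →L[ℝ] X →L[ℝ] ℝ)
      (f := fun z : X × (ℝ × ℝ) => z.1) y hH.hasFDerivAt hf
  have h2 := ((hHf.clm_apply (hasFDerivAt_const a.1 y)).clm_apply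
    (hasFDerivAt_const b.1 y)).add (hasFDerivAt_const (a.2.1 * b.2.2 + a.2.2 * b.2.1) y)
  have h3 := h2.add (((hφ.hasFDerivAt.comp y hf).mul
    (hd.hasDerivAt.comp_hasFDerivAt y hu)).mul_const (a.2.1 * b.2.1))
  have h4 := h1.unique h3
  have h5 := DFunLike.congr_fun h4 c
  simp at h5
  rw [h5]
  ring

theorem christoffel_waveForm [FiniteDimensional ℝ X] (hH : DifferentiableAt ℝ H y.1)
    (hφ : DifferentiableAt ℝ φ y.1) (hd : DifferentiableAt ℝ d y.2.1)
    (hpos : ∀ a, a ≠ 0 → 0 < H y.1 a a) {g : X} (hg : ∀ a, H y.1 g a = fderiv ℝ φ y.1 a)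
    (a : X × (ℝ × ℝ)) :
    christoffel (fun z : X × (ℝ × ℝ) => waveForm (H z.1) (φ z.1 * d z.2.1)) y a a =
      (christoffel H y.1 a.1 a.1 - (1 / 2 * d y.2.1 * a.2.1 ^ 2) • g,
        (0, fderiv ℝ φ y.1 a.1 * d y.2.1 * a.2.1 + 1 / 2 * φ y.1 * deriv d y.2.1 * a.2.1 ^ 2)) := by
  obtain ⟨e, he⟩ := exists_equiv_of_nondegenerate (waveForm_nondegenerate hpos (φ y.1 * d y.2.1))
  obtain ⟨e₁, he₁⟩ := exists_equiv_of_nondegenerate (B := H y.1) fun a h => by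
    by_contra h0
    exact (hpos a h0).ne' (h a)
  refine (eq_christoffel (G := fun z : X × (ℝ × ℝ) => waveForm (H z.1) (φ z.1 * d z.2.1)) he
    fun c => ?_).symm
  rw [fderiv_waveForm hH hφ hd, fderiv_waveForm hH hφ hd, waveForm_apply]
  simp only [map_sub, map_smul, _root_.sub_apply, _root_.smul_apply, apply_christoffel he₁, hg,
    smul_eq_mul]
  ring

end WaveChristoffel

section CovAccel

theorem one_le_infty : (1 : ℕ∞ω) ≤ ∞ := by exact_mod_cast le_top

set_option linter.unusedSectionVars false

variable {E : Type u} [NormedAddCommGroup E] [NormedSpace ℝ E] [FiniteDimensional ℝ E]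
  {N : Type*} [TopologicalSpace N] [ChartedSpace E N] [IsManifold 𝓘(ℝ, E) ∞ N]
  [RiemannianBundle (fun x : N => TangentSpace 𝓘(ℝ, E) x)]
  [IsContMDiffRiemannianBundle 𝓘(ℝ, E) ∞ E (fun x : N => TangentSpace 𝓘(ℝ, E) x)]

theorem chartCoeff_inpwTensor_eventuallyEq (f : N → ℝ) (d : ℝ → ℝ) (p : N × (ℝ × ℝ))
    {y : E × (ℝ × ℝ)} (hy : y ∈ (extChartAt (inpwModel E) p).target) :
    chartCoeff (inpwModel E) p (inpwTensor f d) =ᶠ[𝓝 y] fun z => waveForm (metricCoeff p.1 z.1)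
      (f ((extChartAt 𝓘(ℝ, E) p.1).symm z.1) * d z.2.1) := by
  filter_upwards [(isOpen_extChartAt_target p).mem_nhds hy] with z hz
    using chartCoeff_inpwTensor f d p hz

theorem christoffel_congr {F : Type*} [NormedAddCommGroup F] [NormedSpace ℝ F]
    {G G' : F → F →L[ℝ] F →L[ℝ] ℝ} {y : F} (h : G =ᶠ[𝓝 y] G') (a b : F) :
    christoffel G y a b = christoffel G' y a b := by
  rw [christoffel, christoffel, h.fderiv_eq, h.eq_of_nhds]

theorem christoffel_inpwTensor {f : N → ℝ} (hf : ContMDiff 𝓘(ℝ, E) 𝓘(ℝ, ℝ) ∞ f) {d : ℝ → ℝ}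
    (hd : Differentiable ℝ d) (p : N × (ℝ × ℝ)) {y : E × (ℝ × ℝ)}
    (hy : y ∈ (extChartAt (inpwModel E) p).target) (a : E × (ℝ × ℝ)) :
    christoffel (chartCoeff (inpwModel E) p (inpwTensor f d)) y a a =
      (christoffel (metricCoeff p.1) y.1 a.1 a.1 -
          (1 / 2 * d y.2.1 * a.2.1 ^ 2) • chartGrad f p.1 y.1,
        (0, fderiv ℝ (fun z => f ((extChartAt 𝓘(ℝ, E) p.1).symm z)) y.1 a.1 * d y.2.1 * a.2.1 +
          1 / 2 * f ((extChartAt 𝓘(ℝ, E) p.1).symm y.1) * deriv d y.2.1 * a.2.1 ^ 2)) := by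
  have hy1 : y.1 ∈ (extChartAt 𝓘(ℝ, E) p.1).target := by
    rw [inpw_target] at hy; exact hy.1
  rw [christoffel_congr (chartCoeff_inpwTensor_eventuallyEq f d p hy)]
  exact christoffel_waveForm (φ := fun z => f ((extChartAt 𝓘(ℝ, E) p.1).symm z))
    ((contDiffAt_metricCoeff hy1).differentiableAt (by simp))
    ((contDiffAt_chart_function hf hy1).differentiableAt (by simp)) (hd _)
    (fun a ha => metricCoeff_pos hy1 ha) (metricCoeff_chartGrad f hy1) a

/-- Curves in `N × ℝ²` with smooth components. -/
theorem covAccel_inpwTensor {f : N → ℝ} (hf : ContMDiff 𝓘(ℝ, E) 𝓘(ℝ, ℝ) ∞ f) {d : ℝ → ℝ}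
    (hd : Differentiable ℝ d) {x : ℝ → N} {u v : ℝ → ℝ} {t : ℝ}
    (hx : ∀ᶠ s in 𝓝 t, ContMDiffAt 𝓘(ℝ, ℝ) 𝓘(ℝ, E) ∞ x s) (hu : ContDiffAt ℝ ∞ u t)
    (hv : ContDiffAt ℝ ∞ v t) {p : N × (ℝ × ℝ)} (hp : x t ∈ (extChartAt 𝓘(ℝ, E) p.1).source) :
    covAccel (inpwModel E) (inpwTensor f d) (fun s => (x s, (u s, v s))) p t =
      (chartAccel x p.1 t - (1 / 2 * d (u t) * deriv u t ^ 2) •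
          chartGrad f p.1 (extChartAt 𝓘(ℝ, E) p.1 (x t)),
        (deriv (deriv u) t, deriv (deriv v) t + (deriv (fun s => f (x s)) t * d (u t) * deriv u t +
          1 / 2 * f (x t) * deriv d (u t) * deriv u t ^ 2))) := by
  have hy := contDiffAt_chart hx.self_of_nhds hp
  have hY : (fun s => extChartAt (inpwModel E) p (x s, (u s, v s))) =
      fun s => (extChartAt 𝓘(ℝ, E) p.1 (x s), (u s, v s)) := by
    funext s; rw [inpw_chart]
  have hd1 : ∀ᶠ s in 𝓝 t, deriv (fun s => extChartAt (inpwModel E) p (x s, (u s, v s))) s =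
      (deriv (fun s => extChartAt 𝓘(ℝ, E) p.1 (x s)) s, (deriv u s, deriv v s)) := by
    rw [hY]
    filter_upwards [(hy.of_le one_le_infty).eventually (by simp),
      (hu.of_le one_le_infty).eventually (by simp), (hv.of_le one_le_infty).eventually (by simp)]
      with s h1 h2 h3
    exact ((h1.differentiableAt (by simp)).hasDerivAt.prodMk
      ((h2.differentiableAt (by simp)).hasDerivAt.prodMk
        (h3.differentiableAt (by simp)).hasDerivAt)).deriv
  have hd2 : iteratedDeriv 2 (fun s => extChartAt (inpwModel E) p (x s, (u s, v s))) t =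
      (deriv (deriv (fun s => extChartAt 𝓘(ℝ, E) p.1 (x s))) t,
        (deriv (deriv u) t, deriv (deriv v) t)) := by
    rw [iteratedDeriv_succ, iteratedDeriv_one, Filter.EventuallyEq.deriv_eq hd1]
    exact (((contDiffAt_deriv hy).differentiableAt (by simp)).hasDerivAt.prodMk
      (((contDiffAt_deriv hu).differentiableAt (by simp)).hasDerivAt.prodMk
        ((contDiffAt_deriv hv).differentiableAt (by simp)).hasDerivAt)).deriv
  have ht : extChartAt (inpwModel E) p (x t, (u t, v t)) ∈ (extChartAt (inpwModel E) p).target := by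
    rw [inpw_chart, inpw_target]
    exact ⟨(extChartAt 𝓘(ℝ, E) p.1).map_source hp, mem_univ _⟩
  have e1 : covAccel (inpwModel E) (inpwTensor f d) (fun s => (x s, (u s, v s))) p t =
    iteratedDeriv 2 (fun s => extChartAt (inpwModel E) p (x s, (u s, v s))) t +
      christoffel (chartCoeff (inpwModel E) p (inpwTensor f d))
        (extChartAt (inpwModel E) p (x t, (u t, v t)))
        (deriv (fun s => extChartAt (inpwModel E) p (x s, (u s, v s))) t)
        (deriv (fun s => extChartAt (inpwModel E) p (x s, (u s, v s))) t) := rfl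
  rw [e1, christoffel_inpwTensor hf hd p ht, hd2, hd1.self_of_nhds, inpw_chart]
  simp only [(extChartAt 𝓘(ℝ, E) p.1).left_inv hp]
  rw [(hasDerivAt_comp_chart hf hx.self_of_nhds hp).deriv]
  refine Prod.ext ?_ (Prod.ext ?_ rfl)
  · simp only [Prod.fst_add, chartAccel]
    abel
  · simp

end CovAccel

section Perturbation

variable {F : Type*} [NormedAddCommGroup F] [NormedSpace ℝ F]

set_option synthInstance.maxHeartbeats 400000 in
noncomputable instance bilinSeminormedAddCommGroup : SeminormedAddCommGroup (F →L[ℝ] F →L[ℝ] ℝ) :=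
  ContinuousLinearMap.toSeminormedAddCommGroup

set_option synthInstance.maxHeartbeats 400000 in
noncomputable instance bilinNormedAddCommGroup : NormedAddCommGroup (F →L[ℝ] F →L[ℝ] ℝ) :=
  ContinuousLinearMap.toNormedAddCommGroup

set_option synthInstance.maxHeartbeats 400000 in
noncomputable instance bilinNormedSpace : NormedSpace ℝ (F →L[ℝ] F →L[ℝ] ℝ) :=
  ContinuousLinearMap.toNormedSpace

theorem ModerateOn.sub {V : Type*} [NormedAddCommGroup V] [NormedSpace ℝ V] {U : Set F}
    (hU : IsOpen U) {w w' : ℝ → F → V}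
    (hs : ∀ ε ∈ Ioo (0 : ℝ) 1, ContDiffOn ℝ ∞ (w ε) U)
    (hs' : ∀ ε ∈ Ioo (0 : ℝ) 1, ContDiffOn ℝ ∞ (w' ε) U) (h : ModerateOn U w)
    (h' : ModerateOn U w') : ModerateOn U fun ε y => w ε y - w' ε y := by
  intro K hK hKc k
  have h1 : PolyBdd K fun ε y => ‖iteratedFDeriv ℝ k (w ε) y‖ := h K hK hKc k
  have h2 : PolyBdd K fun ε y => ‖iteratedFDeriv ℝ k (w' ε) y‖ := h' K hK hKc k
  refine (h1.add h2).le fun ε hε y hy => ?_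
  have e1 := ((hs ε hε).contDiffAt (hU.mem_nhds (hK hy))).of_le (m := k) (by exact_mod_cast le_top)
  have e2 := ((hs' ε hε).contDiffAt (hU.mem_nhds (hK hy))).of_le (m := k) (by exact_mod_cast le_top)
  have e3 := iteratedFDeriv_sub_apply e1 e2
  change ‖iteratedFDeriv ℝ k (w ε - w' ε) y‖ ≤ _
  rw [e3]
  exact norm_sub_le _ _

/-- The one-form whose metric dual is the value of the Christoffel symbols on `(a, a)`. -/
noncomputable def christoffelForm (D : F →L[ℝ] F →L[ℝ] F →L[ℝ] ℝ) (a : F) : F →L[ℝ] ℝ :=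
  (1 / 2 : ℝ) • (D a a + D a a - (D.flip a).flip a)

theorem norm_christoffelForm_le (D : F →L[ℝ] F →L[ℝ] F →L[ℝ] ℝ) (a : F) :
    ‖christoffelForm D a‖ ≤ 3 / 2 * ‖D‖ * ‖a‖ ^ 2 := by
  refine ContinuousLinearMap.opNorm_le_bound _ (by positivity) fun c => ?_
  have e1 : christoffelForm D a c = 1 / 2 * (D a a c + D a a c - D c a a) := rfl
  have h : ∀ a b c, ‖D a b c‖ ≤ ‖D‖ * ‖a‖ * ‖b‖ * ‖c‖ := fun a b c =>
    ((D a b).le_opNorm c).trans (by gcongr; exact D.le_opNorm₂ a b)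
  have h1 := h a a c
  have h2 := h c a a
  rw [e1, norm_mul]
  calc ‖(1 / 2 : ℝ)‖ * ‖D a a c + D a a c - D c a a‖
      ≤ 1 / 2 * (‖D a a c‖ + ‖D a a c‖ + ‖D c a a‖) := by
        rw [Real.norm_of_nonneg (by norm_num)]
        gcongr
        exact (norm_sub_le _ _).trans (add_le_add (norm_add_le _ _) le_rfl)
    _ ≤ _ := by nlinarith

theorem christoffelForm_sub (D D' : F →L[ℝ] F →L[ℝ] F →L[ℝ] ℝ) (a : F) :
    christoffelForm (D - D') a = christoffelForm D a - christoffelForm D' a := by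
  ext c
  have e1 : ∀ D : F →L[ℝ] F →L[ℝ] F →L[ℝ] ℝ,
    christoffelForm D a c = 1 / 2 * (D a a c + D a a c - D c a a) := fun _ => rfl
  rw [_root_.sub_apply, e1, e1, e1]
  simp only [_root_.sub_apply]
  ring

theorem norm_christoffel_sub_le [FiniteDimensional ℝ F] {G G₀ : F → F →L[ℝ] F →L[ℝ] ℝ} {y : F}
    (hG : DifferentiableAt ℝ G y) (hG₀ : DifferentiableAt ℝ G₀ y) {Q n : ℝ} (hQ : 0 ≤ Q)
    (hb : ∀ a, ‖a‖ ≤ Q * ‖G₀ y a‖) (h0 : ‖G y - G₀ y‖ ≤ n)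
    (h1 : ‖fderiv ℝ (fun z => G z - G₀ z) y‖ ≤ n) (hn : Q * n ≤ 1 / 2) (a : F) :
    ‖christoffel G y a a - christoffel G₀ y a a‖ ≤
      3 * Q * n * ‖a‖ ^ 2 * (1 + Q * ‖fderiv ℝ G₀ y‖) := by
  have hb' : ∀ a, ‖a‖ ≤ 2 * Q * ‖G y a‖ := fun a => by
    have h2 : ‖G₀ y a‖ ≤ ‖G y a‖ + n * ‖a‖ := by
      have : G₀ y a = G y a - (G y - G₀ y) a := by simp
      rw [this]
      exact (norm_sub_le _ _).trans
        (add_le_add le_rfl (((G y - G₀ y).le_opNorm a).trans (by gcongr)))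
    have h3 := hb a
    have h4 : Q * ‖G₀ y a‖ ≤ Q * ‖G y a‖ + 1 / 2 * ‖a‖ := by
      calc _ ≤ Q * (‖G y a‖ + n * ‖a‖) := by gcongr
        _ = Q * ‖G y a‖ + Q * n * ‖a‖ := by ring
        _ ≤ _ := by gcongr
    linarith
  obtain ⟨e, he⟩ := exists_equiv_of_nondegenerate (B := G y) fun a h => by
    have h2 : G y a = 0 := ContinuousLinearMap.ext h
    have := hb' a
    rw [h2, norm_zero, mul_zero] at this
    exact norm_le_zero_iff.1 this
  obtain ⟨e₀, he₀⟩ := exists_equiv_of_nondegenerate (B := G₀ y) fun a h => by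
    have h2 : G₀ y a = 0 := ContinuousLinearMap.ext h
    have := hb a
    rw [h2, norm_zero, mul_zero] at this
    exact norm_le_zero_iff.1 this
  have e1 : G y (christoffel G y a a) = christoffelForm (fderiv ℝ G y) a :=
    apply_inverse_of_equiv he _
  have e2 : G₀ y (christoffel G₀ y a a) = christoffelForm (fderiv ℝ G₀ y) a :=
    apply_inverse_of_equiv he₀ _
  set z := christoffel G y a a
  set z₀ := christoffel G₀ y a a
  have hz₀ : ‖z₀‖ ≤ Q * (3 / 2 * ‖fderiv ℝ G₀ y‖ * ‖a‖ ^ 2) :=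
    (hb z₀).trans (by rw [e2]; gcongr; exact norm_christoffelForm_le _ _)
  have hn0 : 0 ≤ n := (norm_nonneg _).trans h0
  have e3 : G y (z - z₀) = christoffelForm (fderiv ℝ (fun z => G z - G₀ z) y) a -
      (G y - G₀ y) z₀ := by
    rw [map_sub, e1, fderiv_fun_sub hG hG₀, christoffelForm_sub, _root_.sub_apply, e2]
    abel
  have h4 : ‖G y (z - z₀)‖ ≤ 3 / 2 * n * ‖a‖ ^ 2 + n * ‖z₀‖ := by
    rw [e3]
    refine (norm_sub_le _ _).trans (add_le_add ?_ ?_)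
    · exact (norm_christoffelForm_le _ _).trans (by gcongr)
    · exact ((G y - G₀ y).le_opNorm z₀).trans (by gcongr)
  calc ‖z - z₀‖ ≤ 2 * Q * ‖G y (z - z₀)‖ := hb' _
    _ ≤ 2 * Q * (3 / 2 * n * ‖a‖ ^ 2 + n * (Q * (3 / 2 * ‖fderiv ℝ G₀ y‖ * ‖a‖ ^ 2))) := by
        gcongr
        exact h4.trans (by gcongr)
    _ = _ := by ring

theorem div_pow_le_div_pow {C A ε : ℝ} {m M : ℕ} (hCA : C ≤ A) (hA : 0 ≤ A) (hmM : m ≤ M)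
    (hε : ε ∈ Ioc (0 : ℝ) 1) : C / ε ^ m ≤ A / ε ^ M := by
  have h0 := hε.1
  exact div_le_div₀ hA hCA (by positivity) (pow_le_pow_of_le_one h0.le hε.2 hmM)

set_option maxHeartbeats 2000000 in
theorem exists_christoffel_sub_le [FiniteDimensional ℝ F] {U : Set F} (hU : IsOpen U)
    {g g₀ : ℝ → F → F →L[ℝ] F →L[ℝ] ℝ}
    (hs : ∀ ε ∈ Ioo (0 : ℝ) 1, ContDiffOn ℝ ∞ (g ε) U)
    (hs₀ : ∀ ε ∈ Ioo (0 : ℝ) 1, ContDiffOn ℝ ∞ (g₀ ε) U) (hg : ModerateOn U g)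
    (hg₀ : ModerateOn U g₀) (hn : NegligibleOn U fun ε y => g ε y - g₀ ε y) {K : Set F}
    (hK : K ⊆ U) (hKc : IsCompact K) (hQ : ∃ (m : ℕ) (C ε₀ : ℝ), 0 < ε₀ ∧ ∀ ε ∈ Ioo 0 ε₀,
      ∀ y ∈ K, ∀ a, ‖a‖ ≤ C / ε ^ m * ‖g₀ ε y a‖) (m₂ : ℕ) (C₂ : ℝ) (m : ℕ) :
    ∃ C ε₀ : ℝ, 0 < ε₀ ∧ ∀ ε ∈ Ioo 0 ε₀, ∀ y ∈ K, ∀ a, ‖a‖ ≤ C₂ / ε ^ m₂ →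
      ‖christoffel (g ε) y a a - christoffel (g₀ ε) y a a‖ ≤ C * ε ^ m := by
  have hm : ModerateOn U fun ε y => g ε y - g₀ ε y :=
    ModerateOn.sub hU hs hs₀ hg hg₀
  have hn' := NegligibleOn.fderiv hU (fun ε hε => (hs ε hε).sub (hs₀ ε hε)) hm hn
  obtain ⟨m₁, C₁, ε₁, hε₁, h1⟩ := hQ
  obtain ⟨m₃, C₃, ε₃, hε₃, h3⟩ := hg₀ K hK hKc 1
  set A := 1 + |C₁| + |C₂| + |C₃| with hA
  have hA1 : 1 ≤ A := by have := abs_nonneg C₁; have := abs_nonneg C₂; have := abs_nonneg C₃; linarith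
  set k := m₁ + m₂ + m₃ with hk
  obtain ⟨C₄, ε₄, hε₄, h4⟩ := hn K hK hKc (5 * k + m + 1)
  obtain ⟨C₅, ε₅, hε₅, h5⟩ := hn' K hK hKc (5 * k + m + 1)
  set B := |C₄| + |C₅| with hB
  have hB0 : 0 ≤ B := by positivity
  refine ⟨6 * A ^ 5 * B, min (min (min ε₁ ε₃) (min ε₄ ε₅)) (min 1 (1 / (2 * A * (B + 1)))),
    by positivity, fun ε hε y hy a ha => ?_⟩
  obtain ⟨hε0, hlt⟩ := hε
  simp only [lt_min_iff] at hlt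
  obtain ⟨⟨⟨l1, l3⟩, l4, l5⟩, l6, l7⟩ := hlt
  have hε' : ε ∈ Ioc (0 : ℝ) 1 := ⟨hε0, l6.le⟩
  have hεo : ε ∈ Ioo (0 : ℝ) 1 := ⟨hε0, l6⟩
  have hyU := hU.mem_nhds (hK hy)
  set S := A / ε ^ k with hS
  have hS1 : 1 ≤ S := by
    rw [hS, le_div_iff₀ (by positivity), one_mul]
    exact (pow_le_one₀ hε0.le l6.le).trans hA1
  have q1 : C₁ / ε ^ m₁ ≤ S := div_pow_le_div_pow
    (by have := le_abs_self C₁; have := abs_nonneg C₂; have := abs_nonneg C₃; linarith)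
    (by linarith) (by omega) hε'
  have q2 : C₂ / ε ^ m₂ ≤ S := div_pow_le_div_pow
    (by have := le_abs_self C₂; have := abs_nonneg C₁; have := abs_nonneg C₃; linarith)
    (by linarith) (by omega) hε'
  have q3 : C₃ / ε ^ m₃ ≤ S := div_pow_le_div_pow
    (by have := le_abs_self C₃; have := abs_nonneg C₂; have := abs_nonneg C₁; linarith)
    (by linarith) (by omega) hε'
  set n := B * ε ^ (5 * k + m + 1) with hn_def
  have hn0 : 0 ≤ n := by positivity
  have n4 : ‖g ε y - g₀ ε y‖ ≤ n := (h4 ε ⟨hε0, l4⟩ y hy).trans (by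
    rw [hn_def]; gcongr; have := le_abs_self C₄; have := abs_nonneg C₅; linarith)
  have n5 : ‖fderiv ℝ (fun z => g ε z - g₀ ε z) y‖ ≤ n := (h5 ε ⟨hε0, l5⟩ y hy).trans (by
    rw [hn_def]; gcongr; have := le_abs_self C₅; have := abs_nonneg C₄; linarith)
  have hkε : ∀ j : ℕ, S ^ j * ε ^ (j * k) = A ^ j := fun j => by
    rw [hS, div_pow, ← pow_mul, mul_comm k j, div_mul_cancel₀ _ (by positivity)]
  have hSn5 : S ^ 5 * n = A ^ 5 * B * ε ^ (m + 1) := by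
    rw [← hkε 5, hn_def, show 5 * k + m + 1 = 5 * k + (m + 1) by ring, pow_add]; ring
  have hSn : S * n ≤ 1 / 2 := by
    have hε5 : ε ^ (5 * k + m + 1) ≤ ε ^ (k + 1) :=
      pow_le_pow_of_le_one hε0.le l6.le (by omega)
    have h6 : S * ε ^ (k + 1) = A * ε := by
      have := hkε 1
      rw [pow_one, pow_one, one_mul] at this
      rw [pow_succ, ← mul_assoc, this]
    calc S * n ≤ S * (B * ε ^ (k + 1)) := by rw [hn_def]; gcongr
      _ = B * (S * ε ^ (k + 1)) := by ring
      _ = B * A * ε := by rw [h6]; ring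
      _ ≤ (B + 1) * A * (1 / (2 * A * (B + 1))) := by gcongr; linarith
      _ = 1 / 2 := by field_simp
  have hD : ‖fderiv ℝ (g₀ ε) y‖ ≤ S := by
    have := h3 ε ⟨hε0, l3⟩ y hy
    rw [norm_iteratedFDeriv_one] at this
    exact this.trans q3
  have key := norm_christoffel_sub_le (G := g ε) (G₀ := g₀ ε) (y := y)
    (((hs ε hεo).contDiffAt hyU).differentiableAt (by simp))
    (((hs₀ ε hεo).contDiffAt hyU).differentiableAt (by simp)) (Q := S) (by linarith)
    (fun a => (h1 ε ⟨hε0, l1⟩ y hy a).trans (by gcongr)) n4 n5 hSn a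
  refine key.trans ?_
  have ha' : ‖a‖ ≤ S := ha.trans q2
  calc 3 * S * n * ‖a‖ ^ 2 * (1 + S * ‖fderiv ℝ (g₀ ε) y‖)
      ≤ 3 * S * n * S ^ 2 * (S ^ 2 + S * S) := by
        gcongr
        nlinarith
    _ = 6 * (S ^ 5 * n) := by ring
    _ = 6 * A ^ 5 * B * ε ^ (m + 1) := by rw [hSn5]; ring
    _ ≤ 6 * A ^ 5 * B * ε ^ m := by
        gcongr 6 * A ^ 5 * B * ?_
        exact pow_le_pow_of_le_one hε0.le l6.le (by omega)

end Perturbation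

section Representative

set_option linter.unusedSectionVars false

variable {E : Type u} [NormedAddCommGroup E] [NormedSpace ℝ E] [FiniteDimensional ℝ E]
  {N : Type*} [TopologicalSpace N] [ChartedSpace E N] [IsManifold 𝓘(ℝ, E) ∞ N]
  [RiemannianBundle (fun x : N => TangentSpace 𝓘(ℝ, E) x)]
  [IsContMDiffRiemannianBundle 𝓘(ℝ, E) ∞ E (fun x : N => TangentSpace 𝓘(ℝ, E) x)]

theorem exists_norm_le_chartCoeff_inpwNet (f : C^∞⟮𝓘(ℝ, E), N; ℝ⟯) (δ : ModNet ℝ (univ : Set ℝ))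
    (p : N × (ℝ × ℝ)) {K : Set (E × (ℝ × ℝ))} (hK : K ⊆ (extChartAt (inpwModel E) p).target)
    (hKc : IsCompact K) : ∃ (m : ℕ) (C ε₀ : ℝ), 0 < ε₀ ∧ ∀ ε ∈ Ioo 0 ε₀, ∀ y ∈ K, ∀ a,
      ‖a‖ ≤ C / ε ^ m * ‖chartCoeff (inpwModel E) p ((inpwNet f δ).1 ε) y a‖ := by
  have hK1 : Prod.fst '' K ⊆ (extChartAt 𝓘(ℝ, E) p.1).target := by
    rintro _ ⟨y, hy, rfl⟩
    have := hK hy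
    rw [inpw_target] at this
    exact this.1
  obtain ⟨c, hc, _, _, hb⟩ := exists_metricCoeff_bounds (hKc.image continuous_fst) hK1
  have hfc : ContinuousOn (fun y : E × (ℝ × ℝ) => f ((extChartAt 𝓘(ℝ, E) p.1).symm y.1)) K :=
    f.contMDiff.continuous.comp_continuousOn ((continuousOn_extChartAt_symm p.1).comp
      continuousOn_fst fun y hy => hK1 (mem_image_of_mem _ hy))
  obtain ⟨A, hA⟩ := hKc.bddAbove_image hfc.norm
  obtain ⟨m, C, ε₀, hε₀, hδ⟩ := δ.2.2 ((fun y : E × (ℝ × ℝ) => y.2.1) '' K) (subset_univ _)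
    (hKc.image (by fun_prop)) 0
  refine ⟨m, c⁻¹ + 1 + |A| * |C|, min ε₀ 1, by positivity, fun ε hε y hy a => ?_⟩
  have hε0 : 0 < ε := hε.1
  have hε1 : ε ≤ 1 := (hε.2.trans_le (min_le_right _ _)).le
  have e1 : chartCoeff (inpwModel E) p ((inpwNet f δ).1 ε) y = _ :=
    chartCoeff_inpwTensor f (δ.1 ε) p (hK hy)
  rw [e1]
  refine (norm_le_waveForm hc (fun a => (hb y.1 (mem_image_of_mem _ hy) a).1)
    (f ((extChartAt 𝓘(ℝ, E) p.1).symm y.1) * δ.1 ε y.2.1) a).trans ?_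
  gcongr
  have h1 : |f ((extChartAt 𝓘(ℝ, E) p.1).symm y.1)| ≤ |A| :=
    (hA (mem_image_of_mem _ hy)).trans (le_abs_self _)
  have h2 := hδ ε ⟨hε.1, hε.2.trans_le (min_le_left _ _)⟩ y.2.1 (mem_image_of_mem _ hy)
  rw [norm_iteratedFDeriv_zero, Real.norm_eq_abs] at h2
  have h3 : C / ε ^ m ≤ |C| / ε ^ m := by gcongr; exact le_abs_self _
  have h4 : ε ^ m ≤ 1 := pow_le_one₀ hε0.le hε1
  have h5 : 0 < ε ^ m := by positivity
  rw [le_div_iff₀ h5, abs_mul]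
  have h6 : |δ.1 ε y.2.1| * ε ^ m ≤ |C| := by
    rw [← le_div_iff₀ h5]; exact h2.trans h3
  have h7 : 0 < c⁻¹ := by positivity
  calc _ = (c⁻¹ + 1) * ε ^ m + |f ((extChartAt 𝓘(ℝ, E) p.1).symm y.1)| *
        (|δ.1 ε y.2.1| * ε ^ m) := by ring
    _ ≤ (c⁻¹ + 1) * 1 + |A| * |C| := by gcongr
    _ = _ := by ring

theorem exists_christoffel_inpwNet_sub_le (f : C^∞⟮𝓘(ℝ, E), N; ℝ⟯) (δ : ModNet ℝ (univ : Set ℝ))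
    {G : ModTensor (inpwModel E) (N × (ℝ × ℝ))} (hG : G ≈ inpwNet f δ)
    (p : N × (ℝ × ℝ)) {K : Set (E × (ℝ × ℝ))} (hK : K ⊆ (extChartAt (inpwModel E) p).target)
    (hKc : IsCompact K) (m₂ : ℕ) (C₂ : ℝ) (m : ℕ) : ∃ C ε₀ : ℝ, 0 < ε₀ ∧ ∀ ε ∈ Ioo 0 ε₀,
      ∀ y ∈ K, ∀ a, ‖a‖ ≤ C₂ / ε ^ m₂ →
      ‖christoffel (chartCoeff (inpwModel E) p (G.1 ε)) y a a -
        christoffel (chartCoeff (inpwModel E) p ((inpwNet f δ).1 ε)) y a a‖ ≤ C * ε ^ m := by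
  exact exists_christoffel_sub_le (isOpen_extChartAt_target p)
    (fun ε hε => (G.2 p).1.contDiffOn ⟨hε.1, hε.2.le⟩)
    (fun ε hε => ((inpwNet f δ).2 p).1.contDiffOn ⟨hε.1, hε.2.le⟩)
    (G.2 p).2 ((inpwNet f δ).2 p).2 (hG p) hK hKc
    (exists_norm_le_chartCoeff_inpwNet f δ p hK hKc) m₂ C₂ m

end Representative

open MeasureTheory in
theorem integral_abs_comp_affine_le {d : ℝ → ℝ} {C : ℝ} (hd : Continuous d)
    (hdc : HasCompactSupport d) (hC : ∫ s, |d s| ≤ C) (u₀ u₁ t₀ a b : ℝ) (hab : a ≤ b) :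
    ∫ t in a..b, |1 / 2 * d (u₀ + u₁ * (t - t₀)) * u₁ ^ 2| ≤ 1 / 2 * C * |u₁| := by
  by_cases h1 : u₁ = 0
  · simp [h1]
  have hint : Integrable fun s => |d s| := (hd.integrable_of_hasCompactSupport hdc).abs
  have e1 : ∀ t, |1 / 2 * d (u₀ + u₁ * (t - t₀)) * u₁ ^ 2| =
      (1 / 2 * u₁ ^ 2) * |d (u₁ * t + (u₀ - u₁ * t₀))| := fun t => by
    rw [abs_mul, abs_mul, abs_of_nonneg (sq_nonneg u₁), abs_of_pos (by norm_num : (0:ℝ) < 1 / 2)]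
    ring_nf
  have hint2 : Integrable fun t => |d (u₁ * t + (u₀ - u₁ * t₀))| :=
    (hint.comp_add_right (u₀ - u₁ * t₀)).comp_mul_left' h1
  simp_rw [e1]
  rw [intervalIntegral.integral_const_mul, intervalIntegral.integral_of_le hab]
  have h2 : ∫ t in Ioc a b, |d (u₁ * t + (u₀ - u₁ * t₀))| ≤ ∫ t, |d (u₁ * t + (u₀ - u₁ * t₀))| :=
    setIntegral_le_integral hint2 (Eventually.of_forall fun t => abs_nonneg _)
  have h3 : ∫ t, |d (u₁ * t + (u₀ - u₁ * t₀))| = |u₁⁻¹| * ∫ s, |d s| := by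
    rw [Measure.integral_comp_mul_left (fun s => |d (s + (u₀ - u₁ * t₀))|) u₁,
      integral_add_right_eq_self (fun s => |d s|), smul_eq_mul]
  have h4 : 0 < |u₁| := abs_pos.2 h1
  calc 1 / 2 * u₁ ^ 2 * ∫ t in Ioc a b, |d (u₁ * t + (u₀ - u₁ * t₀))|
      ≤ 1 / 2 * u₁ ^ 2 * (|u₁⁻¹| * C) := by
        gcongr
        rw [h3] at h2
        exact h2.trans (by gcongr)
    _ = 1 / 2 * C * |u₁| := by
        rw [abs_inv, ← sq_abs]
        field_simp

theorem exists_clamp (s t α β : ℝ) (hαβ : α ≤ β) : ∃ p ∈ uIcc s t, ∃ q ∈ uIcc s t,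
    |q - p| ≤ β - α ∧ (p = s ∨ ∀ r ∈ uIcc s p, r ∉ Ioo α β) ∧
      (q = t ∨ ∀ r ∈ uIcc q t, r ∉ Ioo α β) := by
  wlog h : s ≤ t generalizing s t α β
  · obtain ⟨p, hp, q, hq, h1, h2, h3⟩ := this (-s) (-t) (-β) (-α) (by linarith) (by linarith)
    have key : ∀ {a b r : ℝ}, r ∈ uIcc a b → -r ∈ uIcc (-a) (-b) := fun {a b r} hr => by
      rcases mem_uIcc.1 hr with h | h
      · exact mem_uIcc.2 (Or.inr ⟨by linarith, by linarith⟩)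
      · exact mem_uIcc.2 (Or.inl ⟨by linarith, by linarith⟩)
    refine ⟨-p, by simpa using key hp, -q, by simpa using key hq, ?_, h2.imp (by grind)
      fun h2 r hr hr' => ?_, h3.imp (by grind) fun h3 r hr hr' => ?_⟩
    · rw [show -q - -p = -(q - p) by ring, abs_neg]
      linarith
    · exact h2 (-r) (by simpa using key hr) ⟨by linarith [hr'.2], by linarith [hr'.1]⟩
    · exact h3 (-r) (by simpa using key hr) ⟨by linarith [hr'.2], by linarith [hr'.1]⟩
  · refine ⟨max s (min t α), ?_, max s (min t β), ?_, ?_, ?_, ?_⟩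
    · rw [uIcc_of_le h]; exact ⟨le_max_left _ _, max_le h (min_le_left _ _)⟩
    · rw [uIcc_of_le h]; exact ⟨le_max_left _ _, max_le h (min_le_left _ _)⟩
    · grind
    · by_cases hα : α ≤ s
      · left; grind
      · right
        rw [uIcc_of_le (le_max_left _ _)]
        grind
    · by_cases hβ : t ≤ β
      · left; grind
      · right
        rw [uIcc_of_le (by grind)]
        grind

section Step

set_option linter.unusedSectionVars false

variable {E : Type u} [NormedAddCommGroup E] [NormedSpace ℝ E] [FiniteDimensional ℝ E]
  {N : Type*} [MetricSpace N] [ChartedSpace E N] [IsManifold 𝓘(ℝ, E) ∞ N]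
  [RiemannianBundle (fun x : N => TangentSpace 𝓘(ℝ, E) x)]
  [IsContMDiffRiemannianBundle 𝓘(ℝ, E) ∞ E (fun x : N => TangentSpace 𝓘(ℝ, E) x)]
  [IsRiemannianManifold 𝓘(ℝ, E) N]

/-- The curve `x` has acceleration `κ grad F`. -/
def ForcedGeodesic (E : Type u) [NormedAddCommGroup E] [NormedSpace ℝ E]
    {N : Type*} [TopologicalSpace N] [ChartedSpace E N]
    [RiemannianBundle (fun x : N => TangentSpace 𝓘(ℝ, E) x)] (κ : ℝ → ℝ) (F : N → ℝ)
    (x : ℝ → N) : Prop :=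
  ∀ t, ContMDiffAt 𝓘(ℝ, ℝ) 𝓘(ℝ, E) ∞ x t ∧ ∀ p, x t ∈ (extChartAt 𝓘(ℝ, E) p).source →
    chartAccel x p t = κ t • chartGrad F p (extChartAt 𝓘(ℝ, E) p (x t))

theorem ForcedGeodesic.bound_step {κ : ℝ → ℝ} {F : N → ℝ} {x : ℝ → N}
    (hx : ForcedGeodesic E κ F x) (hκ : Continuous κ) {x₀ : N} {R B : ℝ} (hB : 0 ≤ B)
    (hF : GradBound E F (Metric.closedBall x₀ R) B) {s s' k S : ℝ} (hk0 : 0 ≤ k)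
    (hk : ∫ r in min s s'..max s s', |κ r| ≤ k) (hS : √(speedSq E x s) ≤ S)
    (hd : dist (x s) x₀ + (S + B * k) * |s' - s| < R) :
    ∀ t ∈ uIcc s s', dist (x t) x₀ ≤ dist (x s) x₀ + (S + B * k) * |s' - s| ∧
      √(speedSq E x t) ≤ S + B * k := by
  have hS0 : 0 ≤ S := (Real.sqrt_nonneg _).trans hS
  have hxc : Continuous x := continuous_iff_continuousAt.2 fun t => (hx t).1.continuousAt
  have key : ∀ t ∈ uIcc s s', (∀ r ∈ uIcc s t, dist (x r) x₀ ≤ R) →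
      ∀ r ∈ uIcc s t, dist (x r) x₀ ≤ dist (x s) x₀ + (S + B * k) * |s' - s| ∧
        √(speedSq E x r) ≤ S + B * k := by
    intro t ht hR r hr
    have hsub : Icc (min s t) (max s t) ⊆ Icc (min s s') (max s s') :=
      Set.uIcc_subset_uIcc left_mem_uIcc ht
    have hspeed : ∀ r ∈ uIcc s t, √(speedSq E x r) ≤ S + B * k := by
      intro r hr
      have h1 := sqrt_le_sqrt_add_integral (a := min s t) (b := max s t) (e := speedSq E x)
        (e' := deriv (speedSq E x)) (k := fun r => B * |κ r|) (by fun_prop)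
        (fun r => by positivity) (fun r hr => ?_) (fun r _ => speedSq_nonneg x r)
        (fun r hr => ?_) (s := s) (t := r) left_mem_uIcc hr
      · refine h1.trans (add_le_add hS ?_)
        rw [intervalIntegral.integral_const_mul]
        gcongr
        refine le_trans ?_ hk
        refine intervalIntegral.integral_mono_interval (hsub (left_mem_Icc.2 min_le_max)).1
          min_le_max (hsub (right_mem_Icc.2 min_le_max)).2
          (Eventually.of_forall fun r => abs_nonneg _) (by
            exact (hκ.abs).intervalIntegrable _ _)
      all_goals
        have hp := mem_extChartAt_source (I := 𝓘(ℝ, E)) (x r)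
        have h2 := abs_deriv_speedSq_le (Eventually.of_forall fun s => (hx s).1) hp (hR r hr) hF
          (e := 0) (η := 0) (by rw [add_zero]; exact (hx r).2 _ hp) (by simp)
      · exact h2.1
      · rw [add_zero] at h2; exact h2.2
    refine ⟨?_, hspeed r hr⟩
    have h1 := dist_le_mul_dist_of_speed_le (E := E) (J := uIcc s t) ordConnected_uIcc
      (fun r _ => (hx r).1) hspeed r hr s left_mem_uIcc
    have h2 : dist r s ≤ |s' - s| := by
      rw [Real.dist_eq]
      exact abs_sub_left_of_mem_uIcc (hsub hr)
    calc dist (x r) x₀ ≤ dist (x s) x₀ + dist (x r) (x s) := by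
          rw [add_comm]; exact dist_triangle _ _ _
      _ ≤ dist (x s) x₀ + (S + B * k) * |s' - s| := by
          gcongr
          exact h1.trans (by gcongr)
  suffices hR : ∀ t ∈ uIcc s s', dist (x t) x₀ ≤ R from
    fun t ht => key s' right_mem_uIcc hR t ht
  by_contra! hcon
  obtain ⟨t, ht, htR⟩ := hcon
  let φ : ℝ → ℝ := fun τ => s + τ * (t - s)
  have hφc : Continuous φ := by fun_prop
  have hφm : ∀ τ ∈ Icc (0 : ℝ) 1, φ τ ∈ uIcc s t := fun τ hτ => by
    have := hτ.1; have := hτ.2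
    rcases le_total s t with h | h
    · rw [uIcc_of_le h]; constructor <;> simp only [φ] <;> nlinarith
    · rw [uIcc_of_ge h]; constructor <;> simp only [φ] <;> nlinarith
  have hcpt : IsCompact {τ ∈ Icc (0 : ℝ) 1 | R ≤ dist (x (φ τ)) x₀} := isCompact_Icc.inter_right
    (isClosed_le continuous_const ((hxc.comp hφc).dist continuous_const))
  obtain ⟨τ, ⟨hτ, hτR⟩, hmin⟩ := hcpt.exists_isLeast ⟨1, ⟨by simp, by simp [φ, htR.le]⟩⟩
  have hτt : φ τ ∈ uIcc s s' := uIcc_subset_uIcc left_mem_uIcc ht (hφm τ hτ)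
  have hlt : ∀ σ ∈ Ico (0 : ℝ) τ, dist (x (φ σ)) x₀ < R := fun σ hσ => by
    by_contra! h
    exact (hmin ⟨⟨hσ.1, hσ.2.le.trans hτ.2⟩, h⟩).not_gt hσ.2
  have hφ0 : φ 0 = s := by simp [φ]
  have hR0 : dist (x s) x₀ < R := by
    have : 0 ≤ (S + B * k) * |s' - s| := by positivity
    linarith
  have hτ0 : 0 < τ := lt_of_le_of_ne hτ.1 fun h => by
    rw [← h, hφ0] at hτR; linarith
  have hτle : dist (x (φ τ)) x₀ ≤ R := by
    have hmem : τ ∈ closure (Ico 0 τ) := by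
      rw [closure_Ico hτ0.ne]; exact right_mem_Icc.2 hτ0.le
    exact closure_minimal (s := Ico 0 τ) (t := {σ | dist (x (φ σ)) x₀ ≤ R})
      (fun σ hσ => (hlt σ hσ).le)
      (isClosed_le ((hxc.comp hφc).dist continuous_const) continuous_const) hmem
  have hall : ∀ r ∈ uIcc s (φ τ), dist (x r) x₀ ≤ R := by
    intro r hr
    rcases eq_or_ne t s with h | h
    · have : φ τ = s := by simp [φ, h]
      rw [this, uIcc_self] at hr
      rw [hr]; exact hR0.le
    · have hts : t - s ≠ 0 := sub_ne_zero.2 h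
      have e : φ ((r - s) / (t - s)) = r := by simp only [φ]; field_simp; ring
      have h1 : (r - s) / (t - s) ∈ Icc 0 τ := by
        rcases lt_or_gt_of_ne hts with h2 | h2
        · have h3 : φ τ ≤ s := by simp only [φ]; nlinarith
          rw [uIcc_of_ge h3] at hr
          refine ⟨div_nonneg_of_nonpos (by linarith [hr.2]) h2.le, ?_⟩
          rw [div_le_iff_of_neg h2]
          have := hr.1
          simp only [φ] at this
          linarith
        · have h3 : s ≤ φ τ := by simp only [φ]; nlinarith
          rw [uIcc_of_le h3] at hr
          refine ⟨div_nonneg (by linarith [hr.1]) h2.le, ?_⟩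
          rw [div_le_iff₀ h2]
          have := hr.2
          simp only [φ] at this
          linarith
      rw [← e]
      rcases h1.2.eq_or_lt with h4 | h4
      · rw [h4]; exact hτle
      · exact (hlt _ ⟨h1.1, h4⟩).le
  have := (key (φ τ) hτt hall (φ τ) right_mem_uIcc).1
  linarith

theorem exists_forcedGeodesic_bound [CompleteSpace N] {f : N → ℝ}
    (hf : ContMDiff 𝓘(ℝ, E) 𝓘(ℝ, ℝ) ∞ f) (x₀ : N) {C V R₀ S₀ T : ℝ} (hC : 0 ≤ C) (hV : 0 ≤ V)
    (hS₀ : 0 ≤ S₀) (hT : 0 ≤ T) : ∃ R S ε₁ : ℝ, 0 < ε₁ ∧ ∀ ε ∈ Ioo 0 ε₁, ∀ d : ℝ → ℝ,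
      Continuous d → tsupport d ⊆ Ioo (-ε) ε → ∫ s, |d s| ≤ C → ∀ u₀ u₁ t₀ : ℝ, |u₁| ≤ V →
      ∀ (F : N → ℝ) (x : ℝ → N), (∀ y ∈ Metric.closedBall x₀ R, F =ᶠ[𝓝 y] f) →
      ForcedGeodesic E (fun t => 1 / 2 * d (u₀ + u₁ * (t - t₀)) * u₁ ^ 2) F x →
      dist (x t₀) x₀ ≤ R₀ → √(speedSq E x t₀) ≤ S₀ →
      ∀ t, |t - t₀| ≤ T → dist (x t) x₀ ≤ R ∧ √(speedSq E x t) ≤ S := by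
  have := properSpace_of_completeSpace E (N := N)
  obtain ⟨B₁, hB₁, h1⟩ := exists_gradBound hf (isCompact_closedBall x₀ (R₀ + (S₀ + 1) * T + 1))
  set η : ℝ := 1 / (B₁ * C + 1) with hη
  have hη0 : 0 < η := by positivity
  have hη1 : B₁ * (1 / 2 * C * η) ≤ 1 := by
    rw [hη, ← mul_assoc, mul_one_div, div_le_one (by positivity)]
    nlinarith [mul_nonneg hB₁ hC]
  obtain ⟨B₂, hB₂, h2⟩ := exists_gradBound hf (isCompact_closedBall x₀ (R₀ + S₀ * T + 2))
  set S₂ := S₀ + B₂ * (1 / 2 * C * V) with hS₂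
  have hS₂0 : 0 ≤ S₂ := by positivity
  obtain ⟨B₃, hB₃, h3⟩ := exists_gradBound hf
    (isCompact_closedBall x₀ (R₀ + S₀ * T + 2 + S₂ * T + 1))
  refine ⟨max (R₀ + (S₀ + 1) * T + 1) (R₀ + S₀ * T + 2 + S₂ * T + 1), max (S₀ + 1) S₂,
    η / (2 * S₂ + 1), by positivity, fun ε hε d hd hds hdC u₀ u₁ t₀ hu₁ F x hFf hx hx0 hs0 t ht => ?_⟩
  have hε0 := hε.1
  have hdc : HasCompactSupport d := HasCompactSupport.of_support_subset_isCompact isCompact_Icc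
    ((subset_tsupport d).trans (hds.trans Ioo_subset_Icc_self))
  have hF : ∀ {R B}, R ≤ max (R₀ + (S₀ + 1) * T + 1) (R₀ + S₀ * T + 2 + S₂ * T + 1) →
      GradBound E f (Metric.closedBall x₀ R) B → GradBound E F (Metric.closedBall x₀ R) B :=
    fun hR h => h.congr fun y hy => hFf y (Metric.closedBall_subset_closedBall hR hy)
  have hint := fun a b hab => integral_abs_comp_affine_le hd hdc hdC u₀ u₁ t₀ a b hab
  set κ : ℝ → ℝ := fun t => 1 / 2 * d (u₀ + u₁ * (t - t₀)) * u₁ ^ 2 with hκ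
  have hκc : Continuous κ := by fun_prop
  have hmm : ∀ a b : ℝ, min a b ≤ max a b := fun a b => min_le_max
  rcases le_total |u₁| η with hu | hu
  · have hk : 1 / 2 * C * |u₁| ≤ 1 / 2 * C * η := by gcongr
    have h4 : B₁ * (1 / 2 * C * |u₁|) ≤ 1 := (by gcongr : _ ≤ _).trans hη1
    have hd1 : dist (x t₀) x₀ + (S₀ + B₁ * (1 / 2 * C * |u₁|)) * |t - t₀| ≤
        R₀ + (S₀ + 1) * T := by gcongr
    have h5 := hx.bound_step hκc hB₁ (hF (le_max_left _ _) h1) (s := t₀) (s' := t)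
      (k := 1 / 2 * C * |u₁|) (by positivity) (hint _ _ (hmm _ _)) hs0 (by linarith)
      t right_mem_uIcc
    exact ⟨le_max_of_le_left (by linarith [h5.1]), le_max_of_le_left (by linarith [h5.2])⟩
  · have hu0 : 0 < |u₁| := hη0.trans_le hu
    have hu0' : u₁ ≠ 0 := abs_pos.1 hu0
    set w := ε / |u₁| with hw
    set τ := t₀ - u₀ / u₁ with hτ
    have hκ0 : ∀ r, r ∉ Ioo (τ - w) (τ + w) → κ r = 0 := by
      intro r hr
      by_contra hne
      refine hr ?_
      have h4 : d (u₀ + u₁ * (r - t₀)) ≠ 0 := fun h => hne (by simp [hκ, h])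
      have h5 := hds (subset_tsupport d h4)
      have h6 : u₀ + u₁ * (r - t₀) = u₁ * (r - τ) := by rw [hτ]; field_simp; ring
      rw [h6, mem_Ioo, ← abs_lt, abs_mul] at h5
      have h7 : |r - τ| < w := by rw [hw, lt_div_iff₀ hu0]; linarith
      rw [abs_lt] at h7
      exact ⟨by linarith, by linarith⟩
    have hw0 : 0 < w := by positivity
    obtain ⟨p, hp, q, hq, hpq, hp1, hq1⟩ := exists_clamp t₀ t (τ - w) (τ + w) (by linarith)
    have hzero : ∀ a b : ℝ, (∀ r ∈ uIcc a b, κ r = 0) → ∫ r in min a b..max a b, |κ r| = 0 := by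
      intro a b hab
      rw [intervalIntegral.integral_congr (g := fun _ => (0 : ℝ)) fun r hr => ?_]
      · simp
      · rw [uIcc_of_le (hmm _ _)] at hr
        simp [hab r hr]
    have hI1 : ∫ r in min t₀ p..max t₀ p, |κ r| = 0 := by
      rcases hp1 with rfl | hp1
      · simp
      · exact hzero _ _ fun r hr => hκ0 r (hp1 r hr)
    have hI3 : ∫ r in min q t..max q t, |κ r| = 0 := by
      rcases hq1 with rfl | hq1
      · simp
      · exact hzero _ _ fun r hr => hκ0 r (hq1 r hr)
    have hpT : |p - t₀| ≤ T := (abs_sub_left_of_mem_uIcc hp).trans ht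
    have hqT : |t - q| ≤ T := (abs_sub_right_of_mem_uIcc hq).trans ht
    have hsm : S₂ * |q - p| < 1 := by
      have h4 : |q - p| ≤ 2 * (ε / η) := by
        refine hpq.trans ?_
        have : w ≤ ε / η := by rw [hw]; gcongr
        linarith
      have h5 : ε / η < 1 / (2 * S₂ + 1) := by
        rw [div_lt_iff₀ hη0, div_mul_eq_mul_div, one_mul]; exact hε.2
      rw [lt_div_iff₀ (by positivity)] at h5
      have h6 : 0 < ε / η := by positivity
      calc S₂ * |q - p| ≤ S₂ * (2 * (ε / η)) := by gcongr
        _ < 1 := by nlinarith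
    have hd1 : dist (x t₀) x₀ + (S₀ + B₂ * 0) * |p - t₀| ≤ R₀ + S₀ * T := by
      rw [mul_zero, add_zero]; gcongr
    have a1 := hx.bound_step hκc hB₂ (hF (le_max_of_le_right (by nlinarith)) h2) (s := t₀) (s' := p)
      (k := 0) le_rfl hI1.le hs0 (by linarith) p right_mem_uIcc
    rw [mul_zero, add_zero] at a1 hd1
    have hk : 1 / 2 * C * |u₁| ≤ 1 / 2 * C * V := by gcongr
    have a2 := hx.bound_step hκc hB₂ (hF (le_max_of_le_right (by nlinarith)) h2) (s := p) (s' := q)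
      (k := 1 / 2 * C * V) (by positivity) ((hint _ _ (hmm _ _)).trans hk) a1.2
      (by rw [← hS₂]; linarith [a1.1]) q right_mem_uIcc
    rw [← hS₂] at a2
    have hd3 : (S₂ + B₃ * 0) * |t - q| ≤ S₂ * T := by rw [mul_zero, add_zero]; gcongr
    have a3 := hx.bound_step hκc hB₃ (hF (le_max_right _ _) h3) (s := q) (s' := t)
      (k := 0) le_rfl hI3.le a2.2 (by linarith [a1.1, a2.1]) t right_mem_uIcc
    rw [mul_zero, add_zero] at a3 hd3
    exact ⟨le_max_of_le_right (by linarith [a1.1, a2.1, a3.1]), le_max_of_le_right a3.2⟩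

end Step

theorem exists_le_of_fintype {ι : Type*} [Finite ι] (b : ι → ℝ) : ∃ B ≥ 0, ∀ i, b i ≤ B := by
  obtain ⟨B, hB⟩ := (Set.finite_range b).bddAbove
  exact ⟨max B 0, le_max_right _ _, fun i => le_max_of_le_left (hB (mem_range_self i))⟩

theorem exists_pos_le_of_fintype {ι : Type*} [Finite ι] {e : ι → ℝ} (he : ∀ i, 0 < e i) :
    ∃ ε₀ > 0, ∀ i, ε₀ ≤ e i := by
  have := (eventually_all (l := 𝓝[>] (0 : ℝ)) (p := fun i r => r ≤ e i)).2 fun i => by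
    filter_upwards [Ioo_mem_nhdsGT (he i)] with r hr using hr.2.le
  obtain ⟨r, hr, hr0⟩ := (this.and self_mem_nhdsWithin).exists
  exact ⟨r, hr0, hr⟩

theorem exists_norm_le_sum_dual (V : Type*) [NormedAddCommGroup V] [NormedSpace ℝ V]
    [FiniteDimensional ℝ V] : ∃ (n : ℕ) (l : Fin n → V →L[ℝ] ℝ) (A : ℝ), 0 ≤ A ∧
      ∀ v, ‖v‖ ≤ A * ∑ j, |l j v| := by
  let e := ((Module.finBasis ℝ V).equivFun).toContinuousLinearEquiv
  refine ⟨_, fun j => (ContinuousLinearMap.proj (R := ℝ) (φ := fun _ => ℝ) j).comp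
    (e : V →L[ℝ] (Fin (Module.finrank ℝ V) → ℝ)), ‖(e.symm : (Fin (Module.finrank ℝ V) → ℝ) →L[ℝ] V)‖,
    norm_nonneg _, fun v => ?_⟩
  have h1 := (e.symm : (Fin (Module.finrank ℝ V) → ℝ) →L[ℝ] V).le_opNorm (e v)
  have h2 : (e.symm : (Fin (Module.finrank ℝ V) → ℝ) →L[ℝ] V) (e v) = v := e.symm_apply_apply v
  rw [h2] at h1
  refine h1.trans ?_
  gcongr
  rw [pi_norm_le_iff_of_nonneg (Finset.sum_nonneg fun j _ => abs_nonneg _)]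
  intro j
  exact Finset.single_le_sum (f := fun j => |e v j|) (fun j _ => abs_nonneg _) (Finset.mem_univ j)

theorem exists_abs_deriv_le_of_negligibleOn_sub {J : Set ℝ} (hJ : IsOpen J) {w w' : ℝ → ℝ → ℝ}
    (hs : ∀ ε ∈ Ioo (0 : ℝ) 1, ContDiffOn ℝ ∞ (w ε) J)
    (hs' : ∀ ε ∈ Ioo (0 : ℝ) 1, ContDiffOn ℝ ∞ (w' ε) J) (hm : ModerateOn J w)
    (hm' : ModerateOn J w') (hn : NegligibleOn J fun ε t => w ε t - w' ε t) {t₀ : ℝ} (ht₀ : t₀ ∈ J)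
    (h : ∃ C ε₀ : ℝ, 0 < ε₀ ∧ ∀ ε ∈ Ioo 0 ε₀, |deriv (w ε) t₀| ≤ C) :
    ∃ C ε₀ : ℝ, 0 < ε₀ ∧ ∀ ε ∈ Ioo 0 ε₀, |deriv (w' ε) t₀| ≤ C := by
  obtain ⟨C, ε₀, hε₀, h⟩ := h
  have hn' := NegligibleOn.fderiv hJ (fun ε hε => (hs ε hε).sub (hs' ε hε))
    (ModerateOn.sub hJ hs hs' hm hm') hn
  obtain ⟨C', ε₁, hε₁, h'⟩ := hn' {t₀} (by simpa using ht₀) isCompact_singleton 0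
  refine ⟨C + C', min 1 (min ε₀ ε₁), by positivity, fun ε hε => ?_⟩
  obtain ⟨hε0, hlt⟩ := hε
  simp only [lt_min_iff] at hlt
  have a1 := h ε ⟨hε0, hlt.2.1⟩
  have a2 := h' ε ⟨hε0, hlt.2.2⟩ t₀ rfl
  have hd : DifferentiableAt ℝ (w ε) t₀ :=
    ((hs ε ⟨hε0, hlt.1⟩).contDiffAt (hJ.mem_nhds ht₀)).differentiableAt (by simp)
  have hd' : DifferentiableAt ℝ (w' ε) t₀ :=
    ((hs' ε ⟨hε0, hlt.1⟩).contDiffAt (hJ.mem_nhds ht₀)).differentiableAt (by simp)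
  rw [pow_zero, mul_one, ← norm_deriv_eq_norm_fderiv] at a2
  have e1 : deriv (fun t => w ε t - w' ε t) t₀ = deriv (w ε) t₀ - deriv (w' ε) t₀ :=
    (hd.hasDerivAt.sub hd'.hasDerivAt).deriv
  change ‖deriv (fun t => w ε t - w' ε t) t₀‖ ≤ _ at a2
  rw [e1, Real.norm_eq_abs] at a2
  have a3 := abs_sub_abs_le_abs_sub (deriv (w' ε) t₀) (deriv (w ε) t₀)
  rw [abs_sub_comm] at a3
  linarith

section ModMap

set_option linter.unusedSectionVars false

variable {F : Type*} [NormedAddCommGroup F] [NormedSpace ℝ F]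
  {H : Type*} [TopologicalSpace H] {I : ModelWithCorners ℝ F H}
  {M : Type*} [TopologicalSpace M] [ChartedSpace H M] {J : Set ℝ}
  {V : Type*} [NormedAddCommGroup V] [NormedSpace ℝ V]

theorem ModMap.contMDiffAt (hJ : IsOpen J) (c : ModMap I M J) {ε t : ℝ} (hε : ε ∈ Ioc (0 : ℝ) 1)
    (ht : t ∈ J) : ContMDiffAt 𝓘(ℝ, ℝ) I ∞ (c.1 ε) t := by
  have h1 : ContMDiffOn 𝓘(ℝ, ℝ) I ∞ (c.1 ε) J :=
    c.2.1.comp (t := Ioc (0 : ℝ) 1 ×ˢ J) (f := fun s : ℝ => (ε, s))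
      (contDiff_const.prodMk contDiff_id).contMDiff.contMDiffOn fun s hs => ⟨hε, hs⟩
  exact h1.contMDiffAt (hJ.mem_nhds ht)

theorem ModMap.contDiffAt_comp (hJ : IsOpen J) (c : ModMap I M J) {ψ : M → V}
    (hψ : ContMDiff I 𝓘(ℝ, V) ∞ ψ) {ε t : ℝ} (hε : ε ∈ Ioc (0 : ℝ) 1) (ht : t ∈ J) :
    ContDiffAt ℝ ∞ (fun s => ψ (c.1 ε s)) t :=
  ((hψ (c.1 ε t)).comp t (c.contMDiffAt hJ hε ht)).contDiffAt

theorem ModMap.deriv_dual_comp (hJ : IsOpen J) (c : ModMap I M J) {ψ : M → V}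
    (hψ : ContMDiff I 𝓘(ℝ, V) ∞ ψ) {ε t : ℝ} (hε : ε ∈ Ioc (0 : ℝ) 1) (ht : t ∈ J)
    (l : V →L[ℝ] ℝ) : deriv (fun s => l (ψ (c.1 ε s))) t = l (deriv (fun s => ψ (c.1 ε s)) t) :=
  (l.hasFDerivAt.comp_hasDerivAt t
    ((c.contDiffAt_comp hJ hψ hε ht).differentiableAt (by simp)).hasDerivAt).deriv

theorem ModMap.polyBdd_deriv [FiniteDimensional ℝ V] (hJ : IsOpen J) (c : ModMap I M J)
    {ψ : M → V} (hψ : ContMDiff I 𝓘(ℝ, V) ∞ ψ) {L : Set ℝ} (hL : L ⊆ J) (hLc : IsCompact L) :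
    PolyBdd L fun ε t => ‖deriv (fun s => ψ (c.1 ε s)) t‖ := by
  obtain ⟨n, l, A, hA, hl⟩ := exists_norm_le_sum_dual V
  have h1 : ∀ j, PolyBdd L fun ε t => ‖iteratedFDeriv ℝ 1 (fun s => l j (ψ (c.1 ε s))) t‖ :=
    fun j => c.2.2 _ ((l j).contDiff.contMDiff.comp hψ) L hL hLc 1
  refine (((PolyBdd.const A).mul (PolyBdd.sum Finset.univ fun j _ => h1 j) (fun _ _ => hA)
    fun ε t => by positivity).le fun ε hε t ht => ?_)
  refine (hl _).trans_eq ?_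
  simp_rw [norm_iteratedFDeriv_one, norm_deriv_eq_norm_fderiv.symm,
    c.deriv_dual_comp hJ hψ ⟨hε.1, hε.2.le⟩ (hL ht), Real.norm_eq_abs]

theorem ModMap.bounded_deriv [FiniteDimensional ℝ V] (hJ : IsOpen J) (c : ModMap I M J)
    {ψ : M → V} (hψ : ContMDiff I 𝓘(ℝ, V) ∞ ψ) {t₀ : ℝ} (ht₀ : t₀ ∈ J)
    (hb : BoundedVelocityAt (Quotient.mk _ c : GenMap I M J) t₀) :
    ∃ C ε₀ : ℝ, 0 < ε₀ ∧ ∀ ε ∈ Ioo 0 ε₀, ‖deriv (fun s => ψ (c.1 ε s)) t₀‖ ≤ C := by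
  obtain ⟨n, l, A, hA, hl⟩ := exists_norm_le_sum_dual V
  obtain ⟨c', hc', hb⟩ := hb
  have hcc : ∀ ψ : M → ℝ, ContMDiff I 𝓘(ℝ, ℝ) ∞ ψ →
    NegligibleOn J (fun ε t => ψ (c'.1 ε t) - ψ (c.1 ε t)) :=
    Quotient.exact (s := ModMap.setoid I M J) hc'
  have h1 : ∀ j, ∃ C ε₀ : ℝ, 0 < ε₀ ∧ ∀ ε ∈ Ioo 0 ε₀,
      |deriv (fun s => l j (ψ (c.1 ε s))) t₀| ≤ C := by
    intro j
    have hj : ContMDiff I 𝓘(ℝ, ℝ) ∞ fun q => l j (ψ q) := (l j).contDiff.contMDiff.comp hψ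
    obtain ⟨C, ε₀, hε₀, h⟩ := hb _ hj
    have hs : ∀ c : ModMap I M J, ∀ ε ∈ Ioo (0 : ℝ) 1,
        ContDiffOn ℝ ∞ (fun s => l j (ψ (c.1 ε s))) J := fun c ε hε t ht =>
      (c.contDiffAt_comp hJ hj ⟨hε.1, hε.2.le⟩ ht).contDiffWithinAt
    have hcj : NegligibleOn J fun ε t => l j (ψ (c'.1 ε t)) - l j (ψ (c.1 ε t)) := hcc (fun q => l j (ψ q)) hj
    have hm : ∀ c : ModMap I M J, ModerateOn J fun ε t => l j (ψ (c.1 ε t)) :=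
      fun c => c.2.2 (fun q => l j (ψ q)) hj
    exact exists_abs_deriv_le_of_negligibleOn_sub (w := fun ε t => l j (ψ (c'.1 ε t)))
      (w' := fun ε t => l j (ψ (c.1 ε t))) hJ (hs c') (hs c) (hm c') (hm c) hcj ht₀
      ⟨C, ε₀, hε₀, h⟩
  choose C e he h using h1
  obtain ⟨ε₀, hε₀, hle⟩ := exists_pos_le_of_fintype he
  refine ⟨A * ∑ j, C j, min 1 ε₀, by positivity, fun ε hε => (hl _).trans ?_⟩
  gcongr with j
  rw [← c.deriv_dual_comp hJ hψ ⟨hε.1, (hε.2.trans_le (min_le_left _ _)).le⟩ ht₀]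
  exact h j ε ⟨hε.1, (hε.2.trans_le (min_le_right _ _)).trans_le (hle j)⟩

end ModMap

section Speed

set_option linter.unusedSectionVars false

variable {E : Type u} [NormedAddCommGroup E] [NormedSpace ℝ E] [FiniteDimensional ℝ E]
  {N : Type*} [TopologicalSpace N] [ChartedSpace E N] [IsManifold 𝓘(ℝ, E) ∞ N]
  [RiemannianBundle (fun x : N => TangentSpace 𝓘(ℝ, E) x)]
  [IsContMDiffRiemannianBundle 𝓘(ℝ, E) ∞ E (fun x : N => TangentSpace 𝓘(ℝ, E) x)]
  {K : Set N} (C : Coordinates E K)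

theorem Coordinates.exists_weight_ne_zero {x : N} (hx : x ∈ K) :
    ∃ i, C.weight i (C.toFun x) ≠ 0 := by
  by_contra! h
  have := C.sum_weight x hx
  simp [h] at this

theorem Coordinates.isCompact_chart_core (i : C.index) :
    IsCompact (extChartAt 𝓘(ℝ, E) (i : N) '' C.core i) :=
  (C.isCompact_core i).image_of_continuousOn ((continuousOn_extChartAt _).mono (C.core_subset i))

theorem Coordinates.chart_core_subset (i : C.index) :
    extChartAt 𝓘(ℝ, E) (i : N) '' C.core i ⊆ (extChartAt 𝓘(ℝ, E) (i : N)).target := by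
  rintro _ ⟨x, hx, rfl⟩
  exact (extChartAt 𝓘(ℝ, E) (i : N)).map_source (C.core_subset i hx)

theorem Coordinates.chart_mem_core {i : C.index} {x : N} (hi : C.weight i (C.toFun x) ≠ 0) :
    extChartAt 𝓘(ℝ, E) (i : N) x ∈ extChartAt 𝓘(ℝ, E) (i : N) '' C.core i :=
  mem_image_of_mem _ (C.mem_core i x hi)

theorem Coordinates.exists_sqrt_metricCoeff_le : ∃ B ≥ 0, ∀ (i : C.index) (x : N),
    C.weight i (C.toFun x) ≠ 0 → ∀ a,
      √(metricCoeff (i : N) (extChartAt 𝓘(ℝ, E) (i : N) x) a a) ≤ B * ‖a‖ := by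
  choose c hc A hA h using fun i : C.index =>
    exists_metricCoeff_bounds (C.isCompact_chart_core i) (C.chart_core_subset i)
  obtain ⟨B, hB, hle⟩ := exists_le_of_fintype fun i => √(A i)
  refine ⟨B, hB, fun i x hi a => ?_⟩
  calc _ ≤ √(A i * ‖a‖ ^ 2) := Real.sqrt_le_sqrt (h i _ (C.chart_mem_core hi) a).2
    _ = √(A i) * ‖a‖ := by rw [Real.sqrt_mul (hA i).le, Real.sqrt_sq (norm_nonneg a)]
    _ ≤ B * ‖a‖ := by gcongr; exact hle i

theorem Coordinates.deriv_chart {i : C.index} {x : ℝ → N} {t : ℝ}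
    (hx : ContMDiffAt 𝓘(ℝ, ℝ) 𝓘(ℝ, E) ∞ x t) (hi : C.weight i (C.toFun (x t)) ≠ 0) :
    deriv (fun s => extChartAt 𝓘(ℝ, E) (i : N) (x s)) t =
      (deriv (fun s => C.toFun (x s)) t i).2 := by
  have h1 : (fun s => extChartAt 𝓘(ℝ, E) (i : N) (x s)) =ᶠ[𝓝 t] fun s => (C.toFun (x s) i).2 := by
    filter_upwards [hx.continuousAt.eventually (C.eventually_eq i _ hi)] with s hs using hs.symm
  have h2 : DifferentiableAt ℝ (fun s => C.toFun (x s)) t :=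
    ((C.contMDiff (x t)).comp t hx).contDiffAt.differentiableAt (by simp)
  rw [h1.deriv_eq]
  exact (hasDerivAt_snd (hasDerivAt_pi.1 h2.hasDerivAt i)).deriv

theorem Coordinates.exists_sqrt_speedSq_le : ∃ B ≥ 0, ∀ (x : ℝ → N) (t : ℝ),
    ContMDiffAt 𝓘(ℝ, ℝ) 𝓘(ℝ, E) ∞ x t → x t ∈ K →
      √(speedSq E x t) ≤ B * ‖deriv (fun s => C.toFun (x s)) t‖ := by
  obtain ⟨B, hB, h⟩ := C.exists_sqrt_metricCoeff_le
  refine ⟨B, hB, fun x t hx hK => ?_⟩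
  obtain ⟨i, hi⟩ := C.exists_weight_ne_zero hK
  rw [speedSq_eq hx (C.mem_source hi)]
  refine (h i _ hi _).trans ?_
  gcongr
  rw [C.deriv_chart hx hi]
  exact (norm_snd_le _).trans (norm_le_pi_norm _ i)

theorem Coordinates.exists_norm_deriv_le : ∃ B ≥ 0, ∀ (x : ℝ → N) (t : ℝ),
    ContMDiffAt 𝓘(ℝ, ℝ) 𝓘(ℝ, E) ∞ x t → x t ∈ K →
      ‖deriv (fun s => C.toFun (x s)) t‖ ≤ B * √(speedSq E x t) := by
  choose c hc A hA h using fun i : C.index =>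
    exists_metricCoeff_bounds (C.isCompact_chart_core i) (C.chart_core_subset i)
  have h2 : ∀ i : C.index, ∃ D, ∀ y ∈ extChartAt 𝓘(ℝ, E) (i : N) '' C.core i,
      ‖fderiv ℝ (fun y => C.toFun ((extChartAt 𝓘(ℝ, E) (i : N)).symm y)) y‖ ≤ D := by
    intro i
    have hc : ContinuousOn (fderiv ℝ fun y => C.toFun ((extChartAt 𝓘(ℝ, E) (i : N)).symm y))
        (extChartAt 𝓘(ℝ, E) (i : N) '' C.core i) := fun y hy =>
      (((contDiffAt_chart_function C.contMDiff (C.chart_core_subset i hy)).fderiv_right (m := ∞)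
        (by simp)).continuousAt).continuousWithinAt
    obtain ⟨D, hD⟩ := (C.isCompact_chart_core i).bddAbove_image hc.norm
    exact ⟨D, fun y hy => hD (mem_image_of_mem _ hy)⟩
  choose D hD using h2
  obtain ⟨B, hB, hle⟩ := exists_le_of_fintype fun i => |D i| * √((c i)⁻¹)
  refine ⟨B, hB, fun x t hx hK => ?_⟩
  obtain ⟨i, hi⟩ := C.exists_weight_ne_zero hK
  have hp := C.mem_source hi
  rw [(hasDerivAt_comp_chart C.contMDiff hx hp).deriv, speedSq_eq hx hp]
  set a := deriv (fun s => extChartAt 𝓘(ℝ, E) (i : N) (x s)) t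
  set Q := metricCoeff (i : N) (extChartAt 𝓘(ℝ, E) (i : N) (x t)) a a
  have h3 : ‖a‖ ≤ √((c i)⁻¹) * √Q := by
    rw [← Real.sqrt_mul (inv_nonneg.2 (hc i).le)]
    refine Real.le_sqrt_of_sq_le ?_
    rw [inv_mul_eq_div, le_div_iff₀ (hc i), mul_comm]
    exact (h i _ (C.chart_mem_core hi) a).1
  refine (ContinuousLinearMap.le_opNorm _ _).trans ?_
  calc _ ≤ |D i| * (√((c i)⁻¹) * √Q) := by
        gcongr
        exact (hD i _ (C.chart_mem_core hi)).trans (le_abs_self _)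
    _ = |D i| * √((c i)⁻¹) * √Q := by ring
    _ ≤ _ := by gcongr; exact hle i

theorem Coordinates.deriv_eq_of_sameJet {x x' : ℝ → N} {t : ℝ}
    (hx : ContMDiffAt 𝓘(ℝ, ℝ) 𝓘(ℝ, E) ∞ x t) (hx' : ContMDiffAt 𝓘(ℝ, ℝ) 𝓘(ℝ, E) ∞ x' t)
    (h : SameJet E x x' t) :
    deriv (fun s => C.toFun (x s)) t = deriv (fun s => C.toFun (x' s)) t := by
  have hp := mem_extChartAt_source (I := 𝓘(ℝ, E)) (x t)
  have hp' : x' t ∈ (extChartAt 𝓘(ℝ, E) (x t)).source := by rw [← h.1]; exact hp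
  rw [(hasDerivAt_comp_chart C.contMDiff hx hp).deriv,
    (hasDerivAt_comp_chart C.contMDiff hx' hp').deriv, h.2 _ hp, h.1]

end Speed

section NetAlgebra

variable {X : Type*} {L : Set ℝ}

theorem negligibleOn_iff_of_isCompact (hL : IsCompact L) {V : Type*} [NormedAddCommGroup V]
    [NormedSpace ℝ V] {w : ℝ → ℝ → V} : NegligibleOn L w ↔
      ∀ m : ℕ, ∃ C ε₀ : ℝ, 0 < ε₀ ∧ ∀ ε ∈ Ioo 0 ε₀, ∀ t ∈ L, ‖w ε t‖ ≤ C * ε ^ m := by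
  refine ⟨fun h => h L le_rfl hL, fun h K hK _ m => ?_⟩
  obtain ⟨C, e, he, H⟩ := h m
  exact ⟨C, e, he, fun ε hε t ht => H ε hε t (hK ht)⟩

theorem NegligibleOn.mul_polyBdd (hL : IsCompact L) {w g : ℝ → ℝ → ℝ} (hw : NegligibleOn L w)
    (hg : PolyBdd L fun ε t => ‖g ε t‖) : NegligibleOn L fun ε t => w ε t * g ε t := by
  rw [negligibleOn_iff_of_isCompact hL] at hw ⊢
  intro m
  obtain ⟨k, A, e, he, H⟩ := hg
  obtain ⟨C, e', he', H'⟩ := hw (m + k)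
  refine ⟨C * A, min e e', lt_min he he', fun ε hε t ht => ?_⟩
  have h1 := H ε ⟨hε.1, hε.2.trans_le (min_le_left _ _)⟩ t ht
  have h2 := H' ε ⟨hε.1, hε.2.trans_le (min_le_right _ _)⟩ t ht
  have h0 : 0 < ε := hε.1
  rw [norm_mul]
  calc ‖w ε t‖ * ‖g ε t‖ ≤ (C * ε ^ (m + k)) * (A / ε ^ k) :=
        mul_le_mul h2 h1 (norm_nonneg _) ((norm_nonneg _).trans h2)
    _ = C * A * ε ^ m := by rw [pow_add]; field_simp

theorem NegligibleOn.congr_small {V : Type*} [NormedAddCommGroup V] [NormedSpace ℝ V]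
    {w w' : ℝ → ℝ → V} (h : NegligibleOn L w) {ε₁ : ℝ} (hε₁ : 0 < ε₁)
    (hw : ∀ ε ∈ Ioo 0 ε₁, ∀ y ∈ L, ‖w' ε y‖ ≤ ‖w ε y‖) : NegligibleOn L w' := by
  intro K hK hKc m
  obtain ⟨C, e, he, H⟩ := h K hK hKc m
  exact ⟨C, min e ε₁, lt_min he hε₁, fun ε hε y hy =>
    (hw ε ⟨hε.1, hε.2.trans_le (min_le_right _ _)⟩ y (hK hy)).trans
      (H ε ⟨hε.1, hε.2.trans_le (min_le_left _ _)⟩ y hy)⟩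

theorem PolyBdd.norm_mul {g h : ℝ → X → ℝ} {K : Set X} (hg : PolyBdd K fun ε y => ‖g ε y‖)
    (hh : PolyBdd K fun ε y => ‖h ε y‖) : PolyBdd K fun ε y => ‖g ε y * h ε y‖ := by
  simp only [_root_.norm_mul]
  exact hg.mul hh (fun _ _ => norm_nonneg _) fun _ _ => norm_nonneg _

/-- A moderate net composed with bounded nets that differ negligibly. -/
theorem NegligibleOn.net_comp_sub (hL : IsCompact L) {Φ : ℝ → ℝ → ℝ}
    (hΦs : ∀ ε ∈ Ioo (0 : ℝ) 1, ContDiff ℝ ∞ (Φ ε)) (hΦ : ModerateOn univ Φ) {g h : ℝ → ℝ → ℝ}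
    (hg : LocBounded L g) (hh : LocBounded L h) (hn : NegligibleOn L fun ε t => g ε t - h ε t) :
    NegligibleOn L fun ε t => Φ ε (g ε t) - Φ ε (h ε t) := by
  rw [negligibleOn_iff_of_isCompact hL] at hn ⊢
  obtain ⟨R, e₁, he₁, h1⟩ := hg L le_rfl hL
  obtain ⟨R', e₂, he₂, h2⟩ := hh L le_rfl hL
  obtain ⟨k, A, e₃, he₃, h3⟩ := hΦ (Metric.closedBall 0 (max R R')) (subset_univ _)
    (isCompact_closedBall _ _) 1
  intro m
  obtain ⟨C, e₄, he₄, h4⟩ := hn (m + k)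
  refine ⟨A * C, min (min e₁ e₂) (min e₃ (min e₄ 1)), by positivity, fun ε hε t ht => ?_⟩
  obtain ⟨hε0, hlt⟩ := hε
  simp only [lt_min_iff] at hlt
  have hb : ∀ y ∈ Metric.closedBall (0 : ℝ) (max R R'), ‖_root_.fderiv ℝ (Φ ε) y‖ ≤ A / ε ^ k := by
    intro y hy
    rw [← norm_iteratedFDeriv_one]
    exact h3 ε ⟨hε0, hlt.2.1⟩ y hy
  have hmem : h ε t ∈ Metric.closedBall (0 : ℝ) (max R R') :=
    mem_closedBall_zero_iff.2 ((h2 ε ⟨hε0, hlt.1.2⟩ t ht).trans (le_max_right _ _))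
  have key := (convex_closedBall (0 : ℝ) (max R R')).norm_image_sub_le_of_norm_fderiv_le
    (fun y _ => (hΦs ε ⟨hε0, hlt.2.2.2⟩).differentiable (by simp) y) hb hmem
    (mem_closedBall_zero_iff.2 ((h1 ε ⟨hε0, hlt.1.1⟩ t ht).trans (le_max_left _ _)))
  refine key.trans ?_
  have h0 : 0 ≤ A / ε ^ k := (norm_nonneg _).trans (hb _ hmem)
  calc A / ε ^ k * ‖g ε t - h ε t‖ ≤ A / ε ^ k * (C * ε ^ (m + k)) := by
        gcongr; exact h4 ε ⟨hε0, hlt.2.2.1⟩ t ht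
    _ = A * C * ε ^ m := by rw [pow_add]; field_simp

theorem ModerateOn.deriv_net {J : Set ℝ} {Φ : ℝ → ℝ → ℝ} (hΦ : ModerateOn J Φ) :
    ModerateOn J fun ε => deriv (Φ ε) := by
  intro K hK hKc k
  obtain ⟨m, C, e, he, H⟩ := hΦ K hK hKc (k + 1)
  refine ⟨m, C, e, he, fun ε hε y hy => ?_⟩
  have h1 := H ε hε y hy
  rw [norm_iteratedFDeriv_eq_norm_iteratedDeriv] at h1 ⊢
  rwa [← iteratedDeriv_succ']

theorem ModerateOn.polyBdd_comp {Φ : ℝ → ℝ → ℝ} (hΦ : ModerateOn univ Φ) (hL : IsCompact L)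
    {g : ℝ → ℝ → ℝ} (hg : LocBounded L g) : PolyBdd L fun ε t => ‖Φ ε (g ε t)‖ := by
  obtain ⟨R, e₁, he₁, h1⟩ := hg L le_rfl hL
  obtain ⟨k, A, e₃, he₃, h3⟩ := hΦ (Metric.closedBall 0 R) (subset_univ _)
    (isCompact_closedBall _ _) 0
  refine ⟨k, A, min e₁ e₃, lt_min he₁ he₃, fun ε hε t ht => ?_⟩
  have := h3 ε ⟨hε.1, hε.2.trans_le (min_le_right _ _)⟩ (g ε t)
    (mem_closedBall_zero_iff.2 (h1 ε ⟨hε.1, hε.2.trans_le (min_le_left _ _)⟩ t ht))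
  rwa [norm_iteratedFDeriv_zero] at this

/-- A net vanishing at a point and with negligible derivative is negligible. -/
theorem NegligibleOn.of_deriv {a b t₀ : ℝ} (ht₀ : t₀ ∈ Icc a b) {w w' : ℝ → ℝ → ℝ}
    (hd : ∀ ε ∈ Ioo (0 : ℝ) 1, ∀ t ∈ Icc a b, HasDerivAt (w ε) (w' ε t) t)
    (h0 : ∀ ε ∈ Ioo (0 : ℝ) 1, w ε t₀ = 0) (hn : NegligibleOn (Icc a b) w') :
    NegligibleOn (Icc a b) w := by
  rw [negligibleOn_iff_of_isCompact isCompact_Icc] at hn ⊢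
  intro m
  obtain ⟨C, e, he, H⟩ := hn m
  refine ⟨C * (b - a), min e 1, by positivity, fun ε hε t ht => ?_⟩
  have hε1 : ε ∈ Ioo (0 : ℝ) 1 := ⟨hε.1, hε.2.trans_le (min_le_right _ _)⟩
  have hb := H ε ⟨hε.1, hε.2.trans_le (min_le_left _ _)⟩
  have key := (convex_Icc a b).norm_image_sub_le_of_norm_hasDerivWithin_le
    (fun t ht => (hd ε hε1 t ht).hasDerivWithinAt) hb ht₀ ht
  rw [h0 ε hε1, sub_zero] at key
  have h2 : ‖t - t₀‖ ≤ b - a := by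
    rw [Real.norm_eq_abs, abs_le]; constructor <;> linarith [ht.1, ht.2, ht₀.1, ht₀.2]
  calc ‖w ε t‖ ≤ C * ε ^ m * ‖t - t₀‖ := key
    _ ≤ C * ε ^ m * (b - a) := by
        gcongr
        exact (norm_nonneg _).trans (hb t ht)
    _ = _ := by ring

end NetAlgebra

/-- The geodesic equation for nets. -/
def IsGeodesicNet {F : Type*} [NormedAddCommGroup F] [NormedSpace ℝ F]
    {H : Type*} [TopologicalSpace H] {I : ModelWithCorners ℝ F H}
    {M : Type*} [TopologicalSpace M] [ChartedSpace H M] {J : Set ℝ} (G : ModTensor I M)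
    (c : ModMap I M J) : Prop :=
  ∀ p : M, ∀ K ⊆ (extChartAt I p).source, IsCompact K → ∀ L ⊆ J, IsCompact L →
    ∀ m : ℕ, ∃ C ε₀ : ℝ, 0 < ε₀ ∧ ∀ ε ∈ Ioo 0 ε₀, ∀ t ∈ L, c.1 ε t ∈ K →
      ‖covAccel I (G.1 ε) (c.1 ε) p t‖ ≤ C * ε ^ m

section Residual

set_option linter.unusedSectionVars false

variable {E : Type u} [NormedAddCommGroup E] [NormedSpace ℝ E] [FiniteDimensional ℝ E]
  {N : Type*} [TopologicalSpace N] [ChartedSpace E N] [IsManifold 𝓘(ℝ, E) ∞ N]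
  [T2Space N] [SigmaCompactSpace N]
  [RiemannianBundle (fun x : N => TangentSpace 𝓘(ℝ, E) x)]
  [IsContMDiffRiemannianBundle 𝓘(ℝ, E) ∞ E (fun x : N => TangentSpace 𝓘(ℝ, E) x)]
  {f : C^∞⟮𝓘(ℝ, E), N; ℝ⟯} {δ : ModNet ℝ (univ : Set ℝ)}
  {G : ModTensor (inpwModel E) (N × (ℝ × ℝ))} {J : Set ℝ}
  {c : ModMap (inpwModel E) (N × (ℝ × ℝ)) J} {K : Set N} (C : Coordinates E K)

theorem Coordinates.contMDiff_prod : ContMDiff (inpwModel E)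
    𝓘(ℝ, (C.index → ℝ × E) × (ℝ × ℝ)) ∞ fun q : N × (ℝ × ℝ) => (C.toFun q.1, q.2) :=
  (C.contMDiff.comp contMDiff_fst).prodMk_space contMDiff_snd

theorem IsGeodesicNet.exists_covAccel_inpwNet_le (hG : G ≈ inpwNet f δ) (hJ : IsOpen J)
    (hc : IsGeodesicNet G c) {L : Set ℝ} (hL : L ⊆ J) (hLc : IsCompact L) (m : ℕ) :
    ∃ B ε₀ : ℝ, 0 < ε₀ ∧ ∀ ε ∈ Ioo 0 ε₀, ∀ t ∈ L, ∀ i : C.index,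
      C.weight i (C.toFun (c.1 ε t).1) ≠ 0 →
      ‖covAccel (inpwModel E) (inpwTensor f (δ.1 ε)) (c.1 ε) ((i : N), 0) t‖ ≤ B * ε ^ m := by
  obtain ⟨R, e₁, he₁, hR⟩ := c.exists_bound (ρ := fun q : N × (ℝ × ℝ) => ‖q.2‖)
    (continuous_norm.comp continuous_snd) hL hLc
  obtain ⟨m₂, C₂, e₂, he₂, h2⟩ := c.polyBdd_deriv hJ C.contMDiff_prod hL hLc
  have hKs : ∀ i : C.index, C.core i ×ˢ Metric.closedBall (0 : ℝ × ℝ) R ⊆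
      (extChartAt (inpwModel E) ((i : N), (0 : ℝ × ℝ))).source := fun i q hq => by
    rw [inpw_source]
    exact ⟨C.core_subset i hq.1, mem_univ _⟩
  have hKc : ∀ i : C.index, IsCompact (C.core i ×ˢ Metric.closedBall (0 : ℝ × ℝ) R) := fun i =>
    (C.isCompact_core i).prod (isCompact_closedBall _ _)
  have hi : ∀ i : C.index, ∃ B ε₀ : ℝ, 0 < ε₀ ∧ ∀ ε ∈ Ioo 0 ε₀, ∀ t ∈ L,
      C.weight i (C.toFun (c.1 ε t).1) ≠ 0 →
      ‖covAccel (inpwModel E) (inpwTensor f (δ.1 ε)) (c.1 ε) ((i : N), 0) t‖ ≤ B * ε ^ m := by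
    intro i
    obtain ⟨C₃, e₃, he₃, h3⟩ := hc ((i : N), 0) _ (hKs i) (hKc i) L hL hLc m
    obtain ⟨C₄, e₄, he₄, h4⟩ := exists_christoffel_inpwNet_sub_le f δ hG ((i : N), 0)
      (K := extChartAt (inpwModel E) ((i : N), (0 : ℝ × ℝ)) ''
        (C.core i ×ˢ Metric.closedBall (0 : ℝ × ℝ) R))
      (by
        rintro _ ⟨q, hq, rfl⟩
        exact (extChartAt (inpwModel E) ((i : N), (0 : ℝ × ℝ))).map_source (hKs i hq))
      ((hKc i).image_of_continuousOn ((continuousOn_extChartAt _).mono (hKs i))) m₂ C₂ m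
    refine ⟨C₃ + C₄, min (min e₁ e₂) (min e₃ (min e₄ 1)), by positivity, fun ε hε t ht hi => ?_⟩
    obtain ⟨hε0, hlt⟩ := hε
    simp only [lt_min_iff] at hlt
    have hmem : c.1 ε t ∈ C.core i ×ˢ Metric.closedBall (0 : ℝ × ℝ) R :=
      ⟨C.mem_core i _ hi, mem_closedBall_zero_iff.2 (hR ε ⟨hε0, hlt.1.1⟩ t ht)⟩
    have a3 := h3 ε ⟨hε0, hlt.2.1⟩ t ht hmem
    have hcs := c.contMDiffAt hJ ⟨hε0, hlt.2.2.2.le⟩ (hL ht)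
    have hcd := c.contDiffAt_comp hJ C.contMDiff_prod ⟨hε0, hlt.2.2.2.le⟩ (hL ht)
    let P : ((C.index → ℝ × E) × (ℝ × ℝ)) →L[ℝ] E × (ℝ × ℝ) :=
      (((ContinuousLinearMap.snd ℝ ℝ E).comp (ContinuousLinearMap.proj i)).comp
        (ContinuousLinearMap.fst ℝ _ _)).prod (ContinuousLinearMap.snd ℝ _ _)
    have hPn : ∀ z, ‖P z‖ ≤ ‖z‖ := fun z => by
      refine max_le ((norm_snd_le _).trans ((norm_le_pi_norm _ i).trans (norm_fst_le z)))
        (norm_snd_le z)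
    have he : (fun s => extChartAt (inpwModel E) ((i : N), (0 : ℝ × ℝ)) (c.1 ε s)) =ᶠ[𝓝 t]
        fun s => P (C.toFun (c.1 ε s).1, (c.1 ε s).2) := by
      have : ContinuousAt (fun s => (c.1 ε s).1) t := hcs.continuousAt.fst
      filter_upwards [this.eventually (C.eventually_eq i _ hi)] with s hs
      rw [inpw_chart]
      exact Prod.ext hs.symm rfl
    have hderiv : deriv (fun s => extChartAt (inpwModel E) ((i : N), (0 : ℝ × ℝ)) (c.1 ε s)) t =
        P (deriv (fun s => (C.toFun (c.1 ε s).1, (c.1 ε s).2)) t) := by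
      rw [he.deriv_eq]
      exact (P.hasFDerivAt.comp_hasDerivAt t
        (hcd.differentiableAt (by simp)).hasDerivAt).deriv
    have a4 := h4 ε ⟨hε0, hlt.2.2.1⟩ _ (mem_image_of_mem _ hmem)
      (deriv (fun s => extChartAt (inpwModel E) ((i : N), (0 : ℝ × ℝ)) (c.1 ε s)) t)
      (by rw [hderiv]; exact (hPn _).trans (h2 ε ⟨hε0, hlt.1.2⟩ t ht))
    have e1 : covAccel (inpwModel E) (inpwTensor f (δ.1 ε)) (c.1 ε) ((i : N), 0) t =
      covAccel (inpwModel E) (G.1 ε) (c.1 ε) ((i : N), 0) t -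
        (christoffel (chartCoeff (inpwModel E) ((i : N), 0) (G.1 ε))
          (extChartAt (inpwModel E) ((i : N), (0 : ℝ × ℝ)) (c.1 ε t))
          (deriv (fun s => extChartAt (inpwModel E) ((i : N), (0 : ℝ × ℝ)) (c.1 ε s)) t)
          (deriv (fun s => extChartAt (inpwModel E) ((i : N), (0 : ℝ × ℝ)) (c.1 ε s)) t) -
        christoffel (chartCoeff (inpwModel E) ((i : N), 0) ((inpwNet f δ).1 ε))
          (extChartAt (inpwModel E) ((i : N), (0 : ℝ × ℝ)) (c.1 ε t))
          (deriv (fun s => extChartAt (inpwModel E) ((i : N), (0 : ℝ × ℝ)) (c.1 ε s)) t)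
          (deriv (fun s => extChartAt (inpwModel E) ((i : N), (0 : ℝ × ℝ)) (c.1 ε s)) t)) := by
      simp only [covAccel, inpwNet]
      abel
    rw [e1, add_mul]
    exact (norm_sub_le _ _).trans (add_le_add a3 a4)
  choose B e he H using hi
  obtain ⟨B', hB', hle⟩ := exists_le_of_fintype B
  obtain ⟨ε₀, hε₀, hle'⟩ := exists_pos_le_of_fintype he
  refine ⟨B', ε₀, hε₀, fun ε hε t ht i hi =>
    (H i ε ⟨hε.1, hε.2.trans_le (hle' i)⟩ t ht hi).trans ?_⟩
  have := hε.1
  gcongr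
  exact hle i

end Residual

theorem NegligibleOn.locBounded {L : Set ℝ} {w : ℝ → ℝ → ℝ}
    (h : NegligibleOn L w) : LocBounded L w := by
  intro K hK hKc
  obtain ⟨C, e, he, H⟩ := h K hK hKc 0
  exact ⟨C, e, he, fun ε hε t ht => by simpa using H ε hε t ht⟩

theorem LocBounded.sub {L : Set ℝ} {V : Type*} [NormedAddCommGroup V] {g h : ℝ → ℝ → V}
    (hg : LocBounded L g) (hh : LocBounded L h) : LocBounded L fun ε t => g ε t - h ε t := by
  intro K hK hKc
  obtain ⟨C, e, he, H⟩ := hg K hK hKc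
  obtain ⟨C', e', he', H'⟩ := hh K hK hKc
  exact ⟨C + C', min e e', lt_min he he', fun ε hε t ht => (norm_sub_le _ _).trans
    (add_le_add (H ε ⟨hε.1, hε.2.trans_le (min_le_left _ _)⟩ t ht)
      (H' ε ⟨hε.1, hε.2.trans_le (min_le_right _ _)⟩ t ht))⟩

theorem LocBounded.congr {L : Set ℝ} {V : Type*} [NormedAddCommGroup V] {g h : ℝ → ℝ → V}
    (hg : LocBounded L g) (he : ∀ ε, ∀ t ∈ L, h ε t = g ε t) : LocBounded L h := by
  intro K hK hKc
  obtain ⟨C, e, he', H⟩ := hg K hK hKc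
  exact ⟨C, e, he', fun ε hε t ht => by rw [he ε t (hK ht)]; exact H ε hε t ht⟩

section Ray

/-- The linearization at `t₀` of the `u`-component of a net of curves. -/
noncomputable def ray (u : ℝ → ℝ → ℝ) (t₀ ε t : ℝ) : ℝ :=
  u ε t₀ + deriv (u ε) t₀ * (t - t₀)

variable {u : ℝ → ℝ → ℝ} {δ : ModNet ℝ (univ : Set ℝ)} {a b t₀ : ℝ}

theorem hasDerivAt_ray (u : ℝ → ℝ → ℝ) (t₀ ε t : ℝ) :
    HasDerivAt (ray u t₀ ε) (deriv (u ε) t₀) t := by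
  have h1 : HasDerivAt (fun s => u ε t₀ + deriv (u ε) t₀ * (s - t₀)) (deriv (u ε) t₀ * 1) t :=
    (((hasDerivAt_id t).sub_const t₀).const_mul _).const_add _
  rwa [mul_one] at h1

theorem ModNet.contDiff (δ : ModNet ℝ (univ : Set ℝ)) {ε : ℝ} (hε : ε ∈ Ioc (0 : ℝ) 1) :
    ContDiff ℝ ∞ (δ.1 ε) := contDiffOn_univ.1 (δ.2.1.contDiffOn hε)

/-- A net `u` with negligible second derivative may be replaced by its linearization. -/
theorem negligibleOn_kicks_sub (ht₀ : t₀ ∈ Icc a b)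
    (hu : ∀ ε ∈ Ioo (0 : ℝ) 1, ∀ t ∈ Icc a b, ContDiffAt ℝ ∞ (u ε) t)
    (hub : LocBounded (Icc a b) u) (hup : PolyBdd (Icc a b) fun ε t => ‖deriv (u ε) t‖)
    (h2 : NegligibleOn (Icc a b) fun ε => deriv (deriv (u ε))) :
    NegligibleOn (Icc a b) (fun ε t => u ε t - ray u t₀ ε t) ∧
    NegligibleOn (Icc a b) (fun ε t => δ.1 ε (u ε t) * deriv (u ε) t ^ 2 -
      δ.1 ε (ray u t₀ ε t) * deriv (u ε) t₀ ^ 2) ∧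
    NegligibleOn (Icc a b) (fun ε t => δ.1 ε (u ε t) * deriv (u ε) t -
      δ.1 ε (ray u t₀ ε t) * deriv (u ε) t₀) ∧
    NegligibleOn (Icc a b) (fun ε t => deriv (δ.1 ε) (u ε t) * deriv (u ε) t ^ 2 -
      deriv (δ.1 ε) (ray u t₀ ε t) * deriv (u ε) t₀ ^ 2) := by
  have hL : IsCompact (Icc a b) := isCompact_Icc
  have n1 : NegligibleOn (Icc a b) fun ε t => deriv (u ε) t - deriv (u ε) t₀ :=
    NegligibleOn.of_deriv ht₀ (w := fun ε t => deriv (u ε) t - deriv (u ε) t₀)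
      (fun ε hε t ht => (((contDiffAt_deriv (hu ε hε t ht)).differentiableAt
        (by simp)).hasDerivAt.sub_const _)) (fun ε hε => sub_self _) h2
  have n2 : NegligibleOn (Icc a b) fun ε t => u ε t - ray u t₀ ε t :=
    NegligibleOn.of_deriv ht₀ (w := fun ε t => u ε t - ray u t₀ ε t)
      (fun ε hε t ht => ((hu ε hε t ht).differentiableAt (by simp)).hasDerivAt.fun_sub
        (hasDerivAt_ray u t₀ ε t)) (fun ε hε => by simp [ray]) n1
  have hr : LocBounded (Icc a b) (ray u t₀) := (hub.sub n2.locBounded).congr fun ε t _ => by ring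
  have hp0 : PolyBdd (Icc a b) fun ε (_ : ℝ) => ‖deriv (u ε) t₀‖ := by
    obtain ⟨m, C, e, he, H⟩ := hup
    exact ⟨m, C, e, he, fun ε hε t ht => H ε hε t₀ ht₀⟩
  have key : ∀ Φ : ℝ → ℝ → ℝ, (∀ ε ∈ Ioo (0 : ℝ) 1, ContDiff ℝ ∞ (Φ ε)) → ModerateOn univ Φ →
      NegligibleOn (Icc a b) (fun ε t => Φ ε (u ε t) * deriv (u ε) t -
        Φ ε (ray u t₀ ε t) * deriv (u ε) t₀) ∧
      NegligibleOn (Icc a b) (fun ε t => Φ ε (u ε t) * deriv (u ε) t ^ 2 -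
        Φ ε (ray u t₀ ε t) * deriv (u ε) t₀ ^ 2) := by
    intro Φ hΦs hΦ
    have k1 := NegligibleOn.net_comp_sub hL hΦs hΦ hub hr n2
    have k2 : PolyBdd (Icc a b) fun ε t => ‖Φ ε (ray u t₀ ε t)‖ := hΦ.polyBdd_comp hL hr
    have k3 : NegligibleOn (Icc a b) (fun ε t => Φ ε (u ε t) * deriv (u ε) t -
        Φ ε (ray u t₀ ε t) * deriv (u ε) t₀) :=
      ((k1.mul_polyBdd hL hup).add (n1.mul_polyBdd hL k2)).congr fun ε t _ => by ring
    refine ⟨k3, ?_⟩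
    exact ((k3.mul_polyBdd hL hup).add (n1.mul_polyBdd hL (k2.norm_mul hp0))).congr
      fun ε t _ => by ring
  have hs : ∀ ε ∈ Ioo (0 : ℝ) 1, ContDiff ℝ ∞ (δ.1 ε) := fun ε hε => δ.contDiff ⟨hε.1, hε.2.le⟩
  have hs' : ∀ ε ∈ Ioo (0 : ℝ) 1, ContDiff ℝ ∞ (deriv (δ.1 ε)) := fun ε hε =>
    ((contDiff_infty_iff_deriv).1 (hs ε hε)).2
  exact ⟨n2, (key _ hs δ.2.2).2, (key _ hs δ.2.2).1, (key _ hs' δ.2.2.deriv_net).2⟩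

end Ray

section Residual

set_option linter.unusedSectionVars false

variable {E : Type u} [NormedAddCommGroup E] [NormedSpace ℝ E] [FiniteDimensional ℝ E]
  {N : Type*} [TopologicalSpace N] [ChartedSpace E N] [IsManifold 𝓘(ℝ, E) ∞ N]
  [T2Space N] [SigmaCompactSpace N]
  [RiemannianBundle (fun x : N => TangentSpace 𝓘(ℝ, E) x)]
  [IsContMDiffRiemannianBundle 𝓘(ℝ, E) ∞ E (fun x : N => TangentSpace 𝓘(ℝ, E) x)]
  {f : C^∞⟮𝓘(ℝ, E), N; ℝ⟯} {δ : ModNet ℝ (univ : Set ℝ)}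
  {G : ModTensor (inpwModel E) (N × (ℝ × ℝ))} {J : Set ℝ}
  {c : ModMap (inpwModel E) (N × (ℝ × ℝ)) J} {K : Set N} (C : Coordinates E K)

/-- The `N`-component of a net of curves. -/
def ModMap.pos (c : ModMap (inpwModel E) (N × (ℝ × ℝ)) J) (ε t : ℝ) : N := (c.1 ε t).1

/-- The `u`-component of a net of curves. -/
def ModMap.u (c : ModMap (inpwModel E) (N × (ℝ × ℝ)) J) (ε t : ℝ) : ℝ := (c.1 ε t).2.1

/-- The `v`-component of a net of curves. -/
def ModMap.v (c : ModMap (inpwModel E) (N × (ℝ × ℝ)) J) (ε t : ℝ) : ℝ := (c.1 ε t).2.2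

theorem ModMap.contMDiffAt_pos (hJ : IsOpen J) {ε t : ℝ} (hε : ε ∈ Ioc (0 : ℝ) 1) (ht : t ∈ J) :
    ContMDiffAt 𝓘(ℝ, ℝ) 𝓘(ℝ, E) ∞ (c.pos ε) t :=
  contMDiffAt_fst.comp t (c.contMDiffAt hJ hε ht)

theorem contMDiff_u : ContMDiff (inpwModel E) 𝓘(ℝ, ℝ) ∞ fun q : N × (ℝ × ℝ) => q.2.1 :=
  contDiff_fst.contMDiff.comp contMDiff_snd

theorem contMDiff_v : ContMDiff (inpwModel E) 𝓘(ℝ, ℝ) ∞ fun q : N × (ℝ × ℝ) => q.2.2 :=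
  contDiff_snd.contMDiff.comp contMDiff_snd

theorem contMDiff_comp_fst (f : C^∞⟮𝓘(ℝ, E), N; ℝ⟯) :
    ContMDiff (inpwModel E) 𝓘(ℝ, ℝ) ∞ fun q : N × (ℝ × ℝ) => f q.1 :=
  f.contMDiff.comp contMDiff_fst

theorem ModMap.contDiffAt_u (hJ : IsOpen J) {ε t : ℝ} (hε : ε ∈ Ioc (0 : ℝ) 1) (ht : t ∈ J) :
    ContDiffAt ℝ ∞ (c.u ε) t := c.contDiffAt_comp hJ contMDiff_u hε ht

theorem ModMap.contDiffAt_v (hJ : IsOpen J) {ε t : ℝ} (hε : ε ∈ Ioc (0 : ℝ) 1) (ht : t ∈ J) :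
    ContDiffAt ℝ ∞ (c.v ε) t := c.contDiffAt_comp hJ contMDiff_v hε ht

theorem ModMap.locBounded_snd {L : Set ℝ} (hL : L ⊆ J) :
    LocBounded L c.u ∧ LocBounded L c.v := by
  have key : ∀ K ⊆ L, IsCompact K → ∃ R ε₀ : ℝ, 0 < ε₀ ∧ ∀ ε ∈ Ioo 0 ε₀, ∀ t ∈ K,
      ‖(c.1 ε t).2‖ ≤ R := fun K hK hKc =>
    c.exists_bound (ρ := fun q : N × (ℝ × ℝ) => ‖q.2‖) (continuous_norm.comp continuous_snd)
      (hK.trans hL) hKc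
  constructor <;> intro K hK hKc <;> obtain ⟨R, e, he, h⟩ := key K hK hKc
  · exact ⟨R, e, he, fun ε hε t ht => (norm_fst_le _).trans (h ε hε t ht)⟩
  · exact ⟨R, e, he, fun ε hε t ht => (norm_snd_le _).trans (h ε hε t ht)⟩

theorem Coordinates.exists_norm_chartGrad_le (f : C^∞⟮𝓘(ℝ, E), N; ℝ⟯) : ∃ B ≥ 0, ∀ (i : C.index)
    (x : N), C.weight i (C.toFun x) ≠ 0 →
      ‖chartGrad f (i : N) (extChartAt 𝓘(ℝ, E) (i : N) x)‖ ≤ B := by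
  have h : ∀ i : C.index, ∃ B, ∀ y ∈ extChartAt 𝓘(ℝ, E) (i : N) '' C.core i,
      ‖chartGrad f (i : N) y‖ ≤ B := fun i => by
    obtain ⟨B, hB⟩ := (C.isCompact_chart_core i).bddAbove_image
      (((contDiffOn_chartGrad f.contMDiff (i : N)).continuousOn.mono
        (C.chart_core_subset i)).norm)
    exact ⟨B, fun y hy => hB (mem_image_of_mem _ hy)⟩
  choose B hB using h
  obtain ⟨B', hB', hle⟩ := exists_le_of_fintype B
  exact ⟨B', hB', fun i x hi => (hB i _ (C.chart_mem_core hi)).trans (hle i)⟩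

/-- The geodesic equations for a net of geodesics: `u` is affine, and the equations for the other
components hold, up to negligible errors. -/
theorem IsGeodesicNet.negligible_residual (hG : G ≈ inpwNet f δ) (hJ : IsOpen J)
    (hc : IsGeodesicNet G c) {a b t₀ : ℝ} (ht₀ : t₀ ∈ Icc a b) (hab : Icc a b ⊆ J) {ε₁ : ℝ}
    (hε₁ : 0 < ε₁) (hK : ∀ ε ∈ Ioo 0 ε₁, ∀ t ∈ Icc a b, c.pos ε t ∈ K) :
    NegligibleOn (Icc a b) (fun ε t => c.u ε t - ray c.u t₀ ε t) ∧
    NegligibleOn (Icc a b) (fun ε t => deriv (deriv (c.v ε)) t +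
      (deriv (fun s => f (c.pos ε s)) t * (δ.1 ε (ray c.u t₀ ε t) * deriv (c.u ε) t₀) +
        1 / 2 * f (c.pos ε t) * (deriv (δ.1 ε) (ray c.u t₀ ε t) * deriv (c.u ε) t₀ ^ 2))) ∧
    ∀ m : ℕ, ∃ B ε₀ : ℝ, 0 < ε₀ ∧ ∀ ε ∈ Ioo 0 ε₀, ∀ t ∈ Icc a b, ∀ i : C.index,
      C.weight i (C.toFun (c.pos ε t)) ≠ 0 →
      ‖chartAccel (c.pos ε) (i : N) t -
        (1 / 2 * δ.1 ε (ray c.u t₀ ε t) * deriv (c.u ε) t₀ ^ 2) •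
          chartGrad f (i : N) (extChartAt 𝓘(ℝ, E) (i : N) (c.pos ε t))‖ ≤ B * ε ^ m := by
  have hL : IsCompact (Icc a b) := isCompact_Icc
  have hcov : ∀ ε ∈ Ioo (0 : ℝ) 1, ∀ t ∈ Icc a b, ∀ i : C.index,
      C.weight i (C.toFun (c.pos ε t)) ≠ 0 →
      covAccel (inpwModel E) (inpwTensor f (δ.1 ε)) (c.1 ε) ((i : N), 0) t =
      (chartAccel (c.pos ε) (i : N) t - (1 / 2 * δ.1 ε (c.u ε t) * deriv (c.u ε) t ^ 2) •
          chartGrad f (i : N) (extChartAt 𝓘(ℝ, E) (i : N) (c.pos ε t)),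
        (deriv (deriv (c.u ε)) t, deriv (deriv (c.v ε)) t +
          (deriv (fun s => f (c.pos ε s)) t * δ.1 ε (c.u ε t) * deriv (c.u ε) t +
          1 / 2 * f (c.pos ε t) * deriv (δ.1 ε) (c.u ε t) * deriv (c.u ε) t ^ 2))) := by
    intro ε hε t ht i hi
    have hε' : ε ∈ Ioc (0 : ℝ) 1 := ⟨hε.1, hε.2.le⟩
    exact covAccel_inpwTensor f.contMDiff ((δ.contDiff hε').differentiable (by simp))
      (x := c.pos ε) (u := c.u ε) (v := c.v ε) (p := ((i : N), 0))
      (by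
        filter_upwards [hJ.mem_nhds (hab ht)] with s hs using ModMap.contMDiffAt_pos hJ hε' hs)
      (ModMap.contDiffAt_u hJ hε' (hab ht)) (ModMap.contDiffAt_v hJ hε' (hab ht))
      (C.mem_source hi)
  have hres := fun m => hc.exists_covAccel_inpwNet_le C hG hJ hab hL m
  have h2 : NegligibleOn (Icc a b) fun ε => deriv (deriv (c.u ε)) := by
    rw [negligibleOn_iff_of_isCompact hL]
    intro m
    obtain ⟨B, e, he, H⟩ := hres m
    refine ⟨B, min e (min 1 ε₁), by positivity, fun ε hε t ht => ?_⟩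
    obtain ⟨hε0, hlt⟩ := hε
    simp only [lt_min_iff] at hlt
    obtain ⟨i, hi⟩ := C.exists_weight_ne_zero (hK ε ⟨hε0, hlt.2.2⟩ t ht)
    have := H ε ⟨hε0, hlt.1⟩ t ht i hi
    rw [hcov ε ⟨hε0, hlt.2.1⟩ t ht i hi] at this
    exact (norm_fst_le _).trans ((norm_snd_le _).trans this)
  have h3 : NegligibleOn (Icc a b) fun ε t => deriv (deriv (c.v ε)) t +
      (deriv (fun s => f (c.pos ε s)) t * δ.1 ε (c.u ε t) * deriv (c.u ε) t +
        1 / 2 * f (c.pos ε t) * deriv (δ.1 ε) (c.u ε t) * deriv (c.u ε) t ^ 2) := by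
    rw [negligibleOn_iff_of_isCompact hL]
    intro m
    obtain ⟨B, e, he, H⟩ := hres m
    refine ⟨B, min e (min 1 ε₁), by positivity, fun ε hε t ht => ?_⟩
    obtain ⟨hε0, hlt⟩ := hε
    simp only [lt_min_iff] at hlt
    obtain ⟨i, hi⟩ := C.exists_weight_ne_zero (hK ε ⟨hε0, hlt.2.2⟩ t ht)
    have := H ε ⟨hε0, hlt.1⟩ t ht i hi
    rw [hcov ε ⟨hε0, hlt.2.1⟩ t ht i hi] at this
    exact (norm_snd_le _).trans ((norm_snd_le _).trans this)
  obtain ⟨n1, n2, n3, n4⟩ := negligibleOn_kicks_sub (δ := δ) ht₀ (u := c.u)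
    (fun ε hε t ht => ModMap.contDiffAt_u hJ ⟨hε.1, hε.2.le⟩ (hab ht))
    (ModMap.locBounded_snd hab).1 (c.polyBdd_deriv hJ contMDiff_u hab hL) h2
  refine ⟨n1, ?_, fun m => ?_⟩
  · have p1 : PolyBdd (Icc a b) fun ε t => ‖deriv (fun s => f (c.pos ε s)) t‖ :=
      c.polyBdd_deriv hJ (contMDiff_comp_fst f) hab hL
    have p2 : PolyBdd (Icc a b) fun ε t => ‖1 / 2 * f (c.pos ε t)‖ := by
      refine PolyBdd.norm_mul (g := fun _ _ => 1 / 2) (PolyBdd.const _) ?_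
      obtain ⟨m, B, e, he, H⟩ := c.2.2 (fun q => f q.1) (contMDiff_comp_fst f) _ hab hL 0
      exact ⟨m, B, e, he, fun ε hε t ht => by
        have := H ε hε t ht
        rwa [norm_iteratedFDeriv_zero] at this⟩
    exact ((h3.add (n3.mul_polyBdd hL p1).neg).add (n4.mul_polyBdd hL p2).neg).congr
      fun ε t _ => by ring
  · obtain ⟨B, e, he, H⟩ := hres m
    obtain ⟨D, hD, hgrad⟩ := C.exists_norm_chartGrad_le f
    obtain ⟨B', e', he', H'⟩ := n2 _ le_rfl hL m
    refine ⟨B + 1 / 2 * B' * D, min (min e e') 1, by positivity, fun ε hε t ht i hi => ?_⟩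
    obtain ⟨hε0, hlt⟩ := hε
    simp only [lt_min_iff] at hlt
    have a1 := H ε ⟨hε0, hlt.1.1⟩ t ht i hi
    rw [hcov ε ⟨hε0, hlt.2⟩ t ht i hi] at a1
    have a2 := (norm_fst_le _).trans a1
    have a3 := H' ε ⟨hε0, hlt.1.2⟩ t ht
    set g := chartGrad f (i : N) (extChartAt 𝓘(ℝ, E) (i : N) (c.pos ε t)) with hg
    have e1 : chartAccel (c.pos ε) (i : N) t -
        (1 / 2 * δ.1 ε (ray c.u t₀ ε t) * deriv (c.u ε) t₀ ^ 2) • g =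
        (chartAccel (c.pos ε) (i : N) t - (1 / 2 * δ.1 ε (c.u ε t) * deriv (c.u ε) t ^ 2) • g) +
        (1 / 2 * (δ.1 ε (c.u ε t) * deriv (c.u ε) t ^ 2 -
          δ.1 ε (ray c.u t₀ ε t) * deriv (c.u ε) t₀ ^ 2)) • g := by
      rw [mul_sub, sub_smul, mul_assoc, mul_assoc]; abel
    rw [e1]
    refine (norm_add_le _ _).trans ?_
    rw [norm_smul, norm_mul, add_mul]
    have hn : ‖(1 / 2 : ℝ)‖ = 1 / 2 := Real.norm_of_nonneg (by norm_num)
    have a4 : ‖g‖ ≤ D := hgrad i _ hi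
    refine add_le_add a2 ?_
    rw [hn]
    calc _ ≤ 1 / 2 * (B' * ε ^ m) * D := by
          gcongr
          exact mul_nonneg (by norm_num) ((norm_nonneg _).trans a3)
      _ = _ := by ring

end Residual

/-- Strict delta nets, up to the normalization of the integral. -/
def IsDeltaNet (δ : ModNet ℝ (univ : Set ℝ)) (C : ℝ) : Prop :=
  ∀ ε ∈ Ioc (0 : ℝ) 1, tsupport (δ.1 ε) ⊆ Ioo (-ε) ε ∧ ∫ x, |δ.1 ε x| ≤ C

theorem IsDeltaNet.hasCompactSupport {δ : ModNet ℝ (univ : Set ℝ)} {C : ℝ} (h : IsDeltaNet δ C)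
    {ε : ℝ} (hε : ε ∈ Ioc (0 : ℝ) 1) : HasCompactSupport (δ.1 ε) :=
  HasCompactSupport.of_support_subset_isCompact isCompact_Icc
    ((subset_tsupport _).trans ((h ε hε).1.trans Ioo_subset_Icc_self))

theorem IsDeltaNet.nonneg {δ : ModNet ℝ (univ : Set ℝ)} {C : ℝ} (h : IsDeltaNet δ C) : 0 ≤ C :=
  (MeasureTheory.integral_nonneg fun _ => abs_nonneg _).trans (h 1 ⟨one_pos, le_rfl⟩).2

theorem contDiffOn_deriv_param {V : Type*} [NormedAddCommGroup V] [NormedSpace ℝ V] {U J : Set ℝ}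
    (hU : IsOpen U) (hJ : IsOpen J) {w : ℝ → ℝ → V}
    (hw : ContDiffOn ℝ ∞ (fun q : ℝ × ℝ => w q.1 q.2) (U ×ˢ J)) :
    ContDiffOn ℝ ∞ (fun q : ℝ × ℝ => deriv (w q.1) q.2) (U ×ˢ J) := by
  have h1 := hw.fderiv_of_isOpen (m := ∞) (hU.prod hJ) (by simp)
  refine (h1.clm_apply (contDiffOn_const (c := ((0, 1) : ℝ × ℝ)))).congr fun q hq => ?_
  have h2 : HasFDerivAt (fun q : ℝ × ℝ => w q.1 q.2) _ q :=
    ((hw.contDiffAt ((hU.prod hJ).mem_nhds hq)).differentiableAt (by simp)).hasFDerivAt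
  have h3 : HasDerivAt (fun s : ℝ => ((q.1, s) : ℝ × ℝ)) (0, 1) q.2 :=
    (hasDerivAt_const _ _).prodMk (hasDerivAt_id _)
  exact (HasFDerivAt.comp_hasDerivAt (l := fun q : ℝ × ℝ => w q.1 q.2)
    (f := fun s : ℝ => ((q.1, s) : ℝ × ℝ)) q.2 h2 h3).deriv

section Wave

set_option linter.unusedSectionVars false

variable {E : Type u} [NormedAddCommGroup E] [NormedSpace ℝ E] [FiniteDimensional ℝ E]
  {N : Type*} [MetricSpace N] [SigmaCompactSpace N] [ChartedSpace E N] [IsManifold 𝓘(ℝ, E) ∞ N]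
  [RiemannianBundle (fun x : N => TangentSpace 𝓘(ℝ, E) x)]
  [IsContMDiffRiemannianBundle 𝓘(ℝ, E) ∞ E (fun x : N => TangentSpace 𝓘(ℝ, E) x)]
  [IsRiemannianManifold 𝓘(ℝ, E) N] [CompleteSpace N]
  {f : C^∞⟮𝓘(ℝ, E), N; ℝ⟯} {δ : ModNet ℝ (univ : Set ℝ)} {C₀ : ℝ}
  {G : ModTensor (inpwModel E) (N × (ℝ × ℝ))} {J : Set ℝ}
  {c : ModMap (inpwModel E) (N × (ℝ × ℝ)) J} {t₀ : ℝ}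

theorem ModMap.exists_dist_le (x₀ : N) {L : Set ℝ} (hLJ : L ⊆ J)
    (hLc : IsCompact L) :
    ∃ R ε₀ : ℝ, 0 < ε₀ ∧ ∀ ε ∈ Ioo 0 ε₀, ∀ t ∈ L, dist (c.pos ε t) x₀ ≤ R :=
  c.exists_bound (ρ := fun q : N × (ℝ × ℝ) => dist q.1 x₀)
    (continuous_fst.dist continuous_const) hLJ hLc

/-- Bounds for the initial data. -/
theorem ModMap.exists_initial_bound (hJ : IsOpen J) (ht₀ : t₀ ∈ J)
    (hb : BoundedVelocityAt (Quotient.mk _ c : GenMap (inpwModel E) (N × (ℝ × ℝ)) J) t₀) (x₀ : N) :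
    ∃ V R₀ S₀ ε₀ : ℝ, 0 ≤ V ∧ 0 ≤ R₀ ∧ 0 ≤ S₀ ∧ 0 < ε₀ ∧ ε₀ ≤ 1 ∧ ∀ ε ∈ Ioo 0 ε₀,
      |c.u ε t₀| ≤ V ∧ |deriv (c.u ε) t₀| ≤ V ∧ dist (c.pos ε t₀) x₀ ≤ R₀ ∧
      √(speedSq E (c.pos ε) t₀) ≤ S₀ := by
  have := properSpace_of_completeSpace E (N := N)
  obtain ⟨R, e₁, he₁, h1⟩ := ModMap.exists_dist_le (c := c) x₀ (L := {t₀})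
    (by simpa using ht₀) isCompact_singleton
  obtain ⟨C⟩ := exists_coordinates (E := E) (isCompact_closedBall x₀ R)
  obtain ⟨B, hB, h2⟩ := C.exists_sqrt_speedSq_le
  obtain ⟨D, e₂, he₂, h3⟩ := c.bounded_deriv hJ (C.contMDiff.comp contMDiff_fst) ht₀ hb
  obtain ⟨V, e₃, he₃, h4⟩ := c.bounded_deriv hJ contMDiff_u ht₀ hb
  obtain ⟨V', e₄, he₄, h5⟩ := (ModMap.locBounded_snd (c := c) (L := {t₀})
    (by simpa using ht₀)).1 _ le_rfl isCompact_singleton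
  refine ⟨max (max V V') 0, max R 0, max (B * D) 0, min (min e₁ e₂) (min e₃ (min e₄ 1)),
    le_max_right _ _, le_max_right _ _, le_max_right _ _, by positivity,
    (min_le_right _ _).trans ((min_le_right _ _).trans (min_le_right _ _)), fun ε hε => ?_⟩
  obtain ⟨hε0, hlt⟩ := hε
  simp only [lt_min_iff] at hlt
  have a1 := h1 ε ⟨hε0, hlt.1.1⟩ t₀ rfl
  refine ⟨(h5 ε ⟨hε0, hlt.2.2.1⟩ t₀ rfl).trans ((le_max_right _ _).trans (le_max_left _ _)),
    (h4 ε ⟨hε0, hlt.2.1⟩).trans ((le_max_left _ _).trans (le_max_left _ _)),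
    a1.trans (le_max_left _ _), ?_⟩
  refine le_max_of_le_left ((h2 (c.pos ε) t₀
    (ModMap.contMDiffAt_pos hJ ⟨hε0, hlt.2.2.2.le⟩ ht₀) a1).trans ?_)
  gcongr
  exact h3 ε ⟨hε0, hlt.1.2⟩

/-- The acceleration factor `½ δ(u) u'²` along the linearization of `u`. -/
noncomputable def kick (δ : ModNet ℝ (univ : Set ℝ)) (u : ℝ → ℝ → ℝ) (t₀ ε t : ℝ) : ℝ :=
  1 / 2 * δ.1 ε (ray u t₀ ε t) * deriv (u ε) t₀ ^ 2

theorem continuous_kick (u : ℝ → ℝ → ℝ) {ε : ℝ} (hε : ε ∈ Ioc (0 : ℝ) 1) :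
    Continuous (kick δ u t₀ ε) := by
  have h1 : Continuous (ray u t₀ ε) := by unfold ray; fun_prop
  exact (((δ.contDiff hε).continuous.comp h1).const_mul _ |>.mul_const _)

theorem IsDeltaNet.integral_kick_le (hδ : IsDeltaNet δ C₀) {u : ℝ → ℝ → ℝ} {ε V : ℝ}
    (hε : ε ∈ Ioc (0 : ℝ) 1) (hu : |deriv (u ε) t₀| ≤ V) {a b : ℝ} (hab : a ≤ b) :
    ∫ t in a..b, |kick δ u t₀ ε t| ≤ 1 / 2 * C₀ * V :=
  (integral_abs_comp_affine_le (δ.contDiff hε).continuous (hδ.hasCompactSupport hε) (hδ ε hε).2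
    (u ε t₀) (deriv (u ε) t₀) t₀ a b hab).trans (by have := hδ.nonneg; gcongr)

theorem IsGeodesicNet.exists_speed_bound (hδ : IsDeltaNet δ C₀) (hG : G ≈ inpwNet f δ)
    (hJ : IsOpen J) (hc : IsGeodesicNet G c) {a b : ℝ} (ht₀ : t₀ ∈ Icc a b) (hab : Icc a b ⊆ J)
    (hb : BoundedVelocityAt (Quotient.mk _ c : GenMap (inpwModel E) (N × (ℝ × ℝ)) J) t₀) :
    ∃ S ε₀ : ℝ, 0 < ε₀ ∧ ∀ ε ∈ Ioo 0 ε₀, ∀ t ∈ Icc a b, √(speedSq E (c.pos ε) t) ≤ S := by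
  have := properSpace_of_completeSpace E (N := N)
  rcases isEmpty_or_nonempty N with hN | ⟨⟨x₀⟩⟩
  · exact ⟨0, 1, one_pos, fun ε _ t _ => hN.elim (c.pos ε t)⟩
  obtain ⟨R, e₁, he₁, h1⟩ := ModMap.exists_dist_le (c := c) x₀ hab isCompact_Icc
  obtain ⟨C⟩ := exists_coordinates (E := E) (isCompact_closedBall x₀ R)
  obtain ⟨V, R₀, S₀, e₂, hV, hR₀, hS₀, he₂, he₂1, h2⟩ :=
    ModMap.exists_initial_bound hJ (hab ht₀) hb x₀
  obtain ⟨D, e₃, he₃, h3⟩ := (hc.negligible_residual C hG hJ ht₀ hab he₁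
    fun ε hε t ht => h1 ε hε t ht).2.2 0
  obtain ⟨B, hB, hF⟩ := exists_gradBound f.contMDiff (isCompact_closedBall x₀ R)
  obtain ⟨Q, hQ, hQ'⟩ := C.exists_sqrt_metricCoeff_le
  have hle : a ≤ b := ht₀.1.trans ht₀.2
  refine ⟨S₀ + (B * (1 / 2 * C₀ * V) + Q * |D| * (b - a)), min e₁ (min e₂ e₃), by positivity,
    fun ε hε t ht => ?_⟩
  obtain ⟨hε0, hlt⟩ := hε
  simp only [lt_min_iff] at hlt
  have hε1 : ε ∈ Ioc (0 : ℝ) 1 := ⟨hε0, (hlt.2.1.trans_le he₂1).le⟩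
  obtain ⟨-, hu₁, -, hs⟩ := h2 ε ⟨hε0, hlt.2.1⟩
  have hκ := continuous_kick (δ := δ) (t₀ := t₀) c.u hε1
  have hder : ∀ r ∈ Icc a b, HasDerivAt (speedSq E (c.pos ε)) (deriv (speedSq E (c.pos ε)) r) r ∧
      |deriv (speedSq E (c.pos ε)) r| ≤ 2 * (B * |kick δ c.u t₀ ε r| + Q * |D|) *
        √(speedSq E (c.pos ε) r) := by
    intro r hr
    have hrK := h1 ε ⟨hε0, hlt.1⟩ r hr
    obtain ⟨i, hi⟩ := C.exists_weight_ne_zero (x := c.pos ε r) hrK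
    refine abs_deriv_speedSq_le (κ := kick δ c.u t₀ ε r) (F := f) (p := (i : N)) ?_
      (C.mem_source hi) hrK hF
      (e := chartAccel (c.pos ε) (i : N) r - kick δ c.u t₀ ε r •
        chartGrad f (i : N) (extChartAt 𝓘(ℝ, E) (i : N) (c.pos ε r))) (by abel) ?_
    · filter_upwards [hJ.mem_nhds (hab hr)] with s hs using ModMap.contMDiffAt_pos hJ hε1 hs
    · refine (hQ' i _ hi _).trans ?_
      gcongr
      have := h3 ε ⟨hε0, hlt.2.2⟩ r hr i hi
      rw [pow_zero, mul_one] at this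
      exact this.trans (le_abs_self _)
  have key := sqrt_le_sqrt_add_integral (a := a) (b := b) (e := speedSq E (c.pos ε))
    (e' := deriv (speedSq E (c.pos ε))) (k := fun r => B * |kick δ c.u t₀ ε r| + Q * |D|)
    (by fun_prop) (fun r => by positivity) (fun r hr => (hder r hr).1)
    (fun r _ => speedSq_nonneg _ r) (fun r hr => (hder r hr).2) ht₀ ht
  refine key.trans (add_le_add hs ?_)
  rw [intervalIntegral.integral_add ((hκ.abs.const_mul B).intervalIntegrable _ _)
    intervalIntegrable_const, intervalIntegral.integral_const_mul, intervalIntegral.integral_const,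
    smul_eq_mul, mul_comm (b - a)]
  gcongr
  exact hδ.integral_kick_le hε1 hu₁ hle

end Wave

section Wave

set_option linter.unusedSectionVars false

variable {E : Type u} [NormedAddCommGroup E] [NormedSpace ℝ E] [FiniteDimensional ℝ E]
  {N : Type*} [MetricSpace N] [SigmaCompactSpace N] [ChartedSpace E N] [IsManifold 𝓘(ℝ, E) ∞ N]
  [RiemannianBundle (fun x : N => TangentSpace 𝓘(ℝ, E) x)]
  [IsContMDiffRiemannianBundle 𝓘(ℝ, E) ∞ E (fun x : N => TangentSpace 𝓘(ℝ, E) x)]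
  [IsRiemannianManifold 𝓘(ℝ, E) N] [CompleteSpace N]
  {f : C^∞⟮𝓘(ℝ, E), N; ℝ⟯} {δ : ModNet ℝ (univ : Set ℝ)} {C₀ : ℝ}
  {J : Set ℝ} {c : ModMap (inpwModel E) (N × (ℝ × ℝ)) J} {t₀ : ℝ}

theorem ModMap.contDiffOn_snd : ContDiffOn ℝ ∞ (fun q : ℝ × ℝ => (c.1 q.1 q.2).2)
    (Ioo (0 : ℝ) 1 ×ˢ J) := by
  have h1 : ContMDiff (inpwModel E) 𝓘(ℝ, ℝ × ℝ) ∞ fun q : N × (ℝ × ℝ) => q.2 := contMDiff_snd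
  exact ((h1.comp_contMDiffOn c.2.1).contDiffOn).mono (prod_mono Ioo_subset_Ioc_self le_rfl)

theorem contDiffOn_eval_param {V : Type*} [NormedAddCommGroup V] [NormedSpace ℝ V] {U : Set ℝ}
    {w : ℝ → ℝ → V} (hw : ContDiffOn ℝ ∞ (fun q : ℝ × ℝ => w q.1 q.2) (U ×ˢ J)) (ht₀ : t₀ ∈ J) :
    ContDiffOn ℝ ∞ (fun q : ℝ × ℝ => w q.1 t₀) (U ×ˢ univ) :=
  hw.comp (contDiff_fst.prodMk contDiff_const).contDiffOn fun _ hq => ⟨hq.1, ht₀⟩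

theorem contDiffOn_ray {u : ℝ → ℝ → ℝ} (hJ : IsOpen J)
    (hu : ContDiffOn ℝ ∞ (fun q : ℝ × ℝ => u q.1 q.2) (Ioo (0 : ℝ) 1 ×ˢ J)) (ht₀ : t₀ ∈ J) :
    ContDiffOn ℝ ∞ (fun q : ℝ × ℝ => ray u t₀ q.1 q.2) (Ioo (0 : ℝ) 1 ×ˢ univ) :=
  (contDiffOn_eval_param hu ht₀).add ((contDiffOn_eval_param (w := fun ε => deriv (u ε))
    (contDiffOn_deriv_param isOpen_Ioo hJ hu) ht₀).mul
      (contDiff_snd.sub contDiff_const).contDiffOn)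

theorem contDiffOn_net_ray {u : ℝ → ℝ → ℝ} (hJ : IsOpen J)
    (hu : ContDiffOn ℝ ∞ (fun q : ℝ × ℝ => u q.1 q.2) (Ioo (0 : ℝ) 1 ×ˢ J)) (ht₀ : t₀ ∈ J) :
    ContDiffOn ℝ ∞ (fun q : ℝ × ℝ => δ.1 q.1 (ray u t₀ q.1 q.2)) (Ioo (0 : ℝ) 1 ×ˢ univ) := by
  have h1 : ContDiffOn ℝ ∞ (fun q : ℝ × ℝ => δ.1 q.1 q.2) (Ioc (0 : ℝ) 1 ×ˢ univ) := δ.2.1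
  exact h1.comp (contDiff_fst.contDiffOn.prodMk (contDiffOn_ray hJ hu ht₀)) fun q hq =>
    ⟨Ioo_subset_Ioc_self hq.1, mem_univ _⟩

theorem contDiffOn_kick {u : ℝ → ℝ → ℝ} (hJ : IsOpen J)
    (hu : ContDiffOn ℝ ∞ (fun q : ℝ × ℝ => u q.1 q.2) (Ioo (0 : ℝ) 1 ×ˢ J)) (ht₀ : t₀ ∈ J) :
    ContDiffOn ℝ ∞ (fun q : ℝ × ℝ => kick δ u t₀ q.1 q.2) (Ioo (0 : ℝ) 1 ×ˢ univ) :=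
  (contDiffOn_const.mul (contDiffOn_net_ray hJ hu ht₀)).mul
    ((contDiffOn_eval_param (w := fun ε => deriv (u ε)) (contDiffOn_deriv_param isOpen_Ioo hJ hu) ht₀).pow 2)

/-- A smooth family of compactly supported functions that exhausts `f`. -/
theorem exists_cutoff_family [ProperSpace N] [Nonempty N] (f : C^∞⟮𝓘(ℝ, E), N; ℝ⟯) :
    ∃ F : ℝ → N → ℝ, ContMDiff (𝓘(ℝ, ℝ).prod 𝓘(ℝ, E)) 𝓘(ℝ, ℝ) ∞ (fun z : ℝ × N => F z.1 z.2) ∧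
      (∀ ε > 0, HasCompactSupport (F ε)) ∧ ∀ K : Set N, IsCompact K →
        ∃ ε₀ > 0, ∀ ε ∈ Ioo 0 ε₀, ∀ x ∈ K, F ε =ᶠ[𝓝 x] f := by
  obtain ⟨x₀⟩ := ‹Nonempty N›
  obtain ⟨ρ, hρ, hle⟩ := exists_contMDiff_ge 𝓘(ℝ, E) (ρ := fun x : N => dist x x₀)
    (continuous_id.dist continuous_const) monotone_id
  refine ⟨fun ε x => Real.smoothTransition (2 - ε * ρ x) * f x, ?_, fun ε hε => ?_, fun K hK => ?_⟩
  · have h1 : ContMDiff (𝓘(ℝ, ℝ).prod 𝓘(ℝ, E)) 𝓘(ℝ, ℝ) ∞ (fun z : ℝ × N => 2 - z.1 * ρ z.2) :=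
      contMDiff_const.sub (contMDiff_fst.mul (hρ.comp contMDiff_snd))
    have h2 : ContMDiff 𝓘(ℝ, ℝ) 𝓘(ℝ, ℝ) ∞ Real.smoothTransition :=
      Real.smoothTransition.contDiff.contMDiff
    exact (h2.comp h1).mul (f.contMDiff.comp contMDiff_snd)
  · refine HasCompactSupport.of_support_subset_isCompact
      (isCompact_closedBall x₀ (2 / ε)) fun x hx => ?_
    have h1 : ¬ (2 - ε * ρ x ≤ 0) := fun h =>
      hx (by beta_reduce; rw [Real.smoothTransition.zero_of_nonpos h, zero_mul])
    have h2 : dist x x₀ ≤ ρ x := hle x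
    rw [Metric.mem_closedBall, le_div_iff₀ hε]
    nlinarith
  · obtain ⟨M, hM⟩ := hK.bddAbove_image hρ.continuous.continuousOn
    refine ⟨1 / (|M| + 1), by positivity, fun ε hε x hx => ?_⟩
    have h1 : ρ x ≤ M := hM (mem_image_of_mem _ hx)
    have h2 : ε * (|M| + 1) < 1 := by
      have := hε.2
      rwa [lt_div_iff₀ (by positivity)] at this
    have h3 : ε * ρ x < 1 := by nlinarith [hε.1, le_abs_self M]
    have h4 : ∀ᶠ y in 𝓝 x, ε * ρ y < 1 :=
      (continuous_const.mul hρ.continuous).continuousAt.eventually_lt continuousAt_const h3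
    filter_upwards [h4] with y hy
    rw [Real.smoothTransition.one_of_one_le (by linarith), one_mul]

/-- The `N`-component of the geodesics of the wave, launched from the jet of `c` at `t₀`. -/
structure WaveFamily (f : C^∞⟮𝓘(ℝ, E), N; ℝ⟯) (δ : ModNet ℝ (univ : Set ℝ))
    (c : ModMap (inpwModel E) (N × (ℝ × ℝ)) J) (t₀ : ℝ) where
  /-- the net of curves -/
  curve : ℝ → ℝ → N
  smooth : SmoothFamily E (Ioo 0 1) univ curve
  sameJet : ∀ ε ∈ Ioo (0 : ℝ) 1, SameJet E (curve ε) (c.pos ε) t₀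
  bound : ∀ T, 0 ≤ T → ∃ (K : Set N) (S ε₁ : ℝ), IsCompact K ∧ 0 < ε₁ ∧ ε₁ ≤ 1 ∧
    ∀ ε ∈ Ioo 0 ε₁, ∀ t, |t - t₀| ≤ T → curve ε t ∈ K ∧ √(speedSq E (curve ε) t) ≤ S ∧
      ∀ p, curve ε t ∈ (extChartAt 𝓘(ℝ, E) p).source → chartAccel (curve ε) p t =
        kick δ c.u t₀ ε t • chartGrad f p (extChartAt 𝓘(ℝ, E) p (curve ε t))

theorem chartGrad_congr {F F' : N → ℝ} {p x : N} (hp : x ∈ (extChartAt 𝓘(ℝ, E) p).source)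
    (h : F =ᶠ[𝓝 x] F') : chartGrad F p (extChartAt 𝓘(ℝ, E) p x) =
      chartGrad F' p (extChartAt 𝓘(ℝ, E) p x) := by
  have h1 : Tendsto (extChartAt 𝓘(ℝ, E) p).symm (𝓝 (extChartAt 𝓘(ℝ, E) p x)) (𝓝 x) := by
    have h2 := continuousAt_extChartAt_symm' (I := 𝓘(ℝ, E)) hp
    rwa [ContinuousAt, (extChartAt 𝓘(ℝ, E) p).left_inv hp] at h2
  have h3 : (fun z => F ((extChartAt 𝓘(ℝ, E) p).symm z)) =ᶠ[𝓝 (extChartAt 𝓘(ℝ, E) p x)]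
      fun z => F' ((extChartAt 𝓘(ℝ, E) p).symm z) := h1.eventually h
  rw [chartGrad, chartGrad, h3.fderiv_eq]

theorem nonempty_waveFamily [Nonempty N] (hδ : IsDeltaNet δ C₀) (hJ : IsOpen J) (ht₀ : t₀ ∈ J)
    (hb : BoundedVelocityAt (Quotient.mk _ c : GenMap (inpwModel E) (N × (ℝ × ℝ)) J) t₀) :
    Nonempty (WaveFamily f δ c t₀) := by
  have := properSpace_of_completeSpace E (N := N)
  have hu : ContDiffOn ℝ ∞ (fun q : ℝ × ℝ => c.u q.1 q.2) (Ioo (0 : ℝ) 1 ×ˢ J) :=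
    ModMap.contDiffOn_snd.fst
  have hκ := contDiffOn_kick (δ := δ) hJ hu ht₀
  obtain ⟨F, hF, hFc, hFf⟩ := exists_cutoff_family f
  have hcpos : SmoothFamily E (Ioo 0 1) J c.pos := by
    have h1 : ContMDiff (inpwModel E) 𝓘(ℝ, E) ∞ fun q : N × (ℝ × ℝ) => q.1 := contMDiff_fst
    exact (h1.comp_contMDiffOn c.2.1).mono (prod_mono Ioo_subset_Ioc_self le_rfl)
  obtain ⟨X, hX, hj⟩ := exists_global_forcedGeodesic isOpen_Ioo hκ
    (hF.contMDiffOn (s := Ioo (0 : ℝ) 1 ×ˢ univ)) (fun ε hε => hFc ε hε.1) hJ hcpos ht₀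
  refine ⟨⟨X, hX.1, hj, fun T hT => ?_⟩⟩
  obtain ⟨x₀⟩ := ‹Nonempty N›
  obtain ⟨V, R₀, S₀, e₁, hV, -, hS₀, he₁, he₁1, h1⟩ := ModMap.exists_initial_bound hJ ht₀ hb x₀
  obtain ⟨R, S, e₂, he₂, h2⟩ := exists_forcedGeodesic_bound f.contMDiff x₀ hδ.nonneg hV hS₀ hT
  obtain ⟨e₃, he₃, h3⟩ := hFf _ (isCompact_closedBall x₀ R)
  refine ⟨Metric.closedBall x₀ R, S, min e₁ (min e₂ e₃), isCompact_closedBall x₀ R, by positivity,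
    (min_le_left _ _).trans he₁1, fun ε hε t ht => ?_⟩
  obtain ⟨hε0, hlt⟩ := hε
  simp only [lt_min_iff] at hlt
  have hε1 : ε ∈ Ioo (0 : ℝ) 1 := ⟨hε0, hlt.1.trans_le he₁1⟩
  obtain ⟨-, hu₁, hd, hs⟩ := h1 ε ⟨hε0, hlt.1⟩
  have hsol : ForcedGeodesic E (fun t => kick δ c.u t₀ ε t) (F ε) (X ε) := fun t =>
    (isSolution_forcedGeodesicField_iff isOpen_Ioo hκ _).1 (hX.2 ε hε1 t (mem_univ _))
  have key := h2 ε ⟨hε0, hlt.2.1⟩ (δ.1 ε) (δ.contDiff (Ioo_subset_Ioc_self hε1)).continuous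
    (hδ ε (Ioo_subset_Ioc_self hε1)).1 (hδ ε (Ioo_subset_Ioc_self hε1)).2 (c.u ε t₀)
    (deriv (c.u ε) t₀) t₀ hu₁ (F ε) (X ε) (h3 ε ⟨hε0, hlt.2.2⟩) hsol
    (by rw [(hj ε hε1).1]; exact hd) (by rw [(hj ε hε1).speedSq_eq]; exact hs) t ht
  refine ⟨key.1, key.2, fun p hp => ?_⟩
  rw [(hsol t).2 p hp, chartGrad_congr hp (h3 ε ⟨hε0, hlt.2.2⟩ _ key.1)]

end Wave

section Lift

/-- The solution of `v'' = -(g' p + ½ g p')` with initial data `v₀`, `v₁` at `t₀`. -/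
noncomputable def lift (g p : ℝ → ℝ → ℝ) (t₀ : ℝ) (v₀ v₁ : ℝ → ℝ) (ε t : ℝ) : ℝ :=
  v₀ ε + (v₁ ε + 1 / 2 * (g ε t₀ * p ε t₀)) * (t - t₀) - 1 / 2 * (∫ s in t₀..t, g ε s * p ε s) -
    1 / 2 * ∫ s in t₀..t, ∫ r in t₀..s, deriv (g ε) r * p ε r

variable {Λ : Set ℝ} {g p : ℝ → ℝ → ℝ} {t₀ : ℝ} {v₀ v₁ : ℝ → ℝ}

theorem contDiff_of_param {V : Type*} [NormedAddCommGroup V] [NormedSpace ℝ V] {w : ℝ → ℝ → V}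
    (hw : ContDiffOn ℝ ∞ (fun q : ℝ × ℝ => w q.1 q.2) (Λ ×ˢ univ)) {ε : ℝ} (hε : ε ∈ Λ) :
    ContDiff ℝ ∞ (w ε) := by
  rw [← contDiffOn_univ]
  exact hw.comp (contDiff_const.prodMk contDiff_id).contDiffOn fun t _ => ⟨hε, mem_univ _⟩

theorem contDiffOn_lift (hΛ : IsOpen Λ)
    (hg : ContDiffOn ℝ ∞ (fun q : ℝ × ℝ => g q.1 q.2) (Λ ×ˢ univ))
    (hp : ContDiffOn ℝ ∞ (fun q : ℝ × ℝ => p q.1 q.2) (Λ ×ˢ univ))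
    (hv₀ : ContDiffOn ℝ ∞ (fun q : ℝ × ℝ => v₀ q.1) (Λ ×ˢ univ))
    (hv₁ : ContDiffOn ℝ ∞ (fun q : ℝ × ℝ => v₁ q.1) (Λ ×ˢ univ)) :
    ContDiffOn ℝ ∞ (fun q : ℝ × ℝ => lift g p t₀ v₀ v₁ q.1 q.2) (Λ ×ˢ univ) := by
  have h0 : ContDiffOn ℝ ∞ (fun q : ℝ × ℝ => g q.1 q.2 * p q.1 q.2) (Λ ×ˢ univ) := hg.mul hp
  have h1 := contDiffOn_primitive hΛ h0 t₀
  have h2 := contDiffOn_primitive hΛ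
    (contDiffOn_primitive hΛ ((contDiffOn_deriv_param hΛ isOpen_univ hg).mul hp) t₀) t₀
  have h3 := contDiffOn_eval_param (J := univ) (w := fun ε t => g ε t * p ε t) h0 (mem_univ t₀)
  exact ((hv₀.add ((hv₁.add (contDiffOn_const.mul h3)).mul
    (contDiff_snd.sub contDiff_const).contDiffOn)).sub (contDiffOn_const.mul h1)).sub
      (contDiffOn_const.mul h2)

theorem hasDerivAt_lift {ε : ℝ} (hg : ContDiff ℝ ∞ (g ε)) (hp : ContDiff ℝ ∞ (p ε)) (t : ℝ) :
    HasDerivAt (lift g p t₀ v₀ v₁ ε) (v₁ ε + 1 / 2 * (g ε t₀ * p ε t₀) - 1 / 2 * (g ε t * p ε t) -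
      1 / 2 * ∫ r in t₀..t, deriv (g ε) r * p ε r) t := by
  have hg' : Continuous (deriv (g ε)) := hg.continuous_deriv (by simp)
  have hc : Continuous fun r => deriv (g ε) r * p ε r := hg'.mul hp.continuous
  have hi : Continuous fun s => ∫ r in t₀..s, deriv (g ε) r * p ε r :=
    continuous_iff_continuousAt.2 fun s => (hc.integral_hasStrictDerivAt t₀ s).hasDerivAt.continuousAt
  have h1 := ((hg.continuous.mul hp.continuous).integral_hasStrictDerivAt t₀ t).hasDerivAt
  have h2 := (hi.integral_hasStrictDerivAt t₀ t).hasDerivAt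
  have h3 := (((hasDerivAt_id t).sub_const t₀).const_mul
    (v₁ ε + 1 / 2 * (g ε t₀ * p ε t₀))).const_add (v₀ ε)
  have h4 := (h3.sub (h1.const_mul (1 / 2))).sub (h2.const_mul (1 / 2))
  rw [mul_one] at h4
  exact h4

theorem deriv_lift {ε : ℝ} (hg : ContDiff ℝ ∞ (g ε)) (hp : ContDiff ℝ ∞ (p ε)) :
    deriv (lift g p t₀ v₀ v₁ ε) = fun t => v₁ ε + 1 / 2 * (g ε t₀ * p ε t₀) -
      1 / 2 * (g ε t * p ε t) - 1 / 2 * ∫ r in t₀..t, deriv (g ε) r * p ε r :=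
  funext fun t => (hasDerivAt_lift hg hp t).deriv

theorem deriv_deriv_lift {ε : ℝ} (hg : ContDiff ℝ ∞ (g ε)) (hp : ContDiff ℝ ∞ (p ε)) (t : ℝ) :
    deriv (deriv (lift g p t₀ v₀ v₁ ε)) t =
      -(deriv (g ε) t * p ε t + 1 / 2 * (g ε t * deriv (p ε) t)) := by
  rw [deriv_lift hg hp]
  have hg' : Continuous (deriv (g ε)) := hg.continuous_deriv (by simp)
  have hc : Continuous fun r => deriv (g ε) r * p ε r := hg'.mul hp.continuous
  have h1 := (hc.integral_hasStrictDerivAt t₀ t).hasDerivAt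
  have h2 := ((hg.differentiable (by simp) t).hasDerivAt.mul
    (hp.differentiable (by simp) t).hasDerivAt)
  have h3 := ((h2.const_mul (1 / 2)).const_sub (v₁ ε + 1 / 2 * (g ε t₀ * p ε t₀))).sub
    (h1.const_mul (1 / 2))
  refine h3.deriv.trans ?_
  ring

theorem lift_self (ε : ℝ) : lift g p t₀ v₀ v₁ ε t₀ = v₀ ε := by
  simp [lift]

end Lift

section Pulse

variable {δ : ModNet ℝ (univ : Set ℝ)} {C₀ t₀ : ℝ} {J : Set ℝ}

/-- The primitive `δ(u) u'` of twice the variation of the kick, along the linearization of `u`. -/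
noncomputable def pulse (δ : ModNet ℝ (univ : Set ℝ)) (u : ℝ → ℝ → ℝ) (t₀ ε t : ℝ) : ℝ :=
  δ.1 ε (ray u t₀ ε t) * deriv (u ε) t₀

theorem contDiffOn_pulse {u : ℝ → ℝ → ℝ} (hJ : IsOpen J)
    (hu : ContDiffOn ℝ ∞ (fun q : ℝ × ℝ => u q.1 q.2) (Ioo (0 : ℝ) 1 ×ˢ J)) (ht₀ : t₀ ∈ J) :
    ContDiffOn ℝ ∞ (fun q : ℝ × ℝ => pulse δ u t₀ q.1 q.2) (Ioo (0 : ℝ) 1 ×ˢ univ) :=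
  (contDiffOn_net_ray hJ hu ht₀).mul (contDiffOn_eval_param (w := fun ε => deriv (u ε))
    (contDiffOn_deriv_param isOpen_Ioo hJ hu) ht₀)

theorem contDiff_ray (u : ℝ → ℝ → ℝ) (t₀ ε : ℝ) : ContDiff ℝ ∞ (ray u t₀ ε) := by
  unfold ray; fun_prop

theorem contDiff_pulse (u : ℝ → ℝ → ℝ) {ε : ℝ} (hε : ε ∈ Ioc (0 : ℝ) 1) :
    ContDiff ℝ ∞ (pulse δ u t₀ ε) :=
  ((δ.contDiff hε).comp (contDiff_ray u t₀ ε)).mul contDiff_const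

theorem deriv_pulse (u : ℝ → ℝ → ℝ) {ε : ℝ} (hε : ε ∈ Ioc (0 : ℝ) 1) (t : ℝ) :
    deriv (pulse δ u t₀ ε) t = deriv (δ.1 ε) (ray u t₀ ε t) * deriv (u ε) t₀ ^ 2 := by
  have h1 := ((((δ.contDiff hε).differentiable (by simp) _).hasDerivAt.comp t
    (hasDerivAt_ray u t₀ ε t)).mul_const (deriv (u ε) t₀)).deriv
  refine h1.trans ?_
  ring

theorem IsDeltaNet.integral_pulse_le (hδ : IsDeltaNet δ C₀) {u : ℝ → ℝ → ℝ} {ε : ℝ}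
    (hε : ε ∈ Ioc (0 : ℝ) 1) {a b : ℝ} (hab : a ≤ b) :
    ∫ t in a..b, |pulse δ u t₀ ε t| ≤ C₀ := by
  by_cases h0 : deriv (u ε) t₀ = 0
  · simpa [pulse, h0] using hδ.nonneg
  have h1 := integral_abs_comp_affine_le (δ.contDiff hε).continuous (hδ.hasCompactSupport hε)
    (hδ ε hε).2 (u ε t₀) (deriv (u ε) t₀) t₀ a b hab
  have h2 : (fun t => |1 / 2 * δ.1 ε (u ε t₀ + deriv (u ε) t₀ * (t - t₀)) * deriv (u ε) t₀ ^ 2|) =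
      fun t => 1 / 2 * |deriv (u ε) t₀| * |pulse δ u t₀ ε t| := by
    funext t
    rw [pulse, ray, pow_two, abs_mul, abs_mul, abs_mul, abs_mul, abs_of_pos (half_pos one_pos)]
    ring
  rw [h2, intervalIntegral.integral_const_mul] at h1
  have h3 : 0 < |deriv (u ε) t₀| := abs_pos.2 h0
  nlinarith

/-- The primitive of `g p` is bounded, if `g` is bounded and `p` is a pulse. -/
theorem IsDeltaNet.abs_integral_mul_pulse_le (hδ : IsDeltaNet δ C₀) {u : ℝ → ℝ → ℝ} {ε : ℝ}
    (hε : ε ∈ Ioc (0 : ℝ) 1) {g : ℝ → ℝ} (hg : Continuous g) {B s t : ℝ}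
    (hB : ∀ r ∈ uIcc s t, |g r| ≤ B) : |∫ r in s..t, g r * pulse δ u t₀ ε r| ≤ B * C₀ := by
  have hB0 : 0 ≤ B := (abs_nonneg _).trans (hB s left_mem_uIcc)
  have hp := (contDiff_pulse (δ := δ) (t₀ := t₀) u hε).continuous
  have key : ∀ a b, a ≤ b → (∀ r ∈ Icc a b, |g r| ≤ B) →
      |∫ r in a..b, g r * pulse δ u t₀ ε r| ≤ B * C₀ := by
    intro a b hab h
    refine (intervalIntegral.abs_integral_le_integral_abs hab).trans ?_
    calc _ ≤ ∫ r in a..b, B * |pulse δ u t₀ ε r| := by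
          refine intervalIntegral.integral_mono_on hab ((hg.mul hp).abs.intervalIntegrable _ _)
            ((hp.abs.const_mul B).intervalIntegrable _ _) fun r hr => ?_
          rw [abs_mul]
          exact mul_le_mul_of_nonneg_right (h r hr) (abs_nonneg _)
      _ ≤ _ := by
          rw [intervalIntegral.integral_const_mul]
          exact mul_le_mul_of_nonneg_left (hδ.integral_pulse_le hε hab) hB0
  rcases le_total s t with h | h
  · exact key s t h (by rwa [uIcc_of_le h] at hB)
  · rw [intervalIntegral.integral_symm, abs_neg]
    exact key t s h (by rwa [uIcc_of_ge h] at hB)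

end Pulse

section Jet

variable {E : Type u} [NormedAddCommGroup E] [NormedSpace ℝ E] [FiniteDimensional ℝ E]
  {N : Type*} [TopologicalSpace N] [ChartedSpace E N] [IsManifold 𝓘(ℝ, E) ∞ N]
  {K : Set N} (C : Coordinates E K)

/-- Position and velocity of a curve, in terms of coordinates. -/
noncomputable def Coordinates.jet (x : ℝ → ℝ → N) (ε t : ℝ) :
    (C.index → ℝ × E) × (C.index → ℝ × E) :=
  (C.toFun (x ε t), deriv (fun s => C.toFun (x ε s)) t)

/-- A function and its derivative along a curve, in terms of coordinates. -/
theorem Coordinates.exists_function_factor (f : C^∞⟮𝓘(ℝ, E), N; ℝ⟯) :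
    ∃ (h : (C.index → ℝ × E) → ℝ) (h' : (C.index → ℝ × E) × (C.index → ℝ × E) → ℝ),
      ContDiff ℝ ∞ h ∧ ContDiff ℝ ∞ h' ∧ (∀ x ∈ K, f x = h (C.toFun x)) ∧
      ∀ (x : ℝ → ℝ → N) (ε t : ℝ), ContMDiffAt 𝓘(ℝ, ℝ) 𝓘(ℝ, E) ∞ (x ε) t → x ε t ∈ interior K →
        f (x ε t) = h (C.toFun (x ε t)) ∧
        deriv (fun s => f (x ε s)) t = h' (C.jet x ε t) := by
  obtain ⟨ψ, hψ, hf⟩ := C.exists_contDiff_factor (X := ℝ) (ψ := fun q : N × ℝ => f q.1)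
    (f.contMDiff.comp contMDiff_fst)
  have hh : ContDiff ℝ ∞ fun z => ψ (z, 0) := hψ.comp (contDiff_id.prodMk contDiff_const)
  refine ⟨fun z => ψ (z, 0), fun q => fderiv ℝ (fun z => ψ (z, 0)) q.1 q.2, hh,
    ((hh.fderiv_right (m := ∞) (by simp)).comp contDiff_fst).clm_apply contDiff_snd,
    fun x hx => hf x hx 0, fun x ε t hx ht => ⟨hf _ (interior_subset ht) 0, ?_⟩⟩
  have h1 : (fun s => f (x ε s)) =ᶠ[𝓝 t] fun s => ψ (C.toFun (x ε s), 0) := by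
    filter_upwards [hx.continuousAt.eventually (isOpen_interior.mem_nhds ht)] with s hs
    exact hf _ (interior_subset hs) 0
  have h2 : DifferentiableAt ℝ (fun s => C.toFun (x ε s)) t :=
    ((C.contMDiff.contMDiffAt.comp t hx).contDiffAt).differentiableAt (by simp)
  rw [h1.deriv_eq]
  exact HasDerivAt.deriv (((hh.differentiable (by simp) _).hasFDerivAt).comp_hasDerivAt t
    h2.hasDerivAt)

end Jet

section Wave

set_option linter.unusedSectionVars false

variable {E : Type u} [NormedAddCommGroup E] [NormedSpace ℝ E] [FiniteDimensional ℝ E]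
  {N : Type*} [MetricSpace N] [SigmaCompactSpace N] [ChartedSpace E N] [IsManifold 𝓘(ℝ, E) ∞ N]
  [RiemannianBundle (fun x : N => TangentSpace 𝓘(ℝ, E) x)]
  [IsContMDiffRiemannianBundle 𝓘(ℝ, E) ∞ E (fun x : N => TangentSpace 𝓘(ℝ, E) x)]
  [IsRiemannianManifold 𝓘(ℝ, E) N] [CompleteSpace N]
  {f : C^∞⟮𝓘(ℝ, E), N; ℝ⟯} {δ : ModNet ℝ (univ : Set ℝ)} {C₀ : ℝ}
  {G : ModTensor (inpwModel E) (N × (ℝ × ℝ))} {J : Set ℝ}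
  {c : ModMap (inpwModel E) (N × (ℝ × ℝ)) J} {t₀ : ℝ}

theorem WaveFamily.contMDiffAt (X : WaveFamily f δ c t₀) {ε : ℝ} (hε : ε ∈ Ioo (0 : ℝ) 1) (t : ℝ) :
    ContMDiffAt 𝓘(ℝ, ℝ) 𝓘(ℝ, E) ∞ (X.curve ε) t :=
  X.smooth.curve isOpen_Ioo isOpen_univ hε (mem_univ t)

/-- Bounds for a net of curves in coordinates. -/
theorem Coordinates.norm_jet_le {K : Set N} (hK : IsCompact K) (C : Coordinates E K) (S : ℝ) :
    ∃ R, ∀ (x : ℝ → ℝ → N) (ε t : ℝ), ContMDiffAt 𝓘(ℝ, ℝ) 𝓘(ℝ, E) ∞ (x ε) t → x ε t ∈ K →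
      √(speedSq E (x ε) t) ≤ S → ‖C.jet x ε t‖ ≤ R := by
  obtain ⟨B, hB, h1⟩ := C.exists_norm_deriv_le
  obtain ⟨M, hM⟩ := hK.bddAbove_image C.contMDiff.continuous.norm.continuousOn
  refine ⟨max M (B * S), fun x ε t hx hxK hS => ?_⟩
  rw [Coordinates.jet, Prod.norm_mk]
  refine max_le_max (hM (mem_image_of_mem _ hxK)) ((h1 (x ε) t hx hxK).trans ?_)
  gcongr

theorem WaveFamily.exists_comparison [Nonempty N] (X : WaveFamily f δ c t₀) (hδ : IsDeltaNet δ C₀)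
    (hG : G ≈ inpwNet f δ) (hJ : IsOpen J) (hc : IsGeodesicNet G c) {a b : ℝ} (ht₀ : t₀ ∈ Icc a b)
    (hab : Icc a b ⊆ J)
    (hb : BoundedVelocityAt (Quotient.mk _ c : GenMap (inpwModel E) (N × (ℝ × ℝ)) J) t₀) :
    ∃ (K : Set N) (C : Coordinates E K) (ε₁ : ℝ), 0 < ε₁ ∧
      (∀ ε ∈ Ioo 0 ε₁, ∀ t ∈ Icc a b, X.curve ε t ∈ interior K ∧ c.pos ε t ∈ interior K) ∧
      LocBounded (Icc a b) (C.jet X.curve) ∧ LocBounded (Icc a b) (C.jet c.pos) ∧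
      NegligibleOn (Icc a b) (fun ε t => C.jet X.curve ε t - C.jet c.pos ε t) := by
  obtain ⟨x₀⟩ := ‹Nonempty N›
  have := properSpace_of_completeSpace E (N := N)
  have hle : a ≤ b := ht₀.1.trans ht₀.2
  obtain ⟨K₁, S₁, e₁, hK₁, he₁, he₁1, h1⟩ := X.bound (b - a) (sub_nonneg.2 hle)
  obtain ⟨R₂, e₂, he₂, h2⟩ := ModMap.exists_dist_le (c := c) x₀ hab isCompact_Icc
  obtain ⟨K, hK, hKi⟩ := exists_compact_superset (hK₁.union (isCompact_closedBall x₀ R₂))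
  obtain ⟨S₃, e₃, he₃, h3⟩ := hc.exists_speed_bound hδ hG hJ ht₀ hab hb
  obtain ⟨V, _, _, e₄, -, -, -, he₄, -, h4⟩ := ModMap.exists_initial_bound hJ (hab ht₀) hb x₀
  obtain ⟨C⟩ := exists_coordinates (E := E) hK
  obtain ⟨R, hR⟩ := C.norm_jet_le hK (max S₁ S₃)
  have hT : ∀ t ∈ Icc a b, |t - t₀| ≤ b - a := fun t ht =>
    abs_sub_le_iff.2 ⟨by linarith [ht.2, ht₀.1], by linarith [ht.1, ht₀.2]⟩
  have hin : ∀ ε ∈ Ioo 0 (min e₁ e₂), ∀ t ∈ Icc a b,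
      X.curve ε t ∈ interior K ∧ c.pos ε t ∈ interior K := fun ε hε t ht =>
    ⟨hKi (Or.inl (h1 ε ⟨hε.1, hε.2.trans_le (min_le_left _ _)⟩ t (hT t ht)).1),
      hKi (Or.inr (h2 ε ⟨hε.1, hε.2.trans_le (min_le_right _ _)⟩ t ht))⟩
  have hpos : 0 < min (min e₁ e₂) e₃ := by positivity
  have hbd : ∀ ε ∈ Ioo 0 (min (min e₁ e₂) e₃), ∀ t ∈ Icc a b,
      ‖C.jet X.curve ε t‖ ≤ R ∧ ‖C.jet c.pos ε t‖ ≤ R := by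
    intro ε hε t ht
    obtain ⟨hε0, hlt⟩ := hε
    rw [lt_min_iff] at hlt
    have hε1 : ε ∈ Ioo (0 : ℝ) 1 := ⟨hε0, (hlt.1.trans_le (min_le_left _ _)).trans_le he₁1⟩
    have hi := hin ε ⟨hε0, hlt.1⟩ t ht
    exact ⟨hR _ _ _ (X.contMDiffAt hε1 t) (interior_subset hi.1) ((h1 ε
      ⟨hε0, hlt.1.trans_le (min_le_left _ _)⟩ t (hT t ht)).2.1.trans (le_max_left _ _)),
      hR _ _ _ (ModMap.contMDiffAt_pos hJ (Ioo_subset_Ioc_self hε1) (hab ht))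
        (interior_subset hi.2) ((h3 ε ⟨hε0, hlt.2⟩ t ht).trans (le_max_right _ _))⟩
  refine ⟨K, C, min e₁ e₂, by positivity, hin,
    fun L hL _ => ⟨R, _, hpos, fun ε hε t ht => (hbd ε hε t (hL ht)).1⟩,
    fun L hL _ => ⟨R, _, hpos, fun ε hε t ht => (hbd ε hε t (hL ht)).2⟩, ?_⟩
  rw [negligibleOn_iff_of_isCompact isCompact_Icc]
  intro m
  obtain ⟨D, e₅, he₅, h5⟩ := (hc.negligible_residual C hG hJ ht₀ hab (lt_min he₁ he₂)
    fun ε hε t ht => interior_subset (hin ε hε t ht).2).2.2 m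
  obtain ⟨Φ, B, q, hΦ, hB, hq, h6⟩ := C.exists_equation f.contMDiff
  obtain ⟨A, hA⟩ := Colombeau.exists_comparison hΦ hB R (1 / 2 * C₀ * V) a b
  refine ⟨A * (q * |D| + 1), min (min (min e₁ e₂) e₃) (min e₄ e₅), by positivity, ?_⟩
  intro ε hε t ht
  obtain ⟨hε0, hlt⟩ := hε
  have hlt₁ : ε < min (min e₁ e₂) e₃ := hlt.trans_le (min_le_left _ _)
  simp only [lt_min_iff] at hlt
  obtain ⟨hlt', hlt⟩ := hlt
  have hε1 : ε ∈ Ioo (0 : ℝ) 1 := ⟨hε0, hlt'.1.1.trans_le he₁1⟩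
  have hε1' := Ioo_subset_Ioc_self hε1
  have hm : 0 < ε ^ m := pow_pos hε0 m
  have hη : q * (|D| * ε ^ m) ≤ (q * |D| + 1) * ε ^ m := by nlinarith
  have hcs : ∀ s ∈ Icc a b, ∀ᶠ r in 𝓝 s, ContMDiffAt 𝓘(ℝ, ℝ) 𝓘(ℝ, E) ∞ (c.pos ε) r := fun s hs => by
    filter_upwards [hJ.mem_nhds (hab hs)] with r hr using ModMap.contMDiffAt_pos hJ hε1' hr
  have key := hA (fun s => C.toFun (X.curve ε s)) (fun s => C.toFun (c.pos ε s))
    (kick δ c.u t₀ ε) ((q * |D| + 1) * ε ^ m) t₀ (by positivity) ht₀ (continuous_kick c.u hε1')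
    (hδ.integral_kick_le hε1' (h4 ε ⟨hε0, hlt.1⟩).2.1 hle) (fun s hs => ?_)
    (by rw [(X.sameJet ε hε1).1]) (C.deriv_eq_of_sameJet (X.contMDiffAt hε1 t₀)
      (ModMap.contMDiffAt_pos hJ hε1' (hab ht₀)) (X.sameJet ε hε1)) t ht
  · rw [mul_assoc]
    exact (Prod.norm_def _).trans_le (max_le key.1 key.2)
  · have hb := hbd ε ⟨hε0, hlt₁⟩ s hs
    have hi := hin ε ⟨hε0, lt_min hlt'.1.1 hlt'.1.2⟩ s hs
    refine ⟨(C.contMDiff.contMDiffAt.comp s (X.contMDiffAt hε1 s)).contDiffAt,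
      (C.contMDiff.contMDiffAt.comp s (hcs s hs).self_of_nhds).contDiffAt,
      (norm_fst_le _).trans hb.1, (norm_snd_le _).trans hb.1, (norm_fst_le _).trans hb.2,
      (norm_snd_le _).trans hb.2, ?_, ?_⟩
    · refine (h6 (X.curve ε) s (kick δ c.u t₀ ε s) 0 (Eventually.of_forall (X.contMDiffAt hε1))
        (interior_subset hi.1) le_rfl fun i hw => ?_).trans (by rw [mul_zero]; positivity)
      rw [(h1 ε ⟨hε0, hlt'.1.1⟩ s (hT s hs)).2.2 i (C.mem_source hw), sub_self, norm_zero]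
    · refine (h6 (c.pos ε) s (kick δ c.u t₀ ε s) (|D| * ε ^ m) (hcs s hs)
        (interior_subset hi.2) (by positivity) fun i hw => ?_).trans hη
      refine (h5 ε ⟨hε0, hlt.2⟩ s hs i hw).trans ?_
      gcongr
      exact le_abs_self D

theorem ModMap.locBounded_slope [Nonempty N] (hJ : IsOpen J) (ht₀ : t₀ ∈ J)
    (hb : BoundedVelocityAt (Quotient.mk _ c : GenMap (inpwModel E) (N × (ℝ × ℝ)) J) t₀) :
    LocBounded univ (fun ε _ => deriv (c.u ε) t₀) ∧ LocBounded univ (ray c.u t₀) := by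
  obtain ⟨x₀⟩ := ‹Nonempty N›
  obtain ⟨V, _, _, e, hV, -, -, he, -, h⟩ := ModMap.exists_initial_bound hJ ht₀ hb x₀
  refine ⟨fun L _ _ => ⟨V, e, he, fun ε hε t _ => (h ε hε).2.1⟩, fun L _ hL => ?_⟩
  obtain ⟨M, hM⟩ := hL.bddAbove_image (f := fun t => |t - t₀|) (by fun_prop)
  refine ⟨V + V * M, e, he, fun ε hε t ht => (abs_add_le _ _).trans
    (add_le_add (h ε hε).1 ?_)⟩
  rw [abs_mul]
  exact mul_le_mul (h ε hε).2.1 (hM (mem_image_of_mem _ ht)) (abs_nonneg _) hV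

theorem ModMap.polyBdd_pulse [Nonempty N] (hJ : IsOpen J) (ht₀ : t₀ ∈ J)
    (hb : BoundedVelocityAt (Quotient.mk _ c : GenMap (inpwModel E) (N × (ℝ × ℝ)) J) t₀)
    {L : Set ℝ} (hL : IsCompact L) : PolyBdd L fun ε t => ‖pulse δ c.u t₀ ε t‖ :=
  (δ.2.2.polyBdd_comp hL ((ModMap.locBounded_slope hJ ht₀ hb).2.mono (subset_univ _))).norm_mul
    ((ModMap.locBounded_slope hJ ht₀ hb).1.polyBdd (subset_univ _) hL)

/-- The `v`-component of the geodesics of the wave. -/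
noncomputable def WaveFamily.v (X : WaveFamily f δ c t₀) : ℝ → ℝ → ℝ :=
  lift (fun ε t => f (X.curve ε t)) (pulse δ c.u t₀) t₀ (fun ε => c.v ε t₀)
    fun ε => deriv (c.v ε) t₀

theorem WaveFamily.contDiffOn_function (X : WaveFamily f δ c t₀) :
    ContDiffOn ℝ ∞ (fun q : ℝ × ℝ => f (X.curve q.1 q.2)) (Ioo (0 : ℝ) 1 ×ˢ univ) :=
  ContMDiffOn.contDiffOn (f.contMDiff.comp_contMDiffOn X.smooth)

theorem WaveFamily.contDiff_function (X : WaveFamily f δ c t₀) {ε : ℝ} (hε : ε ∈ Ioo (0 : ℝ) 1) :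
    ContDiff ℝ ∞ fun t => f (X.curve ε t) :=
  contDiff_of_param (w := fun ε t => f (X.curve ε t)) X.contDiffOn_function hε

theorem WaveFamily.contDiffOn_v (X : WaveFamily f δ c t₀) (hJ : IsOpen J) (ht₀ : t₀ ∈ J) :
    ContDiffOn ℝ ∞ (fun q : ℝ × ℝ => X.v q.1 q.2) (Ioo (0 : ℝ) 1 ×ˢ univ) := by
  have hu : ContDiffOn ℝ ∞ (fun q : ℝ × ℝ => c.u q.1 q.2) (Ioo (0 : ℝ) 1 ×ˢ J) :=
    ModMap.contDiffOn_snd.fst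
  have hv : ContDiffOn ℝ ∞ (fun q : ℝ × ℝ => c.v q.1 q.2) (Ioo (0 : ℝ) 1 ×ˢ J) :=
    ModMap.contDiffOn_snd.snd
  exact contDiffOn_lift isOpen_Ioo X.contDiffOn_function (contDiffOn_pulse hJ hu ht₀)
    (contDiffOn_eval_param hv ht₀) (contDiffOn_eval_param (w := fun ε => deriv (c.v ε))
      (contDiffOn_deriv_param isOpen_Ioo hJ hv) ht₀)

theorem WaveFamily.deriv_v (X : WaveFamily f δ c t₀) {ε : ℝ} (hε : ε ∈ Ioo (0 : ℝ) 1) :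
    deriv (X.v ε) = fun t => deriv (c.v ε) t₀ +
      1 / 2 * (f (X.curve ε t₀) * pulse δ c.u t₀ ε t₀) -
      1 / 2 * (f (X.curve ε t) * pulse δ c.u t₀ ε t) -
      1 / 2 * ∫ r in t₀..t, deriv (fun t => f (X.curve ε t)) r * pulse δ c.u t₀ ε r :=
  deriv_lift (g := fun ε t => f (X.curve ε t)) (X.contDiff_function hε)
    (contDiff_pulse c.u (Ioo_subset_Ioc_self hε))

theorem WaveFamily.deriv_deriv_v (X : WaveFamily f δ c t₀) {ε : ℝ} (hε : ε ∈ Ioo (0 : ℝ) 1)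
    (t : ℝ) : deriv (deriv (X.v ε)) t = -(deriv (fun t => f (X.curve ε t)) t * pulse δ c.u t₀ ε t +
      1 / 2 * (f (X.curve ε t) * deriv (pulse δ c.u t₀ ε) t)) :=
  deriv_deriv_lift (g := fun ε t => f (X.curve ε t)) (X.contDiff_function hε)
    (contDiff_pulse c.u (Ioo_subset_Ioc_self hε)) t

/-- The new net of geodesics agrees with the given one up to a negligible error. -/
theorem WaveFamily.negligible_sub [Nonempty N] (X : WaveFamily f δ c t₀) (hδ : IsDeltaNet δ C₀)
    (hG : G ≈ inpwNet f δ) (hJ : IsOpen J) (hc : IsGeodesicNet G c) {a b : ℝ} (ht₀ : t₀ ∈ Icc a b)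
    (hab : Icc a b ⊆ J)
    (hb : BoundedVelocityAt (Quotient.mk _ c : GenMap (inpwModel E) (N × (ℝ × ℝ)) J) t₀) :
    (∃ (K : Set N) (C : Coordinates E K) (ε₁ : ℝ), 0 < ε₁ ∧
      (∀ ε ∈ Ioo 0 ε₁, ∀ t ∈ Icc a b, X.curve ε t ∈ K ∧ c.pos ε t ∈ K) ∧
      LocBounded (Icc a b) (fun ε t => C.toFun (X.curve ε t)) ∧
      LocBounded (Icc a b) (fun ε t => C.toFun (c.pos ε t)) ∧
      NegligibleOn (Icc a b) (fun ε t => C.toFun (X.curve ε t) - C.toFun (c.pos ε t))) ∧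
    NegligibleOn (Icc a b) (fun ε t => ray c.u t₀ ε t - c.u ε t) ∧
    NegligibleOn (Icc a b) (fun ε t => X.v ε t - c.v ε t) := by
  obtain ⟨K, C, e₁, he₁, hin, hXb, hcb, hn⟩ := X.exists_comparison hδ hG hJ hc ht₀ hab hb
  have hfst : ∀ {w : ℝ → ℝ → (C.index → ℝ × E) × (C.index → ℝ × E)}, LocBounded (Icc a b) w →
      LocBounded (Icc a b) fun ε t => (w ε t).1 := fun h L hL hLc => by
    obtain ⟨B, e, he, h⟩ := h L hL hLc
    exact ⟨B, e, he, fun ε hε t ht => (norm_fst_le _).trans (h ε hε t ht)⟩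
  have hn1 : NegligibleOn (Icc a b) (fun ε t => C.toFun (X.curve ε t) - C.toFun (c.pos ε t)) :=
    fun L hL hLc m => by
      obtain ⟨B, e, he, h⟩ := hn L hL hLc m
      exact ⟨B, e, he, fun ε hε t ht => (norm_fst_le _).trans (h ε hε t ht)⟩
  obtain ⟨hu, hv, -⟩ := hc.negligible_residual C hG hJ ht₀ hab he₁
    fun ε hε t ht => interior_subset (hin ε hε t ht).2
  refine ⟨⟨K, C, e₁, he₁, fun ε hε t ht => ⟨interior_subset (hin ε hε t ht).1,
    interior_subset (hin ε hε t ht).2⟩, hfst hXb, hfst hcb, hn1⟩, hu.sub_symm, ?_⟩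
  obtain ⟨h, h', hh, hh', -, hf⟩ := C.exists_function_factor f
  have hcs : ∀ ε ∈ Ioo (0 : ℝ) 1, ∀ t ∈ Icc a b,
      ContMDiffAt 𝓘(ℝ, ℝ) 𝓘(ℝ, E) ∞ (c.pos ε) t := fun ε hε t ht =>
    ModMap.contMDiffAt_pos hJ (Ioo_subset_Ioc_self hε) (hab ht)
  have hg : NegligibleOn (Icc a b) fun ε t => f (c.pos ε t) - f (X.curve ε t) := by
    refine (NegligibleOn.comp_sub hh (hfst hcb) (hfst hXb) hn1.sub_symm).congr_small
      (lt_min he₁ one_pos) fun ε hε t ht => ?_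
    obtain ⟨hε0, hlt⟩ := hε
    rw [lt_min_iff] at hlt
    have hi := hin ε ⟨hε0, hlt.1⟩ t ht
    rw [(hf c.pos ε t (hcs ε ⟨hε0, hlt.2⟩ t ht) hi.2).1,
      (hf X.curve ε t (X.contMDiffAt ⟨hε0, hlt.2⟩ t) hi.1).1]
    rfl
  have hg' : NegligibleOn (Icc a b) fun ε t =>
      deriv (fun s => f (c.pos ε s)) t - deriv (fun s => f (X.curve ε s)) t := by
    refine (NegligibleOn.comp_sub hh' hcb hXb hn.sub_symm).congr_small
      (lt_min he₁ one_pos) fun ε hε t ht => ?_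
    obtain ⟨hε0, hlt⟩ := hε
    rw [lt_min_iff] at hlt
    have hi := hin ε ⟨hε0, hlt.1⟩ t ht
    rw [(hf c.pos ε t (hcs ε ⟨hε0, hlt.2⟩ t ht) hi.2).2,
      (hf X.curve ε t (X.contMDiffAt ⟨hε0, hlt.2⟩ t) hi.1).2]
  have hp : PolyBdd (Icc a b) fun ε t => ‖1 / 2 * pulse δ c.u t₀ ε t‖ :=
    (PolyBdd.const (‖(1 / 2 : ℝ)‖)).norm_mul (g := fun _ _ => 1 / 2)
      (ModMap.polyBdd_pulse hJ (hab ht₀) hb isCompact_Icc)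
  have hW : NegligibleOn (Icc a b) fun ε t => deriv (c.v ε) t - deriv (X.v ε) t +
      (f (c.pos ε t) - f (X.curve ε t)) * (1 / 2 * pulse δ c.u t₀ ε t) := by
    refine NegligibleOn.of_deriv ht₀ (fun ε hε t ht => ?_) (fun ε hε => ?_)
      (hv.add (hg'.mul_polyBdd isCompact_Icc hp).neg)
    · have d0 := (ModMap.contDiffAt_v (c := c) hJ (Ioo_subset_Ioc_self hε) (hab ht)).fderiv_right
        (m := ∞) (by simp)
      have d1 : DifferentiableAt ℝ (deriv (c.v ε)) t :=
        (d0.clm_apply contDiffAt_const).differentiableAt (by simp)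
      have hXv : ContDiff ℝ ∞ (X.v ε) := contDiff_of_param (X.contDiffOn_v hJ (hab ht₀)) hε
      have d2 : DifferentiableAt ℝ (deriv (X.v ε)) t :=
        ((contDiff_infty_iff_deriv.1 hXv).2.differentiable (by simp)) t
      have d3 : DifferentiableAt ℝ (fun s => f (c.pos ε s)) t :=
        ((f.contMDiff.contMDiffAt.comp t (hcs ε hε t ht)).contDiffAt).differentiableAt (by simp)
      have d4 := (X.contDiff_function hε).differentiable (by simp) t
      have d5 := (contDiff_pulse (δ := δ) (t₀ := t₀) c.u
        (Ioo_subset_Ioc_self hε)).differentiable (by simp) t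
      refine HasDerivAt.congr_deriv ((d1.hasDerivAt.sub d2.hasDerivAt).add
        ((d3.hasDerivAt.sub d4.hasDerivAt).mul (d5.hasDerivAt.const_mul (1 / 2)))) ?_
      rw [X.deriv_deriv_v hε, deriv_pulse c.u (Ioo_subset_Ioc_self hε)]
      simp only [pulse, Pi.sub_apply]
      ring
    · simp [X.deriv_v hε, (X.sameJet ε hε).1]
  have hV : NegligibleOn (Icc a b) fun ε t => c.v ε t - X.v ε t := by
    refine NegligibleOn.of_deriv ht₀ (fun ε hε t ht => ?_) (fun ε hε => ?_)
      (hW.add (hg.mul_polyBdd isCompact_Icc hp).neg)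
    · have hXv : ContDiff ℝ ∞ (X.v ε) := contDiff_of_param (X.contDiffOn_v hJ (hab ht₀)) hε
      refine HasDerivAt.congr_deriv (((ModMap.contDiffAt_v (c := c) hJ (Ioo_subset_Ioc_self hε)
        (hab ht)).differentiableAt (by simp)).hasDerivAt.sub
          (hXv.differentiable (by simp) t).hasDerivAt) ?_
      ring
    · rw [WaveFamily.v, lift_self, sub_self]
  exact hV.sub_symm

end Wave

section Moderate

variable {V : Type*} [NormedAddCommGroup V] [NormedSpace ℝ V] {J : Set ℝ}

theorem ModerateOn.of_deriv {g : ℝ → ℝ → V} (h0 : LocBounded J g)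
    (h : ModerateOn J fun ε => deriv (g ε)) : ModerateOn J g :=
  moderateOn_iff_moderateOrder.2 fun k => match k with
    | 0 => moderateOrder_zero h0
    | k + 1 => .succ h0 (moderateOn_iff_moderateOrder.1 h k)

theorem ModerateOn.of_const {a : ℝ → V} (h : LocBounded J fun ε _ => a ε) :
    ModerateOn J fun ε _ => a ε := by
  refine .of_deriv h fun L _ _ k => ⟨0, 0, 1, one_pos, fun ε _ t _ => ?_⟩
  have h1 : deriv (fun _ : ℝ => a ε) = fun _ => 0 := funext fun t => deriv_const t (a ε)
  have h2 : iteratedFDeriv ℝ k (fun _ : ℝ => (0 : V)) = 0 := iteratedFDeriv_fun_zero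
  beta_reduce
  rw [h1, h2]
  simp

theorem ModerateOn.mul (hJ : IsOpen J) {g h : ℝ → ℝ → ℝ}
    (hgs : ∀ ε ∈ Ioo (0 : ℝ) 1, ContDiffOn ℝ ∞ (g ε) J)
    (hhs : ∀ ε ∈ Ioo (0 : ℝ) 1, ContDiffOn ℝ ∞ (h ε) J) (hg : ModerateOn J g)
    (hh : ModerateOn J h) : ModerateOn J fun ε t => g ε t * h ε t :=
  moderateOn_iff_moderateOrder.2 fun k =>
    (moderateOn_iff_moderateOrder.1 hg k).smul hJ hgs hhs (moderateOn_iff_moderateOrder.1 hh k)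

theorem ModerateOn.add (hJ : IsOpen J) {g h : ℝ → ℝ → V}
    (hgs : ∀ ε ∈ Ioo (0 : ℝ) 1, ContDiffOn ℝ ∞ (g ε) J)
    (hhs : ∀ ε ∈ Ioo (0 : ℝ) 1, ContDiffOn ℝ ∞ (h ε) J) (hg : ModerateOn J g)
    (hh : ModerateOn J h) : ModerateOn J fun ε t => g ε t + h ε t :=
  moderateOn_iff_moderateOrder.2 fun k =>
    (moderateOn_iff_moderateOrder.1 hg k).add hJ hgs hhs (moderateOn_iff_moderateOrder.1 hh k)

theorem ModerateOn.prodMk {W : Type*} [NormedAddCommGroup W] [NormedSpace ℝ W] (hJ : IsOpen J)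
    {g : ℝ → ℝ → V} {h : ℝ → ℝ → W} (hgs : ∀ ε ∈ Ioo (0 : ℝ) 1, ContDiffOn ℝ ∞ (g ε) J)
    (hhs : ∀ ε ∈ Ioo (0 : ℝ) 1, ContDiffOn ℝ ∞ (h ε) J) (hg : ModerateOn J g)
    (hh : ModerateOn J h) : ModerateOn J fun ε t => (g ε t, h ε t) :=
  moderateOn_iff_moderateOrder.2 fun k =>
    (moderateOn_iff_moderateOrder.1 hg k).prodMk hJ hgs hhs (moderateOn_iff_moderateOrder.1 hh k)

theorem ModerateOn.comp_congr [FiniteDimensional ℝ V] {W : Type*} [NormedAddCommGroup W]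
    [NormedSpace ℝ W] {Φ : V → W} (hΦ : ContDiff ℝ ∞ Φ) (hJ : IsOpen J) {g : ℝ → ℝ → V}
    (hgs : ∀ ε ∈ Ioo (0 : ℝ) 1, ContDiffOn ℝ ∞ (g ε) J) (hb : LocBounded J g)
    (hg : ModerateOn J g) {w : ℝ → ℝ → W} {ε₁ : ℝ} (hε₁ : 0 < ε₁)
    (he : ∀ ε ∈ Ioo 0 ε₁, ∀ t ∈ J, w ε t = Φ (g ε t)) : ModerateOn J w :=
  moderateOn_iff_moderateOrder.2 fun k =>
    ((moderateOn_iff_moderateOrder.1 hg k).comp hΦ hJ hgs hb).congr_small hJ hε₁ he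

theorem LocBounded.of_forall {V : Type*} [NormedAddCommGroup V] {g : ℝ → ℝ → V} {C ε₀ : ℝ}
    (hε₀ : 0 < ε₀) (h : ∀ ε ∈ Ioo 0 ε₀, ∀ t ∈ J, ‖g ε t‖ ≤ C) : LocBounded J g :=
  fun _ hL _ => ⟨C, ε₀, hε₀, fun ε hε t ht => h ε hε t (hL ht)⟩

end Moderate

theorem abs_deriv_le_of_gradBound {E : Type u} [NormedAddCommGroup E] [NormedSpace ℝ E]
    [FiniteDimensional ℝ E] {N : Type*} [TopologicalSpace N] [ChartedSpace E N]
    [IsManifold 𝓘(ℝ, E) ∞ N] [RiemannianBundle (fun x : N => TangentSpace 𝓘(ℝ, E) x)]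
    [IsContMDiffRiemannianBundle 𝓘(ℝ, E) ∞ E (fun x : N => TangentSpace 𝓘(ℝ, E) x)] {F : N → ℝ}
    (hF : ContMDiff 𝓘(ℝ, E) 𝓘(ℝ, ℝ) ∞ F) {A : Set N} {B : ℝ} (hB : GradBound E F A B) {x : ℝ → N}
    {t : ℝ} (hx : ContMDiffAt 𝓘(ℝ, ℝ) 𝓘(ℝ, E) ∞ x t) (hA : x t ∈ A) :
    |deriv (fun s => F (x s)) t| ≤ B * √(speedSq E x t) := by
  have hp := mem_extChartAt_source (I := 𝓘(ℝ, E)) (x t)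
  rw [(hasDerivAt_comp_chart hF hx hp).deriv, speedSq_eq hx hp]
  exact hB _ _ ((extChartAt 𝓘(ℝ, E) (x t)).map_source hp)
    (by rwa [(extChartAt 𝓘(ℝ, E) (x t)).left_inv hp]) _

section Wave

set_option linter.unusedSectionVars false

variable {E : Type u} [NormedAddCommGroup E] [NormedSpace ℝ E] [FiniteDimensional ℝ E]
  {N : Type*} [MetricSpace N] [SigmaCompactSpace N] [ChartedSpace E N] [IsManifold 𝓘(ℝ, E) ∞ N]
  [RiemannianBundle (fun x : N => TangentSpace 𝓘(ℝ, E) x)]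
  [IsContMDiffRiemannianBundle 𝓘(ℝ, E) ∞ E (fun x : N => TangentSpace 𝓘(ℝ, E) x)]
  [IsRiemannianManifold 𝓘(ℝ, E) N] [CompleteSpace N]
  {f : C^∞⟮𝓘(ℝ, E), N; ℝ⟯} {δ : ModNet ℝ (univ : Set ℝ)} {C₀ : ℝ}
  {G : ModTensor (inpwModel E) (N × (ℝ × ℝ))} {J : Set ℝ}
  {c : ModMap (inpwModel E) (N × (ℝ × ℝ)) J} {t₀ : ℝ}

theorem WaveFamily.exists_integral_le (X : WaveFamily f δ c t₀) (hδ : IsDeltaNet δ C₀) {T : ℝ}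
    (hT : 0 ≤ T) : ∃ B ε₁ : ℝ, 0 ≤ B ∧ 0 < ε₁ ∧ ε₁ ≤ 1 ∧ ∀ ε ∈ Ioo 0 ε₁, ∀ t, |t - t₀| ≤ T →
      |f (X.curve ε t)| ≤ B ∧
      |∫ r in t₀..t, f (X.curve ε r) * pulse δ c.u t₀ ε r| ≤ B * C₀ ∧
      |∫ r in t₀..t, deriv (fun s => f (X.curve ε s)) r * pulse δ c.u t₀ ε r| ≤ B * C₀ := by
  obtain ⟨K, S, e₁, hK, he₁, he₁1, h1⟩ := X.bound T hT
  obtain ⟨M, hM⟩ := hK.bddAbove_image f.contMDiff.continuous.abs.continuousOn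
  obtain ⟨B, hB, hF⟩ := exists_gradBound f.contMDiff hK
  have hsub : ∀ t, |t - t₀| ≤ T → ∀ r ∈ uIcc t₀ t, |r - t₀| ≤ T := fun t ht r hr =>
    (abs_sub_left_of_mem_uIcc hr).trans ht
  refine ⟨max M (B * |S|), e₁, le_max_of_le_right (by positivity), he₁, he₁1, fun ε hε t ht => ?_⟩
  have hε1 : ε ∈ Ioo (0 : ℝ) 1 := ⟨hε.1, hε.2.trans_le he₁1⟩
  have hM' : ∀ r, |r - t₀| ≤ T → |f (X.curve ε r)| ≤ max M (B * |S|) := fun r hr =>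
    le_max_of_le_left (hM (mem_image_of_mem (fun x => |f x|) (h1 ε hε r hr).1))
  refine ⟨hM' t ht, hδ.abs_integral_mul_pulse_le (Ioo_subset_Ioc_self hε1)
    (X.contDiff_function hε1).continuous fun r hr => hM' r (hsub t ht r hr),
    hδ.abs_integral_mul_pulse_le (Ioo_subset_Ioc_self hε1)
      ((X.contDiff_function hε1).continuous_deriv (by simp)) fun r hr => le_max_of_le_right ?_⟩
  have h2 := h1 ε hε r (hsub t ht r hr)
  refine (abs_deriv_le_of_gradBound f.contMDiff hF (X.contMDiffAt hε1 r) h2.1).trans ?_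
  gcongr
  exact h2.2.1.trans (le_abs_self S)

/-- The slope of the affine part of the `v`-component. -/
noncomputable def WaveFamily.slope (X : WaveFamily f δ c t₀) (ε : ℝ) : ℝ :=
  deriv (c.v ε) t₀ + 1 / 2 * (f (X.curve ε t₀) * pulse δ c.u t₀ ε t₀)

theorem WaveFamily.exists_remainder_le (X : WaveFamily f δ c t₀) (hδ : IsDeltaNet δ C₀) {T : ℝ}
    (hT : 0 ≤ T) : ∃ B ε₁ : ℝ, 0 < ε₁ ∧ ∀ ε ∈ Ioo 0 ε₁, ∀ t, |t - t₀| ≤ T →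
      |X.v ε t - (c.v ε t₀ + X.slope ε * (t - t₀))| ≤ B := by
  obtain ⟨B, e, hB, he, -, h⟩ := X.exists_integral_le hδ hT
  refine ⟨B * C₀ + B * C₀ * T, e, he, fun ε hε t ht => ?_⟩
  have h1 : |∫ s in t₀..t, ∫ r in t₀..s, deriv (fun s => f (X.curve ε s)) r *
      pulse δ c.u t₀ ε r| ≤ B * C₀ * |t - t₀| :=
    (Real.norm_eq_abs _).symm.trans_le (intervalIntegral.norm_integral_le_of_norm_le_const
      fun s hs => (h ε hε s ((abs_sub_left_of_mem_uIcc (uIoc_subset_uIcc hs)).trans ht)).2.2)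
  have h2 := (h ε hε t ht).2.1
  have h3 : B * C₀ * |t - t₀| ≤ B * C₀ * T :=
    mul_le_mul_of_nonneg_left ht (mul_nonneg hB hδ.nonneg)
  have h4 : X.v ε t - (c.v ε t₀ + X.slope ε * (t - t₀)) =
      -(1 / 2 * (∫ r in t₀..t, f (X.curve ε r) * pulse δ c.u t₀ ε r) +
        1 / 2 * ∫ s in t₀..t, ∫ r in t₀..s, deriv (fun s => f (X.curve ε s)) r *
          pulse δ c.u t₀ ε r) := by
    rw [WaveFamily.v, lift, WaveFamily.slope]
    ring
  rw [h4, abs_neg]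
  refine (abs_add_le _ _).trans ?_
  rw [abs_mul, abs_mul, abs_of_pos (half_pos one_pos)]
  linarith [abs_nonneg (∫ r in t₀..t, f (X.curve ε r) * pulse δ c.u t₀ ε r),
    abs_nonneg (∫ s in t₀..t, ∫ r in t₀..s, deriv (fun s => f (X.curve ε s)) r *
      pulse δ c.u t₀ ε r)]

/-- The `v`-component is bounded, since it is so on `J`. -/
theorem WaveFamily.locBounded_v [Nonempty N] (X : WaveFamily f δ c t₀) (hδ : IsDeltaNet δ C₀)
    (hG : G ≈ inpwNet f δ) (hJ : IsOpen J) (hc : IsGeodesicNet G c) (ht₀ : t₀ ∈ J)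
    (hb : BoundedVelocityAt (Quotient.mk _ c : GenMap (inpwModel E) (N × (ℝ × ℝ)) J) t₀) :
    (∃ B ε₁ : ℝ, 0 < ε₁ ∧ ∀ ε ∈ Ioo 0 ε₁, |X.slope ε| ≤ B) ∧ LocBounded univ X.v := by
  obtain ⟨r, hr, hrJ⟩ := Metric.isOpen_iff.1 hJ t₀ ht₀
  have hsub : Icc t₀ (t₀ + r / 2) ⊆ J := fun t ht => hrJ (by
    rw [Metric.mem_ball, Real.dist_eq, abs_lt]
    exact ⟨by linarith [ht.1], by linarith [ht.2]⟩)
  have hmem : t₀ ∈ Icc t₀ (t₀ + r / 2) := ⟨le_rfl, by linarith⟩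
  have hmem' : t₀ + r / 2 ∈ Icc t₀ (t₀ + r / 2) := ⟨by linarith, le_rfl⟩
  obtain ⟨B₁, e₁, he₁, h1⟩ := X.exists_remainder_le hδ (half_pos hr).le
  obtain ⟨B₂, e₂, he₂, h2⟩ := (ModMap.locBounded_snd (c := c) hsub).2 _ le_rfl isCompact_Icc
  obtain ⟨B₃, e₃, he₃, h3⟩ := (X.negligible_sub hδ hG hJ hc hmem hsub hb).2.2 _ le_rfl
    isCompact_Icc 0
  have hv₀ : ∀ ε ∈ Ioo 0 e₂, |c.v ε t₀| ≤ B₂ := fun ε hε => h2 ε hε _ hmem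
  have hslope : ∃ B ε₁ : ℝ, 0 < ε₁ ∧ ∀ ε ∈ Ioo 0 ε₁, |X.slope ε| ≤ B := by
    refine ⟨(B₁ + B₂ + B₂ + B₃) / (r / 2), min e₁ (min e₂ e₃), by positivity, fun ε hε => ?_⟩
    obtain ⟨hε0, hlt⟩ := hε
    simp only [lt_min_iff] at hlt
    have a1 := h1 ε ⟨hε0, hlt.1⟩ (t₀ + r / 2) (by rw [add_sub_cancel_left, abs_of_pos (half_pos hr)])
    have a2 : |c.v ε (t₀ + r / 2)| ≤ B₂ := h2 ε ⟨hε0, hlt.2.1⟩ _ hmem'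
    have a3 : |X.v ε (t₀ + r / 2) - c.v ε (t₀ + r / 2)| ≤ B₃ := by
      simpa using h3 ε ⟨hε0, hlt.2.2⟩ _ hmem'
    have a4 := hv₀ ε ⟨hε0, hlt.2.1⟩
    rw [le_div_iff₀ (half_pos hr), ← abs_of_pos (half_pos hr), ← abs_mul]
    rw [add_sub_cancel_left] at a1
    rw [abs_le] at a1 a2 a3 a4 ⊢
    constructor <;> linarith
  refine ⟨hslope, fun L _ hL => ?_⟩
  obtain ⟨A, e₄, he₄, h4⟩ := hslope
  obtain ⟨T, hT⟩ := hL.bddAbove_image (f := fun t => |t - t₀|) (by fun_prop)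
  obtain ⟨B₅, e₅, he₅, h5⟩ := X.exists_remainder_le hδ (le_max_right T 0)
  refine ⟨B₅ + (B₂ + A * max T 0), min e₂ (min e₄ e₅), by positivity, fun ε hε t ht => ?_⟩
  obtain ⟨hε0, hlt⟩ := hε
  simp only [lt_min_iff] at hlt
  have htT : |t - t₀| ≤ max T 0 := le_max_of_le_left (hT (mem_image_of_mem _ ht))
  have a1 := h5 ε ⟨hε0, hlt.2.2⟩ t htT
  have a2 := hv₀ ε ⟨hε0, hlt.1⟩
  have a3 := h4 ε ⟨hε0, hlt.2.1⟩
  have a4 : |X.slope ε * (t - t₀)| ≤ A * max T 0 := by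
    rw [abs_mul]
    exact mul_le_mul a3 htT (abs_nonneg _) ((abs_nonneg _).trans a3)
  rw [Real.norm_eq_abs]
  calc |X.v ε t| = |(X.v ε t - (c.v ε t₀ + X.slope ε * (t - t₀))) +
        (c.v ε t₀ + X.slope ε * (t - t₀))| := by rw [sub_add_cancel]
    _ ≤ _ := (abs_add_le _ _).trans (add_le_add a1 ((abs_add_le _ _).trans (add_le_add a2 a4)))

theorem ModMap.moderateOn_ray [Nonempty N] (hJ : IsOpen J) (ht₀ : t₀ ∈ J)
    (hb : BoundedVelocityAt (Quotient.mk _ c : GenMap (inpwModel E) (N × (ℝ × ℝ)) J) t₀) :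
    ModerateOn univ (ray c.u t₀) ∧ ModerateOn univ (fun ε t => δ.1 ε (ray c.u t₀ ε t)) ∧
      ModerateOn univ fun ε (_ : ℝ) => deriv (c.u ε) t₀ := by
  obtain ⟨h1, h2⟩ := ModMap.locBounded_slope hJ ht₀ hb
  have h3 : ModerateOn univ (ray c.u t₀) := .of_deriv h2 (by
    have : ∀ ε, deriv (ray c.u t₀ ε) = fun _ => deriv (c.u ε) t₀ := fun ε =>
      funext fun t => (hasDerivAt_ray c.u t₀ ε t).deriv
    simpa only [this] using ModerateOn.of_const h1)
  exact ⟨h3, moderateOn_iff_moderateOrder.2 fun k => δ.2.2.comp_moderateOrder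
    (fun ε hε => δ.contDiff (Ioo_subset_Ioc_self hε)) isOpen_univ
    (fun ε _ => (contDiff_ray c.u t₀ ε).contDiffOn) h2 (moderateOn_iff_moderateOrder.1 h3 k),
    .of_const h1⟩

/-- The net of geodesics on the real line. -/
noncomputable def WaveFamily.geodesic (X : WaveFamily f δ c t₀) (ε t : ℝ) : N × (ℝ × ℝ) :=
  (X.curve ε t, (ray c.u t₀ ε t, X.v ε t))

theorem WaveFamily.abs_sub_le_of_mem {T t : ℝ} (ht : t ∈ Ioo (t₀ - T) (t₀ + T)) : |t - t₀| ≤ T :=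
  abs_sub_le_iff.2 ⟨by linarith [ht.2], by linarith [ht.1]⟩

theorem ModMap.moderateOn_kick [Nonempty N] (hJ : IsOpen J) (ht₀ : t₀ ∈ J)
    (hb : BoundedVelocityAt (Quotient.mk _ c : GenMap (inpwModel E) (N × (ℝ × ℝ)) J) t₀) :
    ModerateOn univ (kick δ c.u t₀) := by
  obtain ⟨-, h1, h2⟩ := ModMap.moderateOn_ray (δ := δ) hJ ht₀ hb
  have h3 : ModerateOn univ fun (_ : ℝ) (_ : ℝ) => (1 / 2 : ℝ) :=
    .of_const fun L _ _ => ⟨_, 1, one_pos, fun _ _ _ _ => le_rfl⟩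
  have h4 : ModerateOn univ fun ε (_ : ℝ) => deriv (c.u ε) t₀ * deriv (c.u ε) t₀ :=
    h2.mul isOpen_univ (fun _ _ => contDiffOn_const) (fun _ _ => contDiffOn_const) h2
  have h5 : ModerateOn univ fun ε (_ : ℝ) => 1 / 2 * (deriv (c.u ε) t₀ * deriv (c.u ε) t₀) :=
    h3.mul isOpen_univ (fun _ _ => contDiffOn_const) (fun _ _ => contDiffOn_const) h4
  refine (h1.mul isOpen_univ (fun ε hε => ?_) (fun _ _ => contDiffOn_const) h5).congr isOpen_univ
    fun ε t _ => ?_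
  · exact ((δ.contDiff (Ioo_subset_Ioc_self hε)).comp (contDiff_ray c.u t₀ ε)).contDiffOn
  · rw [kick]
    ring

/-- Moderateness of the `N`-component. -/
theorem WaveFamily.exists_moderateOn_curve [Nonempty N] (X : WaveFamily f δ c t₀) (hJ : IsOpen J)
    (ht₀ : t₀ ∈ J)
    (hb : BoundedVelocityAt (Quotient.mk _ c : GenMap (inpwModel E) (N × (ℝ × ℝ)) J) t₀) {T : ℝ}
    (hT : 0 ≤ T) : ∃ (K : Set N) (C : Coordinates E K) (ε₁ : ℝ), 0 < ε₁ ∧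
      (∀ ε ∈ Ioo 0 ε₁, ∀ t ∈ Ioo (t₀ - T) (t₀ + T), X.curve ε t ∈ interior K) ∧
      LocBounded (Ioo (t₀ - T) (t₀ + T)) (fun ε t => C.toFun (X.curve ε t)) ∧
      ModerateOn (Ioo (t₀ - T) (t₀ + T)) fun ε t => C.toFun (X.curve ε t) := by
  have := properSpace_of_completeSpace E (N := N)
  obtain ⟨K₁, S, e, hK₁, he, he1, h⟩ := X.bound T hT
  obtain ⟨K, hK, hKi⟩ := exists_compact_superset hK₁
  obtain ⟨C⟩ := exists_coordinates (E := E) hK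
  obtain ⟨R, hR⟩ := C.norm_jet_le hK S
  obtain ⟨Φ, B, q, hΦ, hB, hq, heq⟩ := C.exists_equation f.contMDiff
  have hI : IsOpen (Ioo (t₀ - T) (t₀ + T)) := isOpen_Ioo
  have hin : ∀ ε ∈ Ioo 0 e, ∀ t ∈ Ioo (t₀ - T) (t₀ + T), X.curve ε t ∈ interior K :=
    fun ε hε t ht => hKi (h ε hε t (abs_sub_le_of_mem ht)).1
  have hbd : ∀ ε ∈ Ioo 0 e, ∀ t ∈ Ioo (t₀ - T) (t₀ + T), ‖C.jet X.curve ε t‖ ≤ R :=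
    fun ε hε t ht => hR _ _ _ (X.contMDiffAt ⟨hε.1, hε.2.trans_le he1⟩ t)
      (interior_subset (hin ε hε t ht)) (h ε hε t (abs_sub_le_of_mem ht)).2.1
  have hz : LocBounded (Ioo (t₀ - T) (t₀ + T)) fun ε t => C.toFun (X.curve ε t) :=
    .of_forall he fun ε hε t ht => (norm_fst_le _).trans (hbd ε hε t ht)
  refine ⟨K, C, e, he, hin, hz, moderateOn_of_equation (κ := kick δ c.u t₀) hI (fun ε hε t _ =>
    (C.contMDiff.contMDiffAt.comp t (X.contMDiffAt hε t)).contDiffAt.contDiffWithinAt) hz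
    (.of_forall he fun ε hε t ht => (norm_snd_le _).trans (hbd ε hε t ht)) (fun ε hε => ?_) ?_ hΦ hB
    he fun ε hε t ht => ?_⟩
  · exact (((δ.contDiff (Ioo_subset_Ioc_self hε)).comp (contDiff_ray c.u t₀ ε)).const_smul
      (1 / 2 : ℝ) |>.mul contDiff_const).contDiffOn
  · exact (ModMap.moderateOn_kick hJ ht₀ hb).mono (subset_univ _)
  · have h1 := heq (X.curve ε) t (kick δ c.u t₀ ε t) 0
      (Eventually.of_forall (X.contMDiffAt ⟨hε.1, hε.2.trans_le he1⟩))
      (interior_subset (hin ε hε t ht)) le_rfl fun i hw => by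
        rw [(h ε hε t (abs_sub_le_of_mem ht)).2.2 i (C.mem_source hw), sub_self, norm_zero]
    rw [mul_zero] at h1
    exact sub_eq_zero.1 (norm_le_zero_iff.1 h1)

theorem WaveFamily.moderateOn_comp [Nonempty N] (X : WaveFamily f δ c t₀) (hδ : IsDeltaNet δ C₀)
    (hG : G ≈ inpwNet f δ) (hJ : IsOpen J) (hc : IsGeodesicNet G c) (ht₀ : t₀ ∈ J)
    (hb : BoundedVelocityAt (Quotient.mk _ c : GenMap (inpwModel E) (N × (ℝ × ℝ)) J) t₀)
    {ψ : N × (ℝ × ℝ) → ℝ} (hψ : ContMDiff (inpwModel E) 𝓘(ℝ, ℝ) ∞ ψ) :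
    ModerateOn univ fun ε t => ψ (X.geodesic ε t) := by
  suffices h : ∀ T, 0 ≤ T → ModerateOn (Ioo (t₀ - T) (t₀ + T)) fun ε t => ψ (X.geodesic ε t) by
    intro L _ hL
    obtain ⟨T, hT⟩ := hL.bddAbove_image (f := fun t => |t - t₀|) (by fun_prop)
    refine h (max T 0 + 1) (by positivity) L (fun t ht => ?_) hL
    have h1 : |t - t₀| ≤ T := hT (mem_image_of_mem _ ht)
    have h2 := abs_le.1 (h1.trans (le_max_left T 0))
    exact ⟨by linarith, by linarith⟩
  intro T hT
  obtain ⟨K, C, e, he, hin, hzb, hz⟩ := X.exists_moderateOn_curve hJ ht₀ hb hT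
  have hI : IsOpen (Ioo (t₀ - T) (t₀ + T)) := isOpen_Ioo
  have hzs : ∀ ε ∈ Ioo (0 : ℝ) 1, ContDiffOn ℝ ∞ (fun t => C.toFun (X.curve ε t))
      (Ioo (t₀ - T) (t₀ + T)) := fun ε hε t _ =>
    (C.contMDiff.contMDiffAt.comp t (X.contMDiffAt hε t)).contDiffAt.contDiffWithinAt
  obtain ⟨h, -, hh, -, hfh, -⟩ := C.exists_function_factor f
  have hf : ModerateOn (Ioo (t₀ - T) (t₀ + T)) fun ε t => f (X.curve ε t) :=
    .comp_congr hh hI hzs hzb hz he fun ε hε t ht => hfh _ (interior_subset (hin ε hε t ht))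
  obtain ⟨hr, hδr, hs⟩ := ModMap.moderateOn_ray (δ := δ) hJ ht₀ hb
  have hrb := (ModMap.locBounded_slope hJ ht₀ hb).2
  have hfs : ∀ ε ∈ Ioo (0 : ℝ) 1, ContDiff ℝ ∞ fun t => f (X.curve ε t) :=
    fun ε hε => X.contDiff_function hε
  have hfs' : ∀ ε ∈ Ioo (0 : ℝ) 1, ContDiff ℝ ∞ (deriv fun t => f (X.curve ε t)) :=
    fun ε hε => (contDiff_infty_iff_deriv.1 (hfs ε hε)).2
  have hps : ∀ ε ∈ Ioo (0 : ℝ) 1, ContDiff ℝ ∞ (pulse δ c.u t₀ ε) :=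
    fun ε hε => contDiff_pulse c.u (Ioo_subset_Ioc_self hε)
  have hp : ModerateOn (Ioo (t₀ - T) (t₀ + T)) (pulse δ c.u t₀) :=
    (hδr.mul isOpen_univ (fun ε hε => ((δ.contDiff (Ioo_subset_Ioc_self hε)).comp
      (contDiff_ray c.u t₀ ε)).contDiffOn) (fun _ _ => contDiffOn_const) hs).mono (subset_univ _)
  have hfp := hf.mul hI (fun ε hε => (hfs ε hε).contDiffOn) (fun ε hε => (hps ε hε).contDiffOn) hp
  have hfp' := hf.deriv_net.mul hI (fun ε hε => (hfs' ε hε).contDiffOn)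
    (fun ε hε => (hps ε hε).contDiffOn) hp
  obtain ⟨B, e', -, he', -, hB⟩ := X.exists_integral_le hδ hT
  have hcont : ∀ ε ∈ Ioo (0 : ℝ) 1, Continuous fun r =>
      deriv (fun s => f (X.curve ε s)) r * pulse δ c.u t₀ ε r := fun ε hε =>
    (hfs' ε hε).continuous.mul (hps ε hε).continuous
  have hintd : ∀ ε ∈ Ioo (0 : ℝ) 1, deriv (fun t => ∫ r in t₀..t,
      deriv (fun s => f (X.curve ε s)) r * pulse δ c.u t₀ ε r) =
      fun r => deriv (fun s => f (X.curve ε s)) r * pulse δ c.u t₀ ε r := fun ε hε =>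
    funext fun t => ((hcont ε hε).integral_hasStrictDerivAt t₀ t).hasDerivAt.deriv
  have hints : ∀ ε ∈ Ioo (0 : ℝ) 1, ContDiff ℝ ∞ (fun t => ∫ r in t₀..t,
      deriv (fun s => f (X.curve ε s)) r * pulse δ c.u t₀ ε r) := fun ε hε =>
    contDiff_infty_iff_deriv.2 ⟨fun t =>
      ((hcont ε hε).integral_hasStrictDerivAt t₀ t).hasDerivAt.differentiableAt, by
        rw [hintd ε hε]; exact (hfs' ε hε).mul (hps ε hε)⟩
  have hint : ModerateOn (Ioo (t₀ - T) (t₀ + T)) fun ε t => ∫ r in t₀..t,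
      deriv (fun s => f (X.curve ε s)) r * pulse δ c.u t₀ ε r :=
    .of_deriv (.of_forall he' fun ε hε t ht => (hB ε hε t (abs_sub_le_of_mem ht)).2.2)
      (moderateOn_iff_moderateOrder.2 fun k =>
        (moderateOn_iff_moderateOrder.1 hfp' k).congr_small hI one_pos fun ε hε t _ => by
          rw [hintd ε hε])
  obtain ⟨⟨A, e₃, he₃, hA⟩, hvb⟩ := X.locBounded_v hδ hG hJ hc ht₀ hb
  have hsum := hfp.add hI (fun ε hε => ((hfs ε hε).mul (hps ε hε)).contDiffOn)
    (fun ε hε => (hints ε hε).contDiffOn) hint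
  have hhalf : ModerateOn (Ioo (t₀ - T) (t₀ + T)) fun (_ : ℝ) (_ : ℝ) => (1 / 2 : ℝ) :=
    .of_const fun L _ _ => ⟨_, 1, one_pos, fun _ _ _ _ => le_rfl⟩
  have hsums : ∀ ε ∈ Ioo (0 : ℝ) 1, ContDiffOn ℝ ∞ (fun t => f (X.curve ε t) * pulse δ c.u t₀ ε t +
      ∫ r in t₀..t, deriv (fun s => f (X.curve ε s)) r * pulse δ c.u t₀ ε r)
      (Ioo (t₀ - T) (t₀ + T)) :=
    fun ε hε => (((hfs ε hε).mul (hps ε hε)).add (hints ε hε)).contDiffOn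
  have hv' := (ModerateOn.of_const (J := Ioo (t₀ - T) (t₀ + T)) (a := X.slope)
    (.of_forall he₃ fun ε hε _ _ => hA ε hε)).sub hI (fun _ _ => contDiffOn_const)
      (fun ε hε => contDiffOn_const.mul (hsums ε hε))
      (hhalf.mul hI (fun _ _ => contDiffOn_const) hsums hsum)
  have hv : ModerateOn (Ioo (t₀ - T) (t₀ + T)) X.v :=
    .of_deriv (hvb.mono (subset_univ _)) (moderateOn_iff_moderateOrder.2 fun k =>
      (moderateOn_iff_moderateOrder.1 hv' k).congr_small hI one_pos fun ε hε t _ => by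
        rw [X.deriv_v hε, WaveFamily.slope]
        ring)
  have hvs : ∀ ε ∈ Ioo (0 : ℝ) 1, ContDiffOn ℝ ∞ (X.v ε) (Ioo (t₀ - T) (t₀ + T)) :=
    fun ε hε => (contDiff_of_param (X.contDiffOn_v hJ ht₀) hε).contDiffOn
  have hrs : ∀ ε ∈ Ioo (0 : ℝ) 1, ContDiffOn ℝ ∞ (ray c.u t₀ ε) (Ioo (t₀ - T) (t₀ + T)) :=
    fun ε _ => (contDiff_ray c.u t₀ ε).contDiffOn
  obtain ⟨ψ', hψ', hψe⟩ := C.exists_contDiff_factor hψ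
  exact .comp_congr hψ' hI (fun ε hε => (hzs ε hε).prodMk ((hrs ε hε).prodMk (hvs ε hε)))
    (hzb.prodMk ((hrb.mono (subset_univ _)).prodMk (hvb.mono (subset_univ _))))
    (hz.prodMk hI hzs (fun ε hε => (hrs ε hε).prodMk (hvs ε hε))
      ((hr.mono (subset_univ _)).prodMk hI hrs hvs hv)) he
    fun ε hε t ht => hψe _ (interior_subset (hin ε hε t ht)) _

theorem WaveFamily.contMDiffOn_geodesic (X : WaveFamily f δ c t₀) (hJ : IsOpen J) (ht₀ : t₀ ∈ J) :
    ContMDiffOn 𝓘(ℝ, ℝ × ℝ) (inpwModel E) ∞ (fun q : ℝ × ℝ => X.geodesic q.1 q.2)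
      (Ioo (0 : ℝ) 1 ×ˢ univ) := by
  have hu : ContDiffOn ℝ ∞ (fun q : ℝ × ℝ => c.u q.1 q.2) (Ioo (0 : ℝ) 1 ×ˢ J) :=
    ModMap.contDiffOn_snd.fst
  exact ContMDiffOn.prodMk X.smooth
    ((contDiffOn_ray hJ hu ht₀).prodMk (X.contDiffOn_v hJ ht₀)).contMDiffOn

theorem WaveFamily.covAccel_geodesic (X : WaveFamily f δ c t₀) (hJ : IsOpen J) (ht₀ : t₀ ∈ J)
    {T : ℝ} (hT : 0 ≤ T) : ∃ ε₁ > 0, ∀ ε ∈ Ioo 0 ε₁, ∀ t, |t - t₀| ≤ T → ∀ p : N × (ℝ × ℝ),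
      X.geodesic ε t ∈ (extChartAt (inpwModel E) p).source →
      covAccel (inpwModel E) (inpwTensor f (δ.1 ε)) (X.geodesic ε) p t = 0 := by
  obtain ⟨K, S, e, -, he, he1, h⟩ := X.bound T hT
  refine ⟨e, he, fun ε hε t ht p hp => ?_⟩
  have hε1 : ε ∈ Ioo (0 : ℝ) 1 := ⟨hε.1, hε.2.trans_le he1⟩
  have hp' : X.curve ε t ∈ (extChartAt 𝓘(ℝ, E) p.1).source := by
    rw [inpw_source] at hp
    exact hp.1
  have hr : deriv (ray c.u t₀ ε) = fun _ => deriv (c.u ε) t₀ :=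
    funext fun t => (hasDerivAt_ray c.u t₀ ε t).deriv
  refine (covAccel_inpwTensor f.contMDiff
    ((δ.contDiff (Ioo_subset_Ioc_self hε1)).differentiable (by simp))
    (Eventually.of_forall (X.contMDiffAt hε1)) (contDiff_ray c.u t₀ ε).contDiffAt
    (contDiff_of_param (X.contDiffOn_v hJ ht₀) hε1).contDiffAt hp').trans ?_
  rw [(h ε hε t ht).2.2 p.1 hp', X.deriv_deriv_v hε1, hr,
    deriv_pulse c.u (Ioo_subset_Ioc_self hε1), deriv_const, kick, pulse, sub_self]
  refine Prod.ext rfl (Prod.ext rfl ?_)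
  change _ = (0 : ℝ)
  ring

theorem WaveFamily.exists_geodesic [Nonempty N] (X : WaveFamily f δ c t₀) (hδ : IsDeltaNet δ C₀)
    (hG : G ≈ inpwNet f δ) (hJ : IsOpen J) (hc : IsGeodesicNet G c) (ht₀ : t₀ ∈ J)
    (hb : BoundedVelocityAt (Quotient.mk _ c : GenMap (inpwModel E) (N × (ℝ × ℝ)) J) t₀) :
    ∃ γ : ModMap (inpwModel E) (N × (ℝ × ℝ)) univ, IsGeodesicNet (inpwNet f δ) γ ∧
      ∀ ε ≤ (1 / 4 : ℝ), γ.1 ε = X.geodesic ε := by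
  obtain ⟨φ, hφ, hφm, hφe⟩ := exists_reparam
  have heq : ∀ ε ≤ (1 / 4 : ℝ), X.geodesic (φ ε) = X.geodesic ε := fun ε hε => by rw [hφe ε hε]
  refine ⟨⟨fun ε => X.geodesic (φ ε), ?_, fun ψ hψ => ?_⟩, fun p K hK _ L _ hL m => ?_, heq⟩
  · have h1 : ContMDiff 𝓘(ℝ, ℝ × ℝ) 𝓘(ℝ, ℝ × ℝ) ∞ fun q : ℝ × ℝ => ((φ q.1, q.2) : ℝ × ℝ) :=
      ((hφ.comp contDiff_fst).prodMk contDiff_snd).contMDiff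
    exact (X.contMDiffOn_geodesic hJ ht₀).comp h1.contMDiffOn fun q hq =>
      ⟨hφm q.1 hq.1, mem_univ _⟩
  · exact moderateOn_iff_moderateOrder.2 fun k => (moderateOn_iff_moderateOrder.1
      (X.moderateOn_comp hδ hG hJ hc ht₀ hb hψ) k).congr_small isOpen_univ
        (ε₁ := 1 / 4) (by norm_num) fun ε hε t _ => by
          beta_reduce; rw [heq ε hε.2.le]
  · obtain ⟨T, hT⟩ := hL.bddAbove_image (f := fun t => |t - t₀|) (by fun_prop)
    obtain ⟨e, he, h⟩ := X.covAccel_geodesic hJ ht₀ (le_max_right T 0)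
    refine ⟨0, min e (1 / 4), by positivity, fun ε hε t ht htK => ?_⟩
    have h4 := heq ε (hε.2.le.trans (min_le_right _ _))
    dsimp only at htK ⊢
    rw [h4] at htK ⊢
    have h5 := h ε ⟨hε.1, hε.2.trans_le (min_le_left _ _)⟩ t
      (le_max_of_le_left (hT (mem_image_of_mem _ ht))) p (hK htK)
    rw [zero_mul]
    exact (norm_eq_zero.2 h5).le

/-- The restriction of the new net of geodesics to `J` is equivalent to the given one. -/
theorem WaveFamily.negligible_comp_sub [Nonempty N] (X : WaveFamily f δ c t₀)
    (hδ : IsDeltaNet δ C₀) (hG : G ≈ inpwNet f δ) (hJ : IsOpen J) (hJc : J.OrdConnected)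
    (hc : IsGeodesicNet G c) (ht₀ : t₀ ∈ J)
    (hb : BoundedVelocityAt (Quotient.mk _ c : GenMap (inpwModel E) (N × (ℝ × ℝ)) J) t₀)
    {ψ : N × (ℝ × ℝ) → ℝ} (hψ : ContMDiff (inpwModel E) 𝓘(ℝ, ℝ) ∞ ψ) :
    NegligibleOn J fun ε t => ψ (X.geodesic ε t) - ψ (c.1 ε t) := by
  intro L hL hLc m
  obtain ⟨a, haL, ha⟩ := (hLc.insert t₀).exists_isLeast (insert_nonempty _ _)
  obtain ⟨b, hbL, hb'⟩ := (hLc.insert t₀).exists_isGreatest (insert_nonempty _ _)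
  have hsub : insert t₀ L ⊆ J := insert_subset ht₀ hL
  have hab : Icc a b ⊆ J := hJc.out (hsub haL) (hsub hbL)
  have hmem : insert t₀ L ⊆ Icc a b := fun t ht => ⟨ha ht, hb' ht⟩
  have ht₀' : t₀ ∈ Icc a b := hmem (mem_insert _ _)
  obtain ⟨⟨K, C, e, he, hin, hXb, hcb, hn⟩, hu, hv⟩ := X.negligible_sub hδ hG hJ hc ht₀' hab hb
  obtain ⟨ψ', hψ', hψe⟩ := C.exists_contDiff_factor hψ
  have hvb := (X.locBounded_v hδ hG hJ hc ht₀ hb).2.mono (subset_univ (Icc a b))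
  have hub := (ModMap.locBounded_slope hJ ht₀ hb).2.mono (subset_univ (Icc a b))
  obtain ⟨hcu, hcv⟩ := ModMap.locBounded_snd (c := c) hab
  have hpair : NegligibleOn (Icc a b) fun ε t => (C.toFun (X.curve ε t),
      (ray c.u t₀ ε t, X.v ε t)) - (C.toFun (c.pos ε t), (c.u ε t, c.v ε t)) := by
    intro L' hL' hLc' m
    obtain ⟨B₁, e₁, he₁, h1⟩ := hn L' hL' hLc' m
    obtain ⟨B₂, e₂, he₂, h2⟩ := hu L' hL' hLc' m
    obtain ⟨B₃, e₃, he₃, h3⟩ := hv L' hL' hLc' m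
    refine ⟨max B₁ (max B₂ B₃), min e₁ (min e₂ e₃), by positivity, fun ε hε t ht => ?_⟩
    obtain ⟨hε0, hlt⟩ := hε
    simp only [lt_min_iff] at hlt
    have hm : 0 ≤ ε ^ m := (pow_pos hε0 m).le
    rw [max_mul_of_nonneg _ _ hm, max_mul_of_nonneg _ _ hm]
    exact max_le_max (h1 ε ⟨hε0, hlt.1⟩ t ht)
      (max_le_max (h2 ε ⟨hε0, hlt.2.1⟩ t ht) (h3 ε ⟨hε0, hlt.2.2⟩ t ht))
  refine (NegligibleOn.comp_sub hψ' (hXb.prodMk (hub.prodMk hvb)) (hcb.prodMk (hcu.prodMk hcv))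
    hpair).congr_small he (fun ε hε t ht => ?_) L ((subset_insert _ _).trans hmem) hLc m
  have h1 := hin ε hε t ht
  have h2 : ψ (X.geodesic ε t) = _ := hψe _ h1.1 _
  have h3 : ψ (c.1 ε t) = _ := hψe (c.pos ε t) h1.2 (c.u ε t, c.v ε t)
  rw [h2, h3]

theorem IsDeltaNet.geodesicallyComplete [Nonempty N] (hδ : IsDeltaNet δ C₀) :
    GeodesicallyComplete (inpwMetric f (Quotient.mk _ δ)) := by
  intro J hJ hJc γ hγ ⟨t₀, ht₀, hb⟩
  obtain ⟨G, c, hG, rfl, hc⟩ := hγ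
  have hG' : G ≈ inpwNet f δ := Quotient.exact hG
  obtain ⟨X⟩ := nonempty_waveFamily (f := f) hδ hJ ht₀ hb
  obtain ⟨γ', hgeo, heq⟩ := X.exists_geodesic hδ hG' hJ hc ht₀ hb
  refine ⟨Quotient.mk _ γ', ⟨inpwNet f δ, γ', rfl, rfl, hgeo⟩, Quotient.sound fun ψ hψ => ?_⟩
  intro L hL hLc m
  obtain ⟨B, e, he, h⟩ := X.negligible_comp_sub hδ hG' hJ hJc hc ht₀ hb hψ L hL hLc m
  refine ⟨B, min e (1 / 4), by positivity, fun ε hε t ht => ?_⟩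
  have h1 := h ε ⟨hε.1, hε.2.trans_le (min_le_left _ _)⟩ t ht
  beta_reduce at h1
  rwa [← heq ε (hε.2.le.trans (min_le_right _ _))] at h1

end Wave

end Colombeau

theorem mainTheorem2
    {E : Type*} [NormedAddCommGroup E] [NormedSpace ℝ E] [FiniteDimensional ℝ E]
    {N : Type*} [MetricSpace N] [SecondCountableTopology N] [ConnectedSpace N]
    [ChartedSpace E N] [IsManifold 𝓘(ℝ, E) ∞ N]
    [RiemannianBundle (fun x : N => TangentSpace 𝓘(ℝ, E) x)]
    [IsContMDiffRiemannianBundle 𝓘(ℝ, E) ∞ E (fun x : N => TangentSpace 𝓘(ℝ, E) x)]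
    [IsRiemannianManifold 𝓘(ℝ, E) N] [CompleteSpace N]
    (f : C^∞⟮𝓘(ℝ, E), N; ℝ⟯)
    (D : Colombeau.GenFun ℝ (univ : Set ℝ)) (hD : Colombeau.IsGenDelta D) :
    Colombeau.IsGenMetric (Colombeau.inpwMetric f D) ∧
      Colombeau.GeodesicallyComplete (Colombeau.inpwMetric f D) := by
  refine ⟨Colombeau.isGenMetric_inpwMetric f D, ?_⟩
  obtain ⟨δ, rfl, hsupp, -, C, -, hC⟩ := hD
  have : LocallyCompactSpace N := ChartedSpace.locallyCompactSpace E N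
  have hδ : Colombeau.IsDeltaNet δ C := fun ε hε => ⟨hsupp ε hε, hC ε hε⟩
  exact hδ.geodesicallyComplete
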